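/- **Setting.** Let $d\ge 2$, $k\ge 0$ an integer, $s_-,s_+\in(0,k+1]$, $s_b\ge 1$ real numbers and $1\le p<\infty$. Let $\Omega\subset\mathbb R^d$ be an open set whose boundary has a finite atlas of graphs of class $C^{k,1}$ over open convex sets $B_j\subset\mathbb{R}^{d-1}$ (in suitable Cartesian coordinates, $\Omega$ is the part below the graph inside a band of positive width around it), with parametrizations $\Phi_j:B_j\to\partial\Omega$, outer unit normal $n$ and surface measure $\sigma$. The space $W^{s,p}(\partial\Omega)$, $1\le p\le\infty$, is the Sobolev–Slobodeckij space with norm $\|g\|_{W^{s,p}(\partial\Omega)}=\sum_j\|g\circ\Phi_j\|_{W^{s,p}(B_j)}$. For real $s\geq 1$, $C^{s}$ is the space of $\lfloor s\rfloor$ times continuously differentiable functions with bounded derivatives up to order $\lfloor s\rfloor$ whose derivatives of order $\lfloor s\rfloor$ are $(s-\lfloor s\rfloor)$-Hölder continuous if $s$ is not an integer. Assume that there is an injective map $\Xi:[0,1]\times[-1,1]^{d-1}\to\overline\Omega$ of class $C^{s_b}$, with inverse of class $C^{s_b}$ on its range, such that $\Xi(0,w)\in\partial\Omega$ and $\Xi(1,w)\in\partial\Omega$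 for all $w\in[-1,1]^{d-1}$. Let $\mathcal P\subset\mathbb R^m$ be a nonempty open set, $m\ge d-1$. **Transport problem.** For a vector field $\beta$ on $\overline\Omega$ let $\Gamma_\pm(\beta)=\{x\in\partial\Omega:\pm\beta(x)\cdot n(x)>0\}$. For an open set $U\subset\mathbb R^d$, a weak solution of $$\beta\cdot\nabla u=0,\qquad u|_{\Gamma_-(\beta)}=g_-$$ on $\omega = U\cap\overline\Omega$ is a function $u\in L^1_{loc}(U\cap\overline\Omega)$ together with an outflow trace $u|_{\Gamma_+(\beta)}$, for which $(\beta\cdot n)\,u|_{\Gamma_+(\beta)}$ is locally integrable on $U\cap\Gamma_+(\beta)$ up to all of $U\cap\partial\Omega$, such that for all $\varphi\in C_c^\infty(U)$ $$\int_{\Omega}u\,\operatorname{div}(\varphi \beta)\,dx=\int_{\Gamma_-(\beta)}g_-\,\varphi\,\beta\cdot n\,d\sigma+\int_{\Gamma_+(\beta)}u\,\varphi\,\beta\cdot n\,d\sigma .$$ For $g_+:\partial\Omega\to\mathbb R$, let $\mathcal B(g_+)$ be the set of all parametric flow fields $b=(b_\mu)_{\mu\in\mathcal P}$ such that for every $\mu\in\mathcal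 P$ there is an open set $U_\mu\supset\operatorname{supp}(g_+)$ with the following property: for every $g_-\in W^{s_-,p}(\partial\Omega)$ the problem with flow field $b_\mu$ has exactly one weak solution $u_\mu$ on $\omega_\mu = U_\mu\cap\overline\Omega$ (with $u_\mu$ unique a.e. on $U_\mu\cap\Omega$ and its outflow trace unique $\sigma$-a.e. on $U_\mu\cap\Gamma_+(b_\mu)$), and $g_+u_\mu$ is integrable on $\Gamma_+(b_\mu)$. For $b \in \mathcal{B}(g_+)$ (with chosen $U_\mu$) let $$Q_{b,g_+}(g_-)(\mu)=\int_{\Gamma_+(b_\mu)}g_+\,u_\mu\,d\sigma,\quad \mu\in\mathcal P,\qquad K_{b,g_+}=\{Q_{b,g_+}(g_-):\ \|g_-\|_{W^{s_-,p}(\partial\Omega)}\le 1\}.$$ For $K\subset L_\infty(\mathcal P)$ let $\epsilon_n(K)$ be the infimum of all $\epsilon$ such that $K$ is covered by $2^n$ balls of radius $\epsilon$ in $L_\infty(\mathcal P)$. **Theorem.** There are a flow field $b\in C^{s_b}(\Omega\times\mathcal P)$, continuous on $\overline\Omega\times\mathcal P$, and a function $g_+$ with $\|g_+\|_{W^{s_+,\infty}(\partial\Omega)}\le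 1$, such that $b\in\mathcal B(g_+)$, $K_{b,g_+}\subset L_\infty(\mathcal P)$, and, for some constant $c>0$ independent of $n$, $$\epsilon_n(K_{b,g_+})\ \ge\ c\,n^{-\frac{s_-+s_++(d-1)}{d-1}}\qquad\text{for all } n\ge 1.$$ -/

import Mathlib

open MeasureTheory Set Metric
open scoped ENNReal NNReal ContDiff

noncomputable section

namespace Transport

/-- Euclidean space of dimension `n`. -/
abbrev E (n : ℕ) : Type := EuclideanSpace ℝ (Fin n)

/-! ### Hölder spaces and boundary regularity -/

/-- Membership in the Hölder space of real order `s ≥ 0` on a set `S`: with `k = ⌊s⌋`, the function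
is `k` times continuously differentiable on `S`, all derivatives up to order `k` are bounded, and
the `k`-th derivative is `(s - k)`-Hölder continuous. For integral `s` the last condition has
exponent `0` and follows from boundedness, so that the space is `C^k` with bounded derivatives. -/
def MemHolder {X Y : Type*} [NormedAddCommGroup X] [NormedSpace ℝ X] [NormedAddCommGroup Y]
    [NormedSpace ℝ Y] (s : ℝ) (f : X → Y) (S : Set X) : Prop :=
  ContDiffOn ℝ (⌊s⌋₊ : ℕ) f S ∧
  ∃ C : ℝ,
    (∀ i : ℕ, i ≤ ⌊s⌋₊ → ∀ x ∈ S, ‖iteratedFDerivWithin ℝ i f S x‖ ≤ C) ∧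
    (∀ x ∈ S, ∀ y ∈ S,
      ‖iteratedFDerivWithin ℝ ⌊s⌋₊ f S x - iteratedFDerivWithin ℝ ⌊s⌋₊ f S y‖
        ≤ C * dist x y ^ (s - ⌊s⌋₊))

/-- A real function of class `C^{k,1}` on an open set `B`: it is `C^k`, the derivatives of orders
`1, …, k` are bounded, and the `k`-th derivative is Lipschitz continuous. -/
def IsCk1 {n : ℕ} (k : ℕ) (f : E n → ℝ) (B : Set (E n)) : Prop :=
  ContDiffOn ℝ k f B ∧
  ∃ C : ℝ,
    (∀ i : ℕ, 1 ≤ i → i ≤ k → ∀ y ∈ B, ‖iteratedFDeriv ℝ i f y‖ ≤ C) ∧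
    (∀ y ∈ B, ∀ z ∈ B, ‖iteratedFDeriv ℝ k f y - iteratedFDeriv ℝ k f z‖ ≤ C * dist y z)

/-- A finite atlas of the boundary of `Ω ⊆ ℝ^d` by graphs of class `C^{k,1}`. In the Cartesian
coordinates `(y, t) ∈ ℝ^{d-1} × ℝ` given by the rigid motion `frame j`, the set `Ω` is the part
below the graph of `height j` within a band of positive width around the graph over the open
convex set `base j`, and the graphs cover the boundary. -/
structure BoundaryAtlas (d k : ℕ) (Ω : Set (E d)) where
  /-- the number of charts -/
  N : ℕ
  frame : Fin N → (E d ≃ᵃⁱ[ℝ] WithLp 2 (E (d - 1) × ℝ))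
  base : Fin N → Set (E (d - 1))
  height : Fin N → E (d - 1) → ℝ
  width : Fin N → ℝ
  isOpen_base : ∀ j, IsOpen (base j)
  convex_base : ∀ j, Convex ℝ (base j)
  width_pos : ∀ j, 0 < width j
  regular : ∀ j, IsCk1 k (height j) (base j)
  below : ∀ j, ∀ y ∈ base j, ∀ t : ℝ, |t| < width j →
    ((frame j).symm (WithLp.toLp 2 (y, height j y + t)) ∈ Ω ↔ t < 0)
  covers : frontier Ω ⊆ ⋃ j, (fun y => (frame j).symm (WithLp.toLp 2 (y, height j y))) '' base j

namespace BoundaryAtlas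

variable {d k : ℕ} {Ω : Set (E d)} (A : BoundaryAtlas d k Ω)

/-- The graph parametrization `Φ_j : B_j → ∂Ω`. -/
def param (j : Fin A.N) (y : E (d - 1)) : E d :=
  (A.frame j).symm (WithLp.toLp 2 (y, A.height j y))

/-- The part of the `j`-th boundary patch that is not covered by the earlier patches. -/
def cell (j : Fin A.N) : Set (E d) :=
  (A.param j '' A.base j) \ ⋃ i : Fin A.N, ⋃ _ : i < j, A.param i '' A.base i

/-- The surface area density `√(1 + |∇φ_j|²)` of the graph. -/
def areaDensity (j : Fin A.N) (y : E (d - 1)) : ℝ :=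
  Real.sqrt (1 + ‖gradient (A.height j) y‖ ^ 2)

/-- The outer unit normal `(-∇φ_j, 1) / √(1 + |∇φ_j|²)`, rotated back to the original frame. -/
def chartNormal (j : Fin A.N) (y : E (d - 1)) : E d :=
  (A.areaDensity j y)⁻¹ •
    (A.frame j).symm.linearIsometryEquiv (WithLp.toLp 2 (-gradient (A.height j) y, (1 : ℝ)))

/-- The surface measure on `∂Ω`: the area formula for graphs, on disjoint pieces of the boundary. -/
def surface : Measure (E d) :=
  ∑ j : Fin A.N,
    ((volume.restrict {y | y ∈ A.base j ∧ A.param j y ∈ A.cell j}).withDensity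
      (fun y => ENNReal.ofReal (A.areaDensity j y))).map (A.param j)

/-- The outer unit normal on `∂Ω` (the cells are disjoint, so at most one summand is nonzero). -/
def normal (x : E d) : E d :=
  ∑ j : Fin A.N, (A.cell j).indicator (fun z => A.chartNormal j (A.frame j z).fst) x

/-- The inflow boundary `{x ∈ ∂Ω : b(x) · n(x) < 0}`. -/
def inflow (b : E d → E d) : Set (E d) :=
  {x | x ∈ frontier Ω ∧ inner ℝ (b x) (A.normal x) < 0}

/-- The outflow boundary `{x ∈ ∂Ω : b(x) · n(x) > 0}`. -/
def outflow (b : E d → E d) : Set (E d) :=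
  {x | x ∈ frontier Ω ∧ 0 < inner ℝ (b x) (A.normal x)}

end BoundaryAtlas

/-! ### Sobolev–Slobodeckij spaces -/

/-- The iterated partial derivative `∂_{a_1} ⋯ ∂_{a_i} f`. -/
def partialDeriv {n i : ℕ} (a : Fin i → Fin n) (f : E n → ℝ) (x : E n) : ℝ :=
  iteratedFDeriv ℝ i f x (fun l => EuclideanSpace.single (a l) (1 : ℝ))

/-- `g` is the weak derivative `∂_{a_1} ⋯ ∂_{a_i} f` on the open set `B`. -/
def HasWeakDeriv {n i : ℕ} (B : Set (E n)) (f g : E n → ℝ) (a : Fin i → Fin n) : Prop :=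
  LocallyIntegrableOn f B ∧ LocallyIntegrableOn g B ∧
  ∀ φ : E n → ℝ, ContDiff ℝ ∞ φ → HasCompactSupport φ → tsupport φ ⊆ B →
    ∫ x in B, f x * partialDeriv a φ x = (-1) ^ i * ∫ x in B, g x * φ x

/-- The norm of `W^{s,p}(B)` for real `s ≥ 0` and `1 ≤ p ≤ ∞`, with value `∞` outside of the
space: with `k = ⌊s⌋`, the sum of the `L^p` norms of the weak derivatives of all orders up to `k`
and, if `s` is not an integer, of the Gagliardo–Slobodeckij seminorms of order `s - k` of the
derivatives of order `k` (the Hölder seminorms if `p = ∞`). -/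
def sobolevNorm {n : ℕ} (s : ℝ) (p : ℝ≥0∞) (B : Set (E n)) (f : E n → ℝ) : ℝ≥0∞ :=
  ⨅ (G : (i : ℕ) → (Fin i → Fin n) → E n → ℝ)
    (_ : ∀ i, i ≤ ⌊s⌋₊ → ∀ a : Fin i → Fin n, HasWeakDeriv B f (G i a) a),
    (∑ i ∈ Finset.range (⌊s⌋₊ + 1), ∑ a : Fin i → Fin n,
        eLpNorm (G i a) p (volume.restrict B)) +
    (if s = ⌊s⌋₊ then 0 else
      ∑ a : Fin ⌊s⌋₊ → Fin n,
        eLpNorm (fun z : E n × E n =>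
            (G ⌊s⌋₊ a z.1 - G ⌊s⌋₊ a z.2) / dist z.1 z.2 ^ ((n : ℝ) / p.toReal + (s - ⌊s⌋₊)))
          p ((volume.restrict B).prod (volume.restrict B)))

/-- The norm of `W^{s,p}(∂Ω)`, computed in the charts of a given atlas. -/
def boundaryNorm {d k : ℕ} {Ω : Set (E d)} (A : BoundaryAtlas d k Ω) (s : ℝ) (p : ℝ≥0∞)
    (g : E d → ℝ) : ℝ≥0∞ :=
  ∑ j : Fin A.N, sobolevNorm s p (A.base j) (fun y => g (A.param j y))

/-! ### The transport problem -/

/-- The divergence of a vector field. -/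
def divergence {d : ℕ} (F : E d → E d) (x : E d) : ℝ :=
  ∑ i : Fin d, (fderiv ℝ F x (EuclideanSpace.single i 1)) i

/-- Weak solutions of `b · ∇u = 0`, `u = g_-` on the inflow boundary, on the relatively open subset
`U ∩ closure Ω` of `closure Ω`, where `U` is open in `ℝ^d`. Here `uOut` is the trace of `u` on the
outflow boundary. Test functions are supported in `U` but need not vanish on `∂Ω`. -/
structure IsWeakSolution {d k : ℕ} {Ω : Set (E d)} (A : BoundaryAtlas d k Ω) (b : E d → E d)
    (gIn : E d → ℝ) (U : Set (E d)) (u uOut : E d → ℝ) : Prop where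
  locallyIntegrable : LocallyIntegrableOn u (U ∩ closure Ω) (volume.restrict Ω)
  locallyIntegrable_trace :
    LocallyIntegrableOn (fun x => inner ℝ (b x) (A.normal x) * uOut x) (U ∩ frontier Ω)
      (A.surface.restrict (A.outflow b))
  weak : ∀ φ : E d → ℝ, ContDiff ℝ ∞ φ → HasCompactSupport φ → tsupport φ ⊆ U →
    ∫ x in Ω, u x * divergence (fun y => φ y • b y) x =
      (∫ x in A.inflow b, gIn x * φ x * inner ℝ (b x) (A.normal x) ∂A.surface) +
      ∫ x in A.outflow b, uOut x * φ x * inner ℝ (b x) (A.normal x) ∂A.surface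

/-- The transport problem with flow field `b` is uniquely solvable on `U ∩ closure Ω`, which
contains the support of `gOut`, for all inflow data in `W^{s,p}(∂Ω)`, and the quantities of
interest are well defined. -/
structure IsWellPosed {d k : ℕ} {Ω : Set (E d)} (A : BoundaryAtlas d k Ω) (s : ℝ) (p : ℝ≥0∞)
    (b : E d → E d) (gOut : E d → ℝ) (U : Set (E d)) : Prop where
  isOpen : IsOpen U
  support_subset : closure {x | x ∈ frontier Ω ∧ gOut x ≠ 0} ⊆ U
  exists_solution : ∀ gIn : E d → ℝ, boundaryNorm A s p gIn < ⊤ →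
    ∃ u uOut : E d → ℝ, IsWeakSolution A b gIn U u uOut
  unique_solution : ∀ gIn : E d → ℝ, boundaryNorm A s p gIn < ⊤ →
    ∀ u uOut v vOut : E d → ℝ,
      IsWeakSolution A b gIn U u uOut → IsWeakSolution A b gIn U v vOut →
        u =ᵐ[volume.restrict (U ∩ Ω)] v ∧
        uOut =ᵐ[A.surface.restrict (U ∩ A.outflow b)] vOut
  integrable : ∀ gIn : E d → ℝ, boundaryNorm A s p gIn < ⊤ →
    ∀ u uOut : E d → ℝ, IsWeakSolution A b gIn U u uOut →
      IntegrableOn (fun x => gOut x * uOut x) (A.outflow b) A.surface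

/-- `q` is the quantity of interest `q(μ) = ∫_{Γ_+(b_μ)} g_+ u_μ` on the parameter set `P`, where
`u_μ` is the solution of the transport problem with flow field `b_μ` and inflow data `g_-` on the
subdomain given by `U μ`. -/
def IsQuantityOfInterest {d k m : ℕ} {Ω : Set (E d)} (A : BoundaryAtlas d k Ω) (P : Set (E m))
    (b : E m → E d → E d) (gOut : E d → ℝ) (U : E m → Set (E d)) (gIn : E d → ℝ)
    (q : E m → ℝ) : Prop :=
  ∀ μ ∈ P, ∃ u uOut : E d → ℝ, IsWeakSolution A (b μ) gIn (U μ) u uOut ∧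
    q μ = ∫ x in A.outflow (b μ), gOut x * uOut x ∂A.surface

/-- The set of all quantities of interest for inflow data in the unit ball of `W^{s,p}(∂Ω)`, as a
subset of `L_∞(P)`. -/
def qoiClass {d k m : ℕ} {Ω : Set (E d)} (A : BoundaryAtlas d k Ω) (s : ℝ) (p : ℝ≥0∞)
    (P : Set (E m)) (b : E m → E d → E d) (gOut : E d → ℝ) (U : E m → Set (E d)) :
    Set (Lp ℝ ⊤ ((volume : Measure (E m)).restrict P)) :=
  {f | ∃ (gIn : E d → ℝ) (q : E m → ℝ), boundaryNorm A s p gIn ≤ 1 ∧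
    IsQuantityOfInterest A P b gOut U gIn q ∧ f =ᵐ[volume.restrict P] q}

/-- The reference domain `[0,1] × [-1,1]^{d-1}`. -/
def referenceBox (d : ℕ) : Set (ℝ × E (d - 1)) :=
  Icc 0 1 ×ˢ {w | ∀ i, w i ∈ Icc (-1 : ℝ) 1}

/-- A bijection of class `C^s` in both directions from the reference domain onto a subset of
`closure Ω`, which maps the faces `{0} × [-1,1]^{d-1}` and `{1} × [-1,1]^{d-1}` into `∂Ω`. -/
structure IsReferenceMap {d : ℕ} (s : ℝ) (Ω : Set (E d)) (Ξ : ℝ × E (d - 1) → E d) : Prop where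
  mapsTo : MapsTo Ξ (referenceBox d) (closure Ω)
  injOn : InjOn Ξ (referenceBox d)
  left_face : ∀ w : E (d - 1), (∀ i, w i ∈ Icc (-1 : ℝ) 1) → Ξ (0, w) ∈ frontier Ω
  right_face : ∀ w : E (d - 1), (∀ i, w i ∈ Icc (-1 : ℝ) 1) → Ξ (1, w) ∈ frontier Ω
  smooth : MemHolder s Ξ (referenceBox d)
  smooth_inverse : ∃ Ψ : E d → ℝ × E (d - 1), LeftInvOn Ψ Ξ (referenceBox d) ∧
    MemHolder s Ψ (Ξ '' referenceBox d)

/-! ### Metric entropy -/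

/-- The entropy number `ε_n(K)`: the infimum of all `ε` such that `K` is covered by `2^n` balls of
radius `ε` (with centers anywhere in the space). -/
def entropyNumber {Z : Type*} [PseudoEMetricSpace Z] (n : ℕ) (K : Set Z) : ℝ≥0∞ :=
  ⨅ (ε : ℝ≥0) (_ : externalCoveringNumber ε K ≤ 2 ^ n), (ε : ℝ≥0∞)

end Transport

end

noncomputable section

namespace Transport

/-! ### Functions with Hölder continuous derivatives -/

section HolderBound

/-! Everything happens near a single boundary point. A field with short parabolic flow lines enters
`Ω` through one small piece of the boundary, turns, and leaves through a neighbouring piece. The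
parameter steers the velocity, so that any outflow point near `xs` can be joined to any inflow point
near `yc`.

Geometry. For `k = 0` the charts are only Lipschitz, but a face of `Ξ` is a `C¹` patch inside the
boundary, so some chart is `C¹` near some point (`exists_regular_point`). There the height is affine
plus a function `r` of slope at most `1 / 64` (`exists_contDiff_extension`). Relative to the affine
part the flow lines are upward parabolas that dip below the graph between times close to `-1` and
`1`. Leaf and time are volume preserving coordinates (`measurePreserving_flow`). The flux through
the boundary is, up to sign, Lebesgue measure on the leaves (`inner_field_normal`, `det_leafDeriv`).
By Fubini and the fundamental theorem of calculus, functions constant on leaves are therefore weak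
solutions (`isWeakSolution`). Uniqueness follows by duality, with test functions obtained by
integrating along the leaves (`exists_test_function`). The quantity of interest becomes `response`,
the integral of a weight times the inflow data composed with the map `transport` from outflow to
inflow points. This map is Lipschitz and distorts measure only by bounded factors, uniformly in the
velocity. The velocity joining two given points is explicit (`transport_connect`,
`exists_velocities`).

Entropy. At level `l` put `N = B ^ l`. The inflow data are sums of `N ^ (d - 1)` disjoint bumps of
width about `1 / N`, height about `N ^ (-sIn)` and arbitrary signs `ε k`. The outflow function is
one series `∑ ξ i * φ i` of bumps of width about `B ^ (-i)` and height about `B ^ (-sOut * i)`, with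
disjoint supports shrinking geometrically towards `xs`; a single function thus serves all scales.
For the velocity that carries the centre of `φ l` to the grid point `Y k`, the term `i = l`
contributes `amp l` with sign `ε k`, up to the factor `ξ l`, and `amp l` is at least a constant
times `N ^ (-(sIn + sOut + (d - 1)))`. The terms `i > l` live on a tiny set and together give at
most half of `amp l` if `B` is large. The terms `i < l` see the inflow pattern in an uncontrolled
way and might cancel the main term.

The signs `ξ` prevent such cancellation. They are chosen greedily: if both signs at level `l`
failed, two colourings of the patterns by few colours would have a common pair of equally coloured
patterns, and the two resulting inequalities contradict each other (`exists_sign`, `exists_signs`).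
Hence, for `2 n < N ^ (d - 1)`, among any `2 ^ n` classes of patterns two members of one class have
quantities of interest that differ by at least `amp l` at some parameter. Continuity in the
parameter turns this into a distance in `L_∞`, and choosing `N ^ (d - 1)` comparable to `n` yields
the rate. -/

theorem norm_sub_le_rpow_of_norm_le {V : Type*} [NormedAddCommGroup V] {θ M t : ℝ}
    (hθ : 0 < θ) (hθ' : θ ≤ 1) (ht : 0 ≤ t) (hM : 0 ≤ M) {a b : V} (ha : ‖a‖ ≤ M) (hb : ‖b‖ ≤ M) (hab : ‖a - b‖ ≤ M * t) :
    ‖a - b‖ ≤ 2 * M * t ^ θ := by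
  rcases le_total t 1 with h | h
  · have : t ≤ t ^ θ := by
      simpa using Real.rpow_le_rpow_of_exponent_ge_of_imp ht h hθ' (fun _ h0 => by linarith)
    have : M * t ≤ M * t ^ θ := by gcongr
    have h0 : 0 ≤ M * t ^ θ := by positivity
    linarith
  · have : 1 ≤ t ^ θ := Real.one_le_rpow h hθ.le
    calc ‖a - b‖ ≤ 2 * M := by linarith [norm_sub_le a b]
      _ ≤ 2 * M * t ^ θ := le_mul_of_one_le_right (by positivity) this

theorem norm_iteratedFDeriv_succ_sub {V W : Type*} [NormedAddCommGroup V] [NormedSpace ℝ V]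
    [NormedAddCommGroup W] [NormedSpace ℝ W] (k : ℕ) (f : V → W) (x y : V) :
    ‖iteratedFDeriv ℝ (k + 1) f x - iteratedFDeriv ℝ (k + 1) f y‖ =
      ‖iteratedFDeriv ℝ k (fderiv ℝ f) x - iteratedFDeriv ℝ k (fderiv ℝ f) y‖ := by
  have := (continuousMultilinearCurryRightEquiv' ℝ k V W).symm.norm_map
    (iteratedFDeriv ℝ k (fderiv ℝ f) x - iteratedFDeriv ℝ k (fderiv ℝ f) y)
  rw [LinearIsometryEquiv.map_sub] at this
  rw [iteratedFDeriv_succ_eq_comp_right, iteratedFDeriv_succ_eq_comp_right]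
  exact this

variable {X : Type} [NormedAddCommGroup X] [NormedSpace ℝ X]

/-- The function `f` is of class `C^{k,θ}` on `S` at the length scale `1 / Λ`: its derivatives of
order `i ≤ k` are bounded by `M * Λ ^ i` and the last one is `θ`-Hölder continuous with constant
`M * Λ ^ (k + θ)`. -/
def HolderBound (θ Λ : ℝ) (S : Set X) :
    ℕ → ∀ {Y : Type} [NormedAddCommGroup Y] [NormedSpace ℝ Y], (X → Y) → ℝ → Prop
  | 0, _, _, _, f, M => (∀ x ∈ S, ‖f x‖ ≤ M) ∧
      ∀ x ∈ S, ∀ y ∈ S, ‖f x - f y‖ ≤ M * (Λ * dist x y) ^ θ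
  | k + 1, _, _, _, f, M => (∀ x ∈ S, DifferentiableAt ℝ f x) ∧ (∀ x ∈ S, ‖f x‖ ≤ M) ∧
      HolderBound θ Λ S k (fderiv ℝ f) (M * Λ)

variable {Y : Type} [NormedAddCommGroup Y] [NormedSpace ℝ Y]
  {Y₁ : Type} [NormedAddCommGroup Y₁] [NormedSpace ℝ Y₁]
  {Y₂ : Type} [NormedAddCommGroup Y₂] [NormedSpace ℝ Y₂]
  {θ Λ : ℝ} {S : Set X} {k : ℕ}

theorem HolderBound.norm_le {f : X → Y} {M : ℝ} (h : HolderBound θ Λ S k f M) {x : X}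
    (hx : x ∈ S) : ‖f x‖ ≤ M := by
  cases k with
  | zero => exact h.1 x hx
  | succ k => exact h.2.1 x hx

theorem HolderBound.mono {f : X → Y} {M M' : ℝ} (hΛ : 0 ≤ Λ) (hM : M ≤ M')
    (h : HolderBound θ Λ S k f M) : HolderBound θ Λ S k f M' := by
  induction k generalizing Y M M' with
  | zero =>
    refine ⟨fun x hx => (h.1 x hx).trans hM, fun x hx y hy => (h.2 x hx y hy).trans ?_⟩
    gcongr
  | succ k ih =>
    exact ⟨h.1, fun x hx => (h.2.1 x hx).trans hM, ih (by gcongr) h.2.2⟩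

theorem HolderBound.congr (hS : IsOpen S) {f g : X → Y} {M : ℝ} (hfg : ∀ x ∈ S, f x = g x)
    (h : HolderBound θ Λ S k f M) : HolderBound θ Λ S k g M := by
  induction k generalizing Y M with
  | zero =>
    exact ⟨fun x hx => hfg x hx ▸ h.1 x hx,
      fun x hx y hy => hfg x hx ▸ hfg y hy ▸ h.2 x hx y hy⟩
  | succ k ih =>
    have key : ∀ x ∈ S, f =ᶠ[nhds x] g := fun x hx =>
      Filter.eventually_of_mem (hS.mem_nhds hx) hfg
    exact ⟨fun x hx => (key x hx).differentiableAt_iff.1 (h.1 x hx),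
      fun x hx => hfg x hx ▸ h.2.1 x hx, ih (fun x hx => (key x hx).fderiv_eq) h.2.2⟩

theorem HolderBound.const (hΛ : 0 ≤ Λ) {c : Y} {M : ℝ} (hc : ‖c‖ ≤ M) :
    HolderBound θ Λ S k (fun _ => c) M := by
  have hM : 0 ≤ M := (norm_nonneg c).trans hc
  induction k generalizing Y M with
  | zero =>
    refine ⟨fun _ _ => hc, fun x _ y _ => ?_⟩
    simp only [sub_self, norm_zero]
    positivity
  | succ k ih =>
    refine ⟨fun x _ => by fun_prop, fun _ _ => hc, ?_⟩
    have : fderiv ℝ (fun _ : X => c) = fun _ => 0 := by ext1 x; simp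
    rw [this]
    exact ih (by simpa using mul_nonneg hM hΛ) (mul_nonneg hM hΛ)

theorem HolderBound.add (hS : IsOpen S) {f g : X → Y} {M M' : ℝ} (hf : HolderBound θ Λ S k f M)
    (hg : HolderBound θ Λ S k g M') : HolderBound θ Λ S k (fun x => f x + g x) (M + M') := by
  induction k generalizing Y M M' with
  | zero =>
    refine ⟨fun x hx => norm_add_le_of_le (hf.1 x hx) (hg.1 x hx), fun x hx y hy => ?_⟩
    rw [add_sub_add_comm, add_mul]
    exact norm_add_le_of_le (hf.2 x hx y hy) (hg.2 x hx y hy)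
  | succ k ih =>
    refine ⟨fun x hx => (hf.1 x hx).add (hg.1 x hx),
      fun x hx => norm_add_le_of_le (hf.2.1 x hx) (hg.2.1 x hx), ?_⟩
    rw [add_mul]
    refine HolderBound.congr hS (fun x hx => ?_) (ih hf.2.2 hg.2.2)
    exact (fderiv_add (hf.1 x hx) (hg.1 x hx)).symm

/-- A bound `C` in place of `‖T‖` survives the induction: composing with `T` on the space of
derivatives is again an operator of norm at most `C`. -/
theorem HolderBound.clm_comp (hS : IsOpen S) (T : Y →L[ℝ] Y₁) {f : X → Y} {M C : ℝ}
    (hT : ‖T‖ ≤ C) (hf : HolderBound θ Λ S k f M) :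
    HolderBound θ Λ S k (fun x => T (f x)) (C * M) := by
  have hC : 0 ≤ C := (norm_nonneg T).trans hT
  induction k generalizing Y Y₁ M with
  | zero =>
    refine ⟨fun x hx => T.le_of_opNorm_le_of_le hT (hf.1 x hx), fun x hx y hy => ?_⟩
    rw [← map_sub, mul_assoc]
    exact T.le_of_opNorm_le_of_le hT (hf.2 x hx y hy)
  | succ k ih =>
    refine ⟨fun x hx => T.differentiableAt.comp x (hf.1 x hx),
      fun x hx => T.le_of_opNorm_le_of_le hT (hf.2.1 x hx), ?_⟩
    rw [mul_assoc]
    refine HolderBound.congr hS (fun x hx => ?_)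
      (ih (ContinuousLinearMap.compL ℝ X Y Y₁ T) ?_ hf.2.2)
    · exact ((T.hasFDerivAt.comp x (hf.1 x hx).hasFDerivAt).fderiv).symm
    · refine ContinuousLinearMap.opNorm_le_bound _ hC fun A => ?_
      exact (ContinuousLinearMap.opNorm_comp_le T A).trans (by gcongr)

theorem HolderBound.norm_sub_le (hSc : Convex ℝ S) {f : X → Y} {M : ℝ}
    (h : HolderBound θ Λ S (k + 1) f M) {x y : X} (hx : x ∈ S) (hy : y ∈ S) :
    ‖f x - f y‖ ≤ M * (Λ * dist x y) := by
  rw [← mul_assoc, dist_eq_norm]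
  exact hSc.norm_image_sub_le_of_norm_fderiv_le (fun z hz => h.1 z hz)
    (fun z hz => h.2.2.norm_le hz) hy hx

/-- The mean value inequality on the convex set `S` gives a Lipschitz bound in the last order;
interpolation with the sup bound makes it a Hölder bound. -/
theorem HolderBound.of_succ (hSc : Convex ℝ S) (hθ : 0 < θ) (hθ' : θ ≤ 1) (hΛ : 0 ≤ Λ)
    {f : X → Y} {M : ℝ} (hM : 0 ≤ M) (h : HolderBound θ Λ S (k + 1) f M) :
    HolderBound θ Λ S k f (2 * M) := by
  induction k generalizing Y M with
  | zero =>
    refine ⟨fun x hx => (h.norm_le hx).trans (by linarith), fun x hx y hy => ?_⟩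
    exact norm_sub_le_rpow_of_norm_le hθ hθ' (by positivity) hM (h.norm_le hx) (h.norm_le hy)
      (h.norm_sub_le hSc hx hy)
  | succ k ih =>
    refine ⟨h.1, fun x hx => (h.norm_le hx).trans (by linarith), ?_⟩
    rw [mul_assoc]
    exact ih (by positivity) h.2.2

theorem HolderBound.of_le (hSc : Convex ℝ S) (hθ : 0 < θ) (hθ' : θ ≤ 1) (hΛ : 0 ≤ Λ)
    {f : X → Y} {M : ℝ} (hM : 0 ≤ M) {j : ℕ} (hj : j ≤ k) (h : HolderBound θ Λ S k f M) :
    HolderBound θ Λ S j f (2 ^ k * M) := by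
  induction k generalizing M with
  | zero =>
    obtain rfl : j = 0 := by omega
    simpa using h
  | succ k ih =>
    rcases hj.eq_or_lt with rfl | hj
    · exact h.mono hΛ (le_mul_of_one_le_left hM (one_le_pow₀ (by norm_num)))
    · have := ih (M := 2 * M) (by positivity) (by omega) (h.of_succ hSc hθ hθ' hΛ hM)
      rwa [← mul_assoc, ← pow_succ] at this

/-- Charts are controlled at the fixed scale `1`, bumps at the scale `1 / Λ`. This brings both to
the same scale, so that they can enter one product estimate. -/
theorem HolderBound.of_unit_scale (hθ : 0 < θ) (hθ' : θ ≤ 1) (hΛ : 1 ≤ Λ) {f : X → Y} {M : ℝ}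
    (hM : 0 ≤ M) (h : HolderBound 1 1 S k f M) : HolderBound θ Λ S k f (2 * M) := by
  induction k generalizing Y M with
  | zero =>
    refine ⟨fun x hx => (h.1 x hx).trans (by linarith), fun x hx y hy => ?_⟩
    refine norm_sub_le_rpow_of_norm_le hθ hθ' (by positivity) hM (h.1 x hx) (h.1 y hy)
      ((h.2 x hx y hy).trans ?_)
    rw [Real.rpow_one]
    gcongr
  | succ k ih =>
    refine ⟨h.1, fun x hx => (h.norm_le hx).trans (by linarith), ?_⟩
    refine (ih (by positivity) h.2.2).mono (by linarith) ?_
    rw [mul_one]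
    exact le_mul_of_one_le_right (by positivity) hΛ

/-- By Leibniz' rule the derivative is a sum of two bilinear expressions of one order less, built
from `B.precompR` and `B.precompL`, whose norms do not exceed that of `B`. The induction therefore
runs over all codomains and bilinear maps at once. In each term the undifferentiated factor loses
one order through `of_succ` and costs a factor `2`, so that the constant grows by `4` per order. -/
theorem HolderBound.bilinear (hS : IsOpen S) (hSc : Convex ℝ S) (hθ : 0 < θ) (hθ' : θ ≤ 1)
    (hΛ : 0 ≤ Λ) (B : Y →L[ℝ] Y₁ →L[ℝ] Y₂) {f : X → Y} {g : X → Y₁} {M M' C : ℝ}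
    (hM : 0 ≤ M) (hM' : 0 ≤ M') (hB : ‖B‖ ≤ C)
    (hf : HolderBound θ Λ S k f M) (hg : HolderBound θ Λ S k g M') :
    HolderBound θ Λ S k (fun x => B (f x) (g x)) (2 * 4 ^ k * C * M * M') := by
  have hC : 0 ≤ C := (norm_nonneg B).trans hB
  have hbd : ∀ {Z Z₁ Z₂ : Type} [NormedAddCommGroup Z] [NormedSpace ℝ Z] [NormedAddCommGroup Z₁]
      [NormedSpace ℝ Z₁] [NormedAddCommGroup Z₂] [NormedSpace ℝ Z₂] (B : Z →L[ℝ] Z₁ →L[ℝ] Z₂)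
      (_ : ‖B‖ ≤ C) {a : Z} {b : Z₁} {m m' : ℝ} (_ : 0 ≤ m) (_ : ‖a‖ ≤ m) (_ : ‖b‖ ≤ m'),
      ‖B a b‖ ≤ C * m * m' := by
    intro Z Z₁ Z₂ _ _ _ _ _ _ B hB a b m m' hm ha hb
    exact (B.le_opNorm₂ a b).trans (by gcongr)
  induction k generalizing Y Y₁ Y₂ M M' with
  | zero =>
    refine ⟨fun x hx => (hbd B hB hM (hf.1 x hx) (hg.1 x hx)).trans ?_, fun x hx y hy => ?_⟩
    · have : 0 ≤ C * M * M' := by positivity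
      linarith
    · have e : B (f x) (g x) - B (f y) (g y) = B (f x) (g x - g y) + B (f x - f y) (g y) := by
        simp
      rw [e]
      have h1 := hbd B hB hM (hf.1 x hx) (hg.2 x hx y hy)
      have h2 := hbd B hB (by positivity) (hf.2 x hx y hy) (hg.1 y hy)
      refine (norm_add_le_of_le h1 h2).trans (le_of_eq ?_)
      ring
  | succ k ih =>
    refine ⟨fun x hx => ?_, fun x hx => (hbd B hB hM (hf.2.1 x hx) (hg.2.1 x hx)).trans ?_, ?_⟩
    · exact (B.hasFDerivAt_of_bilinear (hf.1 x hx).hasFDerivAt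
        (hg.1 x hx).hasFDerivAt).differentiableAt
    · have h1 : (1 : ℝ) ≤ 2 * 4 ^ (k + 1) := by
        have : (1 : ℝ) ≤ 4 ^ (k + 1) := one_le_pow₀ (by norm_num)
        linarith
      have : 0 ≤ C * M * M' := by positivity
      nlinarith
    · have e : 2 * 4 ^ (k + 1) * C * M * M' * Λ =
          2 * 4 ^ k * C * (2 * M) * (M' * Λ) + 2 * 4 ^ k * C * (M * Λ) * (2 * M') := by ring
      rw [e]
      have h1 := ih (B.precompR X) (by positivity) (by positivity)
        ((ContinuousLinearMap.norm_precompR_le X B).trans hB)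
        (hf.of_succ hSc hθ hθ' hΛ hM) hg.2.2
      have h2 := ih (B.precompL X) (by positivity) (by positivity)
        ((ContinuousLinearMap.norm_precompL_le X B).trans hB)
        hf.2.2 (hg.of_succ hSc hθ hθ' hΛ hM')
      refine (h1.add hS h2).congr hS fun x hx => ?_
      exact (B.hasFDerivAt_of_bilinear (hf.1 x hx).hasFDerivAt
        (hg.1 x hx).hasFDerivAt).fderiv.symm

/-- The chain rule writes the derivative as a product of `(fderiv ℝ G) ∘ Φ` and `fderiv ℝ Φ`, so
induction and `bilinear` apply. The order of quantifiers is the point: `C` is fixed before `Λ`, `G`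
and the codomain, so that a chart costs the same factor at every scale. -/
theorem HolderBound.comp (hS : IsOpen S) (hSc : Convex ℝ S) (hθ : 0 < θ) (hθ' : θ ≤ 1)
    {Z : Type} [NormedAddCommGroup Z] [NormedSpace ℝ Z] {Φ : X → Z} {K : ℝ} (hK : 1 ≤ K) :
    ∀ k : ℕ, (∀ x ∈ S, ∀ y ∈ S, ‖Φ x - Φ y‖ ≤ K * dist x y) →
      (∀ j < k, (∀ x ∈ S, DifferentiableAt ℝ Φ x) ∧ HolderBound 1 1 S j (fderiv ℝ Φ) K) →
      ∃ C : ℝ, 1 ≤ C ∧ ∀ {Y : Type} [NormedAddCommGroup Y] [NormedSpace ℝ Y] (Λ : ℝ) (_ : 1 ≤ Λ)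
        (G : Z → Y) (M : ℝ) (_ : 0 ≤ M), HolderBound θ Λ univ k G M →
        HolderBound θ Λ S k (fun x => G (Φ x)) (C * M) := by
  intro k hL
  induction k with
  | zero =>
    intro _
    refine ⟨K, hK, fun Λ hΛ G M hM hG => ⟨fun x hx => ?_, fun x hx y hy => ?_⟩⟩
    · exact (hG.1 _ trivial).trans (le_mul_of_one_le_left hM hK)
    · refine (hG.2 _ trivial _ trivial).trans ?_
      have h1 : (Λ * dist (Φ x) (Φ y)) ^ θ ≤ (K * (Λ * dist x y)) ^ θ := by
        refine Real.rpow_le_rpow (by positivity) ?_ hθ.le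
        rw [dist_eq_norm (Φ x)]
        calc Λ * ‖Φ x - Φ y‖ ≤ Λ * (K * dist x y) := by gcongr; exact hL x hx y hy
          _ = _ := by ring
      have h2 : K ^ θ ≤ K := by
        simpa using Real.rpow_le_rpow_of_exponent_le hK hθ'
      have h3 : (K * (Λ * dist x y)) ^ θ = K ^ θ * (Λ * dist x y) ^ θ :=
        Real.mul_rpow (by positivity) (by positivity)
      rw [h3] at h1
      calc M * (Λ * dist (Φ x) (Φ y)) ^ θ ≤ M * (K ^ θ * (Λ * dist x y) ^ θ) := by gcongr
        _ ≤ M * (K * (Λ * dist x y) ^ θ) := by gcongr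
        _ = _ := by ring
  | succ k ih =>
    intro hΦ
    obtain ⟨C, hC, h⟩ := ih fun j hj => hΦ j (by omega)
    obtain ⟨hd, hk⟩ := hΦ k (by omega)
    refine ⟨2 * 4 ^ k * 1 * C * (2 * K), ?_, fun {Y} _ _ Λ hΛ G M hM hG => ⟨?_, ?_, ?_⟩⟩
    · have : (1 : ℝ) ≤ 4 ^ k := one_le_pow₀ (by norm_num)
      have : (1 : ℝ) ≤ 4 ^ k * C := one_le_mul_of_one_le_of_one_le this hC
      have : (1 : ℝ) ≤ 4 ^ k * C * K := one_le_mul_of_one_le_of_one_le this hK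
      linarith
    · exact fun x hx => (hG.1 _ trivial).comp x (hd x hx)
    · intro x hx
      refine (hG.2.1 _ trivial).trans (le_mul_of_one_le_left hM ?_)
      have : (1 : ℝ) ≤ 4 ^ k := one_le_pow₀ (by norm_num)
      have : (1 : ℝ) ≤ 4 ^ k * C := one_le_mul_of_one_le_of_one_le this hC
      have : (1 : ℝ) ≤ 4 ^ k * C * K := one_le_mul_of_one_le_of_one_le this hK
      linarith
    · have h1 := h Λ hΛ (fderiv ℝ G) (M * Λ) (by positivity) hG.2.2
      have h2 := hk.of_unit_scale hθ hθ' hΛ (by linarith)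
      have h3 := HolderBound.bilinear hS hSc hθ hθ' (by linarith)
        (ContinuousLinearMap.compL ℝ X Z Y) (by positivity) (by positivity)
        (ContinuousLinearMap.norm_compL_le ℝ X Z Y) h1 h2
      have e : 2 * 4 ^ k * 1 * C * (2 * K) * M * Λ =
        2 * 4 ^ k * 1 * (C * (M * Λ)) * (2 * K) := by ring
      rw [e]
      refine h3.congr hS fun x hx => ?_
      exact (fderiv_comp x (hG.1 _ trivial) (hd x hx)).symm

theorem HolderBound.of_iteratedFDeriv (hS : IsOpen S) {f : X → Y} {M : ℝ}
    (hf : ContDiffOn ℝ k f S) (hb : ∀ i ≤ k, ∀ x ∈ S, ‖iteratedFDeriv ℝ i f x‖ ≤ M * Λ ^ i)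
    (hl : ∀ x ∈ S, ∀ y ∈ S, ‖iteratedFDeriv ℝ k f x - iteratedFDeriv ℝ k f y‖
      ≤ M * Λ ^ k * (Λ * dist x y) ^ θ) : HolderBound θ Λ S k f M := by
  induction k generalizing Y M with
  | zero =>
    refine ⟨fun x hx => by simpa using hb 0 le_rfl x hx, fun x hx y hy => ?_⟩
    have := hl x hx y hy
    rw [iteratedFDeriv_zero_eq_comp, Function.comp_apply, Function.comp_apply, ← map_sub,
      LinearIsometryEquiv.norm_map, pow_zero, mul_one] at this
    exact this
  | succ k ih =>
    refine ⟨fun x hx => ?_, fun x hx => by simpa using hb 0 (by omega) x hx, ih ?_ ?_ ?_⟩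
    · exact (hf.differentiableOn (by simp)).differentiableAt (hS.mem_nhds hx)
    · exact hf.fderiv_of_isOpen hS (by simp)
    · intro i hi x hx
      rw [norm_iteratedFDeriv_fderiv, mul_assoc, ← pow_succ']
      exact hb _ (by omega) x hx
    · intro x hx y hy
      have := hl x hx y hy
      rw [norm_iteratedFDeriv_succ_sub] at this
      rwa [mul_assoc M, ← pow_succ']

end HolderBound

/-! ### Weak derivatives of functions with Lipschitz continuous derivatives -/

/-- The partial derivatives `∂_{a_i} ⋯ ∂_{a_1} f`, evaluated one after the other. -/
def iterDeriv {n : ℕ} : (i : ℕ) → (Fin i → Fin n) → (E n → ℝ) → E n → ℝ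
  | 0, _, f => f
  | i + 1, a, f =>
    iterDeriv i (fun l => a l.succ) fun x => fderiv ℝ f x (EuclideanSpace.single (a 0) 1)

theorem contDiff_partialDeriv {n i : ℕ} (a : Fin i → Fin n) {φ : E n → ℝ}
    (hφ : ContDiff ℝ ∞ φ) : ContDiff ℝ ∞ (partialDeriv a φ) := by
  have : ContDiff ℝ ∞ (iteratedFDeriv ℝ i φ) := hφ.iteratedFDeriv_right (by exact_mod_cast le_top)
  exact (ContinuousMultilinearMap.apply ℝ (fun _ : Fin i => E n) ℝ
    (fun l => EuclideanSpace.single (a l) (1 : ℝ))).contDiff.comp this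

theorem tsupport_partialDeriv_subset {n i : ℕ} (a : Fin i → Fin n) (φ : E n → ℝ) :
    tsupport (partialDeriv a φ) ⊆ tsupport φ := by
  refine (closure_mono ?_).trans (tsupport_iteratedFDeriv_subset (𝕜 := ℝ) i)
  intro x hx h0
  exact hx (by simp [partialDeriv, h0])

theorem partialDeriv_succ {n i : ℕ} (a : Fin (i + 1) → Fin n) {φ : E n → ℝ}
    (hφ : ContDiff ℝ ∞ φ) (x : E n) :
    partialDeriv a φ x =
      fderiv ℝ (partialDeriv (fun l => a l.succ) φ) x (EuclideanSpace.single (a 0) 1) := by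
  have : ContDiff ℝ ∞ (iteratedFDeriv ℝ i φ) := hφ.iteratedFDeriv_right (by exact_mod_cast le_top)
  unfold partialDeriv
  rw [iteratedFDeriv_succ_apply_left,
    fderiv_continuousMultilinear_apply_const_apply (this.differentiable (by simp) x)]
  rfl

/-- Extended to a Lipschitz function on the whole space, `g` is differentiable almost everywhere by
Rademacher's theorem and can be integrated by parts against `ψ`. Outside `B` the test function and
its derivative vanish, so the extension leaves no trace. -/
theorem integral_mul_fderiv_eq_neg {n : ℕ} {B : Set (E n)} (hB : IsOpen B) {g : E n → ℝ}
    {K : ℝ≥0} (hg : LipschitzOnWith K g B) {ψ : E n → ℝ} (hψ : ContDiff ℝ ∞ ψ)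
    (hc : HasCompactSupport ψ) (hs : tsupport ψ ⊆ B) (w : E n) :
    ∫ x in B, g x * fderiv ℝ ψ x w = - ∫ x in B, fderiv ℝ g x w * ψ x := by
  obtain ⟨g', hg', hgg'⟩ := hg.extend_real
  obtain ⟨D, hD⟩ := hψ.lipschitzWith_of_hasCompactSupport hc (by simp)
  have key := hg'.integral_lineDeriv_mul_eq (μ := volume) hD hc w
  have hzero : ∀ x, x ∉ B → ψ x = 0 := fun x hx =>
    image_eq_zero_of_notMem_tsupport fun h => hx (hs h)
  have hzero' : ∀ x, x ∉ B → fderiv ℝ ψ x w = 0 := fun x hx => by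
    rw [image_eq_zero_of_notMem_tsupport (f := fderiv ℝ ψ) fun h =>
      hx (hs (tsupport_fderiv_subset ℝ h))]
    simp
  have h1 : ∫ x, lineDeriv ℝ g' x w * ψ x = ∫ x in B, fderiv ℝ g x w * ψ x := by
    rw [setIntegral_eq_integral_of_forall_compl_eq_zero]
    swap
    · intro x hx; simp [hzero x hx]
    refine integral_congr_ae ?_
    filter_upwards [hg'.ae_differentiableAt] with x hx
    by_cases hxB : x ∈ B
    · have e : g' =ᶠ[nhds x] g := Filter.eventually_of_mem (hB.mem_nhds hxB)
        fun y hy => (hgg' hy).symm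
      rw [hx.lineDeriv_eq_fderiv, e.fderiv_eq]
    · simp [hzero x hxB]
  have h2 : ∫ x, lineDeriv ℝ ψ x (-w) * g' x = - ∫ x in B, g x * fderiv ℝ ψ x w := by
    rw [← integral_neg, setIntegral_eq_integral_of_forall_compl_eq_zero]
    swap
    · intro x hx; simp [hzero' x hx]
    refine integral_congr_ae (Filter.Eventually.of_forall fun x => ?_)
    dsimp only
    rw [(hψ.differentiable (by simp) x).lineDeriv_eq_fderiv, map_neg]
    by_cases hxB : x ∈ B
    · rw [hgg' hxB]; ring
    · rw [hzero' x hxB]; ring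
  rw [h1, h2] at key
  linarith

theorem hasWeakDeriv_zero {n : ℕ} {B : Set (E n)} {f : E n → ℝ} (hf : LocallyIntegrableOn f B)
    (a : Fin 0 → Fin n) : HasWeakDeriv B f f a :=
  ⟨hf, hf, fun φ _ _ _ => by simp [partialDeriv]⟩

/-- Only a Lipschitz bound is required of `f`. This is what permits the last derivative of a
`C^{k,1}` function to exist merely almost everywhere. -/
theorem HasWeakDeriv.of_fderiv {n i : ℕ} {B : Set (E n)} (hB : IsOpen B) {f g : E n → ℝ}
    {K : ℝ≥0} (hf : LipschitzOnWith K f B) (a : Fin (i + 1) → Fin n)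
    (h : HasWeakDeriv B (fun x => fderiv ℝ f x (EuclideanSpace.single (a 0) 1)) g
      (fun l => a l.succ)) : HasWeakDeriv B f g a := by
  refine ⟨hf.continuousOn.locallyIntegrableOn hB.measurableSet, h.2.1, fun φ hφ hc hs => ?_⟩
  have h1 := integral_mul_fderiv_eq_neg hB hf
    (contDiff_partialDeriv (fun l => a l.succ) hφ)
    (hc.of_isClosed_subset (isClosed_tsupport _) (tsupport_partialDeriv_subset _ φ))
    ((tsupport_partialDeriv_subset _ φ).trans hs) (EuclideanSpace.single (a 0) 1)
  simp only [partialDeriv_succ a hφ]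
  rw [h1, h.2.2 φ hφ hc hs, pow_succ]
  ring

section

variable {n : ℕ} {θ Λ : ℝ} {B : Set (E n)} {k : ℕ} {f : E n → ℝ} {M : ℝ}

theorem HolderBound.fderiv_apply (hB : IsOpen B) (h : HolderBound θ Λ B (k + 1) f M)
    (i : Fin n) :
    HolderBound θ Λ B k (fun x => fderiv ℝ f x (EuclideanSpace.single i 1)) (M * Λ) := by
  have := h.2.2.clm_comp hB (ContinuousLinearMap.apply ℝ ℝ (EuclideanSpace.single i (1 : ℝ)))
    (C := 1) (ContinuousLinearMap.opNorm_le_bound _ zero_le_one fun A => by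
      simpa using A.le_opNorm (EuclideanSpace.single i (1 : ℝ)))
  simpa using this

theorem HolderBound.iterDeriv (hB : IsOpen B) {i : ℕ} (a : Fin i → Fin n)
    (h : HolderBound θ Λ B (k + i) f M) : HolderBound θ Λ B k (iterDeriv i a f) (M * Λ ^ i) := by
  induction i generalizing f M with
  | zero => simpa [Transport.iterDeriv] using h
  | succ i ih =>
    have := ih (fun l => a l.succ) (h.fderiv_apply hB (a 0))
    rwa [mul_assoc, ← pow_succ'] at this

theorem HolderBound.continuousOn (hθ : 0 < θ) (h : HolderBound θ Λ B k f M) :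
    ContinuousOn f B := by
  cases k with
  | zero =>
    intro x hx
    rw [ContinuousWithinAt, tendsto_iff_norm_sub_tendsto_zero]
    refine squeeze_zero' (Filter.Eventually.of_forall fun _ => norm_nonneg _)
      (eventually_nhdsWithin_of_forall fun y hy => h.2 y hy x hx) ?_
    have : ContinuousAt (fun y => M * (Λ * dist y x) ^ θ) x := by
      refine continuousAt_const.mul (ContinuousAt.rpow_const ?_ (Or.inr hθ.le))
      fun_prop
    have h2 := this.tendsto
    simp only [dist_self, mul_zero, Real.zero_rpow hθ.ne'] at h2
    exact h2.mono_left nhdsWithin_le_nhds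
  | succ k => exact fun x hx => (h.1 x hx).continuousAt.continuousWithinAt

theorem lipschitzOnWith_of_norm_sub_le {X Y : Type*} [PseudoMetricSpace X]
    [NormedAddCommGroup Y] {f : X → Y} {S : Set X} {C : ℝ}
    (h : ∀ x ∈ S, ∀ y ∈ S, ‖f x - f y‖ ≤ C * dist x y) :
    LipschitzOnWith C.toNNReal f S :=
  LipschitzOnWith.of_dist_le_mul fun x hx y hy => by
    rw [dist_eq_norm (f x)]
    refine (h x hx y hy).trans ?_
    gcongr
    exact Real.le_coe_toNNReal C

theorem HolderBound.lipschitzOnWith (hBc : Convex ℝ B) (h : HolderBound θ Λ B (k + 1) f M) :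
    LipschitzOnWith (M * Λ).toNNReal f B :=
  lipschitzOnWith_of_norm_sub_le fun x hx y hy => by
    rw [mul_assoc]; exact h.norm_sub_le hBc hx hy

theorem HolderBound.hasWeakDeriv (hB : IsOpen B) (hBc : Convex ℝ B) (hθ : 0 < θ) {i : ℕ}
    (a : Fin i → Fin n) (h : HolderBound θ Λ B (k + i) f M) :
    HasWeakDeriv B f (Transport.iterDeriv i a f) a := by
  induction i generalizing f M with
  | zero => exact hasWeakDeriv_zero ((h.continuousOn hθ).locallyIntegrableOn hB.measurableSet) a
  | succ i ih =>
    exact HasWeakDeriv.of_fderiv hB (HolderBound.lipschitzOnWith (k := k + i) hBc h) a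
      (ih (fun l => a l.succ) (HolderBound.fderiv_apply (k := k + i) hB h (a 0)))

/-- One order beyond the classical derivatives: those of order `k` are Lipschitz, and their almost
everywhere defined gradient is a bounded weak derivative. This covers integral smoothness `s = k +
1` on boundaries of class `C^{k,1}`. -/
theorem HolderBound.hasWeakDeriv_succ (hB : IsOpen B) (hBc : Convex ℝ B) (hΛ : 0 ≤ Λ)
    (hM : 0 ≤ M) (a : Fin (k + 1) → Fin n) (h : HolderBound 1 Λ B k f M) :
    HasWeakDeriv B f (Transport.iterDeriv (k + 1) a f) a ∧
      ∀ x ∈ B, ‖Transport.iterDeriv (k + 1) a f x‖ ≤ M * Λ ^ (k + 1) := by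
  induction k generalizing f M with
  | zero =>
    have hL : LipschitzOnWith (M * Λ).toNNReal f B := lipschitzOnWith_of_norm_sub_le
      fun x hx y hy => by simpa [mul_assoc] using h.2 x hx y hy
    have hb : ∀ x ∈ B, ‖fderiv ℝ f x (EuclideanSpace.single (a 0) 1)‖ ≤ M * Λ := by
      intro x hx
      have h1 := norm_fderiv_le_of_lipschitzOn ℝ (hB.mem_nhds hx) hL
      rw [Real.coe_toNNReal _ (by positivity)] at h1
      simpa using (fderiv ℝ f x).le_of_opNorm_le h1 (EuclideanSpace.single (a 0) 1)
    refine ⟨HasWeakDeriv.of_fderiv hB hL a (hasWeakDeriv_zero ?_ _), ?_⟩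
    · refine fun x hx => ⟨B ∩ ball x 1, ?_, ?_⟩
      · exact Filter.inter_mem self_mem_nhdsWithin (mem_nhdsWithin_of_mem_nhds (ball_mem_nhds x one_pos))
      · refine Measure.integrableOn_of_bounded (M := M * Λ)
          ((measure_mono inter_subset_right).trans_lt measure_ball_lt_top).ne
          (measurable_fderiv_apply_const ℝ f _).aestronglyMeasurable ?_
        exact (ae_restrict_iff' (hB.measurableSet.inter measurableSet_ball)).2
          (Filter.Eventually.of_forall fun y hy => hb y hy.1)
    · simpa [Transport.iterDeriv] using hb
  | succ k ih =>
    obtain ⟨h1, h2⟩ := ih (by positivity) (fun l => a l.succ) (h.fderiv_apply hB (a 0))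
    refine ⟨HasWeakDeriv.of_fderiv hB (h.lipschitzOnWith hBc) a h1, fun x hx => ?_⟩
    rw [pow_succ', ← mul_assoc]
    exact h2 x hx

theorem iterDeriv_eq_zero {O : Set (E n)} (hO : IsOpen O) (hf : ∀ x ∈ O, f x = 0) {i : ℕ}
    (a : Fin i → Fin n) : ∀ x ∈ O, iterDeriv i a f x = 0 := by
  induction i generalizing f with
  | zero => exact hf
  | succ i ih =>
    refine ih (fun x hx => ?_) _
    have : f =ᶠ[nhds x] fun _ => 0 := Filter.eventually_of_mem (hO.mem_nhds hx) hf
    rw [this.fderiv_eq]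
    simp

end

/-- In polar coordinates the integrand is `y ^ ((1 - σ) * p - 1)` for `y ≤ 1` and at most a multiple
of `y ^ (-1 - σ * p)` for `y > 1`. The two conditions on `σ` are exactly integrability at `0` and at
infinity. -/
theorem integrable_slobodeckij_kernel {n : ℕ} (hn : 1 ≤ n) {p σ : ℝ} (hp : 1 ≤ p) (hσ : 0 < σ)
    (hσ' : σ < 1) :
    Integrable fun x : E n => (min 2 ‖x‖ / ‖x‖ ^ ((n : ℝ) / p + σ)) ^ p := by
  have : Nontrivial (E n) := Module.nontrivial_of_finrank_pos (R := ℝ) (by simp; omega)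
  rw [integrable_fun_norm_addHaar volume (f := fun y : ℝ => (min 2 y / y ^ ((n : ℝ) / p + σ)) ^ p)]
  have hp0 : 0 < p := by linarith
  have hmeas : Measurable fun y : ℝ =>
      y ^ (Module.finrank ℝ (E n) - 1) • (min 2 y / y ^ ((n : ℝ) / p + σ)) ^ p := by
    fun_prop
  have hform : ∀ y : ℝ, 0 < y → ∀ c : ℝ, 0 < c → y ^ (Module.finrank ℝ (E n) - 1) •
      (c / y ^ ((n : ℝ) / p + σ)) ^ p = c ^ p * y ^ (-1 - σ * p) := by
    intro y hy c hc
    rw [smul_eq_mul, Real.div_rpow hc.le (by positivity), ← Real.rpow_mul hy.le,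
      ← Real.rpow_natCast, finrank_euclideanSpace_fin, Nat.cast_sub hn,
      show (-1 - σ * p) = ((n : ℝ) - (1 : ℕ)) - ((n : ℝ) / p + σ) * p by field_simp; push_cast; ring,
      Real.rpow_sub hy _ (_ * p)]
    ring
  rw [← Ioc_union_Ioi_eq_Ioi zero_le_one]
  refine IntegrableOn.union ?_ ?_
  · have h1 : IntegrableOn (fun y : ℝ => y ^ ((1 - σ) * p - 1)) (Ioc 0 1) := by
      rw [← intervalIntegrable_iff_integrableOn_Ioc_of_le zero_le_one]
      exact intervalIntegral.intervalIntegrable_rpow' (by nlinarith)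
    refine h1.congr_fun (fun y hy => ?_) measurableSet_Ioc
    dsimp only
    rw [min_eq_right (by linarith [hy.2]), hform y hy.1 y hy.1, ← Real.rpow_add hy.1]
    congr 1; ring
  · have h1 : IntegrableOn (fun y : ℝ => 2 ^ p * y ^ (-1 - σ * p)) (Ioi 1) :=
      (integrableOn_Ioi_rpow_of_lt (by nlinarith) one_pos).const_mul _
    refine Integrable.mono' h1 hmeas.aestronglyMeasurable ?_
    refine (ae_restrict_iff' measurableSet_Ioi).2 (Filter.Eventually.of_forall fun y hy => ?_)
    have hy0 : (0 : ℝ) < y := zero_lt_one.trans hy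
    rw [← hform y hy0 2 two_pos, Real.norm_of_nonneg]
    · have : (0 : ℝ) ≤ min 2 y := le_min (by norm_num) hy0.le
      simp only [smul_eq_mul]
      gcongr
      exact min_le_left _ _
    · have : (0 : ℝ) ≤ min 2 y := le_min (by norm_num) hy0.le
      simp only [smul_eq_mul]
      positivity

/-! ### Upper bounds for the Sobolev–Slobodeckij norm -/

theorem eLpNorm_le_of_support {n : ℕ} {B Z : Set (E n)} (hB : IsOpen B) (p : ℝ≥0∞) {g : E n → ℝ}
    {c : ℝ} (hc : 0 ≤ c) (hg : ∀ x ∈ B, ‖g x‖ ≤ c) (hZ : ∀ x, x ∉ Z → g x = 0) :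
    eLpNorm g p (volume.restrict B) ≤
      ENNReal.ofReal c * eLpNorm (Z.indicator fun _ => (1 : ℝ)) p volume := by
  calc eLpNorm g p (volume.restrict B)
      ≤ eLpNorm (c • Z.indicator fun _ => (1 : ℝ)) p (volume.restrict B) := by
        refine eLpNorm_mono_ae ((ae_restrict_iff' hB.measurableSet).2
          (Filter.Eventually.of_forall fun x hx => ?_))
        by_cases hxZ : x ∈ Z
        · simpa [hxZ, abs_of_nonneg hc] using hg x hx
        · simp [hxZ, hZ x hxZ]
    _ ≤ eLpNorm (c • Z.indicator fun _ => (1 : ℝ)) p volume :=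
        eLpNorm_mono_measure _ Measure.restrict_le_self
    _ = _ := by
        rw [eLpNorm_const_smul, Real.enorm_of_nonneg hc]

/-- The kernel that dominates the difference quotients in the Slobodeckij seminorm. -/
def slobodeckijKernel (n : ℕ) (α : ℝ) (x : E n) : ℝ := min 2 ‖x‖ / ‖x‖ ^ α

theorem slobodeckijKernel_nonneg (n : ℕ) (α : ℝ) (x : E n) : 0 ≤ slobodeckijKernel n α x :=
  div_nonneg (le_min (by norm_num) (norm_nonneg x)) (by positivity)

theorem measurable_slobodeckijKernel (n : ℕ) (α : ℝ) : Measurable (slobodeckijKernel n α) := by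
  unfold slobodeckijKernel
  fun_prop

theorem eLpNorm_slobodeckijKernel_ne_top {n : ℕ} (hn : 1 ≤ n) {p : ℝ≥0∞} (hp : 1 ≤ p)
    (hp' : p ≠ ⊤) {σ : ℝ} (hσ : 0 < σ) (hσ' : σ < 1) :
    eLpNorm (slobodeckijKernel n (n / p.toReal + σ)) p volume ≠ ⊤ := by
  have hp0 : p ≠ 0 := (zero_lt_one.trans_le hp).ne'
  have h1 : 1 ≤ p.toReal := by
    simpa using ENNReal.toReal_mono hp' hp
  refine ((integrable_norm_rpow_iff
    (measurable_slobodeckijKernel n _).aestronglyMeasurable hp0 hp').1 ?_).2.ne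
  refine (integrable_slobodeckij_kernel hn h1 hσ hσ').congr
    (Filter.Eventually.of_forall fun x => ?_)
  dsimp only
  rw [Real.norm_of_nonneg (slobodeckijKernel_nonneg n _ x), slobodeckijKernel]

theorem lintegral_comp_const_smul {n : ℕ} {Λ : ℝ} (hΛ : 0 < Λ) {F : E n → ℝ≥0∞}
    (hF : Measurable F) :
    ∫⁻ y, F (Λ • y) = ENNReal.ofReal (Λ ^ (-(n : ℝ))) * ∫⁻ y, F y := by
  have h := lintegral_map (μ := (volume : Measure (E n))) hF (measurable_const_smul Λ)
  rw [Measure.map_addHaar_smul volume hΛ.ne', lintegral_smul_measure] at h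
  rw [← h, finrank_euclideanSpace_fin, abs_of_pos (by positivity), Real.rpow_neg hΛ.le,
    Real.rpow_natCast, smul_eq_mul]

/-- For a fixed first variable, translation and dilation turn the inner integral into a quantity
independent of that variable, so the double integral factorizes. -/
theorem eLpNorm_indicator_mul_kernel {n : ℕ} {p : ℝ≥0∞} (hp : 1 ≤ p) (hp' : p ≠ ⊤) {Z : Set (E n)}
    (hZ : MeasurableSet Z) {K : E n → ℝ} (hK : Measurable K) {Λ : ℝ} (hΛ : 0 < Λ) :
    eLpNorm (fun z : E n × E n => Z.indicator (fun _ => (1 : ℝ)) z.1 * K (Λ • (z.1 - z.2))) p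
      ((volume : Measure (E n)).prod volume) =
      ENNReal.ofReal (Λ ^ (-((n : ℝ) / p.toReal))) *
        (eLpNorm (Z.indicator fun _ => (1 : ℝ)) p volume * eLpNorm K p volume) := by
  have hp0 : p ≠ 0 := (zero_lt_one.trans_le hp).ne'
  have hq : 0 < p.toReal := ENNReal.toReal_pos hp0 hp'
  have hm : Measurable (Z.indicator fun _ => (1 : ℝ)) := measurable_const.indicator hZ
  simp only [eLpNorm_eq_lintegral_rpow_enorm_toReal hp0 hp']
  rw [← ENNReal.mul_rpow_of_nonneg _ _ (by positivity)]
  have e : ENNReal.ofReal (Λ ^ (-((n : ℝ) / p.toReal))) =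
      ENNReal.ofReal (Λ ^ (-(n : ℝ))) ^ (1 / p.toReal) := by
    rw [ENNReal.ofReal_rpow_of_pos (by positivity), ← Real.rpow_mul hΛ.le]
    congr 2; ring
  rw [e, ← ENNReal.mul_rpow_of_nonneg _ _ (by positivity)]
  congr 1
  have hF : Measurable fun y => ‖K y‖ₑ ^ p.toReal := by fun_prop
  rw [lintegral_prod _ (by fun_prop)]
  have inner : ∀ x : E n, ∫⁻ y, ‖Z.indicator (fun _ => (1 : ℝ)) x * K (Λ • (x - y))‖ₑ ^ p.toReal =
      ‖Z.indicator (fun _ => (1 : ℝ)) x‖ₑ ^ p.toReal *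
        (ENNReal.ofReal (Λ ^ (-(n : ℝ))) * ∫⁻ y, ‖K y‖ₑ ^ p.toReal) := by
    intro x
    simp only [enorm_mul, ENNReal.mul_rpow_of_nonneg _ _ hq.le]
    rw [lintegral_const_mul' _ _ (ENNReal.rpow_ne_top_of_nonneg hq.le enorm_ne_top),
      ← lintegral_comp_const_smul hΛ hF,
      ← lintegral_sub_left_eq_self (fun y => ‖K (Λ • y)‖ₑ ^ p.toReal) x]
  simp only [inner]
  rw [lintegral_mul_const _ (by fun_prop)]
  ring

/-- The increment is at most `m * min 2 (Λ * dist x y)` and vanishes unless one of the two points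
lies in `Z`. The quotient is thus dominated by `m * Λ ^ α` times two mirror images of a dilated
kernel. The dilation gives back `Λ ^ (-n / p)`, and `Λ ^ σ` remains, as befits a derivative of order
`σ`. -/
theorem eLpNorm_differenceQuotient_le {n : ℕ} {B Z : Set (E n)} (hB : IsOpen B)
    (hZ : MeasurableSet Z) {p : ℝ≥0∞} (hp : 1 ≤ p) (hp' : p ≠ ⊤) {σ Λ m : ℝ} (hΛ : 0 < Λ)
    (hm : 0 ≤ m) {w : E n → ℝ} (hw : HolderBound 1 Λ B 0 w m) (hwZ : ∀ x, x ∉ Z → w x = 0) :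
    eLpNorm (fun z : E n × E n => (w z.1 - w z.2) / dist z.1 z.2 ^ ((n : ℝ) / p.toReal + σ)) p
      ((volume.restrict B).prod (volume.restrict B)) ≤
      2 * (eLpNorm (Z.indicator fun _ => (1 : ℝ)) p volume *
        eLpNorm (slobodeckijKernel n (n / p.toReal + σ)) p volume) *
        ENNReal.ofReal (m * Λ ^ σ) := by
  set α := (n : ℝ) / p.toReal + σ with hα
  set K := slobodeckijKernel n α with hK
  set I : E n → ℝ := Z.indicator fun _ => (1 : ℝ) with hI
  have hI0 : ∀ x, 0 ≤ I x := fun x => indicator_nonneg (fun _ _ => zero_le_one) x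
  have hm' : Measurable I := measurable_const.indicator hZ
  have hKm : Measurable K := measurable_slobodeckijKernel n α
  let F₁ : E n × E n → ℝ := fun z => I z.1 * K (Λ • (z.1 - z.2))
  let F₂ : E n × E n → ℝ := fun z => I z.2 * K (Λ • (z.2 - z.1))
  have hF₁ : Measurable F₁ := by fun_prop
  have hF₂ : Measurable F₂ := by fun_prop
  have e₁ := eLpNorm_indicator_mul_kernel hp hp' hZ hKm hΛ
  have e₂ : eLpNorm F₂ p ((volume : Measure (E n)).prod volume) =
      eLpNorm F₁ p ((volume : Measure (E n)).prod volume) := by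
    have := eLpNorm_comp_measurePreserving (p := p) (μ := (volume : Measure (E n)).prod volume)
      hF₁.aestronglyMeasurable (Measure.measurePreserving_swap)
    exact this
  have hpt : ∀ z ∈ B ×ˢ B, ‖(w z.1 - w z.2) / dist z.1 z.2 ^ α‖ ≤
      ‖((m * Λ ^ α) • (F₁ + F₂)) z‖ := by
    rintro ⟨x, y⟩ ⟨hx, hy⟩
    simp only at hx hy
    have hKs : ∀ x y : E n, K (Λ • (x - y)) = min 2 (Λ * dist x y) / (Λ * dist x y) ^ α := by
      intro x y
      simp [hK, slobodeckijKernel, norm_smul, abs_of_pos hΛ, dist_eq_norm]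
    have hval : ((m * Λ ^ α) • (F₁ + F₂)) (x, y) =
        (m * (I x + I y) * min 2 (Λ * dist x y)) / dist x y ^ α := by
      simp only [Pi.smul_apply, Pi.add_apply, F₁, F₂, smul_eq_mul, hKs, dist_comm y x]
      rw [Real.mul_rpow hΛ.le dist_nonneg]
      have : Λ ^ α ≠ 0 := (by positivity : (0:ℝ) < Λ ^ α).ne'
      field_simp
    rw [hval, norm_div, norm_div, Real.norm_of_nonneg (by positivity : 0 ≤ dist x y ^ α)]
    have hmin : 0 ≤ min 2 (Λ * dist x y) := le_min (by norm_num) (by positivity)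
    have hIxy : 0 ≤ I x + I y := add_nonneg (hI0 x) (hI0 y)
    rw [Real.norm_of_nonneg (by positivity : 0 ≤ m * (I x + I y) * min 2 (Λ * dist x y))]
    refine div_le_div_of_nonneg_right ?_ (by positivity)
    change ‖w x - w y‖ ≤ _
    have hbd : ‖w x - w y‖ ≤ m * min 2 (Λ * dist x y) := by
      rcases min_choice 2 (Λ * dist x y) with h | h <;> rw [h]
      · exact (norm_sub_le _ _).trans (by linarith [hw.1 x hx, hw.1 y hy])
      · simpa using hw.2 x hx y hy
    by_cases hZx : x ∈ Z ∨ y ∈ Z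
    · have : 1 ≤ I x + I y := by
        rcases hZx with h | h
        · have : I x = 1 := by simp [hI, h]
          linarith [hI0 y]
        · have : I y = 1 := by simp [hI, h]
          linarith [hI0 x]
      refine hbd.trans ?_
      rw [mul_assoc]
      refine mul_le_mul_of_nonneg_left ?_ hm
      exact le_mul_of_one_le_left hmin this
    · push Not at hZx
      rw [hwZ x hZx.1, hwZ y hZx.2]
      simp only [sub_self, norm_zero]
      positivity
  rw [Measure.prod_restrict]
  calc _ ≤ eLpNorm ((m * Λ ^ α) • (F₁ + F₂)) p
          (((volume : Measure (E n)).prod volume).restrict (B ×ˢ B)) :=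
        eLpNorm_mono_ae ((ae_restrict_iff' (hB.measurableSet.prod hB.measurableSet)).2
          (Filter.Eventually.of_forall hpt))
    _ ≤ eLpNorm ((m * Λ ^ α) • (F₁ + F₂)) p ((volume : Measure (E n)).prod volume) :=
        eLpNorm_mono_measure _ Measure.restrict_le_self
    _ ≤ ENNReal.ofReal (m * Λ ^ α) * (eLpNorm F₁ p ((volume : Measure (E n)).prod volume) +
          eLpNorm F₂ p ((volume : Measure (E n)).prod volume)) := by
        rw [eLpNorm_const_smul, Real.enorm_of_nonneg (by positivity)]
        gcongr
        exact eLpNorm_add_le hF₁.aestronglyMeasurable hF₂.aestronglyMeasurable hp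
    _ = _ := by
        rw [e₂]
        rw [show eLpNorm F₁ p ((volume : Measure (E n)).prod volume) = _ from e₁]
        have : ENNReal.ofReal (m * Λ ^ σ) = ENNReal.ofReal (m * Λ ^ α) *
            ENNReal.ofReal (Λ ^ (-((n : ℝ) / p.toReal))) := by
          rw [← ENNReal.ofReal_mul (by positivity), mul_assoc, ← Real.rpow_add hΛ, hα]
          congr 3; ring
        rw [this]
        ring

theorem nat_floor_le_ceil_sub_one_add_one {s : ℝ} : ⌊s⌋₊ ≤ ⌈s⌉₊ - 1 + 1 :=
  (Nat.floor_le_ceil s).trans (by omega)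

theorem natCeil_sub_one_eq_natFloor {s : ℝ} (h : s ≠ ⌊s⌋₊) (hs : 0 < s) :
    ⌈s⌉₊ - 1 = ⌊s⌋₊ := by
  have h1 : (⌊s⌋₊ : ℝ) < s := lt_of_le_of_ne (Nat.floor_le hs.le) (Ne.symm h)
  have h2 : ⌊s⌋₊ < ⌈s⌉₊ := Nat.lt_ceil.2 h1
  have h3 : ⌈s⌉₊ ≤ ⌊s⌋₊ + 1 := Nat.ceil_le_floor_add_one s
  omega

theorem HolderBound.hasWeakDeriv_of_le {n k : ℕ} {B : Set (E n)} (hB : IsOpen B)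
    (hBc : Convex ℝ B) {Λ M : ℝ} (hΛ : 0 ≤ Λ) (hM : 0 ≤ M) {f : E n → ℝ}
    (h : HolderBound 1 Λ B k f M) {i : ℕ} (hi : i ≤ k + 1) (a : Fin i → Fin n) :
    HasWeakDeriv B f (Transport.iterDeriv i a f) a ∧
      ∀ x ∈ B, ‖Transport.iterDeriv i a f x‖ ≤ 2 ^ k * M * Λ ^ i := by
  rcases hi.eq_or_lt with rfl | hi
  · obtain ⟨h1, h2⟩ := h.hasWeakDeriv_succ hB hBc hΛ hM a
    refine ⟨h1, fun x hx => (h2 x hx).trans ?_⟩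
    have : (1 : ℝ) ≤ 2 ^ k := one_le_pow₀ (by norm_num)
    gcongr
    exact le_mul_of_one_le_left hM this
  · obtain ⟨j, rfl⟩ : ∃ j, k = 0 + i + j := ⟨k - i, by omega⟩
    have h1 := h.of_le hBc one_pos le_rfl hΛ hM (j := 0 + i) (by omega)
    exact ⟨h1.hasWeakDeriv hB hBc one_pos a, fun x hx => (h1.iterDeriv hB a).norm_le hx⟩

/-- With `⌈s⌉₊ - 1`, the largest integer below `s`, Lipschitz continuity of the top derivative
covers both cases. For integral `s` it supplies the last weak derivative, otherwise the Slobodeckij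
seminorm. It is also a regularity that charts of class `C^{k,1}` preserve when `s ≤ k + 1`. Each
derivative costs its order as a power of `Λ`, and the bounded support turns sup bounds into `L^p`
bounds. -/
theorem exists_sobolevNorm_le {n : ℕ} (hn : 1 ≤ n) {B : Set (E n)} (hB : IsOpen B)
    (hBc : Convex ℝ B) (R : ℝ) {s : ℝ} (hs : 0 < s) {p : ℝ≥0∞} (hp : 1 ≤ p) (hp' : p ≠ ⊤) :
    ∃ C : ℝ≥0∞, C ≠ ⊤ ∧ ∀ (Λ : ℝ) (f : E n → ℝ) (M : ℝ), 1 ≤ Λ → 0 ≤ M →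
      (∀ x, x ∉ closedBall 0 R → f x = 0) → HolderBound 1 Λ B (⌈s⌉₊ - 1) f M →
      sobolevNorm s p B f ≤ C * ENNReal.ofReal (M * Λ ^ s) := by
  set k := ⌈s⌉₊ - 1 with hk
  set V := eLpNorm ((closedBall (0 : E n) R).indicator fun _ => (1 : ℝ)) p volume with hV
  have hVtop : V ≠ ⊤ := by
    refine (memLp_indicator_const p measurableSet_closedBall 1 (Or.inr ?_)).2.ne
    exact measure_closedBall_lt_top.ne
  set W := eLpNorm (slobodeckijKernel n (n / p.toReal + (s - ⌊s⌋₊))) p volume with hW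
  let C₁ : ℝ≥0∞ := ∑ i ∈ Finset.range (⌊s⌋₊ + 1), ∑ _a : Fin i → Fin n, 2 ^ k * V
  let C₂ : ℝ≥0∞ := if s = ⌊s⌋₊ then 0 else ∑ _a : Fin ⌊s⌋₊ → Fin n, 2 ^ k * (2 * (V * W))
  refine ⟨C₁ + C₂, ?_, fun Λ f M hΛ hM hf h => ?_⟩
  · refine ENNReal.add_ne_top.2 ⟨?_, ?_⟩
    · simp only [C₁, ENNReal.sum_ne_top]
      intro i _ a _
      exact ENNReal.mul_ne_top (by simp) hVtop
    · by_cases hsk : s = ⌊s⌋₊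
      · simp [C₂, ← hsk]
      · have hWtop : W ≠ ⊤ := eLpNorm_slobodeckijKernel_ne_top hn hp hp'
          (sub_pos.2 (lt_of_le_of_ne (Nat.floor_le hs.le) (Ne.symm hsk)))
          (by linarith [Nat.lt_floor_add_one s])
        simp only [C₂, if_neg hsk, ENNReal.sum_ne_top]
        intro a _
        exact ENNReal.mul_ne_top (by simp) (ENNReal.mul_ne_top (by simp)
          (ENNReal.mul_ne_top hVtop hWtop))
  · have hΛ0 : 0 < Λ := by linarith
    have hw : ∀ i, i ≤ ⌊s⌋₊ → ∀ a : Fin i → Fin n, HasWeakDeriv B f (iterDeriv i a f) a ∧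
        ∀ x ∈ B, ‖iterDeriv i a f x‖ ≤ 2 ^ k * M * Λ ^ i := fun i hi a =>
      h.hasWeakDeriv_of_le hB hBc hΛ0.le hM (hi.trans nat_floor_le_ceil_sub_one_add_one) a
    have hz : ∀ (i : ℕ) (a : Fin i → Fin n) x, x ∉ closedBall 0 R → iterDeriv i a f x = 0 :=
      fun i a => iterDeriv_eq_zero isClosed_closedBall.isOpen_compl hf a
    have h2k : ENNReal.ofReal (2 ^ k * M * Λ ^ s) = 2 ^ k * ENNReal.ofReal (M * Λ ^ s) := by
      rw [mul_assoc, ENNReal.ofReal_mul (by positivity), ENNReal.ofReal_pow (by norm_num)]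
      simp
    refine (iInf₂_le (fun i a => iterDeriv i a f) (fun i hi a => (hw i hi a).1)).trans ?_
    rw [add_mul]
    refine add_le_add ?_ ?_
    · simp only [C₁, Finset.sum_mul]
      refine Finset.sum_le_sum fun i hi => Finset.sum_le_sum fun a _ => ?_
      have hi' : i ≤ ⌊s⌋₊ := by simpa [Nat.lt_succ_iff] using hi
      refine (eLpNorm_le_of_support hB p (by positivity) (hw i hi' a).2 (hz i a)).trans ?_
      rw [mul_right_comm _ V, ← h2k]
      gcongr
      rw [← Real.rpow_natCast]
      exact Real.rpow_le_rpow_of_exponent_le hΛ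
        ((Nat.cast_le.2 hi').trans (Nat.floor_le hs.le))
    · by_cases hsk : s = ⌊s⌋₊
      · rw [if_pos hsk]; simp
      · simp only [C₂, if_neg hsk, Finset.sum_mul]
        refine Finset.sum_le_sum fun a _ => ?_
        have h0 : HolderBound 1 Λ B (0 + ⌊s⌋₊) f M := by
          rw [zero_add, ← natCeil_sub_one_eq_natFloor hsk hs]; exact h
        refine (eLpNorm_differenceQuotient_le hB measurableSet_closedBall hp hp' hΛ0
          (by positivity) (h0.iterDeriv hB a) (hz _ a)).trans ?_
        have e : M * Λ ^ ⌊s⌋₊ * Λ ^ (s - ⌊s⌋₊) = M * Λ ^ s := by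
          rw [mul_assoc, ← Real.rpow_natCast, ← Real.rpow_add hΛ0]
          congr 2; ring
        rw [e]
        exact mul_le_mul' (le_mul_of_one_le_left zero_le (one_le_pow₀ one_le_two)) le_rfl

/-- For integral `s` the Hölder exponent is `1`, and the derivative of order `s` comes from
Rademacher's theorem. Otherwise `⌈s⌉₊ - 1 = ⌊s⌋₊`, and the Hölder bound of the top derivative is the
seminorm itself. -/
theorem exists_sobolevNorm_top_le {n : ℕ} {B : Set (E n)} (hB : IsOpen B)
    (hBc : Convex ℝ B) {s : ℝ} (hs : 0 < s) :
    ∃ C : ℝ≥0∞, C ≠ ⊤ ∧ ∀ (f : E n → ℝ) (M : ℝ), 0 ≤ M →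
      HolderBound (s - (⌈s⌉₊ - 1 : ℕ)) 1 B (⌈s⌉₊ - 1) f M →
      sobolevNorm s ⊤ B f ≤ C * ENNReal.ofReal M := by
  set k := ⌈s⌉₊ - 1 with hk
  let C₁ : ℝ≥0∞ := ∑ i ∈ Finset.range (⌊s⌋₊ + 1), ∑ _a : Fin i → Fin n, 2 ^ k
  let C₂ : ℝ≥0∞ := if s = ⌊s⌋₊ then 0 else ∑ _a : Fin ⌊s⌋₊ → Fin n, 1
  have hceil : ⌈s⌉₊ = k + 1 := by
    have : 0 < ⌈s⌉₊ := Nat.ceil_pos.2 hs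
    omega
  have hks : (k : ℝ) < s := Nat.lt_ceil.1 (by omega)
  have hks' : s ≤ k + 1 := by
    have := Nat.le_ceil s
    rw [hceil] at this
    exact_mod_cast this
  refine ⟨C₁ + C₂, ?_, fun f M hM h => ?_⟩
  · refine ENNReal.add_ne_top.2 ⟨?_, ?_⟩
    · simp [C₁]
      exact fun i _ => ENNReal.mul_ne_top (by simp) (by simp)
    · by_cases hsk : s = ⌊s⌋₊
      · simp [C₂, ← hsk]
      · simp [C₂, if_neg hsk]
  · have hw : ∀ i, i ≤ ⌊s⌋₊ → ∀ a : Fin i → Fin n, HasWeakDeriv B f (iterDeriv i a f) a ∧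
        ∀ x ∈ B, ‖iterDeriv i a f x‖ ≤ 2 ^ k * M := by
      intro i hi a
      by_cases hik : i ≤ k
      · obtain ⟨j, hj⟩ : ∃ j, k = 0 + i + j := ⟨k - i, by omega⟩
        have h1 := h.of_le hBc (by linarith) (by linarith) zero_le_one hM (j := 0 + i) (by omega)
        refine ⟨h1.hasWeakDeriv hB hBc (by linarith) a, fun x hx => ?_⟩
        simpa using (h1.iterDeriv hB a).norm_le hx
      · have hfl : k + 1 ≤ ⌊s⌋₊ := by omega
        have hs1 : s - k = 1 := by
          have h1 : ((k + 1 : ℕ) : ℝ) ≤ ⌊s⌋₊ := Nat.cast_le.2 hfl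
          have h2 := Nat.floor_le hs.le
          push_cast at h1
          linarith
        rw [hs1] at h
        simpa using h.hasWeakDeriv_of_le hB hBc zero_le_one hM
          (hi.trans nat_floor_le_ceil_sub_one_add_one) a
    have h2k : ENNReal.ofReal (2 ^ k * M) = 2 ^ k * ENNReal.ofReal M := by
      rw [ENNReal.ofReal_mul (by positivity), ENNReal.ofReal_pow (by norm_num)]
      simp
    refine (iInf₂_le (fun i a => iterDeriv i a f) (fun i hi a => (hw i hi a).1)).trans ?_
    rw [add_mul]
    refine add_le_add ?_ ?_
    · simp only [C₁, Finset.sum_mul]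
      refine Finset.sum_le_sum fun i hi => Finset.sum_le_sum fun a _ => ?_
      have hi' : i ≤ ⌊s⌋₊ := by simpa [Nat.lt_succ_iff] using hi
      rw [← h2k, eLpNorm_exponent_top]
      refine eLpNormEssSup_le_of_ae_bound ((ae_restrict_iff' hB.measurableSet).2
        (Filter.Eventually.of_forall fun x hx => (hw i hi' a).2 x hx))
    · by_cases hsk : s = ⌊s⌋₊
      · rw [if_pos hsk]; simp
      · simp only [C₂, if_neg hsk, Finset.sum_mul, one_mul]
        refine Finset.sum_le_sum fun a _ => ?_
        have hkf : k = ⌊s⌋₊ := natCeil_sub_one_eq_natFloor hsk hs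
        have h0 : HolderBound (s - k) 1 B (0 + ⌊s⌋₊) f M := by
          rw [zero_add, ← hkf]; exact h
        have h1 := (h0.iterDeriv hB a).2
        rw [hkf] at h1
        rw [eLpNorm_exponent_top, Measure.prod_restrict]
        refine eLpNormEssSup_le_of_ae_bound
          ((ae_restrict_iff' (hB.measurableSet.prod hB.measurableSet)).2
          (Filter.Eventually.of_forall fun z hz => ?_))
        have h2 := h1 z.1 hz.1 z.2 hz.2
        simp only [one_pow, mul_one, one_mul] at h2
        simp only [ENNReal.toReal_top, div_zero, zero_add]
        rw [norm_div, Real.norm_of_nonneg (by positivity : 0 ≤ dist z.1 z.2 ^ (s - ⌊s⌋₊))]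
        exact div_le_of_le_mul₀ (by positivity) hM h2

/-! ### Lower bounds for the Sobolev–Slobodeckij norm -/

/-- The fundamental lemma of the calculus of variations. The infimum in `sobolevNorm` runs over
families of weak derivatives, and identifying the member of order zero is what turns a finite norm
into integrability of the function. -/
theorem HasWeakDeriv.ae_eq {n : ℕ} {B : Set (E n)} (hB : IsOpen B) {f g : E n → ℝ}
    {a : Fin 0 → Fin n} (h : HasWeakDeriv B f g a) : f =ᵐ[volume.restrict B] g := by
  have h0 : ∀ᵐ x, x ∈ B → (f - g) x = 0 := by
    refine hB.ae_eq_zero_of_integral_contDiff_smul_eq_zero (h.1.sub h.2.1) fun φ hφ hc hs => ?_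
    have h1 := h.2.2 φ hφ hc hs
    simp only [partialDeriv, iteratedFDeriv_zero_apply, pow_zero, one_mul] at h1
    have hi : ∀ u : E n → ℝ, LocallyIntegrableOn u B → IntegrableOn (fun x => φ x • u x) B := by
      intro u hu
      have hu' : IntegrableOn u (tsupport φ) := hu.integrableOn_compact_subset hs hc
      have h2 := hu'.continuousOn_mul hφ.continuous.continuousOn hc
      have h3 : IntegrableOn (fun x => φ x * u x) univ := by
        refine (integrableOn_iff_integrable_of_support_subset ?_).1 h2 |>.integrableOn
        intro x hx
        refine subset_tsupport φ fun h0 => hx (by simp [h0])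
      exact h3.mono_set (subset_univ _)
    rw [← setIntegral_eq_integral_of_forall_compl_eq_zero (s := B)]
    · simp only [Pi.sub_apply, smul_sub]
      rw [integral_sub (hi f h.1) (hi g h.2.1), sub_eq_zero]
      simpa only [smul_eq_mul, mul_comm (φ _)] using h1
    · intro x hx
      rw [image_eq_zero_of_notMem_tsupport fun h => hx (hs h), zero_smul]
  rw [Filter.EventuallyEq, ae_restrict_iff' hB.measurableSet]
  filter_upwards [h0] with x hx hxB
  exact sub_eq_zero.1 (hx hxB)

theorem aestronglyMeasurable_of_sobolevNorm_lt_top {n : ℕ} {B : Set (E n)}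
    {s : ℝ} {p : ℝ≥0∞} {f : E n → ℝ} (h : sobolevNorm s p B f < ⊤) :
    AEStronglyMeasurable f (volume.restrict B) := by
  simp only [sobolevNorm, iInf_lt_iff] at h
  obtain ⟨G, hG, -⟩ := h
  exact (hG 0 (by omega) default).1.aestronglyMeasurable

theorem eLpNorm_le_sobolevNorm {n : ℕ} {B : Set (E n)} (hB : IsOpen B) {s : ℝ} {p : ℝ≥0∞}
    {f : E n → ℝ} : eLpNorm f p (volume.restrict B) ≤ sobolevNorm s p B f := by
  refine le_iInf₂ fun G hG => ?_
  rw [eLpNorm_congr_ae (HasWeakDeriv.ae_eq hB (hG 0 (by omega) default))]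
  refine le_trans ?_ le_self_add
  refine le_trans ?_ (Finset.single_le_sum (fun _ _ => zero_le)
    (Finset.mem_range.2 (Nat.succ_pos _)))
  exact Finset.single_le_sum (f := fun a => eLpNorm (G 0 a) p (volume.restrict B))
    (fun _ _ => zero_le) (Finset.mem_univ default)

/-! ### Bounds for the Sobolev–Slobodeckij norm on the boundary -/

/-- No bound of `h` itself is available, only of its increments and derivatives. For `k = 0` the
Lipschitz constant is everything and the second part is empty. -/
theorem IsCk1.exists_bound {n k : ℕ} {h : E n → ℝ} {B : Set (E n)} (hB : IsOpen B)
    (hBc : Convex ℝ B) (hh : IsCk1 k h B) :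
    ∃ K : ℝ, 1 ≤ K ∧ (∀ x ∈ B, ∀ y ∈ B, ‖h x - h y‖ ≤ K * dist x y) ∧
      ∀ j < k, (∀ x ∈ B, DifferentiableAt ℝ h x) ∧ HolderBound 1 1 B j (fderiv ℝ h) K := by
  obtain ⟨hc, C, hb, hl⟩ := hh
  cases k with
  | zero =>
    refine ⟨max C 1, le_max_right _ _, fun x hx y hy => ?_, fun j hj => absurd hj (by omega)⟩
    have := hl x hx y hy
    rw [iteratedFDeriv_zero_eq_comp, Function.comp_apply, Function.comp_apply, ← map_sub,
      LinearIsometryEquiv.norm_map] at this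
    refine this.trans ?_
    gcongr
    exact le_max_left _ _
  | succ m =>
    have hC : C ≤ max C 1 := le_max_left _ _
    have hd : ∀ x ∈ B, DifferentiableAt ℝ h x := fun x hx =>
      (hc.differentiableOn (by simp)).differentiableAt (hB.mem_nhds hx)
    have h2m : (1 : ℝ) ≤ 2 ^ m := one_le_pow₀ (by norm_num)
    have hK : max C 1 ≤ 2 ^ m * max C 1 := le_mul_of_one_le_left (by positivity) h2m
    have hfd : HolderBound 1 1 B m (fderiv ℝ h) (max C 1) := by
      refine HolderBound.of_iteratedFDeriv hB (hc.fderiv_of_isOpen hB (by simp)) ?_ ?_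
      · intro i hi x hx
        rw [norm_iteratedFDeriv_fderiv, one_pow, mul_one]
        exact (hb _ (by omega) (by omega) x hx).trans hC
      · intro x hx y hy
        rw [← norm_iteratedFDeriv_succ_sub, one_pow, mul_one, one_mul, Real.rpow_one]
        exact (hl x hx y hy).trans (by gcongr)
    refine ⟨2 ^ m * max C 1, (le_max_right _ _).trans hK, fun x hx y hy => ?_, fun j hj => ⟨hd, ?_⟩⟩
    · rw [dist_eq_norm]
      refine hBc.norm_image_sub_le_of_norm_fderiv_le (𝕜 := ℝ) (fun z hz => hd z hz)
        (fun z hz => (hfd.norm_le hz).trans hK) hy hx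
    · exact hfd.of_le hBc one_pos le_rfl zero_le_one (by positivity) (by omega)

namespace BoundaryAtlas

variable {d k : ℕ} {Ω : Set (E d)} (A : BoundaryAtlas d k Ω)

/-- The linear embedding of the horizontal directions of the `j`-th chart. -/
def horizontal (j : Fin A.N) : E (d - 1) →L[ℝ] E d :=
  LinearMap.toContinuousLinearMap
    ((A.frame j).symm.linearIsometryEquiv.toLinearEquiv.toLinearMap ∘ₗ
      (WithLp.linearEquiv 2 ℝ (E (d - 1) × ℝ)).symm.toLinearMap ∘ₗ LinearMap.inl ℝ (E (d - 1)) ℝ)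

/-- The vertical direction of the `j`-th chart. -/
def vertical (j : Fin A.N) : E d :=
  (A.frame j).symm.linearIsometryEquiv (WithLp.toLp 2 (0, 1))

theorem frame_symm_apply (j : Fin A.N) (y : E (d - 1)) (t : ℝ) :
    (A.frame j).symm (WithLp.toLp 2 (y, t)) =
      A.horizontal j y + t • A.vertical j + (A.frame j).symm 0 := by
  have h := (A.frame j).symm.map_vadd 0 (WithLp.toLp 2 (y, t))
  simp only [vadd_eq_add, add_zero] at h
  rw [h]
  have e : WithLp.toLp 2 (y, t) = WithLp.toLp 2 (y, (0 : ℝ)) +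
      t • WithLp.toLp 2 ((0 : E (d - 1)), (1 : ℝ)) := by
    refine WithLp.ofLp_injective 2 ?_
    simp
  rw [e, map_add, map_smul]
  rfl

theorem param_eq (j : Fin A.N) (y : E (d - 1)) :
    A.param j y = A.horizontal j y + A.height j y • A.vertical j + (A.frame j).symm 0 :=
  A.frame_symm_apply j y _

theorem dist_frame_symm (j : Fin A.N) (a b : E (d - 1)) (s t : ℝ) :
    dist ((A.frame j).symm (WithLp.toLp 2 (a, s))) ((A.frame j).symm (WithLp.toLp 2 (b, t))) =
      Real.sqrt (dist a b ^ 2 + dist s t ^ 2) := by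
  rw [AffineIsometryEquiv.dist_map, WithLp.prod_dist_eq_of_L2]
  rfl

theorem dist_param_le (j : Fin A.N) {a b : E (d - 1)} {K : ℝ}
    (h : ‖A.height j a - A.height j b‖ ≤ K * dist a b) (hK : 0 ≤ K) :
    dist (A.param j a) (A.param j b) ≤ (1 + K) * dist a b := by
  rw [param, param, dist_frame_symm]
  refine Real.sqrt_le_iff.2 ⟨by positivity, ?_⟩
  rw [← dist_eq_norm] at h
  have h1 : dist (A.height j a) (A.height j b) ^ 2 ≤ (K * dist a b) ^ 2 := by gcongr
  have : 0 ≤ K * dist a b ^ 2 := by positivity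
  nlinarith

theorem exists_param_bound (j : Fin A.N) :
    ∃ K : ℝ, 1 ≤ K ∧ (∀ x ∈ A.base j, ∀ y ∈ A.base j, ‖A.param j x - A.param j y‖ ≤ K * dist x y) ∧
      ∀ i < k, (∀ x ∈ A.base j, DifferentiableAt ℝ (A.param j) x) ∧
        HolderBound 1 1 (A.base j) i (fderiv ℝ (A.param j)) K := by
  obtain ⟨K, hK, hl, hi⟩ := (A.regular j).exists_bound (A.isOpen_base j) (A.convex_base j)
  have e : A.param j = fun y =>
      A.horizontal j y + A.height j y • A.vertical j + (A.frame j).symm 0 :=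
    funext (A.param_eq j)
  let T : (E (d - 1) →L[ℝ] ℝ) →L[ℝ] (E (d - 1) →L[ℝ] E d) :=
    (ContinuousLinearMap.smulRightL ℝ (E (d - 1)) (E d)).flip (A.vertical j)
  have hder : ∀ x ∈ A.base j, DifferentiableAt ℝ (A.height j) x →
      HasFDerivAt (A.param j) (A.horizontal j + T (fderiv ℝ (A.height j) x)) x := by
    intro x hx hd
    rw [e]
    exact ((A.horizontal j).hasFDerivAt.add (hd.hasFDerivAt.smul_const _)).add_const _
  refine ⟨max (1 + K) (‖A.horizontal j‖ + ‖T‖ * K),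
    (by linarith : 1 ≤ 1 + K).trans (le_max_left _ _),
    fun x hx y hy => ?_, fun i hik => ⟨fun x hx => (hder x hx ((hi i hik).1 x hx)).differentiableAt,
      ?_⟩⟩
  · rw [← dist_eq_norm]
    refine (A.dist_param_le j (hl x hx y hy) (by linarith)).trans ?_
    gcongr
    exact le_max_left _ _
  · have h1 := (HolderBound.const (θ := 1) (S := A.base j) (k := i) zero_le_one
      (le_refl ‖A.horizontal j‖)).add (A.isOpen_base j)
      ((hi i hik).2.clm_comp (A.isOpen_base j) T le_rfl)
    exact (h1.mono zero_le_one (le_max_right _ _)).congr (A.isOpen_base j)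
      fun x hx => (hder x hx ((hi i hik).1 x hx)).fderiv.symm

theorem norm_le_norm_param (j : Fin A.N) (y : E (d - 1)) :
    ‖y‖ ≤ ‖A.param j y‖ + ‖A.frame j 0‖ := by
  have h1 : ‖A.frame j (A.param j y)‖ ≤ ‖A.param j y‖ + ‖A.frame j 0‖ := by
    have := (A.frame j).dist_map (A.param j y) 0
    rw [dist_eq_norm, dist_zero_right] at this
    calc _ = ‖(A.frame j (A.param j y) - A.frame j 0) + A.frame j 0‖ := by rw [sub_add_cancel]
      _ ≤ _ := (norm_add_le _ _).trans (by rw [this])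
  refine le_trans ?_ h1
  rw [param, AffineIsometryEquiv.apply_symm_apply, WithLp.prod_norm_eq_of_L2]
  exact Real.le_sqrt_of_sq_le (le_add_of_nonneg_right (by positivity))

theorem exists_comp_param_bound (j : Fin A.N) {i : ℕ} (hi : i ≤ k) {θ : ℝ} (hθ : 0 < θ)
    (hθ' : θ ≤ 1) :
    ∃ C : ℝ, 1 ≤ C ∧ ∀ (Λ : ℝ) (_ : 1 ≤ Λ) (F : E d → ℝ) (M : ℝ) (_ : 0 ≤ M),
      HolderBound θ Λ univ i F M →
        HolderBound θ Λ (A.base j) i (fun y => F (A.param j y)) (C * M) := by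
  obtain ⟨K, hK, hl, hb⟩ := A.exists_param_bound j
  obtain ⟨C, hC, h⟩ := HolderBound.comp (A.isOpen_base j) (A.convex_base j) hθ hθ' hK i hl
    fun l hl' => hb l (by omega)
  exact ⟨C, hC, fun Λ hΛ F M hM hF => h Λ hΛ F M hM hF⟩

/-- The hypotheses concern a function on the ambient space, so that one construction controls all
charts at once, however they overlap. The frames are isometries; hence supports seen in a chart stay
in a fixed ball. -/
theorem exists_boundaryNorm_le (hd : 2 ≤ d) (R : ℝ) {s : ℝ} (hs : 0 < s) (hsk : s ≤ k + 1)
    {p : ℝ≥0∞} (hp : 1 ≤ p) (hp' : p ≠ ⊤) :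
    ∃ C : ℝ≥0∞, C ≠ ⊤ ∧ ∀ (Λ : ℝ) (F : E d → ℝ) (M : ℝ), 1 ≤ Λ → 0 ≤ M →
      (∀ x, x ∉ closedBall 0 R → F x = 0) → HolderBound 1 Λ univ (⌈s⌉₊ - 1) F M →
      boundaryNorm A s p F ≤ C * ENNReal.ofReal (M * Λ ^ s) := by
  have hceil : ⌈s⌉₊ - 1 ≤ k := by
    have : ⌈s⌉₊ ≤ k + 1 := Nat.ceil_le.2 (by exact_mod_cast hsk)
    omega
  choose K hK hcomp using fun j => A.exists_comp_param_bound j hceil one_pos le_rfl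
  choose C hC hsob using fun j => exists_sobolevNorm_le (n := d - 1) (by omega) (A.isOpen_base j)
    (A.convex_base j) (R + ‖A.frame j 0‖) hs hp hp'
  refine ⟨∑ j, C j * ENNReal.ofReal (K j), ?_, fun Λ F M hΛ hM hF h => ?_⟩
  · exact ENNReal.sum_ne_top.2 fun j _ => ENNReal.mul_ne_top (hC j) ENNReal.ofReal_ne_top
  · rw [boundaryNorm, Finset.sum_mul]
    refine Finset.sum_le_sum fun j _ => ?_
    have hKj : 0 ≤ K j := zero_le_one.trans (hK j)
    refine (hsob j Λ _ (K j * M) hΛ (by positivity) ?_ (hcomp j Λ hΛ F M hM h)).trans ?_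
    · intro y hy
      refine hF _ fun hmem => hy ?_
      simp only [mem_closedBall, dist_zero_right] at hmem ⊢
      exact (A.norm_le_norm_param j y).trans (by gcongr)
    · rw [mul_assoc (K j), ENNReal.ofReal_mul hKj, mul_assoc]

theorem exists_boundaryNorm_top_le {s : ℝ} (hs : 0 < s) (hsk : s ≤ k + 1) :
    ∃ C : ℝ≥0∞, C ≠ ⊤ ∧ ∀ (F : E d → ℝ) (M : ℝ), 0 ≤ M →
      HolderBound (s - (⌈s⌉₊ - 1 : ℕ)) 1 univ (⌈s⌉₊ - 1) F M →
      boundaryNorm A s ⊤ F ≤ C * ENNReal.ofReal M := by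
  have hceil : ⌈s⌉₊ - 1 ≤ k := by
    have : ⌈s⌉₊ ≤ k + 1 := Nat.ceil_le.2 (by exact_mod_cast hsk)
    omega
  have hpos : 0 < ⌈s⌉₊ := Nat.ceil_pos.2 hs
  have h1 : ((⌈s⌉₊ - 1 : ℕ) : ℝ) < s := Nat.lt_ceil.1 (by omega)
  have h2 : s ≤ ((⌈s⌉₊ - 1 : ℕ) : ℝ) + 1 := by
    have := Nat.le_ceil s
    push_cast [Nat.cast_sub (show 1 ≤ ⌈s⌉₊ by omega)]
    linarith
  choose K hK hcomp using fun j => A.exists_comp_param_bound j hceil (sub_pos.2 h1) (by linarith)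
  choose C hC hsob using fun j => exists_sobolevNorm_top_le (A.isOpen_base j)
    (A.convex_base j) hs
  refine ⟨∑ j, C j * ENNReal.ofReal (K j), ?_, fun F M hM h => ?_⟩
  · exact ENNReal.sum_ne_top.2 fun j _ => ENNReal.mul_ne_top (hC j) ENNReal.ofReal_ne_top
  · rw [boundaryNorm, Finset.sum_mul]
    refine Finset.sum_le_sum fun j _ => ?_
    have hKj : 0 ≤ K j := zero_le_one.trans (hK j)
    refine (hsob j _ (K j * M) (by positivity) (hcomp j 1 le_rfl F M hM h)).trans ?_
    rw [ENNReal.ofReal_mul hKj, mul_assoc]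

end BoundaryAtlas

theorem sobolevNorm_comp_param_le_boundaryNorm {d k : ℕ} {Ω : Set (E d)} (A : BoundaryAtlas d k Ω)
    (s : ℝ) (p : ℝ≥0∞) (g : E d → ℝ) (j : Fin A.N) :
    sobolevNorm s p (A.base j) (fun y => g (A.param j y)) ≤ boundaryNorm A s p g :=
  Finset.single_le_sum (f := fun j => sobolevNorm s p (A.base j) fun y => g (A.param j y))
    (fun _ _ => zero_le) (Finset.mem_univ j)

/-! ### Boundary points near which the boundary is continuously differentiable -/

/-- Along the line through `x` in direction `v` the increments of `F` are of smaller order than the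
step, hence so are those of `T`. -/
theorem fderiv_apply_eq_zero_of_norm_sub_le {X Y Z : Type*} [NormedAddCommGroup X]
    [NormedSpace ℝ X] [NormedAddCommGroup Y] [NormedSpace ℝ Y] [NormedAddCommGroup Z]
    [NormedSpace ℝ Z] {F : X → Y} {T : X → Z} {F' : X →L[ℝ] Y} {T' : X →L[ℝ] Z} {x v : X} {K : ℝ}
    (hF : HasFDerivAt F F' x) (hT : HasFDerivAt T T' x)
    (h : ∀ᶠ w in nhds x, ‖T w - T x‖ ≤ K * ‖F w - F x‖) (hv : F' v = 0) : T' v = 0 := by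
  have hline : HasDerivAt (fun τ : ℝ => x + τ • v) v 0 := by
    simpa using ((hasDerivAt_id (0 : ℝ)).smul_const v).const_add x
  have e : x + (0 : ℝ) • v = x := by simp
  have hF' : HasDerivAt (fun τ : ℝ => F (x + τ • v)) (F' v) 0 :=
    HasFDerivAt.comp_hasDerivAt (l := F) (l' := F') (0 : ℝ) (e.symm ▸ hF) hline
  have hT' : HasDerivAt (fun τ : ℝ => T (x + τ • v)) (T' v) 0 :=
    HasFDerivAt.comp_hasDerivAt (l := T) (l' := T') (0 : ℝ) (e.symm ▸ hT) hline
  have hT0 : HasDerivAt (fun τ : ℝ => T (x + τ • v)) 0 0 := by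
    rw [hv] at hF'
    rw [hasDerivAt_iff_isLittleO] at hF' ⊢
    simp only [smul_zero, sub_zero, zero_smul, add_zero] at hF' ⊢
    refine Asymptotics.IsBigO.trans_isLittleO ?_ hF'
    refine Asymptotics.IsBigO.of_bound K ?_
    have hc : Filter.Tendsto (fun τ : ℝ => x + τ • v) (nhds 0) (nhds x) := by
      have := hline.continuousAt.tendsto
      rwa [e] at this
    exact hc.eventually h
  exact hT'.unique hT0

namespace BoundaryAtlas

variable {d k : ℕ} {Ω : Set (E d)} (A : BoundaryAtlas d k Ω)

theorem continuousOn_height (j : Fin A.N) : ContinuousOn (A.height j) (A.base j) := by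
  obtain ⟨K, hK, hl, -⟩ := (A.regular j).exists_bound (A.isOpen_base j) (A.convex_base j)
  exact (lipschitzOnWith_of_norm_sub_le hl).continuousOn

/-- The band around the `j`-th boundary patch in which `Ω` is the part below the graph. -/
def band (j : Fin A.N) : Set (E d) :=
  {z | (A.frame j z).fst ∈ A.base j ∧
    |(A.frame j z).snd - A.height j (A.frame j z).fst| < A.width j}

theorem continuous_frame_fst (j : Fin A.N) : Continuous fun z => (A.frame j z).fst :=
  (WithLp.continuous_fst 2 _ _).comp (A.frame j).continuous

theorem continuous_frame_snd (j : Fin A.N) : Continuous fun z => (A.frame j z).snd :=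
  (WithLp.continuous_snd 2 _ _).comp (A.frame j).continuous

theorem continuousOn_excess (j : Fin A.N) :
    ContinuousOn (fun z => (A.frame j z).snd - A.height j (A.frame j z).fst)
      {z | (A.frame j z).fst ∈ A.base j} :=
  (A.continuous_frame_snd j).continuousOn.sub
    ((A.continuousOn_height j).comp (A.continuous_frame_fst j).continuousOn fun _ hz => hz)

theorem isOpen_band (j : Fin A.N) : IsOpen (A.band j) := by
  have h1 : IsOpen {z | (A.frame j z).fst ∈ A.base j} :=
    (A.isOpen_base j).preimage (A.continuous_frame_fst j)
  have h2 := (A.continuousOn_excess j).isOpen_inter_preimage h1 (isOpen_lt continuous_abs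
    (continuous_const (y := A.width j)))
  exact h2

theorem frame_symm_eq (j : Fin A.N) (z : E d) :
    (A.frame j).symm (WithLp.toLp 2 ((A.frame j z).fst, (A.frame j z).snd)) = z := by
  conv_rhs => rw [← (A.frame j).symm_apply_apply z]
  rfl

@[simp] theorem frame_param (j : Fin A.N) (y : E (d - 1)) :
    A.frame j (A.param j y) = WithLp.toLp 2 (y, A.height j y) :=
  (A.frame j).apply_symm_apply _

theorem param_mem_band (j : Fin A.N) {y : E (d - 1)} (hy : y ∈ A.base j) :
    A.param j y ∈ A.band j := by
  have h : |A.height j y - A.height j y| < A.width j := by simpa using A.width_pos j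
  have h' : y ∈ A.base j ∧ |A.height j y - A.height j y| < A.width j := ⟨hy, h⟩
  simp only [band, mem_ofPred_eq, frame_param]
  exact h'

theorem mem_iff_of_mem_band (j : Fin A.N) {z : E d} (hz : z ∈ A.band j) :
    z ∈ Ω ↔ (A.frame j z).snd < A.height j (A.frame j z).fst := by
  have := A.below j _ hz.1 _ hz.2
  rw [add_sub_cancel, frame_symm_eq] at this
  rw [this, sub_neg]

theorem mem_frontier_iff_of_mem_band (hΩ : IsOpen Ω) (j : Fin A.N) {z : E d} (hz : z ∈ A.band j) :
    z ∈ frontier Ω ↔ (A.frame j z).snd = A.height j (A.frame j z).fst := by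
  rw [hΩ.frontier_eq, mem_sdiff, A.mem_iff_of_mem_band j hz, not_lt]
  constructor
  · rintro ⟨hcl, hle⟩
    refine le_antisymm (not_lt.1 fun hlt => ?_) hle
    have hO : IsOpen (A.band j ∩ {z | 0 < (A.frame j z).snd - A.height j (A.frame j z).fst}) :=
      ((A.continuousOn_excess j).mono fun z hz => hz.1).isOpen_inter_preimage (A.isOpen_band j)
        isOpen_Ioi
    obtain ⟨z', ⟨hz'1, hz'2⟩, hz'3⟩ := mem_closure_iff.1 hcl _ hO ⟨hz, by simpa using hlt⟩
    have := (A.mem_iff_of_mem_band j hz'1).1 hz'3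
    simp only [mem_ofPred_eq] at hz'2
    linarith
  · intro heq
    refine ⟨?_, heq.ge⟩
    rw [mem_closure_iff_nhds]
    intro t ht
    let γ : ℝ → E d := fun τ =>
      (A.frame j).symm (WithLp.toLp 2 ((A.frame j z).fst, (A.frame j z).snd - τ))
    have hγ : Continuous γ := by
      refine (A.frame j).symm.continuous.comp ((WithLp.prod_continuous_toLp 2 _ _).comp ?_)
      fun_prop
    have hγ0 : γ 0 = z := by
      simp only [γ, sub_zero]
      exact A.frame_symm_eq j z
    have hev : ∀ᶠ τ in nhds (0 : ℝ), γ τ ∈ t ∩ A.band j := by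
      refine hγ.continuousAt.eventually_mem ?_
      rw [hγ0]
      exact Filter.inter_mem ht ((A.isOpen_band j).mem_nhds hz)
    obtain ⟨τ, hτ, hτ0⟩ := ((hev.filter_mono nhdsWithin_le_nhds).and
      (self_mem_nhdsWithin : Ioi (0 : ℝ) ∈ nhdsWithin 0 (Ioi 0))).exists
    refine ⟨γ τ, hτ.1, (A.mem_iff_of_mem_band j hτ.2).2 ?_⟩
    simp only [γ, AffineIsometryEquiv.apply_symm_apply]
    change (A.frame j z).snd - τ < A.height j (A.frame j z).fst
    rw [← heq]
    simpa using hτ0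

theorem param_mem_frontier (hΩ : IsOpen Ω) (j : Fin A.N) {y : E (d - 1)} (hy : y ∈ A.base j) :
    A.param j y ∈ frontier Ω := by
  rw [A.mem_frontier_iff_of_mem_band hΩ j (A.param_mem_band j hy), frame_param]
  rfl

theorem eq_param_of_mem_frontier (hΩ : IsOpen Ω) (j : Fin A.N) {z : E d} (hz : z ∈ A.band j)
    (hf : z ∈ frontier Ω) : z = A.param j (A.frame j z).fst := by
  rw [param, ← (A.mem_frontier_iff_of_mem_band hΩ j hz).1 hf, frame_symm_eq]

end BoundaryAtlas

/-- Differentiating `Ψ ∘ Ξ = id` along the face gives a left inverse of the derivative. The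
derivative of `Ψ` exists only within the image of the box; this suffices because a neighbourhood of
`w` in the face is mapped into that image. -/
theorem IsReferenceMap.contDiffAt_face {d : ℕ} {s : ℝ} (hs : 1 ≤ s) {Ω : Set (E d)}
    {Ξ : ℝ × E (d - 1) → E d} (hΞ : IsReferenceMap s Ω Ξ) {w : E (d - 1)}
    (hw : ∀ i, w i ∈ Ioo (-1 : ℝ) 1) :
    ContDiffAt ℝ 1 (fun w => Ξ (0, w)) w ∧
      Function.Injective (fderiv ℝ (fun w => Ξ (0, w)) w) := by
  have hfl : 1 ≤ ⌊s⌋₊ := Nat.one_le_floor_iff _ |>.2 hs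
  let Q : Set (E (d - 1)) := {w | ∀ i, w i ∈ Icc (-1 : ℝ) 1}
  have hQ : Q ∈ nhds w := by
    have hO : IsOpen {w : E (d - 1) | ∀ i, w i ∈ Ioo (-1 : ℝ) 1} := by
      simp only [ofPred_forall]
      exact isOpen_iInter_of_finite fun i => isOpen_Ioo.preimage (by fun_prop)
    exact Filter.mem_of_superset (hO.mem_nhds hw) fun z hz i => Ioo_subset_Icc_self (hz i)
  have hmaps : MapsTo (fun w : E (d - 1) => ((0 : ℝ), w)) Q (referenceBox d) :=
    fun z hz => ⟨by simp, hz⟩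
  have hc : ContDiffAt ℝ 1 (fun w => Ξ (0, w)) w :=
    ((hΞ.smooth.1.of_le (by exact_mod_cast hfl)).comp (contDiff_prodMk_right 0).contDiffOn
      hmaps).contDiffAt hQ
  refine ⟨hc, ?_⟩
  obtain ⟨Ψ, hinv, hΨ⟩ := hΞ.smooth_inverse
  have hwQ : w ∈ Q := mem_of_mem_nhds hQ
  have hΨd := (hΨ.1.differentiableOn (by exact_mod_cast (by omega : ⌊s⌋₊ ≠ 0)))
    (Ξ (0, w)) (mem_image_of_mem _ (hmaps hwQ))
  have h1 : HasFDerivWithinAt (fun w => Ψ (Ξ (0, w))) _ Q w :=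
    hΨd.hasFDerivWithinAt.comp w (hc.differentiableAt one_ne_zero).hasFDerivAt.hasFDerivWithinAt
      fun z hz => mem_image_of_mem _ (hmaps hz)
  have h2 : HasFDerivAt (fun w : E (d - 1) => ((0 : ℝ), w)) _ w :=
    (h1.congr (fun z hz => (hinv (hmaps hz)).symm) (hinv (hmaps hwQ)).symm).hasFDerivAt hQ
  have h3 := h2.unique (hasFDerivAt_prodMk_right (0 : ℝ) w)
  rw [injective_iff_map_eq_zero]
  intro z hz
  have h4 := congrArg (fun L => (L z).2) h3
  simpa [hz] using h4.symm

/-- Among the charts whose patches meet the open face take the one of least index. Near the point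
found, no earlier patch contains boundary points coming from the face, so these points lie in the
cell of `j`. The horizontal projection of the face in this chart has an invertible derivative, and
composing the vertical coordinate with its local inverse exhibits the height as a `C¹` function. -/
theorem BoundaryAtlas.exists_regular_point {d k : ℕ} {Ω : Set (E d)} (hΩ : IsOpen Ω)
    (A : BoundaryAtlas d k Ω) {s : ℝ} (hs : 1 ≤ s) {Ξ : ℝ × E (d - 1) → E d}
    (hΞ : IsReferenceMap s Ω Ξ) :
    ∃ (j : Fin A.N) (y₀ : E (d - 1)) (ρ : ℝ), 0 < ρ ∧ ball y₀ ρ ⊆ A.base j ∧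
      ContDiffOn ℝ 1 (A.height j) (ball y₀ ρ) ∧ ∀ y ∈ ball y₀ ρ, A.param j y ∈ A.cell j := by
  let Q : Set (E (d - 1)) := {w | ∀ i, w i ∈ Ioo (-1 : ℝ) 1}
  have hQ : IsOpen Q := by
    simp only [Q, ofPred_forall]
    exact isOpen_iInter_of_finite fun i => isOpen_Ioo.preimage (by fun_prop)
  have hfr : ∀ w ∈ Q, Ξ (0, w) ∈ frontier Ω := fun w hw =>
    hΞ.left_face w fun i => Ioo_subset_Icc_self (hw i)
  let J : Set (Fin A.N) := {j | ∃ w ∈ Q, Ξ (0, w) ∈ A.param j '' A.base j}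
  have hJ : J.Nonempty := by
    have h0 : (0 : E (d - 1)) ∈ Q := fun i => by simp
    obtain ⟨j, hj⟩ := mem_iUnion.1 (A.covers (hfr 0 h0))
    exact ⟨j, 0, h0, hj⟩
  obtain ⟨j, ⟨w₀, hw₀, y₀, hy₀, hyw⟩, hmin⟩ := wellFounded_lt.has_min J hJ
  set c : E (d - 1) → E d := fun w => Ξ (0, w) with hc
  obtain ⟨hc1, hcinj⟩ := hΞ.contDiffAt_face hs hw₀
  let F : E (d - 1) → E (d - 1) := fun w => (A.frame j (c w)).fst
  let T : E (d - 1) → ℝ := fun w => (A.frame j (c w)).snd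
  have hframe : ContDiffAt ℝ 1 (fun w => A.frame j (c w)) w₀ :=
    ((A.frame j).toAffineIsometry.toContinuousAffineMap.contDiff (𝕜 := ℝ)).contDiffAt.comp w₀ hc1
  let π₁ : WithLp 2 (E (d - 1) × ℝ) →L[ℝ] E (d - 1) := WithLp.fstL 2 ℝ _ _
  let π₂ : WithLp 2 (E (d - 1) × ℝ) →L[ℝ] ℝ := WithLp.sndL 2 ℝ _ _
  have hF : ContDiffAt ℝ 1 F w₀ := π₁.contDiff.contDiffAt.comp w₀ hframe
  have hT : ContDiffAt ℝ 1 T w₀ := π₂.contDiff.contDiffAt.comp w₀ hframe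
  have hFw : F w₀ = y₀ := by simp [F, hc, ← hyw]
  have hnear : ∀ᶠ w in nhds w₀, w ∈ Q ∧ c w ∈ A.band j := by
    refine Filter.Eventually.and (hQ.mem_nhds hw₀) (hc1.continuousAt.eventually_mem ?_)
    refine (A.isOpen_band j).mem_nhds ?_
    rw [← hyw]
    exact A.param_mem_band j hy₀
  have hTF : ∀ w, w ∈ Q ∧ c w ∈ A.band j → T w = A.height j (F w) := fun w hw =>
    (A.mem_frontier_iff_of_mem_band hΩ j hw.2).1 (hfr w hw.1)
  obtain ⟨K, hK, hl, -⟩ := (A.regular j).exists_bound (A.isOpen_base j) (A.convex_base j)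
  have hFd := (hF.differentiableAt one_ne_zero).hasFDerivAt
  have hTd := (hT.differentiableAt one_ne_zero).hasFDerivAt
  have hcd := (hc1.differentiableAt one_ne_zero).hasFDerivAt
  have hinj : Function.Injective (fderiv ℝ F w₀) := by
    rw [injective_iff_map_eq_zero]
    intro v hv
    -- A tangent vector without horizontal part cannot be vertical, since the height is Lipschitz;
    -- so it vanishes altogether.
    have hTv : fderiv ℝ T w₀ v = 0 := by
      refine fderiv_apply_eq_zero_of_norm_sub_le (K := K) hFd hTd ?_ hv
      filter_upwards [hnear] with w hw
      rw [hTF w hw, hTF w₀ hnear.self_of_nhds, ← dist_eq_norm (F w)]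
      exact hl _ hw.2.1 _ hnear.self_of_nhds.2.1
    have hfr' : HasFDerivAt (fun w => A.frame j (c w))
        (((A.frame j).linearIsometryEquiv : E d →L[ℝ] WithLp 2 (E (d - 1) × ℝ)) ∘L
          fderiv ℝ c w₀) w₀ := by
      have h1 : HasFDerivAt (A.frame j)
          ((A.frame j).linearIsometryEquiv : E d →L[ℝ] WithLp 2 (E (d - 1) × ℝ)) (c w₀) := by
        have := ((A.frame j).linearIsometryEquiv :
          E d →L[ℝ] WithLp 2 (E (d - 1) × ℝ)).hasFDerivAt (x := c w₀) |>.add_const (A.frame j 0)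
        refine this.congr_of_eventuallyEq (Filter.Eventually.of_forall fun z => ?_)
        have := (A.frame j).map_vadd 0 z
        simpa using this
      exact h1.comp w₀ hcd
    have hFv := hFd.unique (π₁.hasFDerivAt.comp w₀ hfr')
    have hTv' := hTd.unique (π₂.hasFDerivAt.comp w₀ hfr')
    have hzero : (A.frame j).linearIsometryEquiv (fderiv ℝ c w₀ v) = 0 := by
      refine WithLp.ofLp_injective 2 (Prod.ext ?_ ?_)
      · have := congrArg (fun L => L v) hFv
        rw [hv] at this
        exact this.symm
      · have := congrArg (fun L => L v) hTv'
        rw [hTv] at this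
        exact this.symm
    rw [LinearIsometryEquiv.map_eq_zero_iff] at hzero
    exact (injective_iff_map_eq_zero _).1 hcinj v hzero
  let F' : E (d - 1) ≃L[ℝ] E (d - 1) :=
    (LinearEquiv.ofInjectiveEndo (fderiv ℝ F w₀ : E (d - 1) →ₗ[ℝ] E (d - 1))
      hinj).toContinuousLinearEquiv
  have hF' : HasFDerivAt F (F' : E (d - 1) →L[ℝ] E (d - 1)) w₀ := by
    exact hFd
  let g := hF.localInverse hF' one_ne_zero
  have hg : ContDiffAt ℝ 1 g y₀ := hFw ▸ hF.to_localInverse hF' one_ne_zero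
  have hgy : g y₀ = w₀ := by
    rw [← hFw]; exact hF.localInverse_apply_image hF' one_ne_zero
  have hright : ∀ᶠ y in nhds y₀, F (g y) = y := by
    rw [← hFw]
    exact (hF.hasStrictFDerivAt' hF' one_ne_zero).eventually_right_inverse
  have hgnear : ∀ᶠ y in nhds y₀, g y ∈ Q ∧ c (g y) ∈ A.band j := by
    refine hg.continuousAt.tendsto.eventually (p := fun w => w ∈ Q ∧ c w ∈ A.band j) ?_
    rw [hgy]
    exact hnear
  have hheight : ∀ᶠ y in nhds y₀, A.height j y = T (g y) := by
    filter_upwards [hright, hgnear] with y h1 h2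
    rw [hTF _ h2, h1]
  have hreg : ContDiffAt ℝ 1 (A.height j) y₀ := by
    refine ContDiffAt.congr_of_eventuallyEq ?_ hheight
    exact (hgy.symm ▸ hT : ContDiffAt ℝ 1 T (g y₀)).comp y₀ hg
  have hall : ∀ᶠ y in nhds y₀, y ∈ A.base j ∧ ContDiffAt ℝ 1 (A.height j) y ∧
      A.param j y ∈ A.cell j := by
    filter_upwards [(A.isOpen_base j).mem_nhds hy₀, hreg.eventually (by simp), hright, hgnear,
      hheight] with y h1 h2 h3 h4 h5
    refine ⟨h1, h2, mem_image_of_mem _ h1, ?_⟩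
    simp only [mem_iUnion, not_exists]
    intro i hij hmem
    refine hmin i ⟨g y, h4.1, ?_⟩ hij
    have : A.param j y = c (g y) := by
      rw [A.eq_param_of_mem_frontier hΩ j h4.2 (hfr _ h4.1)]
      exact congrArg _ h3.symm
    exact (this ▸ hmem : c (g y) ∈ A.param i '' A.base i)
  obtain ⟨ρ, hρ, hball⟩ := Metric.eventually_nhds_iff_ball.1 hall
  exact ⟨j, y₀, ρ, hρ, fun y hy => (hball y hy).1,
    fun y hy => (hball y hy).2.1.contDiffWithinAt, fun y hy => (hball y hy).2.2⟩

/-! ### Surface measure and normal in a single chart -/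

namespace BoundaryAtlas

variable {d k : ℕ} {Ω : Set (E d)} (A : BoundaryAtlas d k Ω)

theorem continuousOn_param (j : Fin A.N) : ContinuousOn (A.param j) (A.base j) := by
  obtain ⟨K, hK, hl, -⟩ := A.exists_param_bound j
  exact (lipschitzOnWith_of_norm_sub_le hl).continuousOn

theorem eq_of_mem_cell {i j : Fin A.N} {x : E d} (hi : x ∈ A.cell i) (hj : x ∈ A.cell j) :
    i = j := by
  rcases lt_trichotomy i j with h | h | h
  · exact absurd (mem_iUnion₂.2 ⟨i, h, hi.1⟩) hj.2
  · exact h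
  · exact absurd (mem_iUnion₂.2 ⟨j, h, hj.1⟩) hi.2

theorem normal_param {j : Fin A.N} {y : E (d - 1)} (hy : A.param j y ∈ A.cell j) :
    A.normal (A.param j y) = A.chartNormal j y := by
  rw [normal, Finset.sum_eq_single j]
  · rw [indicator_of_mem hy, frame_param]
    rfl
  · intro i _ hij
    exact indicator_of_notMem (fun h => hij (A.eq_of_mem_cell h hy)) _
  · simp

theorem measurable_areaDensity (j : Fin A.N) : Measurable (A.areaDensity j) := by
  unfold areaDensity
  have : Measurable (gradient (A.height j)) :=
    (InnerProductSpace.toDual ℝ (E (d - 1))).symm.continuous.measurable.comp (measurable_fderiv ℝ _)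
  fun_prop

/-- The parametrization of a graph by a chart frame. -/
def graphMap (j : Fin A.N) (h : E (d - 1) → ℝ) (y : E (d - 1)) : E d :=
  (A.frame j).symm (WithLp.toLp 2 (y, h y))

@[simp] theorem frame_graphMap (j : Fin A.N) (h : E (d - 1) → ℝ) (y : E (d - 1)) :
    A.frame j (A.graphMap j h y) = WithLp.toLp 2 (y, h y) :=
  (A.frame j).apply_symm_apply _

theorem continuous_graphMap (j : Fin A.N) {h : E (d - 1) → ℝ} (hh : Continuous h) :
    Continuous (A.graphMap j h) :=
  (A.frame j).symm.continuous.comp ((WithLp.prod_continuous_toLp 2 _ _).comp (by fun_prop))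

theorem measurableEmbedding_graphMap (j : Fin A.N) {h : E (d - 1) → ℝ} (hh : Continuous h) :
    MeasurableEmbedding (A.graphMap j h) := by
  have hc := A.continuous_graphMap j hh
  refine MeasurableEmbedding.of_measurable_inverse hc.measurable ?_
    (A.continuous_frame_fst j).measurable (fun y => by rw [frame_graphMap]; rfl)
  have : range (A.graphMap j h) = {z | (A.frame j z).snd = h (A.frame j z).fst} := by
    ext z
    constructor
    · rintro ⟨y, rfl⟩
      rw [mem_ofPred_eq, frame_graphMap]
      rfl
    · intro hz
      refine ⟨(A.frame j z).fst, ?_⟩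
      rw [graphMap, ← (show (A.frame j z).snd = h (A.frame j z).fst from hz), frame_symm_eq]
  rw [this]
  exact (isClosed_eq (A.continuous_frame_snd j)
    (hh.comp (A.continuous_frame_fst j))).measurableSet

/-- The band of the given width around a graph over the set `D`. -/
def graphBand (j : Fin A.N) (h : E (d - 1) → ℝ) (D : Set (E (d - 1))) : Set (E d) :=
  {z | (A.frame j z).fst ∈ D ∧ |(A.frame j z).snd - h (A.frame j z).fst| < A.width j}

theorem isOpen_graphBand (j : Fin A.N) {h : E (d - 1) → ℝ} (hh : Continuous h)
    {D : Set (E (d - 1))} (hD : IsOpen D) : IsOpen (A.graphBand j h D) := by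
  have h1 := A.continuous_frame_fst j
  have h2 := A.continuous_frame_snd j
  exact (hD.preimage h1).inter (isOpen_lt (h2.sub (hh.comp h1)).abs continuous_const)

/-- Boundary points in the band lie on the graph over `D`, hence in the cell of `j`. Cells are
disjoint, so the other charts contribute nothing and the area formula of one graph remains. The
continuous extension `h` makes the graph map a measurable embedding of the whole space. -/
theorem surface_restrict_graphBand (hΩ : IsOpen Ω) (j : Fin A.N) {h : E (d - 1) → ℝ}
    (hh : Continuous h) {D : Set (E (d - 1))} (hD : IsOpen D) (hDb : D ⊆ A.base j)
    (hDh : ∀ y ∈ D, A.height j y = h y) (hcell : ∀ y ∈ D, A.param j y ∈ A.cell j) :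
    A.surface.restrict (A.graphBand j h D) =
      ((volume.restrict D).withDensity fun y => ENNReal.ofReal (A.areaDensity j y)).map
        (A.graphMap j h) := by
  have hW := A.isOpen_graphBand j hh hD
  have hmem : ∀ y ∈ D, A.param j y ∈ A.graphBand j h D := by
    intro y hy
    have : |A.height j y - h y| < A.width j := by simpa [hDh y hy] using A.width_pos j
    simp only [graphBand, mem_ofPred_eq, frame_param]
    exact ⟨hy, this⟩
  have hband : A.graphBand j h D ⊆ A.band j := fun z hz =>
    ⟨hDb hz.1, by rw [hDh _ hz.1]; exact hz.2⟩
  ext S hS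
  have hSW : MeasurableSet (S ∩ A.graphBand j h D) := hS.inter hW.measurableSet
  rw [Measure.restrict_apply hS, surface, Measure.finsetSum_apply]
  have hkey : ∀ i : Fin A.N,
      (((volume.restrict {y | y ∈ A.base i ∧ A.param i y ∈ A.cell i}).withDensity
        (fun y => ENNReal.ofReal (A.areaDensity i y))).map (A.param i))
          (S ∩ A.graphBand j h D) =
      ∫⁻ y in (A.param i ⁻¹' (S ∩ A.graphBand j h D)) ∩
        {y | y ∈ A.base i ∧ A.param i y ∈ A.cell i}, ENNReal.ofReal (A.areaDensity i y) := by
    intro i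
    have hm : AEMeasurable (A.param i)
        (volume.restrict {y | y ∈ A.base i ∧ A.param i y ∈ A.cell i}) :=
      ((A.continuousOn_param i).aemeasurable (A.isOpen_base i).measurableSet).mono_measure
        (Measure.restrict_mono (fun y hy => hy.1) le_rfl)
    rw [Measure.map_apply_of_aemeasurable
      (hm.mono_ac (withDensity_absolutelyContinuous _ _)) hSW, withDensity_apply',
      Measure.restrict_restrict₀ (hm.nullMeasurableSet_preimage hSW)]
  simp only [hkey]
  rw [Finset.sum_eq_single j]
  · rw [(A.measurableEmbedding_graphMap j hh).map_apply, withDensity_apply',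
      Measure.restrict_restrict (hS.preimage (A.continuous_graphMap j hh).measurable)]
    congr 2
    ext y
    constructor
    · rintro ⟨⟨h1, h2⟩, h3, h4⟩
      have hyD : y ∈ D := by
        simp only [graphBand, mem_ofPred_eq, frame_param] at h2
        exact h2.1
      refine ⟨?_, hyD⟩
      rw [mem_preimage, graphMap, ← hDh y hyD]
      exact h1
    · rintro ⟨h1, hyD⟩
      refine ⟨⟨?_, hmem y hyD⟩, hDb hyD, hcell y hyD⟩
      rw [mem_preimage, graphMap, ← hDh y hyD] at h1
      exact h1
  · intro i _ hij
    have : (A.param i ⁻¹' (S ∩ A.graphBand j h D)) ∩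
        {y | y ∈ A.base i ∧ A.param i y ∈ A.cell i} = ∅ := by
      refine eq_empty_of_forall_notMem fun y hy => ?_
      have hb := hband hy.1.2
      have he := A.eq_param_of_mem_frontier hΩ j hb (A.param_mem_frontier hΩ i hy.2.1)
      have hc := hcell _ hy.1.2.1
      rw [← he] at hc
      exact hij (A.eq_of_mem_cell hy.2.2 hc)
    rw [this]
    simp
  · simp

theorem one_le_areaDensity (j : Fin A.N) (y : E (d - 1)) : 1 ≤ A.areaDensity j y :=
  Real.one_le_sqrt.2 (by nlinarith [sq_nonneg ‖gradient (A.height j) y‖])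

/-- The vector with horizontal component `v` and vertical component `t` in the `j`-th chart. -/
def chartVector (j : Fin A.N) (v : E (d - 1)) (t : ℝ) : E d :=
  (A.frame j).symm.linearIsometryEquiv (WithLp.toLp 2 (v, t))

theorem inner_chartVector (j : Fin A.N) (v w : E (d - 1)) (t τ : ℝ) :
    inner ℝ (A.chartVector j v t) (A.chartVector j w τ) = inner ℝ v w + t * τ := by
  rw [chartVector, chartVector, LinearIsometryEquiv.inner_map_map, WithLp.prod_inner_apply]
  simp [mul_comm]

theorem inner_chartNormal (j : Fin A.N) (v : E (d - 1)) (t : ℝ) (y : E (d - 1)) :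
    inner ℝ (A.chartVector j v t) (A.chartNormal j y) =
      (A.areaDensity j y)⁻¹ * (t - fderiv ℝ (A.height j) y v) := by
  rw [chartNormal, inner_smul_right]
  congr 1
  have := A.inner_chartVector j v (-gradient (A.height j) y) t 1
  rw [chartVector, chartVector] at this
  rw [chartVector, this, inner_neg_right, inner_gradient_right]
  simp
  ring

end BoundaryAtlas

/-! ### Extension of the height function -/

/-- The remainder `w` of the first order Taylor expansion is cut off at scale `ε`. There `|w| ≤ 3 *
η * ε` and its slope is at most `η`, whereas the cut-off has slope at most `C / ε`. The product has
slope at most `η * (1 + 3 * C) = δ`, whatever `ε` is. Continuity of the derivative of `h` provides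
an `ε` for this `η`. -/
theorem exists_contDiff_extension {n : ℕ} {h : E n → ℝ} {y₀ : E n} {ρ : ℝ} (hρ : 0 < ρ)
    (hh : ContDiffOn ℝ 1 h (ball y₀ ρ)) {δ : ℝ} (hδ : 0 < δ) :
    ∃ (r : E n → ℝ) (ρ₁ : ℝ), 0 < ρ₁ ∧ ρ₁ ≤ ρ ∧ ContDiff ℝ 1 r ∧ (∀ y, ‖fderiv ℝ r y‖ ≤ δ) ∧
      ∀ y ∈ ball y₀ ρ₁, h y = h y₀ + fderiv ℝ h y₀ (y - y₀) + r y := by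
  let χ : ContDiffBump (0 : E n) := ⟨1, 2, one_pos, one_lt_two⟩
  have hχ : ContDiff ℝ 1 χ := χ.contDiff
  obtain ⟨C, hC⟩ := (χ.hasCompactSupport.fderiv ℝ).exists_bound_of_continuous
    (hχ.continuous_fderiv one_ne_zero)
  have hC0 : 0 ≤ C := (norm_nonneg _).trans (hC 0)
  let η := δ / (1 + 3 * C)
  have hη : 0 < η := by positivity
  let w : E n → ℝ := fun y => h y - h y₀ - fderiv ℝ h y₀ (y - y₀)
  have hw : ContDiffOn ℝ 1 w (ball y₀ ρ) := (hh.sub contDiffOn_const).sub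
    ((fderiv ℝ h y₀).contDiff.comp (contDiff_id.sub contDiff_const)).contDiffOn
  have hy₀ : y₀ ∈ ball y₀ ρ := mem_ball_self hρ
  have hw0 : fderiv ℝ w y₀ = 0 := by
    have h1 : HasFDerivAt h (fderiv ℝ h y₀) y₀ :=
      ((hh.differentiableOn one_ne_zero).differentiableAt (isOpen_ball.mem_nhds hy₀)).hasFDerivAt
    have h2 : HasFDerivAt (fun y => fderiv ℝ h y₀ (y - y₀)) (fderiv ℝ h y₀) y₀ := by
      have := (fderiv ℝ h y₀).hasFDerivAt.comp y₀ ((hasFDerivAt_id y₀).sub_const y₀)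
      rwa [ContinuousLinearMap.comp_id] at this
    exact ((h1.sub_const (h y₀)).sub h2).fderiv.trans (sub_self _)
  have hcont : ContinuousAt (fderiv ℝ w) y₀ :=
    (hw.continuousOn_fderiv_of_isOpen isOpen_ball le_rfl).continuousAt (isOpen_ball.mem_nhds hy₀)
  have hev : ∀ᶠ y in nhds y₀, y ∈ ball y₀ ρ ∧ ‖fderiv ℝ w y‖ ≤ η := by
    refine Filter.Eventually.and (isOpen_ball.mem_nhds hy₀) ?_
    have := hcont.norm.tendsto
    rw [hw0, norm_zero] at this
    filter_upwards [this.eventually_lt_const hη] with y hy using hy.le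
  obtain ⟨ε', hε', hball⟩ := Metric.eventually_nhds_iff_ball.1 hev
  let ε := ε' / 3
  have hε : 0 < ε := by positivity
  have h3 : 3 * ε = ε' := by simp only [ε]; ring
  have hwd : ∀ y ∈ ball y₀ ε', DifferentiableAt ℝ w y := fun y hy =>
    (hw.differentiableOn one_ne_zero).differentiableAt (isOpen_ball.mem_nhds (hball y hy).1)
  have hwb : ∀ y ∈ ball y₀ ε', |w y| ≤ η * (3 * ε) := by
    intro y hy
    have h1 := (convex_ball y₀ ε').norm_image_sub_le_of_norm_fderiv_le (𝕜 := ℝ) hwd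
      (fun z hz => (hball z hz).2) (mem_ball_self hε') hy
    have h2 : w y₀ = 0 := by simp [w]
    rw [h2, sub_zero, Real.norm_eq_abs] at h1
    refine h1.trans ?_
    rw [h3, ← dist_eq_norm]
    gcongr
    exact (mem_ball.1 hy).le
  let s : E n → ℝ := fun y => χ (ε⁻¹ • (y - y₀))
  have hs : ContDiff ℝ 1 s := hχ.comp (by fun_prop)
  have hsd : ∀ y, ‖fderiv ℝ s y‖ ≤ C * ε⁻¹ := by
    intro y
    have h1 : HasFDerivAt (fun y : E n => ε⁻¹ • (y - y₀))
        (ε⁻¹ • ContinuousLinearMap.id ℝ (E n)) y :=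
      ((hasFDerivAt_id y).sub_const y₀).const_smul ε⁻¹
    have h2 := ((hχ.differentiable one_ne_zero) (ε⁻¹ • (y - y₀))).hasFDerivAt.comp y h1
    rw [show s = χ ∘ fun y => ε⁻¹ • (y - y₀) from rfl, h2.fderiv]
    refine (ContinuousLinearMap.opNorm_comp_le _ _).trans ?_
    refine mul_le_mul (hC _) ?_ (norm_nonneg _) hC0
    rw [norm_smul, Real.norm_of_nonneg (by positivity)]
    exact mul_le_of_le_one_right (by positivity) ContinuousLinearMap.norm_id_le
  have hs1 : ∀ y, |s y| ≤ 1 := fun y => by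
    rw [abs_of_nonneg χ.nonneg]; exact χ.le_one
  have hzero : ∀ y, y ∉ closedBall y₀ (2 * ε) → s y = 0 := by
    intro y hy
    refine χ.zero_of_le_dist ?_
    rw [dist_zero_right, norm_smul, Real.norm_of_nonneg (by positivity), ← dist_eq_norm]
    simp only [mem_closedBall, not_le] at hy
    change 2 ≤ _
    rw [inv_mul_eq_div, le_div_iff₀ hε]
    exact hy.le
  let r : E n → ℝ := fun y => s y * w y
  have hloc : ∀ y, y ∉ closedBall y₀ (2 * ε) → r =ᶠ[nhds y] fun _ => 0 := by
    intro y hy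
    filter_upwards [isClosed_closedBall.isOpen_compl.mem_nhds hy] with z hz
    simp [r, hzero z hz]
  have hsub : ∀ y, y ∈ closedBall y₀ (2 * ε) → y ∈ ball y₀ ε' := by
    intro y hy
    refine mem_ball.2 (lt_of_le_of_lt (mem_closedBall.1 hy) (by linarith))
  have hε'ρ : ball y₀ ε' ⊆ ball y₀ ρ := fun y hy => (hball y hy).1
  refine ⟨r, min ε ρ, lt_min hε hρ, min_le_right _ _, ?_, fun y => ?_, fun y hy => ?_⟩
  · refine contDiff_iff_contDiffAt.2 fun y => ?_
    by_cases hy : y ∈ closedBall y₀ (2 * ε)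
    · exact hs.contDiffAt.mul (hw.contDiffAt (isOpen_ball.mem_nhds (hε'ρ (hsub y hy))))
    · exact contDiffAt_const.congr_of_eventuallyEq (hloc y hy)
  · by_cases hy : y ∈ closedBall y₀ (2 * ε)
    · have h1 := ((hs.differentiable one_ne_zero) y).hasFDerivAt.mul (hwd y (hsub y hy)).hasFDerivAt
      rw [show r = s * w from rfl, h1.fderiv]
      refine (norm_add_le _ _).trans ?_
      rw [norm_smul, norm_smul, Real.norm_eq_abs, Real.norm_eq_abs]
      have e : η + η * (3 * ε) * (C * ε⁻¹) = δ := by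
        simp only [η]
        field_simp
      rw [← e]
      refine add_le_add ?_ ?_
      · calc _ ≤ 1 * η := mul_le_mul (hs1 y) (hball y (hsub y hy)).2 (norm_nonneg _) zero_le_one
          _ = η := one_mul _
      · exact mul_le_mul (hwb y (hsub y hy)) (hsd y) (norm_nonneg _) (by positivity)
    · rw [(hloc y hy).fderiv_eq]
      simpa using hδ.le
  · have : s y = 1 := by
      refine χ.one_of_mem_closedBall ?_
      rw [mem_closedBall, dist_zero_right, norm_smul, Real.norm_of_nonneg (by positivity),
        ← dist_eq_norm]
      change _ ≤ 1
      rw [inv_mul_eq_div, div_le_iff₀ hε, one_mul]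
      exact ((mem_ball.1 hy).trans_le (min_le_left _ _)).le
    simp only [r, this, one_mul, w]
    ring

/-! ### A parabolic flow above a nearly flat graph -/

/-- A graph `r` with small slope, together with a direction `e` and a point `xs`. For a horizontal
velocity `v` the parabolas of the flow leave the subgraph of `r` near `xs`, having entered it near
`xs - 2 v`. -/
structure UTurn (n : ℕ) where
  e : E n
  xs : E n
  r : E n → ℝ
  norm_e : ‖e‖ = 1
  contDiff_r : ContDiff ℝ 1 r
  norm_fderiv_r_le : ∀ y, ‖fderiv ℝ r y‖ ≤ 1 / 64

namespace UTurn

variable {n : ℕ} (M : UTurn n)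

/-- The component of the velocity in the direction `e`. -/
def speed (v : E n) : ℝ := inner ℝ v M.e

/-- The time coordinate. -/
def time (v y : E n) : ℝ := inner ℝ (y - M.xs) M.e / M.speed v + 1

/-- The conserved quantity of the flow, at the point of the graph above `y`. -/
def level (v y : E n) : ℝ := M.r y - M.speed v / 2 * M.time v y ^ 2

/-- The leaf through the point of the graph above `y`. -/
def leaf (v y : E n) : E n := y + (M.level v y - M.time v y) • v

/-- The horizontal position on the leaf `L` at time `s`. -/
def pos (v L : E n) (s : ℝ) : E n := L + (s - M.time v L) • v

/-- The height of the graph above the flow line of the leaf `L` at time `s`. -/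
def gap (v L : E n) (s : ℝ) : ℝ := M.level v (M.pos v L s) - M.time v L

/-- The admissible leaves. -/
def leaves (v : E n) : Set (E n) := ball (M.leaf v M.xs) (M.speed v ^ 2 / 16)

/-- Admissible velocities. -/
structure Admissible (v : E n) : Prop where
  speed_pos : 0 < M.speed v
  speed_le_one : M.speed v ≤ 1
  norm_le : ‖v‖ ≤ 2 * M.speed v

variable {M} {v : E n}

theorem abs_r_sub_le (y z : E n) : |M.r y - M.r z| ≤ 1 / 64 * ‖y - z‖ := by
  have := convex_univ.norm_image_sub_le_of_norm_fderiv_le (𝕜 := ℝ) (f := M.r) (C := 1 / 64)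
    (fun x _ => (M.contDiff_r.differentiable one_ne_zero) x) (fun x _ => M.norm_fderiv_r_le x)
    (mem_univ z) (mem_univ y)
  rwa [Real.norm_eq_abs] at this

theorem abs_inner_e_le (y : E n) : |inner ℝ y M.e| ≤ ‖y‖ := by
  have := abs_real_inner_le_norm y M.e
  rwa [M.norm_e, mul_one] at this

theorem time_xs : M.time v M.xs = 1 := by simp [time]

theorem time_sub (y z : E n) :
    M.time v y - M.time v z = inner ℝ (y - z) M.e / M.speed v := by
  have : y - z = (y - M.xs) - (z - M.xs) := by abel
  rw [time, time, this, inner_sub_left (y - M.xs)]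
  ring

theorem Admissible.abs_time_sub_le (hv : M.Admissible v) (y z : E n) :
    |M.time v y - M.time v z| ≤ ‖y - z‖ / M.speed v := by
  rw [time_sub, abs_div, abs_of_pos hv.speed_pos]
  have := hv.speed_pos
  gcongr
  exact abs_inner_e_le _

theorem Admissible.time_add_smul (hv : M.Admissible v) (y : E n) (τ : ℝ) :
    M.time v (y + τ • v) = M.time v y + τ := by
  have h := M.time_sub (v := v) (y + τ • v) y
  have h2 : inner ℝ v M.e = M.speed v := rfl
  rw [add_sub_cancel_left, inner_smul_left, h2, mul_div_assoc, div_self hv.speed_pos.ne'] at h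
  simp at h
  linarith

/-- This is the coding of leaves by points of `E n`: on the line through `y` in direction `v`, the
leaf is the point whose time equals the conserved level. One point records both the line and the
additive constant of the parabola, so that leaves form an open set of `E n` and no quotient is
needed. -/
theorem Admissible.time_leaf (hv : M.Admissible v) (y : E n) :
    M.time v (M.leaf v y) = M.level v y := by
  rw [leaf, hv.time_add_smul]
  ring

theorem Admissible.time_pos (hv : M.Admissible v) (L : E n) (s : ℝ) :
    M.time v (M.pos v L s) = s := by
  rw [pos, hv.time_add_smul]
  ring

theorem Admissible.pos_leaf (hv : M.Admissible v) (y : E n) (s : ℝ) :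
    M.pos v (M.leaf v y) s = y + (s - M.time v y) • v := by
  rw [pos, hv.time_leaf, leaf, add_assoc, ← add_smul]
  congr 2
  ring

theorem Admissible.pos_leaf_time (hv : M.Admissible v) (y : E n) :
    M.pos v (M.leaf v y) (M.time v y) = y := by
  rw [hv.pos_leaf, sub_self, zero_smul, add_zero]

theorem Admissible.gap_eq (hv : M.Admissible v) (L : E n) (s : ℝ) :
    M.gap v L s = M.r (M.pos v L s) - M.speed v / 2 * s ^ 2 - M.time v L := by
  rw [gap, level, hv.time_pos]

theorem Admissible.gap_leaf (hv : M.Admissible v) (y : E n) :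
    M.gap v (M.leaf v y) (M.time v y) = 0 := by
  rw [gap, hv.pos_leaf_time, hv.time_leaf, sub_self]

theorem Admissible.leaf_pos (hv : M.Admissible v) (L : E n) (s : ℝ) (h : M.gap v L s = 0) :
    M.leaf v (M.pos v L s) = L := by
  have h1 : M.level v (M.pos v L s) = M.time v L := sub_eq_zero.1 h
  rw [leaf, h1, hv.time_pos, pos, add_assoc, ← add_smul]
  simp

theorem Admissible.norm_pos_sub_le (hv : M.Admissible v) (L : E n) (s s' : ℝ) :
    ‖M.pos v L s - M.pos v L s'‖ ≤ |s - s'| * (2 * M.speed v) := by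
  have : M.pos v L s - M.pos v L s' = (s - s') • v := by
    rw [pos, pos, add_sub_add_left_eq_sub, ← sub_smul]
    congr 1
    ring
  rw [this, norm_smul, Real.norm_eq_abs]
  exact mul_le_mul_of_nonneg_left hv.norm_le (abs_nonneg _)

/-- Quantitative monotonicity of the gap on both sides of the vertex. -/
theorem Admissible.gap_sub_le (hv : M.Admissible v) (L : E n) {σ s s' : ℝ} (hσ : |σ| = 1)
    (h : s ≤ s') :
    M.gap v L (σ * s') - M.gap v L (σ * s) ≤
      M.speed v * (s' - s) * (1 / 32 - (s + s') / 2) := by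
  have h1 := M.abs_r_sub_le (M.pos v L (σ * s')) (M.pos v L (σ * s))
  have h2 := hv.norm_pos_sub_le L (σ * s') (σ * s)
  rw [← mul_sub, abs_mul, hσ, one_mul, abs_of_nonneg (sub_nonneg.2 h)] at h2
  have h3 := (abs_le.1 h1).2
  have h4 : σ ^ 2 = 1 := by rw [← sq_abs, hσ, one_pow]
  rw [hv.gap_eq, hv.gap_eq, mul_pow, mul_pow, h4]
  nlinarith

theorem Admissible.gap_lt (hv : M.Admissible v) (L : E n) {σ s s' : ℝ} (hσ : |σ| = 1)
    (hs : 1 / 4 ≤ s) (h : s < s') : M.gap v L (σ * s') < M.gap v L (σ * s) := by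
  have h1 := hv.gap_sub_le L hσ h.le
  have h2 := hv.speed_pos
  have h3 : M.speed v * (s' - s) * (1 / 32 - (s + s') / 2) < 0 :=
    mul_neg_of_pos_of_neg (mul_pos h2 (sub_pos.2 h)) (by linarith)
  linarith

/-- Away from the vertex the parabola beats the slope `1 / 32` due to `r`, and the gap is strictly
monotone. The bound converts a perturbation of the gap into one of its root; Lipschitz and
continuity estimates of the transport map rest on it. -/
theorem Admissible.abs_sub_le_abs_gap_sub (hv : M.Admissible v) (L : E n) {σ s s' : ℝ}
    (hσ : |σ| = 1) (hs : 1 / 2 ≤ s) (hs' : 1 / 2 ≤ s') :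
    M.speed v / 4 * |s - s'| ≤ |M.gap v L (σ * s) - M.gap v L (σ * s')| := by
  have key : ∀ {s s' : ℝ}, 1 / 2 ≤ s → s ≤ s' →
      M.speed v / 4 * (s' - s) ≤ M.gap v L (σ * s) - M.gap v L (σ * s') := by
    intro s s' hs h
    have h1 := hv.gap_sub_le L hσ h
    have h2 : 0 ≤ M.speed v * (s' - s) := mul_nonneg hv.speed_pos.le (sub_nonneg.2 h)
    nlinarith
  rcases le_total s s' with h | h
  · rw [abs_sub_comm, abs_of_nonneg (sub_nonneg.2 h)]
    exact (key hs h).trans (le_abs_self _)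
  · rw [abs_of_nonneg (sub_nonneg.2 h), abs_sub_comm]
    exact (key hs' h).trans (le_abs_self _)

/-! ### Crossing times of the admissible leaves. -/

section Leaves

/-- Time has Lipschitz constant `1 / speed`, so the radius `speed ^ 2 / 16` of the set of leaves
fixes the level up to `speed / 16`, which is small against the depth `speed / 2` of the parabola. -/
theorem Admissible.abs_time_sub_of_mem_leaves (hv : M.Admissible v) {L : E n}
    (hL : L ∈ M.leaves v) : |M.time v L - (M.r M.xs - M.speed v / 2)| ≤ M.speed v / 16 := by
  have h1 := hv.abs_time_sub_le L (M.leaf v M.xs)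
  rw [hv.time_leaf, level, time_xs] at h1
  have h2 : ‖L - M.leaf v M.xs‖ ≤ M.speed v ^ 2 / 16 := (mem_ball_iff_norm.1 hL).le
  have h3 := hv.speed_pos
  have h4 : ‖L - M.leaf v M.xs‖ / M.speed v ≤ M.speed v / 16 := by
    rw [div_le_iff₀ h3]
    nlinarith
  simp only [one_pow, mul_one] at h1
  exact h1.trans h4

theorem Admissible.norm_pos_sub_xs_le (hv : M.Admissible v) {L : E n}
    (hL : L ∈ M.leaves v) {s : ℝ} (hs : |s| ≤ 3 / 2) :
    ‖M.pos v L s - M.xs‖ ≤ 6 * M.speed v := by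
  have h1 := hv.abs_time_sub_of_mem_leaves hL
  have h2 : ‖L - M.leaf v M.xs‖ ≤ M.speed v ^ 2 / 16 := (mem_ball_iff_norm.1 hL).le
  have h3 := hv.speed_pos
  have h4 := hv.speed_le_one
  have e : M.pos v L s - M.xs = (L - M.leaf v M.xs) +
      ((s - 1) - (M.time v L - (M.r M.xs - M.speed v / 2))) • v := by
    rw [leaf, level, time_xs, pos]
    simp only [sub_smul]
    simp
    abel
  rw [e]
  refine (norm_add_le _ _).trans ?_
  rw [norm_smul, Real.norm_eq_abs]
  have h5 : |(s - 1) - (M.time v L - (M.r M.xs - M.speed v / 2))| ≤ 5 / 2 + M.speed v / 16 := by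
    rw [abs_le] at *
    constructor <;> linarith
  have h6 := mul_le_mul h5 hv.norm_le (norm_nonneg _) (by positivity)
  nlinarith

/-- The variation of `r` contributes `6 / 64` and the level `1 / 16`, together `5 / 32`. This is too
little to move the zeros `±1` of the model parabola out of `1 / 2 < |s| < 5 / 4`. -/
theorem Admissible.abs_gap_sub_le (hv : M.Admissible v) {L : E n} (hL : L ∈ M.leaves v) {s : ℝ}
    (hs : |s| ≤ 3 / 2) :
    |M.gap v L s - M.speed v / 2 * (1 - s ^ 2)| ≤ 5 / 32 * M.speed v := by
  have h1 := hv.abs_time_sub_of_mem_leaves hL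
  have h2 := hv.norm_pos_sub_xs_le hL hs
  have h3 := M.abs_r_sub_le (M.pos v L s) M.xs
  rw [hv.gap_eq]
  rw [abs_le] at *
  constructor <;> nlinarith

theorem Admissible.abs_gap_le (hv : M.Admissible v) {L : E n} (hL : L ∈ M.leaves v) {s : ℝ}
    (hs : |s| ≤ 3 / 2) : |M.gap v L s| ≤ M.speed v := by
  have h1 := hv.abs_gap_sub_le hL hs
  have h3 := hv.speed_pos
  have h2 : s ^ 2 ≤ 9 / 4 := by
    rw [← sq_abs]; nlinarith [abs_nonneg s]
  have h4 : -(5 / 8) * M.speed v ≤ M.speed v / 2 * (1 - s ^ 2) := by nlinarith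
  have h5 : M.speed v / 2 * (1 - s ^ 2) ≤ M.speed v / 2 := by nlinarith [sq_nonneg s]
  rw [abs_le] at *
  constructor <;> linarith

theorem Admissible.gap_pos (hv : M.Admissible v) {L : E n} (hL : L ∈ M.leaves v) {s : ℝ}
    (hs : |s| ≤ 1 / 2) : 0 < M.gap v L s := by
  have h1 := hv.abs_gap_sub_le hL (hs.trans (by norm_num))
  have h3 := hv.speed_pos
  have h2 : s ^ 2 ≤ 1 / 4 := by
    rw [← sq_abs]; nlinarith [abs_nonneg s]
  have h4 : 3 / 8 * M.speed v ≤ M.speed v / 2 * (1 - s ^ 2) := by nlinarith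
  rw [abs_le] at h1
  linarith

theorem Admissible.gap_neg (hv : M.Admissible v) {L : E n} (hL : L ∈ M.leaves v) {s : ℝ}
    (hs : 5 / 4 ≤ |s|) (hs' : |s| ≤ 3 / 2) : M.gap v L s < 0 := by
  have h1 := hv.abs_gap_sub_le hL hs'
  have h3 := hv.speed_pos
  have h2 : 25 / 16 ≤ s ^ 2 := by
    rw [← sq_abs]; nlinarith
  have h4 : M.speed v / 2 * (1 - s ^ 2) ≤ -(9 / 32) * M.speed v := by nlinarith
  rw [abs_le] at h1
  linarith

theorem continuous_time : Continuous (M.time v) := by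
  unfold time
  fun_prop

theorem continuous_level : Continuous (M.level v) := by
  have h1 := M.contDiff_r.continuous
  have h2 := M.continuous_time (v := v)
  unfold level
  fun_prop

theorem continuous_leaf : Continuous (M.leaf v) := by
  have h1 := M.continuous_level (v := v)
  have h2 := M.continuous_time (v := v)
  unfold leaf
  fun_prop

theorem continuous_gap (L : E n) : Continuous (M.gap v L) := by
  have h1 := M.continuous_level (v := v)
  unfold gap pos
  fun_prop

theorem Admissible.exists_root (hv : M.Admissible v) {L : E n} (hL : L ∈ M.leaves v) {σ : ℝ}
    (hσ : |σ| = 1) : ∃ s ∈ Ioo (1 / 2 : ℝ) (5 / 4), M.gap v L (σ * s) = 0 := by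
  have hc : ContinuousOn (fun s => M.gap v L (σ * s)) (Icc (1 / 2) (5 / 4)) :=
    ((continuous_gap L).comp (by fun_prop)).continuousOn
  refine intermediate_value_Ioo' (by norm_num) hc ⟨?_, ?_⟩
  · exact hv.gap_neg hL (by rw [abs_mul, hσ]; norm_num) (by rw [abs_mul, hσ]; norm_num)
  · exact hv.gap_pos hL (by rw [abs_mul, hσ]; norm_num)

variable (M) in
/-- The time, up to the sign `σ`, at which the leaf `L` crosses the graph. -/
def root (σ : ℝ) (v L : E n) : ℝ :=
  Classical.epsilon fun s => s ∈ Ioo (1 / 2 : ℝ) (5 / 4) ∧ M.gap v L (σ * s) = 0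

theorem Admissible.root_spec (hv : M.Admissible v) {L : E n} (hL : L ∈ M.leaves v) {σ : ℝ}
    (hσ : |σ| = 1) :
    M.root σ v L ∈ Ioo (1 / 2 : ℝ) (5 / 4) ∧ M.gap v L (σ * M.root σ v L) = 0 :=
  Classical.epsilon_spec (p := fun s => s ∈ Ioo (1 / 2 : ℝ) (5 / 4) ∧ M.gap v L (σ * s) = 0)
    (hv.exists_root hL hσ)

theorem Admissible.root_unique (hv : M.Admissible v) {L : E n} (hL : L ∈ M.leaves v) {σ : ℝ}
    (hσ : |σ| = 1) {s : ℝ} (hs : 1 / 4 ≤ s) (h : M.gap v L (σ * s) = 0) :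
    s = M.root σ v L := by
  obtain ⟨h1, h2⟩ := hv.root_spec hL hσ
  rcases lt_trichotomy s (M.root σ v L) with h3 | h3 | h3
  · exact absurd (hv.gap_lt L hσ hs h3) (by rw [h, h2]; exact lt_irrefl _)
  · exact h3
  · exact absurd (hv.gap_lt L hσ (by linarith [h1.1]) h3) (by rw [h, h2]; exact lt_irrefl _)

theorem Admissible.gap_pos_iff_of_sign (hv : M.Admissible v) {L : E n} (hL : L ∈ M.leaves v)
    {σ : ℝ} (hσ : |σ| = 1) {s : ℝ} (hs : 0 ≤ s) :
    0 < M.gap v L (σ * s) ↔ s < M.root σ v L := by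
  obtain ⟨h1, h2⟩ := hv.root_spec hL hσ
  rcases le_or_gt s (1 / 2) with h | h
  · refine iff_of_true (hv.gap_pos hL ?_) (h.trans_lt h1.1)
    rw [abs_mul, hσ, one_mul, abs_of_nonneg hs]
    exact h
  constructor
  · intro hg
    by_contra! hle
    rcases hle.eq_or_lt with h3 | h3
    · rw [← h3, h2] at hg
      exact lt_irrefl _ hg
    · have := hv.gap_lt L hσ (by linarith [h1.1]) h3
      linarith
  · intro h3
    have := hv.gap_lt L hσ (by linarith) h3
    linarith

theorem Admissible.gap_pos_iff (hv : M.Admissible v) {L : E n} (hL : L ∈ M.leaves v) (s : ℝ) :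
    0 < M.gap v L s ↔ s ∈ Ioo (-M.root (-1) v L) (M.root 1 v L) := by
  have hp := (hv.root_spec hL (σ := 1) (by simp)).1
  have hm := (hv.root_spec hL (σ := -1) (by simp)).1
  rcases le_total 0 s with h | h
  · have := hv.gap_pos_iff_of_sign hL (σ := 1) (by simp) h
    rw [one_mul] at this
    rw [this]
    exact ⟨fun h' => ⟨by linarith [hm.1], h'⟩, fun h' => h'.2⟩
  · have := hv.gap_pos_iff_of_sign hL (σ := -1) (by simp) (neg_nonneg.2 h)
    rw [neg_mul_neg, one_mul] at this
    rw [this]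
    exact ⟨fun h' => ⟨by linarith, by linarith [hp.1]⟩, fun h' => by linarith [h'.1]⟩

end Leaves

/-! ### Crossing points -/

variable (M) in
/-- The points above which the flow crosses the graph upwards (`σ = 1`), downwards (`σ = -1`). -/
def crossing (σ : ℝ) (v : E n) : Set (E n) :=
  {y | M.leaf v y ∈ M.leaves v ∧ σ * M.time v y ∈ Ioo (1 / 4 : ℝ) (3 / 2)}

theorem isOpen_crossing (σ : ℝ) : IsOpen (M.crossing σ v) := by
  have h1 : IsOpen (M.leaf v ⁻¹' M.leaves v) := isOpen_ball.preimage continuous_leaf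
  have h2 : IsOpen ((fun y => σ * M.time v y) ⁻¹' Ioo (1 / 4 : ℝ) (3 / 2)) :=
    isOpen_Ioo.preimage (continuous_time.const_mul σ)
  exact h1.inter h2

theorem mul_self_of_abs_eq_one {σ : ℝ} (hσ : |σ| = 1) : σ * σ = 1 := by
  rw [← abs_mul_abs_self, hσ, one_mul]

variable (M) in
/-- The crossing point of a leaf. -/
def cross (σ : ℝ) (v L : E n) : E n := M.pos v L (σ * M.root σ v L)

theorem Admissible.time_cross (hv : M.Admissible v) {σ : ℝ} (L : E n) :
    M.time v (M.cross σ v L) = σ * M.root σ v L := hv.time_pos _ _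

theorem Admissible.leaf_cross (hv : M.Admissible v) {L : E n} (hL : L ∈ M.leaves v) {σ : ℝ}
    (hσ : |σ| = 1) : M.leaf v (M.cross σ v L) = L :=
  hv.leaf_pos _ _ (hv.root_spec hL hσ).2

theorem Admissible.cross_mem (hv : M.Admissible v) {L : E n} (hL : L ∈ M.leaves v) {σ : ℝ}
    (hσ : |σ| = 1) : M.cross σ v L ∈ M.crossing σ v := by
  obtain ⟨h1, h2⟩ := hv.root_spec hL hσ
  refine ⟨by rwa [hv.leaf_cross hL hσ], ?_⟩
  rw [hv.time_cross, ← mul_assoc, mul_self_of_abs_eq_one hσ, one_mul]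
  exact ⟨by linarith [h1.1], by linarith [h1.2]⟩

theorem Admissible.root_leaf (hv : M.Admissible v) {σ : ℝ} (hσ : |σ| = 1) {y : E n}
    (hy : y ∈ M.crossing σ v) : M.root σ v (M.leaf v y) = σ * M.time v y := by
  refine (hv.root_unique hy.1 hσ hy.2.1.le ?_).symm
  rw [← mul_assoc, mul_self_of_abs_eq_one hσ, one_mul, hv.gap_leaf]

theorem Admissible.cross_leaf (hv : M.Admissible v) {σ : ℝ} (hσ : |σ| = 1) {y : E n}
    (hy : y ∈ M.crossing σ v) : M.cross σ v (M.leaf v y) = y := by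
  rw [cross, hv.root_leaf hσ hy, ← mul_assoc, mul_self_of_abs_eq_one hσ, one_mul,
    hv.pos_leaf_time]

theorem Admissible.injOn_leaf (hv : M.Admissible v) {σ : ℝ} (hσ : |σ| = 1) :
    InjOn (M.leaf v) (M.crossing σ v) := fun y hy z hz h => by
  rw [← hv.cross_leaf hσ hy, ← hv.cross_leaf hσ hz, h]

theorem Admissible.image_leaf (hv : M.Admissible v) {σ : ℝ} (hσ : |σ| = 1) :
    M.leaf v '' M.crossing σ v = M.leaves v := by
  ext L
  constructor
  · rintro ⟨y, hy, rfl⟩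
    exact hy.1
  · exact fun hL => ⟨_, hv.cross_mem hL hσ, hv.leaf_cross hL hσ⟩

theorem Admissible.mem_crossing (hv : M.Admissible v) {y : E n} (hL : M.leaf v y ∈ M.leaves v)
    (hs : |M.time v y| < 3 / 2) : y ∈ M.crossing 1 v ∨ y ∈ M.crossing (-1) v := by
  have h1 : 1 / 2 < |M.time v y| := by
    by_contra! h
    have := hv.gap_pos hL h
    rw [hv.gap_leaf] at this
    exact lt_irrefl _ this
  rcases le_total 0 (M.time v y) with h | h
  · rw [abs_of_nonneg h] at *
    exact Or.inl ⟨hL, by constructor <;> linarith⟩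
  · rw [abs_of_nonpos h] at *
    exact Or.inr ⟨hL, by constructor <;> linarith⟩

/-! ### The Jacobian of the leaf map -/

variable (M) in
/-- The derivative of the leaf map. -/
def leafDeriv (v y : E n) : E n →L[ℝ] E n :=
  ContinuousLinearMap.id ℝ (E n) +
    (fderiv ℝ M.r y - (M.speed v * M.time v y + 1) • (M.speed v)⁻¹ • innerSL ℝ M.e).smulRight v

theorem hasFDerivAt_time (y : E n) :
    HasFDerivAt (M.time v) ((M.speed v)⁻¹ • innerSL ℝ M.e) y := by
  have h := (((innerSL ℝ M.e).hasFDerivAt (x := y - M.xs)).comp y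
    ((hasFDerivAt_id y).sub_const M.xs)).const_smul (M.speed v)⁻¹ |>.add_const 1
  rw [ContinuousLinearMap.comp_id] at h
  refine h.congr_of_eventuallyEq (.of_forall fun z => ?_)
  simp [time, real_inner_comm, div_eq_inv_mul]

theorem hasFDerivAt_leaf (y : E n) : HasFDerivAt (M.leaf v) (M.leafDeriv v y) y := by
  have h1 := M.hasFDerivAt_time (v := v) y
  have h2 := ((M.contDiff_r.differentiable one_ne_zero) y).hasFDerivAt
  have h3 := h2.sub ((h1.pow 2).const_smul (M.speed v / 2))
  have h4 := (hasFDerivAt_id y).add ((h3.sub h1).smul_const v)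
  refine (h4.congr_of_eventuallyEq (.of_forall fun z => ?_)).congr_fderiv ?_
  · simp [leaf, level]
  · rw [leafDeriv]
    congr 2
    ext w
    simp
    ring

/-- The derivative is the identity plus a rank one map with range spanned by `v`, so its determinant
is one plus the functional evaluated at `v`. At a crossing the term with the time dominates the
slope of `r`. -/
theorem Admissible.det_leafDeriv (hv : M.Admissible v) (y : E n) :
    (M.leafDeriv v y).det = fderiv ℝ M.r y v - M.speed v * M.time v y := by
  have h : (M.leafDeriv v y).det = (LinearMap.transvection
      ((fderiv ℝ M.r y - (M.speed v * M.time v y + 1) • (M.speed v)⁻¹ • innerSL ℝ M.e :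
        E n →L[ℝ] ℝ) : E n →ₗ[ℝ] ℝ) v).det := by
    rw [ContinuousLinearMap.det]
    congr 1
  have h2 : inner ℝ M.e v = M.speed v := real_inner_comm _ _
  rw [h, LinearMap.transvection.det]
  simp [h2, inv_mul_cancel₀ hv.speed_pos.ne']
  ring

theorem Admissible.abs_fderiv_r_le (hv : M.Admissible v) (y : E n) :
    |fderiv ℝ M.r y v| ≤ M.speed v / 32 := by
  have h1 := (fderiv ℝ M.r y).le_of_opNorm_le (M.norm_fderiv_r_le y) v
  rw [Real.norm_eq_abs] at h1
  have := hv.norm_le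
  linarith

/-- The sign and size of the Jacobian at a crossing point. -/
theorem Admissible.det_leafDeriv_mem (hv : M.Admissible v) {σ : ℝ} (hσ : |σ| = 1) {y : E n}
    (hy : y ∈ M.crossing σ v) :
    -σ * (M.leafDeriv v y).det ∈ Icc (M.speed v / 8) (2 * M.speed v) := by
  have h1 : |σ * fderiv ℝ M.r y v| ≤ M.speed v / 32 := by
    rw [abs_mul, hσ, one_mul]
    exact hv.abs_fderiv_r_le y
  have h2 := hy.2
  have h3 := hv.speed_pos
  have e : -σ * (fderiv ℝ M.r y v - M.speed v * M.time v y) =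
      M.speed v * (σ * M.time v y) - σ * fderiv ℝ M.r y v := by ring
  rw [hv.det_leafDeriv, e]
  rw [abs_le] at h1
  constructor <;> nlinarith [h2.1, h2.2, h1.1, h1.2]

theorem Admissible.abs_det_leafDeriv (hv : M.Admissible v) {σ : ℝ} (hσ : |σ| = 1) {y : E n}
    (hy : y ∈ M.crossing σ v) : |(M.leafDeriv v y).det| = -σ * (M.leafDeriv v y).det := by
  have h := hv.det_leafDeriv_mem hσ hy
  rw [← abs_of_nonneg (a := -σ * (M.leafDeriv v y).det) ((by
    have := hv.speed_pos; positivity : 0 ≤ M.speed v / 8).trans h.1), abs_mul, abs_neg, hσ, one_mul]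

/-! ### The transport map -/

variable (M) in
/-- The map from the points of outflow to the points of inflow. -/
def transport (v y : E n) : E n := M.cross (-1) v (M.leaf v y)

theorem Admissible.abs_level_sub_le (hv : M.Admissible v) {y z : E n}
    (hy : y ∈ ball M.xs (M.speed v ^ 2 / 128)) (hz : z ∈ ball M.xs (M.speed v ^ 2 / 128)) :
    |M.level v y - M.level v z| ≤ 3 / 2 * ‖y - z‖ := by
  have h0 := hv.speed_pos
  have h1 := hv.speed_le_one
  have key : ∀ y ∈ ball M.xs (M.speed v ^ 2 / 128), |M.time v y - 1| ≤ 1 / 128 := by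
    intro y hy
    have h2 := hv.abs_time_sub_le y M.xs
    rw [time_xs] at h2
    refine h2.trans ?_
    rw [div_le_iff₀ h0]
    nlinarith [mem_ball_iff_norm.1 hy]
  have h2 := key y hy
  have h3 := key z hz
  have h4 := hv.abs_time_sub_le y z
  have h5 := M.abs_r_sub_le y z
  have e : M.level v y - M.level v z = (M.r y - M.r z) -
      M.speed v / 2 * (M.time v y + M.time v z) * (M.time v y - M.time v z) := by
    rw [level, level]; ring
  rw [e]
  refine (abs_sub _ _).trans ?_
  rw [abs_mul, abs_of_nonneg (a := M.speed v / 2 * (M.time v y + M.time v z))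
    (by rw [abs_le] at h2 h3; exact mul_nonneg (by positivity) (by linarith))]
  have h6 : M.speed v / 2 * (M.time v y + M.time v z) ≤ M.speed v * (65 / 64) := by
    rw [abs_le] at h2 h3; nlinarith
  have h7 := mul_le_mul h6 h4 (abs_nonneg _) (by positivity)
  have h8 : M.speed v * (65 / 64) * (‖y - z‖ / M.speed v) = 65 / 64 * ‖y - z‖ := by
    field_simp
  rw [h8] at h7
  linarith [norm_nonneg (y - z)]

/-- On this ball the leaf map moves points at most `6` times as far as its argument moves, and `6 /
128 < 1 / 16`; the time stays within `1 / 128` of `1`. -/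
theorem Admissible.ball_subset_crossing (hv : M.Admissible v) :
    ball M.xs (M.speed v ^ 2 / 128) ⊆ M.crossing 1 v := by
  intro y hy
  have h0 := hv.speed_pos
  have h1 := hv.speed_le_one
  have h2 : ‖y - M.xs‖ < M.speed v ^ 2 / 128 := mem_ball_iff_norm.1 hy
  have h3 := hv.abs_level_sub_le hy (mem_ball_self (by positivity))
  have h4 := hv.abs_time_sub_le y M.xs
  refine ⟨?_, ?_⟩
  · refine mem_ball_iff_norm.2 ?_
    have e : M.leaf v y - M.leaf v M.xs = (y - M.xs) +
        ((M.level v y - M.level v M.xs) - (M.time v y - M.time v M.xs)) • v := by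
      simp only [leaf, sub_smul]
      abel
    rw [e]
    refine (norm_add_le _ _).trans_lt ?_
    rw [norm_smul, Real.norm_eq_abs]
    have h5 := (abs_sub (M.level v y - M.level v M.xs) (M.time v y - M.time v M.xs)).trans
      (add_le_add h3 h4)
    have h6 := mul_le_mul h5 hv.norm_le (norm_nonneg _) (by positivity)
    have h7 : (3 / 2 * ‖y - M.xs‖ + ‖y - M.xs‖ / M.speed v) * (2 * M.speed v) =
      3 * M.speed v * ‖y - M.xs‖ + 2 * ‖y - M.xs‖ := by field_simp
    rw [h7] at h6
    nlinarith [norm_nonneg (y - M.xs)]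
  · rw [time_xs] at h4
    have h5 : ‖y - M.xs‖ / M.speed v ≤ 1 / 128 := by
      rw [div_le_iff₀ h0]; nlinarith
    have := abs_le.1 (h4.trans h5)
    constructor <;> linarith [this.1, this.2]

theorem Admissible.transport_eq (hv : M.Admissible v) (y : E n) :
    M.transport v y = y + (-M.root (-1) v (M.leaf v y) - M.time v y) • v := by
  rw [transport, cross, hv.pos_leaf, neg_one_mul]

theorem Admissible.gap_leaf_eq (hv : M.Admissible v) (y : E n) (s : ℝ) :
    M.gap v (M.leaf v y) s =
      M.r (y + (s - M.time v y) • v) - M.speed v / 2 * s ^ 2 - M.level v y := by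
  rw [hv.gap_eq, hv.pos_leaf, hv.time_leaf]

/-- The constant does not depend on the velocity, although slow flows have sensitive crossing times.
The root moves by at most `8 / speed` times the distance, but it is multiplied by `‖v‖ ≤ 2 * speed`.
The shares are `16` from the root, `2` from the time and `1` from the point itself. -/
theorem Admissible.norm_transport_sub_le (hv : M.Admissible v) {y z : E n}
    (hy : y ∈ ball M.xs (M.speed v ^ 2 / 128)) (hz : z ∈ ball M.xs (M.speed v ^ 2 / 128)) :
    ‖M.transport v y - M.transport v z‖ ≤ 19 * ‖y - z‖ := by
  have h0 := hv.speed_pos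
  have hLy := (hv.ball_subset_crossing hy).1
  have hLz := (hv.ball_subset_crossing hz).1
  obtain ⟨h1, h2⟩ := hv.root_spec hLy (σ := -1) (by simp)
  obtain ⟨h3, h4⟩ := hv.root_spec hLz (σ := -1) (by simp)
  have ht := hv.abs_time_sub_le y z
  set a := M.root (-1) v (M.leaf v y) with ha
  set b := M.root (-1) v (M.leaf v z) with hb
  have h5 := hv.abs_sub_le_abs_gap_sub (M.leaf v y) (σ := -1) (by simp) h1.1.le h3.1.le
  have h6 : |M.gap v (M.leaf v y) (-1 * a) - M.gap v (M.leaf v y) (-1 * b)| ≤ 2 * ‖y - z‖ := by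
    rw [h2, ← h4, hv.gap_leaf_eq, hv.gap_leaf_eq]
    have e : M.r (z + (-1 * b - M.time v z) • v) - M.speed v / 2 * (-1 * b) ^ 2 - M.level v z -
        (M.r (y + (-1 * b - M.time v y) • v) - M.speed v / 2 * (-1 * b) ^ 2 - M.level v y) =
        (M.level v y - M.level v z) - (M.r (y + (-1 * b - M.time v y) • v) -
          M.r (z + (-1 * b - M.time v z) • v)) := by ring
    rw [e]
    have h7 := hv.abs_level_sub_le hy hz
    have h8 := M.abs_r_sub_le (y + (-1 * b - M.time v y) • v) (z + (-1 * b - M.time v z) • v)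
    have h9 : ‖y + (-1 * b - M.time v y) • v - (z + (-1 * b - M.time v z) • v)‖ ≤
        3 * ‖y - z‖ := by
      have e2 : y + (-1 * b - M.time v y) • v - (z + (-1 * b - M.time v z) • v) =
        (y - z) - (M.time v y - M.time v z) • v := by
        simp only [sub_smul]
        abel
      rw [e2]
      refine (norm_sub_le _ _).trans ?_
      rw [norm_smul, Real.norm_eq_abs]
      have := mul_le_mul ht hv.norm_le (norm_nonneg _) (by positivity)
      have e3 : ‖y - z‖ / M.speed v * (2 * M.speed v) = 2 * ‖y - z‖ := by field_simp
      linarith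
    refine (abs_sub _ _).trans ?_
    linarith [norm_nonneg (y - z)]
  have h7 : |a - b| ≤ 8 * ‖y - z‖ / M.speed v := by
    rw [le_div_iff₀ h0]
    linarith
  rw [hv.transport_eq, hv.transport_eq, ← ha, ← hb]
  have e : y + (-a - M.time v y) • v - (z + (-b - M.time v z) • v) =
      (y - z) - ((a - b) + (M.time v y - M.time v z)) • v := by
    simp only [sub_smul, add_smul, neg_smul]
    abel
  rw [e]
  refine (norm_sub_le _ _).trans ?_
  rw [norm_smul, Real.norm_eq_abs]
  have h8 := mul_le_mul ((abs_add_le _ _).trans (add_le_add h7 ht)) hv.norm_le (norm_nonneg _)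
    (by positivity)
  have e3 : (8 * ‖y - z‖ / M.speed v + ‖y - z‖ / M.speed v) * (2 * M.speed v) =
    18 * ‖y - z‖ := by field_simp; ring
  linarith

theorem continuousAt_time_velocity (hv : M.Admissible v) (y : E n) :
    ContinuousAt (fun w => M.time w y) v := by
  unfold time
  have h : Continuous M.speed := by unfold speed; fun_prop
  exact (continuousAt_const.div h.continuousAt hv.speed_pos.ne').add continuousAt_const

theorem continuous_speed : Continuous M.speed := by unfold speed; fun_prop

/-- For a nearby velocity `w` the old root almost solves the new equation, because the gap at a
fixed time depends continuously on `w`. The slope bound of the gap then places the new root within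
`4 / speed` times this defect. -/
theorem Admissible.continuousWithinAt_transport {S : Set (E n)} (hS : ∀ w ∈ S, M.Admissible w)
    (hv : v ∈ S) {y : E n} (hy : ∀ w ∈ S, M.leaf w y ∈ M.leaves w) :
    ContinuousWithinAt (fun w => M.transport w y) S v := by
  have hva := hS v hv
  have h1 := (continuousAt_time_velocity hva y).continuousWithinAt (s := S)
  have hr := M.contDiff_r.continuous
  have hsp := M.continuous_speed
  set s := M.root (-1) v (M.leaf v y) with hs
  obtain ⟨h2, h3⟩ := hva.root_spec (hy v hv) (σ := -1) (by simp)
  have hroot : Filter.Tendsto (fun w => M.root (-1) w (M.leaf w y)) (nhdsWithin v S) (nhds s) := by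
    have hg : ContinuousWithinAt (fun w => M.r (y + (-1 * s - M.time w y) • w) -
        M.speed w / 2 * (-1 * s) ^ 2 - M.level w y) S v := by
      unfold level
      have h4 : ContinuousWithinAt (fun w => y + (-1 * s - M.time w y) • w) S v :=
        continuousWithinAt_const.add ((continuousWithinAt_const.sub h1).smul continuousWithinAt_id)
      have h5 := hr.continuousAt.comp_continuousWithinAt h4
      have h6 : ContinuousWithinAt M.speed S v := hsp.continuousWithinAt
      exact (h5.sub ((h6.div_const 2).mul continuousWithinAt_const)).sub
        (continuousWithinAt_const.sub ((h6.div_const 2).mul (h1.pow 2)))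
    have hg2 : Filter.Tendsto (fun w => 4 / M.speed w * |M.r (y + (-1 * s - M.time w y) • w) -
        M.speed w / 2 * (-1 * s) ^ 2 - M.level w y|) (nhdsWithin v S) (nhds 0) := by
      have h7 : ContinuousWithinAt (fun w => 4 / M.speed w) S v :=
        continuousWithinAt_const.div hsp.continuousWithinAt hva.speed_pos.ne'
      have h8 := (h7.mul hg.abs).tendsto
      simp only [Pi.mul_apply] at h8
      rwa [← hva.gap_leaf_eq, h3, abs_zero, mul_zero] at h8
    rw [tendsto_iff_dist_tendsto_zero]
    refine squeeze_zero' (.of_forall fun _ => dist_nonneg) ?_ hg2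
    filter_upwards [self_mem_nhdsWithin] with w hw
    have hwa := hS w hw
    obtain ⟨h4, h5⟩ := hwa.root_spec (hy w hw) (σ := -1) (by simp)
    have h6 := hwa.abs_sub_le_abs_gap_sub (M.leaf w y) (σ := -1) (by simp) h4.1.le h2.1.le
    rw [h5, zero_sub, abs_neg, hwa.gap_leaf_eq] at h6
    have h7 := hwa.speed_pos
    rw [Real.dist_eq, div_mul_eq_mul_div, le_div_iff₀ h7]
    linarith
  have : ContinuousWithinAt (fun w => y + (-M.root (-1) w (M.leaf w y) - M.time w y) • w) S v :=
    continuousWithinAt_const.add (((ContinuousWithinAt.neg hroot).sub h1).smul continuousWithinAt_id)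
  exact this.congr (fun w hw => (hS w hw).transport_eq y) (hva.transport_eq y)

/-! ### Velocities that connect two given points -/

variable (M) in
/-- The travel time from the inflow point `y` to the outflow point `x`. -/
def travelTime (x y : E n) : ℝ :=
  (inner ℝ (x - y) M.e - (M.r x - M.r y)) / (inner ℝ (x - y) M.e / 2 - inner ℝ (x - M.xs) M.e)

variable (M) in
/-- The velocity that leads from `y` to `x`. -/
def connect (x y : E n) : E n := (M.travelTime x y)⁻¹ • (x - y)

/-- After the substitution `τ • v = x - y`, equality of the levels at `x` and `y` is a linear
equation for `τ`, whose solution is `travelTime`. The hypothesis on the time at `y` selects the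
branch of the parabola on which the root is unique. -/
theorem transport_connect {x y : E n} (hv : M.Admissible (M.connect x y))
    (hd : inner ℝ (x - y) M.e / 2 - inner ℝ (x - M.xs) M.e ≠ 0) (hτ : M.travelTime x y ≠ 0)
    (hx : M.leaf (M.connect x y) x ∈ M.leaves (M.connect x y))
    (hs : M.time (M.connect x y) x - M.travelTime x y ≤ -1 / 4) :
    M.transport (M.connect x y) x = y := by
  set v := M.connect x y with hvdef
  set τ := M.travelTime x y with hτdef
  have hvτ : τ • v = x - y := by rw [hvdef, connect, smul_inv_smul₀ hτ]
  have hD : inner ℝ (x - y) M.e = τ * M.speed v := by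
    rw [← hvτ, inner_smul_left]; rfl
  have hpos := hv.pos_leaf x (M.time v x - τ)
  have hy : x + (M.time v x - τ - M.time v x) • v = y := by
    rw [sub_sub_cancel_left, neg_smul, hvτ]
    abel
  rw [hy] at hpos
  have hτ2 : τ * (inner ℝ (x - y) M.e / 2 - inner ℝ (x - M.xs) M.e) =
      inner ℝ (x - y) M.e - (M.r x - M.r y) := by
    rw [hτdef, travelTime, div_mul_cancel₀ _ hd]
  have ht : M.speed v * M.time v x = inner ℝ (x - M.xs) M.e + M.speed v := by
    have := hv.speed_pos.ne'
    rw [time]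
    field_simp
  have hty : M.time v y = M.time v x - τ := by rw [← hpos, hv.time_pos]
  have hgap : M.gap v (M.leaf v x) (M.time v x - τ) = 0 := by
    rw [gap, hpos, hv.time_leaf, level, level, hty]
    rw [hD] at hτ2
    linear_combination (τ * ht - hτ2)
  have hroot := hv.root_unique hx (σ := -1) (by simp) (s := -(M.time v x - τ)) (by linarith)
    (by rw [neg_mul_neg, one_mul, hgap])
  rw [hv.transport_eq, ← hroot, neg_neg, hy]

end UTurn

/-! ### Flow coordinates in a boundary chart -/

theorem affineIsometryEquiv_apply {V W : Type*} [NormedAddCommGroup V] [NormedSpace ℝ V]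
    [NormedAddCommGroup W] [NormedSpace ℝ W] (f : V ≃ᵃⁱ[ℝ] W) (z : V) :
    f z = f.linearIsometryEquiv z + f 0 := by
  have := f.map_vadd 0 z
  rwa [vadd_eq_add, vadd_eq_add, add_zero] at this

theorem contDiff_affineIsometryEquiv {V W : Type*} [NormedAddCommGroup V] [NormedSpace ℝ V]
    [NormedAddCommGroup W] [NormedSpace ℝ W] (f : V ≃ᵃⁱ[ℝ] W) : ContDiff ℝ ∞ f := by
  rw [show (f : V → W) = fun z => f.linearIsometryEquiv z + f 0 from
    funext (affineIsometryEquiv_apply f)]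
  exact f.linearIsometryEquiv.contDiff.add contDiff_const

/-- A boundary chart near a point `xs` where the height function is the sum of an affine function
and a function of small slope. -/
structure LocalChart {d k : ℕ} {Ω : Set (E d)} (A : BoundaryAtlas d k Ω) extends
    UTurn (d - 1) where
  j : Fin A.N
  radius : ℝ
  radius_pos : 0 < radius
  height₀ : ℝ
  slope : E (d - 1) →L[ℝ] ℝ
  ball_subset : ball xs radius ⊆ A.base j
  height_eq : ∀ y ∈ ball xs radius, A.height j y = height₀ + slope (y - xs) + r y
  mem_cell : ∀ y ∈ ball xs radius, A.param j y ∈ A.cell j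

namespace LocalChart

variable {d k : ℕ} {Ω : Set (E d)} {A : BoundaryAtlas d k Ω} (M : LocalChart A)

/-- The height function of the chart, extended to the whole space. -/
def height (y : E (d - 1)) : ℝ := M.height₀ + M.slope (y - M.xs) + M.r y

theorem continuous_height : Continuous M.height := by
  have := M.contDiff_r.continuous
  unfold height
  fun_prop

/-- The horizontal coordinate of the chart. -/
def base (z : E d) : E (d - 1) := (A.frame M.j z).fst

/-- The vertical coordinate of the chart. -/
def elevation (z : E d) : ℝ := (A.frame M.j z).snd

/-- The point with the given chart coordinates. -/
def point (y : E (d - 1)) (t : ℝ) : E d := (A.frame M.j).symm (WithLp.toLp 2 (y, t))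

/-- The boundary point above `y`. -/
def graph (y : E (d - 1)) : E d := M.point y (M.height y)

@[simp] theorem base_point (y : E (d - 1)) (t : ℝ) : M.base (M.point y t) = y := by
  rw [base, point, AffineIsometryEquiv.apply_symm_apply]
  rfl

@[simp] theorem elevation_point (y : E (d - 1)) (t : ℝ) : M.elevation (M.point y t) = t := by
  rw [elevation, point, AffineIsometryEquiv.apply_symm_apply]
  rfl

@[simp] theorem point_base_elevation (z : E d) : M.point (M.base z) (M.elevation z) = z :=
  A.frame_symm_eq M.j z

theorem contDiff_base : ContDiff ℝ ∞ M.base := by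
  have h : ContDiff ℝ ∞ (A.frame M.j) := contDiff_affineIsometryEquiv _
  exact (WithLp.fstL 2 ℝ (E (d - 1)) ℝ).contDiff.comp h

theorem contDiff_elevation : ContDiff ℝ ∞ M.elevation := by
  have h : ContDiff ℝ ∞ (A.frame M.j) := contDiff_affineIsometryEquiv _
  exact (WithLp.sndL 2 ℝ (E (d - 1)) ℝ).contDiff.comp h

theorem contDiff_point : ContDiff ℝ ∞ fun p : E (d - 1) × ℝ => M.point p.1 p.2 := by
  have h : ContDiff ℝ ∞ (A.frame M.j).symm := contDiff_affineIsometryEquiv _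
  exact h.comp (WithLp.prodContinuousLinearEquiv 2 ℝ (E (d - 1)) ℝ).symm.contDiff

/-- The height of the parabola of the flow, up to the leaf-dependent constant. -/
def parabola (v y : E (d - 1)) : ℝ :=
  M.speed v / 2 * M.time v y ^ 2 + M.height₀ + M.slope (y - M.xs)

/-- The point on the leaf `p.1` at time `p.2`. -/
def flow (v : E (d - 1)) (p : E (d - 1) × ℝ) : E d :=
  M.point (M.pos v p.1 p.2) (M.time v p.1 + M.parabola v (M.pos v p.1 p.2))

/-- The leaf and the time of a point. -/
def flowInv (v : E (d - 1)) (z : E d) : E (d - 1) × ℝ :=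
  (M.base z + (M.elevation z - M.parabola v (M.base z) - M.time v (M.base z)) • v,
    M.time v (M.base z))

variable {M} {v : E (d - 1)}

theorem flowInv_flow (hv : M.Admissible v) (p : E (d - 1) × ℝ) :
    M.flowInv v (M.flow v p) = p := by
  rw [flowInv, flow, base_point, elevation_point, hv.time_pos, UTurn.pos]
  refine Prod.ext ?_ rfl
  simp only [add_assoc, ← add_smul]
  simp

theorem flow_flowInv (hv : M.Admissible v) (z : E d) : M.flow v (M.flowInv v z) = z := by
  have h : M.pos v (M.flowInv v z).1 (M.flowInv v z).2 = M.base z := by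
    rw [flowInv, UTurn.pos, hv.time_add_smul]
    simp only [add_assoc, ← add_smul]
    simp
  rw [flow, h, flowInv, hv.time_add_smul]
  conv_rhs => rw [← M.point_base_elevation z]
  congr 1
  ring

theorem contDiff_time : ContDiff ℝ ∞ (M.time v) := by
  unfold UTurn.time
  exact (((contDiff_id.sub contDiff_const).inner ℝ contDiff_const).div_const _).add contDiff_const

theorem contDiff_parabola : ContDiff ℝ ∞ (M.parabola v) := by
  have h := contDiff_time (M := M) (v := v)
  unfold parabola
  exact ((contDiff_const.mul (h.pow 2)).add contDiff_const).add
    (M.slope.contDiff.comp (contDiff_id.sub contDiff_const))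

theorem contDiff_flow : ContDiff ℝ ∞ (M.flow v) := by
  have h := contDiff_time (M := M) (v := v)
  have h1 : ContDiff ℝ ∞ fun p : E (d - 1) × ℝ => M.pos v p.1 p.2 := by
    unfold UTurn.pos
    exact contDiff_fst.add ((contDiff_snd.sub (h.comp contDiff_fst)).smul contDiff_const)
  exact M.contDiff_point.comp (h1.prodMk ((h.comp contDiff_fst).add
    (contDiff_parabola.comp h1)))

theorem contDiff_flowInv : ContDiff ℝ ∞ (M.flowInv v) := by
  have h := contDiff_time (M := M) (v := v)
  have hb := M.contDiff_base
  exact (hb.add (((M.contDiff_elevation.sub (contDiff_parabola.comp hb)).sub (h.comp hb)).smul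
    contDiff_const)).prodMk (h.comp hb)

/-- The flow coordinates. -/
def flowHomeomorph (hv : M.Admissible v) : E (d - 1) × ℝ ≃ₜ E d where
  toFun := M.flow v
  invFun := M.flowInv v
  left_inv := flowInv_flow hv
  right_inv := flow_flowInv hv
  continuous_toFun := contDiff_flow.continuous
  continuous_invFun := contDiff_flowInv.continuous

theorem measurePreserving_point :
    MeasurePreserving (fun p : E (d - 1) × ℝ => M.point p.1 p.2) volume volume := by
  have h1 : MeasurePreserving (A.frame M.j).symm (volume : Measure (WithLp 2 (E (d - 1) × ℝ)))
      volume := by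
    have h2 := (A.frame M.j).symm.linearIsometryEquiv.measurePreserving
    have h3 := (measurePreserving_add_right (volume : Measure (E d)) ((A.frame M.j).symm 0)).comp h2
    rw [show ((A.frame M.j).symm : _ → E d) = _ from
      funext (affineIsometryEquiv_apply (A.frame M.j).symm)]
    exact h3
  exact h1.comp (WithLp.volume_preserving_toLp (E (d - 1)) ℝ)

/-- The flow is a composition of shears, a reflection of the vertical variable and a rigid motion.
The shear in direction `v` is carried out with the two factors swapped. -/
theorem measurePreserving_flow (hv : M.Admissible v) :
    MeasurePreserving (M.flow v) volume volume := by
  have ht : Continuous (M.time v) := contDiff_time.continuous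
  have hp : Continuous (M.parabola v) := contDiff_parabola.continuous
  have h1 : MeasurePreserving (fun p : E (d - 1) × ℝ => (p.1, p.2 + -M.time v p.1))
      volume volume := by
    refine (MeasurePreserving.id volume).skew_product (g := fun L s => s + -M.time v L)
      (by fun_prop) (.of_forall fun L => ?_)
    exact (measurePreserving_add_right volume _).map_eq
  have h2 : MeasurePreserving (fun p : ℝ × E (d - 1) => (p.1, p.2 + p.1 • v))
      (volume.prod volume) (volume.prod volume) := by
    refine (MeasurePreserving.id volume).skew_product (g := fun s L => L + s • v)
      (by fun_prop) (.of_forall fun L => ?_)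
    exact (measurePreserving_add_right volume _).map_eq
  have h3 : MeasurePreserving
      (fun p : E (d - 1) × ℝ => (p.1, (M.time v p.1 + M.parabola v p.1) - p.2))
      volume volume := by
    refine (MeasurePreserving.id volume).skew_product
      (g := fun L s => (M.time v L + M.parabola v L) - s) (by fun_prop) (.of_forall fun L => ?_)
    exact (Measure.measurePreserving_sub_left volume _).map_eq
  have h4 := (measurePreserving_point (M := M)).comp (h3.comp (((Measure.measurePreserving_swap
    (μ := (volume : Measure ℝ)) (ν := (volume : Measure (E (d - 1))))).comp h2).comp
    ((Measure.measurePreserving_swap (μ := (volume : Measure (E (d - 1))))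
      (ν := (volume : Measure ℝ))).comp h1)))
  convert h4 using 1
  ext1 p
  simp only [Function.comp_apply, Prod.swap]
  rw [flow, UTurn.pos, ← sub_eq_add_neg, hv.time_add_smul]
  congr 1
  ring

/-! ### The flow domain -/

variable (M) in
/-- Admissible velocities for which the flow stays in the chart. -/
structure Fits (v : E (d - 1)) : Prop where
  admissible : M.Admissible v
  six_speed_lt : 6 * M.speed v < M.radius
  speed_lt : M.speed v < A.width M.j

variable (M) in
/-- The domain swept by the admissible leaves. -/
def domain (v : E (d - 1)) : Set (E d) :=
  {z | (M.flowInv v z).1 ∈ M.leaves v ∧ |(M.flowInv v z).2| < 3 / 2}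

theorem isOpen_domain : IsOpen (M.domain v) := by
  have h := (contDiff_flowInv (M := M) (v := v)).continuous
  have h1 : IsOpen {z | (M.flowInv v z).1 ∈ M.leaves v} :=
    isOpen_ball.preimage (continuous_fst.comp h)
  have h2 : IsOpen {z | |(M.flowInv v z).2| < 3 / 2} :=
    isOpen_lt (continuous_snd.comp h).abs continuous_const
  exact h1.inter h2

theorem flow_mem_domain_iff (hv : M.Admissible v) (p : E (d - 1) × ℝ) :
    M.flow v p ∈ M.domain v ↔ p.1 ∈ M.leaves v ∧ |p.2| < 3 / 2 := by
  change (M.flowInv v (M.flow v p)).1 ∈ _ ∧ |(M.flowInv v (M.flow v p)).2| < _ ↔ _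
  rw [flowInv_flow hv]

theorem elevation_flow_sub (hv : M.Admissible v) (p : E (d - 1) × ℝ) :
    M.elevation (M.flow v p) - M.height (M.base (M.flow v p)) = -M.gap v p.1 p.2 := by
  rw [flow, elevation_point, base_point, hv.gap_eq, height, parabola, hv.time_pos]
  ring

theorem base_flow (p : E (d - 1) × ℝ) : M.base (M.flow v p) = M.pos v p.1 p.2 := by
  rw [flow, base_point]

/-- On the domain the horizontal distance to `xs` is at most `6 * speed` and the vertical distance
to the graph at most `speed`; the two smallness conditions of `Fits` are made for this. -/
theorem Fits.domain_subset (hv : M.Fits v) :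
    M.domain v ⊆ A.graphBand M.j M.height (ball M.xs M.radius) := by
  intro z hz
  rw [← flow_flowInv hv.admissible z] at hz ⊢
  set p := M.flowInv v z
  obtain ⟨hL, hs⟩ := (flow_mem_domain_iff hv.admissible p).1 hz
  have h1 := hv.admissible.norm_pos_sub_xs_le hL hs.le
  have h2 := hv.admissible.abs_gap_le hL hs.le
  refine ⟨mem_ball_iff_norm.2 ?_, ?_⟩
  · change ‖M.base (M.flow v p) - M.xs‖ < _
    rw [base_flow]
    exact h1.trans_lt hv.six_speed_lt
  · change |M.elevation (M.flow v p) - M.height (M.base (M.flow v p))| < _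
    rw [elevation_flow_sub hv.admissible, abs_neg]
    exact h2.trans_lt hv.speed_lt

theorem graphBand_subset_band :
    A.graphBand M.j M.height (ball M.xs M.radius) ⊆ A.band M.j := fun z hz =>
  ⟨M.ball_subset hz.1, by rw [M.height_eq _ hz.1]; exact hz.2⟩

theorem Fits.height_base (hv : M.Fits v) {z : E d} (hz : z ∈ M.domain v) :
    A.height M.j (M.base z) = M.height (M.base z) :=
  M.height_eq _ (hv.domain_subset hz).1

theorem Fits.flow_mem_iff (hv : M.Fits v) {p : E (d - 1) × ℝ} (hL : p.1 ∈ M.leaves v)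
    (hs : |p.2| < 3 / 2) : M.flow v p ∈ Ω ↔ 0 < M.gap v p.1 p.2 := by
  have hz := (flow_mem_domain_iff hv.admissible p).2 ⟨hL, hs⟩
  have h1 := A.mem_iff_of_mem_band M.j (graphBand_subset_band (hv.domain_subset hz))
  have h2 := elevation_flow_sub hv.admissible p
  have h3 := hv.height_base hz
  rw [h1]
  change M.elevation (M.flow v p) < A.height M.j (M.base (M.flow v p)) ↔ _
  rw [h3, ← sub_neg, h2, neg_neg_iff_pos]

theorem Fits.mem_frontier_iff (hΩ : IsOpen Ω) (hv : M.Fits v) {z : E d} (hz : z ∈ M.domain v) :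
    z ∈ frontier Ω ↔ z = M.graph (M.base z) := by
  rw [A.mem_frontier_iff_of_mem_band hΩ M.j (graphBand_subset_band (hv.domain_subset hz))]
  change M.elevation z = A.height M.j (M.base z) ↔ _
  rw [hv.height_base hz]
  constructor
  · intro h
    rw [graph, ← h, point_base_elevation]
  · intro h
    conv_lhs => rw [h, graph, elevation_point]

theorem flowInv_graph (y : E (d - 1)) :
    M.flowInv v (M.graph y) = (M.leaf v y, M.time v y) := by
  rw [flowInv, graph, base_point, elevation_point, UTurn.leaf, UTurn.level, height, parabola]
  congr 4
  ring

theorem graph_eq_flow (hv : M.Admissible v) (y : E (d - 1)) :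
    M.graph y = M.flow v (M.leaf v y, M.time v y) := by
  rw [← flowInv_graph, flow_flowInv hv]

theorem graph_cross (hv : M.Admissible v) {L : E (d - 1)} (hL : L ∈ M.leaves v) {σ : ℝ}
    (hσ : |σ| = 1) : M.graph (M.cross σ v L) = M.flow v (L, σ * M.root σ v L) := by
  rw [graph_eq_flow hv, hv.leaf_cross hL hσ, hv.time_cross]

theorem graph_mem_domain_iff (y : E (d - 1)) :
    M.graph y ∈ M.domain v ↔ M.leaf v y ∈ M.leaves v ∧ |M.time v y| < 3 / 2 := by
  change (M.flowInv v (M.graph y)).1 ∈ _ ∧ |(M.flowInv v (M.graph y)).2| < _ ↔ _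
  rw [flowInv_graph]

theorem graph_mem_domain {σ : ℝ} (hσ : |σ| = 1) {y : E (d - 1)} (hy : y ∈ M.crossing σ v) :
    M.graph y ∈ M.domain v := by
  refine (graph_mem_domain_iff y).2 ⟨hy.1, ?_⟩
  have h := hy.2
  have h2 : |σ * M.time v y| < 3 / 2 := abs_lt.2 ⟨by linarith [h.1], h.2⟩
  rwa [abs_mul, hσ, one_mul] at h2

theorem graph_eq_param {y : E (d - 1)} (hy : y ∈ ball M.xs M.radius) :
    M.graph y = A.param M.j y := by
  rw [graph, point, BoundaryAtlas.param, M.height_eq y hy]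
  rfl

theorem graph_eq_graphMap : M.graph = A.graphMap M.j M.height := rfl

theorem Fits.crossing_subset (hv : M.Fits v) {σ : ℝ} (hσ : |σ| = 1) :
    M.crossing σ v ⊆ ball M.xs M.radius := fun y hy => by
  have := (hv.domain_subset (graph_mem_domain hσ hy)).1
  change M.base (M.graph y) ∈ _ at this
  rwa [graph, base_point] at this

theorem graph_mem_frontier (hΩ : IsOpen Ω) {y : E (d - 1)} (hy : y ∈ ball M.xs M.radius) :
    M.graph y ∈ frontier Ω := by
  rw [graph_eq_param hy]
  exact A.param_mem_frontier hΩ M.j (M.ball_subset hy)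

/-! ### The vector field -/

variable (M) in
/-- The velocity field of the flow. -/
def field (v : E (d - 1)) (z : E d) : E d :=
  A.chartVector M.j v (M.slope v + M.speed v) +
    inner ℝ (M.base z - M.xs) M.e • A.chartVector M.j 0 1

theorem chartVector_add (j : Fin A.N) (v w : E (d - 1)) (s t : ℝ) :
    A.chartVector j (v + w) (s + t) = A.chartVector j v s + A.chartVector j w t := by
  rw [BoundaryAtlas.chartVector, BoundaryAtlas.chartVector, BoundaryAtlas.chartVector, ← map_add]
  rfl

theorem chartVector_smul (j : Fin A.N) (v : E (d - 1)) (s t : ℝ) :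
    A.chartVector j (s • v) (s * t) = s • A.chartVector j v t := by
  rw [BoundaryAtlas.chartVector, BoundaryAtlas.chartVector, ← map_smul]
  rfl

theorem field_eq (hv : M.Admissible v) (z : E d) :
    M.field v z =
      A.chartVector M.j v (M.slope v + M.speed v * M.time v (M.base z)) := by
  have h : M.speed v * M.time v (M.base z) =
      M.speed v + inner ℝ (M.base z - M.xs) M.e := by
    have := hv.speed_pos.ne'
    rw [UTurn.time]
    field_simp
    ring
  have h2 : A.chartVector M.j v (M.slope v + M.speed v * M.time v (M.base z)) =
      A.chartVector M.j (v + inner ℝ (M.base z - M.xs) M.e • 0)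
        ((M.slope v + M.speed v) + inner ℝ (M.base z - M.xs) M.e * 1) := by
    rw [h]
    congr 1
    · simp
    · ring
  rw [field, h2, chartVector_add, chartVector_smul]

theorem contDiff_field : ContDiff ℝ ∞ (M.field v) := by
  unfold field
  exact contDiff_const.add (((M.contDiff_base.sub contDiff_const).inner ℝ contDiff_const).smul
    contDiff_const)

theorem hasFDerivAt_base (z : E d) :
    HasFDerivAt M.base ((WithLp.fstL 2 ℝ (E (d - 1)) ℝ).comp
      ((A.frame M.j).linearIsometryEquiv : E d →L[ℝ] WithLp 2 (E (d - 1) × ℝ))) z := by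
  have h : HasFDerivAt (A.frame M.j)
      ((A.frame M.j).linearIsometryEquiv : E d →L[ℝ] WithLp 2 (E (d - 1) × ℝ)) z := by
    rw [show (A.frame M.j : E d → _) = _ from funext (affineIsometryEquiv_apply (A.frame M.j))]
    exact (ContinuousLinearMap.hasFDerivAt
      ((A.frame M.j).linearIsometryEquiv : E d →L[ℝ] WithLp 2 (E (d - 1) × ℝ))).add_const _
  exact (WithLp.fstL 2 ℝ (E (d - 1)) ℝ).hasFDerivAt.comp z h

theorem linearIsometryEquiv_chartVector (j : Fin A.N) (v : E (d - 1)) (t : ℝ) :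
    (A.frame j).linearIsometryEquiv (A.chartVector j v t) = WithLp.toLp 2 (v, t) := by
  have : (A.frame j).symm.linearIsometryEquiv = (A.frame j).linearIsometryEquiv.symm := rfl
  rw [BoundaryAtlas.chartVector, this, LinearIsometryEquiv.apply_symm_apply]

/-- The field is divergence free. -/
theorem divergence_smul_field {φ : E d → ℝ} {z : E d} (hφ : DifferentiableAt ℝ φ z) :
    divergence (fun x => φ x • M.field v x) z = fderiv ℝ φ z (M.field v z) := by
  set N := A.chartVector M.j 0 1 with hN
  set B := (WithLp.fstL 2 ℝ (E (d - 1)) ℝ).comp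
      ((A.frame M.j).linearIsometryEquiv : E d →L[ℝ] WithLp 2 (E (d - 1) × ℝ)) with hB
  set c : E d →L[ℝ] ℝ := (innerSL ℝ M.e).comp B with hc
  have h1 : HasFDerivAt (M.field v) (c.smulRight N) z := by
    have h2 := (((innerSL ℝ M.e).hasFDerivAt.comp z
      ((hasFDerivAt_base (M := M) z).sub_const M.xs)).smul_const N).const_add
        (A.chartVector M.j v (M.slope v + M.speed v))
    refine h2.congr_of_eventuallyEq (.of_forall fun x => ?_)
    simp [field, real_inner_comm, hN]
  have h3 := hφ.hasFDerivAt.smul h1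
  have hsum : ∀ (g : E d →L[ℝ] ℝ) (w : E d),
      ∑ i : Fin d, g (EuclideanSpace.single i 1) * w i = g w := by
    intro g w
    conv_rhs => rw [← (EuclideanSpace.basisFun (Fin d) ℝ).sum_repr w, map_sum]
    refine Finset.sum_congr rfl fun i _ => ?_
    simp [mul_comm]
  -- The field varies only in the vertical direction `N`, and only with the horizontal coordinates,
  -- so its derivative has trace zero.
  have hcN : c N = 0 := by
    have : B N = 0 := by
      rw [hB, hN]
      change ((A.frame M.j).linearIsometryEquiv (A.chartVector M.j 0 1)).fst = 0
      rw [linearIsometryEquiv_chartVector]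
      rfl
    rw [hc, ContinuousLinearMap.comp_apply, this, map_zero]
  unfold divergence
  have h4 : fderiv ℝ (fun x => φ x • M.field v x) z = _ := h3.fderiv
  rw [h4]
  have : ∀ i : Fin d, ((φ z • c.smulRight N + (fderiv ℝ φ z).smulRight (M.field v z))
      (EuclideanSpace.single i 1)) i = φ z * (c (EuclideanSpace.single i 1) * N i) +
        fderiv ℝ φ z (EuclideanSpace.single i 1) * (M.field v z) i := by
    intro i
    simp
  simp only [this]
  rw [Finset.sum_add_distrib, ← Finset.mul_sum, hsum, hsum, hcN, mul_zero, zero_add]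

variable (A) in
/-- The linear map from chart coordinates to vectors. -/
def chartVectorL (j : Fin A.N) : E (d - 1) × ℝ →L[ℝ] E d :=
  ((A.frame j).symm.linearIsometryEquiv : WithLp 2 (E (d - 1) × ℝ) →L[ℝ] E d).comp
    ((WithLp.prodContinuousLinearEquiv 2 ℝ (E (d - 1)) ℝ).symm :
      E (d - 1) × ℝ →L[ℝ] WithLp 2 (E (d - 1) × ℝ))

theorem chartVectorL_apply (j : Fin A.N) (p : E (d - 1) × ℝ) :
    chartVectorL A j p = A.chartVector j p.1 p.2 := rfl

theorem point_eq (p : E (d - 1) × ℝ) :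
    M.point p.1 p.2 = chartVectorL A M.j p + (A.frame M.j).symm 0 :=
  affineIsometryEquiv_apply (A.frame M.j).symm (WithLp.toLp 2 (p.1, p.2))

theorem hasFDerivAt_point (p : E (d - 1) × ℝ) :
    HasFDerivAt (fun p : E (d - 1) × ℝ => M.point p.1 p.2) (chartVectorL A M.j) p := by
  rw [show (fun p : E (d - 1) × ℝ => M.point p.1 p.2) = _ from funext point_eq]
  exact (chartVectorL A M.j).hasFDerivAt.add_const _

theorem hasDerivAt_flow (hv : M.Admissible v) (L : E (d - 1)) (s : ℝ) :
    HasDerivAt (fun s => M.flow v (L, s)) (M.field v (M.flow v (L, s))) s := by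
  have h1 : HasDerivAt (fun s => M.pos v L s) v s := by
    have := (((hasDerivAt_id s).sub_const (M.time v L)).smul_const v).const_add L
    rwa [one_smul] at this
  have h2 : HasDerivAt (fun s => M.time v L + M.parabola v (M.pos v L s))
      (M.slope v + M.speed v * s) s := by
    have h4 := (((hasDerivAt_pow 2 s).const_mul (M.speed v / 2)).add_const M.height₀)
    have h5 := (h4.add (M.slope.hasFDerivAt.comp_hasDerivAt s (h1.sub_const M.xs))).const_add
      (M.time v L)
    have e : (fun s => M.time v L + M.parabola v (M.pos v L s)) = fun s => M.time v L +
        (M.speed v / 2 * s ^ 2 + M.height₀ + M.slope (M.pos v L s - M.xs)) := by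
      ext1 s
      rw [parabola, hv.time_pos]
    rw [e]
    refine h5.congr_deriv ?_
    norm_num
    ring
  have h6 : HasDerivAt (fun s => M.flow v (L, s))
      (A.chartVector M.j v (M.slope v + M.speed v * s)) s :=
    (hasFDerivAt_point _).comp_hasDerivAt s (h1.prodMk h2)
  rwa [field_eq hv, base_flow, hv.time_pos]

theorem hasFDerivAt_height {y : E (d - 1)} (hy : y ∈ ball M.xs M.radius) :
    HasFDerivAt (A.height M.j) (M.slope + fderiv ℝ M.r y) y := by
  have h3 := ((M.slope.hasFDerivAt.comp y ((hasFDerivAt_id y).sub_const M.xs)).const_add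
    M.height₀).add (M.contDiff_r.differentiable one_ne_zero y).hasFDerivAt
  rw [ContinuousLinearMap.comp_id] at h3
  refine h3.congr_of_eventuallyEq ?_
  filter_upwards [isOpen_ball.mem_nhds hy] with z hz using M.height_eq z hz

/-- The normal component times the area density is, up to sign, the Jacobian of the leaf map. Hence
the flux through the boundary becomes Lebesgue measure on the leaves, for inflow and outflow alike.
-/
theorem Fits.inner_field_normal (hv : M.Fits v) {σ : ℝ} (hσ : |σ| = 1) {y : E (d - 1)}
    (hy : y ∈ M.crossing σ v) :
    inner ℝ (M.field v (M.graph y)) (A.normal (M.graph y)) =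
      (A.areaDensity M.j y)⁻¹ * -(M.leafDeriv v y).det := by
  have hyb := hv.crossing_subset hσ hy
  have h1 : A.normal (M.graph y) = A.chartNormal M.j y := by
    rw [graph_eq_param hyb, A.normal_param (M.mem_cell y hyb)]
  rw [field_eq hv.admissible, h1, BoundaryAtlas.inner_chartNormal, (hasFDerivAt_height hyb).fderiv,
    hv.admissible.det_leafDeriv, graph, base_point]
  congr 1
  simp

end LocalChart

/-! ### Integrals in flow coordinates -/

namespace LocalChart

variable {d k : ℕ} {Ω : Set (E d)} {A : BoundaryAtlas d k Ω} {M : LocalChart A} {v : E (d - 1)}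

theorem measurableEmbedding_graph : MeasurableEmbedding M.graph :=
  A.measurableEmbedding_graphMap M.j M.continuous_height

theorem continuous_graph : Continuous M.graph := A.continuous_graphMap M.j M.continuous_height

theorem continuous_flow : Continuous (M.flow v) := contDiff_flow.continuous

theorem surface_restrict_image (hΩ : IsOpen Ω) {D : Set (E (d - 1))} (hD : MeasurableSet D)
    (hDb : D ⊆ ball M.xs M.radius) :
    A.surface.restrict (M.graph '' D) =
      ((volume.restrict D).withDensity fun y => ENNReal.ofReal (A.areaDensity M.j y)).map
        M.graph := by
  have h1 : M.graph '' D ⊆ A.graphBand M.j M.height (ball M.xs M.radius) := by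
    rintro _ ⟨y, hy, rfl⟩
    refine ⟨?_, ?_⟩
    · change M.base (M.graph y) ∈ _
      rw [graph, base_point]
      exact hDb hy
    · change |M.elevation (M.graph y) - M.height (M.base (M.graph y))| < _
      rw [graph, base_point, elevation_point, sub_self, abs_zero]
      exact A.width_pos M.j
  have hm : MeasurableSet (M.graph '' D) := measurableEmbedding_graph.measurableSet_image.2 hD
  have h2 := A.surface_restrict_graphBand hΩ M.j M.continuous_height isOpen_ball M.ball_subset
    M.height_eq M.mem_cell
  have h3 : A.surface.restrict (M.graph '' D) = (A.surface.restrict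
      (A.graphBand M.j M.height (ball M.xs M.radius))).restrict (M.graph '' D) := by
    rw [Measure.restrict_restrict hm, inter_eq_left.2 h1]
  rw [h3, h2, ← graph_eq_graphMap, measurableEmbedding_graph.restrict_map,
    preimage_image_eq _ measurableEmbedding_graph.injective, restrict_withDensity hD,
    Measure.restrict_restrict hD, inter_eq_left.2 hDb]

theorem setIntegral_image_graph (hΩ : IsOpen Ω) {D : Set (E (d - 1))} (hD : MeasurableSet D)
    (hDb : D ⊆ ball M.xs M.radius) (K : E d → ℝ) :
    ∫ x in M.graph '' D, K x ∂A.surface = ∫ y in D, A.areaDensity M.j y * K (M.graph y) := by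
  rw [surface_restrict_image hΩ hD hDb, measurableEmbedding_graph.integral_map,
    integral_withDensity_eq_integral_toReal_smul
      (A.measurable_areaDensity M.j).ennreal_ofReal (.of_forall fun _ => ENNReal.ofReal_lt_top)]
  refine integral_congr_ae (.of_forall fun y => ?_)
  change (ENNReal.ofReal _).toReal • _ = _
  rw [ENNReal.toReal_ofReal (zero_le_one.trans (A.one_le_areaDensity M.j y)), smul_eq_mul]

theorem integrableOn_image_graph_iff (hΩ : IsOpen Ω) {D : Set (E (d - 1))} (hD : MeasurableSet D)
    (hDb : D ⊆ ball M.xs M.radius) (K : E d → ℝ) :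
    IntegrableOn K (M.graph '' D) A.surface ↔
      IntegrableOn (fun y => A.areaDensity M.j y * K (M.graph y)) D := by
  rw [IntegrableOn, surface_restrict_image hΩ hD hDb, measurableEmbedding_graph.integrable_map_iff,
    integrable_withDensity_iff_integrable_smul'
      (A.measurable_areaDensity M.j).ennreal_ofReal (.of_forall fun _ => ENNReal.ofReal_lt_top)]
  refine integrable_congr (.of_forall fun y => ?_)
  change (ENNReal.ofReal _).toReal • _ = _
  rw [ENNReal.toReal_ofReal (zero_le_one.trans (A.one_le_areaDensity M.j y)), smul_eq_mul]
  rfl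

end LocalChart

/-! ### Change of variables between leaves and crossing points. -/

namespace UTurn

variable {n : ℕ} {M : UTurn n} {v : E n}

theorem Admissible.integrableOn_leaves_iff (hv : M.Admissible v) {σ : ℝ} (hσ : |σ| = 1)
    (F : E n → ℝ) : IntegrableOn F (M.leaves v) ↔
      IntegrableOn (fun y => |(M.leafDeriv v y).det| * F (M.leaf v y)) (M.crossing σ v) := by
  rw [← hv.image_leaf hσ]
  exact integrableOn_image_iff_integrableOn_abs_det_fderiv_smul volume
    (isOpen_crossing σ).measurableSet (fun y _ => (hasFDerivAt_leaf y).hasFDerivWithinAt)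
    (hv.injOn_leaf hσ) F

theorem Admissible.setIntegral_leaves (hv : M.Admissible v) {σ : ℝ} (hσ : |σ| = 1)
    (F : E n → ℝ) : ∫ L in M.leaves v, F L =
      ∫ y in M.crossing σ v, |(M.leafDeriv v y).det| * F (M.leaf v y) := by
  rw [← hv.image_leaf hσ]
  exact integral_image_eq_integral_abs_det_fderiv_smul volume
    (isOpen_crossing σ).measurableSet (fun y _ => (hasFDerivAt_leaf y).hasFDerivWithinAt)
    (hv.injOn_leaf hσ) F

theorem measurable_det_leafDeriv (hv : M.Admissible v) :
    Measurable fun y => (M.leafDeriv v y).det := by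
  simp only [hv.det_leafDeriv]
  have h1 : Continuous fun y => fderiv ℝ M.r y v :=
    (M.contDiff_r.continuous_fderiv one_ne_zero).clm_apply continuous_const
  exact (h1.sub (continuous_const.mul M.continuous_time)).measurable

/-- On the crossing sets the Jacobian does not matter for integrability. -/
theorem Admissible.integrableOn_det_mul_iff (hv : M.Admissible v) {σ : ℝ} (hσ : |σ| = 1)
    (F : E n → ℝ) :
    IntegrableOn (fun y => |(M.leafDeriv v y).det| * F y) (M.crossing σ v) ↔
      IntegrableOn F (M.crossing σ v) := by
  have hm := (measurable_det_leafDeriv hv).abs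
  have hb := fun y (hy : y ∈ M.crossing σ v) => hv.abs_det_leafDeriv hσ hy ▸
    hv.det_leafDeriv_mem hσ hy
  have h0 := hv.speed_pos
  have hD : MeasurableSet (M.crossing σ v) := (isOpen_crossing σ).measurableSet
  constructor
  · intro h
    have h1 := Integrable.bdd_mul (f := fun y => |(M.leafDeriv v y).det|⁻¹) h
      hm.inv.aestronglyMeasurable (c := (M.speed v / 8)⁻¹) <| by
        refine (ae_restrict_iff' hD).2 (.of_forall fun y hy => ?_)
        rw [norm_inv, Real.norm_eq_abs, abs_abs]
        exact inv_anti₀ (by positivity) (hb y hy).1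
    refine h1.congr ?_
    refine (ae_restrict_iff' hD).2 (.of_forall fun y hy => ?_)
    have : |(M.leafDeriv v y).det| ≠ 0 :=
      (lt_of_lt_of_le (by positivity : 0 < M.speed v / 8) (hb y hy).1).ne'
    exact inv_mul_cancel_left₀ this _
  · intro h
    refine Integrable.bdd_mul (c := 2 * M.speed v) h hm.aestronglyMeasurable ?_
    refine (ae_restrict_iff' hD).2 (.of_forall fun y hy => ?_)
    rw [Real.norm_eq_abs, abs_abs]
    exact (hb y hy).2

end UTurn

namespace LocalChart

variable {d k : ℕ} {Ω : Set (E d)} {A : BoundaryAtlas d k Ω} {M : LocalChart A} {v : E (d - 1)}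

/-! ### Inflow and outflow boundary, flux integrals and existence of weak solutions. -/

section Field

variable {b : E d → E d}

theorem Fits.sign_normal (hv : M.Fits v) (hb : EqOn b (M.field v) (M.domain v)) {σ : ℝ}
    (hσ : |σ| = 1) {y : E (d - 1)} (hy : y ∈ M.crossing σ v) :
    inner ℝ (b (M.graph y)) (A.normal (M.graph y)) =
      σ * ((A.areaDensity M.j y)⁻¹ * |(M.leafDeriv v y).det|) := by
  rw [hb (graph_mem_domain hσ hy), hv.inner_field_normal hσ hy,
    hv.admissible.abs_det_leafDeriv hσ hy]
  linear_combination -(A.areaDensity M.j y)⁻¹ * (M.leafDeriv v y).det *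
    (UTurn.mul_self_of_abs_eq_one hσ) * (-1)

theorem Fits.sign_normal_pos (hv : M.Fits v) {σ : ℝ}
    (hσ : |σ| = 1) {y : E (d - 1)} (hy : y ∈ M.crossing σ v) :
    0 < (A.areaDensity M.j y)⁻¹ * |(M.leafDeriv v y).det| := by
  have h1 := hv.admissible.det_leafDeriv_mem hσ hy
  rw [← hv.admissible.abs_det_leafDeriv hσ hy] at h1
  have h2 := hv.admissible.speed_pos
  have h3 : 0 < |(M.leafDeriv v y).det| := lt_of_lt_of_le (by positivity) h1.1
  have h4 := A.one_le_areaDensity M.j y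
  positivity

theorem Fits.exists_crossing (hΩ : IsOpen Ω) (hv : M.Fits v) {z : E d} (hz : z ∈ M.domain v)
    (hf : z ∈ frontier Ω) : ∃ y, M.graph y = z ∧ (y ∈ M.crossing 1 v ∨ y ∈ M.crossing (-1) v) := by
  have h := (hv.mem_frontier_iff hΩ hz).1 hf
  rw [h] at hz
  obtain ⟨h1, h2⟩ := (graph_mem_domain_iff _).1 hz
  exact ⟨_, h.symm, hv.admissible.mem_crossing h1 h2⟩

/-- Every boundary point of the domain lies in one of the two crossing sets, and on these the normal
component has the strict sign `σ`. In particular the field is nowhere tangential to the boundary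
inside the domain. -/
theorem Fits.domain_inter_outflow (hΩ : IsOpen Ω) (hv : M.Fits v)
    (hb : EqOn b (M.field v) (M.domain v)) :
    M.domain v ∩ A.outflow b = M.graph '' M.crossing 1 v := by
  ext z
  constructor
  · rintro ⟨hz, hf, hs⟩
    obtain ⟨y, rfl, hy | hy⟩ := hv.exists_crossing hΩ hz hf
    · exact ⟨y, hy, rfl⟩
    · rw [hv.sign_normal hb (by simp) hy] at hs
      linarith [hv.sign_normal_pos (by simp) hy]
  · rintro ⟨y, hy, rfl⟩
    refine ⟨graph_mem_domain (by simp) hy,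
      graph_mem_frontier hΩ (hv.crossing_subset (by simp) hy), ?_⟩
    rw [hv.sign_normal hb (by simp) hy]
    linarith [hv.sign_normal_pos (by simp) hy]

theorem Fits.domain_inter_inflow (hΩ : IsOpen Ω) (hv : M.Fits v)
    (hb : EqOn b (M.field v) (M.domain v)) :
    M.domain v ∩ A.inflow b = M.graph '' M.crossing (-1) v := by
  ext z
  constructor
  · rintro ⟨hz, hf, hs⟩
    obtain ⟨y, rfl, hy | hy⟩ := hv.exists_crossing hΩ hz hf
    · rw [hv.sign_normal hb (by simp) hy] at hs
      linarith [hv.sign_normal_pos (by simp) hy]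
    · exact ⟨y, hy, rfl⟩
  · rintro ⟨y, hy, rfl⟩
    refine ⟨graph_mem_domain (by simp) hy,
      graph_mem_frontier hΩ (hv.crossing_subset (by simp) hy), ?_⟩
    rw [hv.sign_normal hb (by simp) hy]
    linarith [hv.sign_normal_pos (by simp) hy]

theorem setIntegral_eq_of_domain {S : Set (E d)} {K : E d → ℝ} (hK : ∀ x ∉ M.domain v, K x = 0) :
    ∫ x in S, K x ∂A.surface = ∫ x in M.domain v ∩ S, K x ∂A.surface := by
  rw [← Measure.restrict_restrict isOpen_domain.measurableSet,
    setIntegral_eq_integral_of_forall_compl_eq_zero hK]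

theorem integrableOn_iff_of_domain {S : Set (E d)} {K : E d → ℝ}
    (hK : ∀ x ∉ M.domain v, K x = 0) :
    IntegrableOn K S A.surface ↔ IntegrableOn K (M.domain v ∩ S) A.surface := by
  rw [IntegrableOn, IntegrableOn, ← Measure.restrict_restrict isOpen_domain.measurableSet]
  change _ ↔ IntegrableOn K (M.domain v) _
  rw [← integrable_indicator_iff isOpen_domain.measurableSet, indicator_eq_self.2]
  intro x hx
  by_contra h
  exact hx (hK x h)

/-- A flux integral over the crossing points, in terms of the leaves. -/
theorem Fits.setIntegral_flux (hΩ : IsOpen Ω) (hv : M.Fits v)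
    (hb : EqOn b (M.field v) (M.domain v)) {σ : ℝ} (hσ : |σ| = 1) (K : E d → ℝ) :
    ∫ x in M.graph '' M.crossing σ v, K x * inner ℝ (b x) (A.normal x) ∂A.surface =
      σ * ∫ L in M.leaves v, K (M.graph (M.cross σ v L)) := by
  have hD := (UTurn.isOpen_crossing (M := M.toUTurn) (v := v) σ).measurableSet
  rw [setIntegral_image_graph hΩ hD (hv.crossing_subset hσ), hv.admissible.setIntegral_leaves hσ,
    ← integral_const_mul]
  refine setIntegral_congr_fun hD fun y hy => ?_
  have := (zero_lt_one.trans_le (A.one_le_areaDensity M.j y)).ne'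
  simp only [hv.sign_normal hb hσ hy, hv.admissible.cross_leaf hσ hy]
  field_simp

theorem Fits.integrableOn_flux_iff (hΩ : IsOpen Ω) (hv : M.Fits v)
    (hb : EqOn b (M.field v) (M.domain v)) {σ : ℝ} (hσ : |σ| = 1) (K : E d → ℝ) :
    IntegrableOn (fun x => inner ℝ (b x) (A.normal x) * K x) (M.graph '' M.crossing σ v) A.surface ↔
      IntegrableOn (fun L => K (M.graph (M.cross σ v L))) (M.leaves v) := by
  have hD := (UTurn.isOpen_crossing (M := M.toUTurn) (v := v) σ).measurableSet
  rw [integrableOn_image_graph_iff hΩ hD (hv.crossing_subset hσ),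
    hv.admissible.integrableOn_leaves_iff hσ]
  have h0 : σ ≠ 0 := by
    rintro rfl
    simp at hσ
  rw [IntegrableOn, IntegrableOn, ← integrable_const_mul_iff (IsUnit.mk0 σ h0) (fun y =>
    |(M.leafDeriv v y).det| * K (M.graph (M.cross σ v (M.leaf v y))))]
  refine integrableOn_congr_fun (fun y hy => ?_) hD
  have := (zero_lt_one.trans_le (A.one_le_areaDensity M.j y)).ne'
  simp only [hv.sign_normal hb hσ hy, hv.admissible.cross_leaf hσ hy]
  field_simp

variable (M) in
/-- The function that equals `F` on the leaves of the domain, extended by zero. -/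
def leafFunction (v : E (d - 1)) (F : E (d - 1) → ℝ) : E d → ℝ :=
  (M.domain v).indicator fun x => F (M.flowInv v x).1

theorem measurableEmbedding_flow (hv : M.Admissible v) : MeasurableEmbedding (M.flow v) :=
  (flowHomeomorph hv).measurableEmbedding

theorem preimage_domain (hv : M.Admissible v) :
    M.flow v ⁻¹' M.domain v = M.leaves v ×ˢ Ioo (-(3 / 2 : ℝ)) (3 / 2) := by
  ext p
  rw [mem_preimage, flow_mem_domain_iff hv, abs_lt]
  rfl

theorem integrableOn_box {F : E (d - 1) → ℝ} (hF : IntegrableOn F (M.leaves v)) :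
    IntegrableOn (fun p : E (d - 1) × ℝ => F p.1)
      (M.leaves v ×ˢ Ioo (-(3 / 2 : ℝ)) (3 / 2)) := by
  have h : IsFiniteMeasure (volume.restrict (Ioo (-(3 / 2 : ℝ)) (3 / 2))) := inferInstance
  have := hF.comp_fst (volume.restrict (Ioo (-(3 / 2 : ℝ)) (3 / 2)))
  rwa [Measure.prod_restrict] at this

theorem integrable_leafFunction (hv : M.Admissible v) {F : E (d - 1) → ℝ}
    (hF : IntegrableOn F (M.leaves v)) : Integrable (M.leafFunction v F) := by
  rw [leafFunction, integrable_indicator_iff isOpen_domain.measurableSet,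
    ← (measurePreserving_flow hv).integrableOn_comp_preimage (measurableEmbedding_flow hv),
    preimage_domain hv]
  refine (integrableOn_box hF).congr_fun (fun p _ => ?_)
    (isOpen_ball.prod isOpen_Ioo).measurableSet
  simp only [Function.comp_apply, flowInv_flow hv]

theorem continuous_gap_prod : Continuous fun p : E (d - 1) × ℝ => M.gap v p.1 p.2 := by
  have h1 := UTurn.continuous_level (M := M.toUTurn) (v := v)
  have h2 := UTurn.continuous_time (M := M.toUTurn) (v := v)
  unfold UTurn.gap UTurn.pos
  fun_prop

theorem divergence_smul_eq (hb : EqOn b (M.field v) (M.domain v)) {φ : E d → ℝ}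
    (hφ : Differentiable ℝ φ) {x : E d} (hx : x ∈ M.domain v) :
    divergence (fun y => φ y • b y) x = fderiv ℝ φ x (M.field v x) := by
  have h : (fun y => φ y • b y) =ᶠ[nhds x] fun y => φ y • M.field v y := by
    filter_upwards [isOpen_domain.mem_nhds hx] with y hy
    rw [hb hy]
  rw [← divergence_smul_field (hφ x), divergence, divergence, h.fderiv_eq]

/-- The times spent in `Ω` form a single interval between the two roots, and the integrand is the
derivative of the test function along the leaf. -/
theorem Fits.setIntegral_along_leaf (hv : M.Fits v) {φ : E d → ℝ} (hφ : ContDiff ℝ 1 φ)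
    {L : E (d - 1)} (hL : L ∈ M.leaves v) :
    ∫ s in Ioo (-(3 / 2 : ℝ)) (3 / 2), {s | 0 < M.gap v L s}.indicator
      (fun s => fderiv ℝ φ (M.flow v (L, s)) (M.field v (M.flow v (L, s)))) s =
      φ (M.graph (M.cross 1 v L)) - φ (M.graph (M.cross (-1) v L)) := by
  have hs : {s | 0 < M.gap v L s} = Ioo (-M.root (-1) v L) (M.root 1 v L) := by
    ext s
    exact hv.admissible.gap_pos_iff hL s
  have h1 := (hv.admissible.root_spec hL (σ := 1) (by simp)).1
  have h2 := (hv.admissible.root_spec hL (σ := -1) (by simp)).1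
  have hsub : Ioo (-M.root (-1) v L) (M.root 1 v L) ⊆ Ioo (-(3 / 2 : ℝ)) (3 / 2) :=
    Ioo_subset_Ioo (by linarith [h2.2]) (by linarith [h1.2])
  rw [hs, setIntegral_indicator measurableSet_Ioo, inter_eq_right.2 hsub,
    ← integral_Ioc_eq_integral_Ioo, ← intervalIntegral.integral_of_le (by linarith [h1.1, h2.1]),
    graph_cross hv.admissible hL (by simp), graph_cross hv.admissible hL (by simp), one_mul,
    neg_one_mul]
  have hd : ∀ s, HasDerivAt (fun s => φ (M.flow v (L, s)))
      (fderiv ℝ φ (M.flow v (L, s)) (M.field v (M.flow v (L, s)))) s := fun s =>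
    (hφ.differentiable one_ne_zero _).hasFDerivAt.comp_hasDerivAt s
      (hasDerivAt_flow hv.admissible L s)
  refine intervalIntegral.integral_eq_sub_of_hasDerivAt (fun s _ => hd s) ?_
  have hc : Continuous fun s => M.flow v (L, s) := continuous_flow.comp (by fun_prop)
  exact (((hφ.continuous_fderiv one_ne_zero).comp hc).clm_apply
    (contDiff_field.continuous.comp hc)).intervalIntegrable _ _

/-- The weak formulation for functions that are constant along the leaves. -/
theorem Fits.integral_leafFunction (hv : M.Fits v)
    (hb : EqOn b (M.field v) (M.domain v)) (hΩ : IsOpen Ω) {F : E (d - 1) → ℝ}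
    (hF : IntegrableOn F (M.leaves v)) {φ : E d → ℝ} (hφ : ContDiff ℝ ∞ φ)
    (hφc : HasCompactSupport φ) :
    ∫ x in Ω, M.leafFunction v F x * divergence (fun y => φ y • b y) x =
      ∫ L in M.leaves v, F L * (φ (M.graph (M.cross 1 v L)) - φ (M.graph (M.cross (-1) v L))) := by
  have hφ1 : ContDiff ℝ 1 φ := hφ.of_le (by norm_cast)
  set g : E d → ℝ := fun x => fderiv ℝ φ x (M.field v x) with hg
  have hgc : Continuous g := (hφ1.continuous_fderiv one_ne_zero).clm_apply contDiff_field.continuous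
  have hgs : HasCompactSupport g := by
    refine (hφc.fderiv ℝ).mono' fun x hx => ?_
    refine subset_tsupport _ ?_
    intro h
    simp only [hg, Function.mem_support] at hx
    rw [h] at hx
    simp at hx
  obtain ⟨C, hC⟩ := hgs.exists_bound_of_continuous hgc
  set h : E (d - 1) × ℝ → ℝ := fun p => F p.1 *
    {p : E (d - 1) × ℝ | 0 < M.gap v p.1 p.2}.indicator (fun p => g (M.flow v p)) p with hh
  have hgap : IsOpen {p : E (d - 1) × ℝ | 0 < M.gap v p.1 p.2} :=
    isOpen_lt continuous_const continuous_gap_prod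
  have hbox : MeasurableSet (M.leaves v ×ˢ Ioo (-(3 / 2 : ℝ)) (3 / 2)) :=
    (isOpen_ball.prod isOpen_Ioo).measurableSet
  have hint : IntegrableOn h (M.leaves v ×ˢ Ioo (-(3 / 2 : ℝ)) (3 / 2)) := by
    refine Integrable.mul_bdd (c := C) (integrableOn_box hF) ?_ (.of_forall fun p => ?_)
    · exact ((hgc.comp continuous_flow).measurable.indicator hgap.measurableSet).aestronglyMeasurable
    · exact (norm_indicator_le_norm_self _ _).trans (hC _)
  -- In flow coordinates the domain is a product, `Ω` is the set of positive gap, and the Jacobian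
  -- is one.
  have e1 : ∫ x in Ω, M.leafFunction v F x * divergence (fun y => φ y • b y) x =
      ∫ p in M.leaves v ×ˢ Ioo (-(3 / 2 : ℝ)) (3 / 2), h p := by
    rw [← integral_indicator hΩ.measurableSet,
      ← (measurePreserving_flow hv.admissible).integral_comp
      (measurableEmbedding_flow hv.admissible), ← integral_indicator hbox]
    refine integral_congr_ae (.of_forall fun p => ?_)
    by_cases hp : p ∈ M.leaves v ×ˢ Ioo (-(3 / 2 : ℝ)) (3 / 2)
    · have hs : |p.2| < 3 / 2 := abs_lt.2 hp.2
      have hd : M.flow v p ∈ M.domain v := (flow_mem_domain_iff hv.admissible p).2 ⟨hp.1, hs⟩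
      have hiff := hv.flow_mem_iff hp.1 hs
      have hgi : (0 < M.gap v p.1 p.2 → {p : E (d - 1) × ℝ | 0 < M.gap v p.1 p.2}.indicator
          (fun p => g (M.flow v p)) p = g (M.flow v p)) ∧ (¬ 0 < M.gap v p.1 p.2 →
          {p : E (d - 1) × ℝ | 0 < M.gap v p.1 p.2}.indicator (fun p => g (M.flow v p)) p = 0) :=
        ⟨fun h => indicator_of_mem (s := {p : E (d - 1) × ℝ | 0 < M.gap v p.1 p.2}) h _,
          fun h => indicator_of_notMem (s := {p : E (d - 1) × ℝ | 0 < M.gap v p.1 p.2}) h _⟩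
      simp only [indicator_of_mem hp, hh]
      by_cases hpΩ : M.flow v p ∈ Ω
      · rw [indicator_of_mem hpΩ, hgi.1 (hiff.1 hpΩ), leafFunction, indicator_of_mem hd,
          flowInv_flow hv.admissible, divergence_smul_eq hb (hφ1.differentiable one_ne_zero) hd]
      · rw [indicator_of_notMem hpΩ, hgi.2 (fun h => hpΩ (hiff.2 h)), mul_zero]
    · have hd : M.flow v p ∉ M.domain v := fun h => hp (by
        rw [← preimage_domain hv.admissible]; exact h)
      rw [indicator_of_notMem hp]
      refine indicator_apply_eq_zero.2 fun _ => ?_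
      rw [leafFunction, indicator_of_notMem hd, zero_mul]
  rw [e1]
  refine (setIntegral_prod h hint).trans ?_
  refine setIntegral_congr_fun isOpen_ball.measurableSet fun L hL => ?_
  simp only [hh]
  rw [integral_const_mul, ← hv.setIntegral_along_leaf hφ1 hL]
  rfl

theorem Fits.integrableOn_leaves_mul (hv : M.Fits v) {σ : ℝ} (hσ : |σ| = 1) {F : E (d - 1) → ℝ}
    (hF : IntegrableOn F (M.leaves v)) {φ : E d → ℝ} (hφ : Continuous φ)
    (hφc : HasCompactSupport φ) :
    IntegrableOn (fun L => F L * φ (M.graph (M.cross σ v L))) (M.leaves v) := by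
  obtain ⟨C, hC⟩ := hφc.exists_bound_of_continuous hφ
  have hD := (UTurn.isOpen_crossing (M := M.toUTurn) (v := v) σ).measurableSet
  rw [hv.admissible.integrableOn_leaves_iff hσ] at hF ⊢
  have h := Integrable.mul_bdd (c := C) (g := fun y => φ (M.graph y)) hF
    (hφ.comp continuous_graph).aestronglyMeasurable (.of_forall fun y => hC _)
  refine IntegrableOn.congr_fun h (fun y hy => ?_) hD
  simp only [hv.admissible.cross_leaf hσ hy, mul_assoc]

variable (M) in
/-- The inflow data as a function of the leaf. -/
def leafData (v : E (d - 1)) (gIn : E d → ℝ) (L : E (d - 1)) : ℝ := gIn (M.graph (M.cross (-1) v L))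

theorem Fits.integrableOn_leafData (hv : M.Fits v) {gIn : E d → ℝ}
    (hg : IntegrableOn (fun y => gIn (M.graph y)) (ball M.xs M.radius)) :
    IntegrableOn (M.leafData v gIn) (M.leaves v) := by
  have hσ : |(-1 : ℝ)| = 1 := by simp
  have hD := (UTurn.isOpen_crossing (M := M.toUTurn) (v := v) (-1)).measurableSet
  rw [hv.admissible.integrableOn_leaves_iff hσ]
  have h := (hv.admissible.integrableOn_det_mul_iff hσ _).2 (hg.mono_set (hv.crossing_subset hσ))
  refine IntegrableOn.congr_fun h (fun y hy => ?_) hD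
  simp only [leafData, hv.admissible.cross_leaf hσ hy]

/-- Existence of weak solutions. -/
theorem Fits.isWeakSolution (hΩ : IsOpen Ω) (hv : M.Fits v)
    (hb : EqOn b (M.field v) (M.domain v)) {gIn : E d → ℝ}
    (hg : IntegrableOn (fun y => gIn (M.graph y)) (ball M.xs M.radius)) :
    IsWeakSolution A b gIn (M.domain v) (M.leafFunction v (M.leafData v gIn))
      (M.leafFunction v (M.leafData v gIn)) := by
  have hF := hv.integrableOn_leafData hg
  have hcross : ∀ {σ : ℝ}, |σ| = 1 → ∀ L ∈ M.leaves v, M.leafFunction v (M.leafData v gIn)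
      (M.graph (M.cross σ v L)) = M.leafData v gIn L := by
    intro σ hσ L hL
    rw [leafFunction, indicator_of_mem (graph_mem_domain hσ (hv.admissible.cross_mem hL hσ)),
      flowInv_graph, hv.admissible.leaf_cross hL hσ]
  have hL := isOpen_ball.measurableSet (s := M.leaves v)
  refine ⟨?_, ?_, fun φ hφ hφc hφs => ?_⟩
  · exact ((integrable_leafFunction hv.admissible hF).mono_measure
      Measure.restrict_le_self).locallyIntegrable.locallyIntegrableOn _
  · refine LocallyIntegrable.locallyIntegrableOn (Integrable.locallyIntegrable ?_) _
    change IntegrableOn _ _ _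
    rw [integrableOn_iff_of_domain (M := M) (v := v)
      (fun x hx => by rw [leafFunction, indicator_of_notMem hx, mul_zero]),
      hv.domain_inter_outflow hΩ hb, hv.integrableOn_flux_iff hΩ hb (by simp)]
    exact hF.congr_fun (fun L hL => (hcross (by simp) L hL).symm) hL
  · have hz : ∀ x ∉ M.domain v, φ x = 0 := fun x hx => by
      by_contra h
      exact hx (hφs (subset_tsupport _ h))
    rw [hv.integral_leafFunction hb hΩ hF hφ hφc,
      setIntegral_eq_of_domain (M := M) (v := v) (fun x hx => by rw [hz x hx]; ring),
      setIntegral_eq_of_domain (M := M) (v := v) (S := A.outflow b)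
        (fun x hx => by rw [hz x hx]; ring),
      hv.domain_inter_outflow hΩ hb, hv.domain_inter_inflow hΩ hb,
      hv.setIntegral_flux hΩ hb (by simp) fun x => gIn x * φ x,
      hv.setIntegral_flux hΩ hb (by simp) fun x =>
        M.leafFunction v (M.leafData v gIn) x * φ x, one_mul, neg_one_mul, neg_add_eq_sub]
    simp only [mul_sub]
    rw [integral_sub (hv.integrableOn_leaves_mul (by simp) hF hφ.continuous hφc)
      (hv.integrableOn_leaves_mul (by simp) hF hφ.continuous hφc)]
    congr 1
    refine setIntegral_congr_fun hL fun L hL => ?_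
    simp only [hcross (by simp : |(1 : ℝ)| = 1) L hL]

end Field

end LocalChart

/-! ### Uniqueness of weak solutions -/

theorem integrable_mul_of_locallyIntegrableOn {d : ℕ} {U C : Set (E d)} {μ : Measure (E d)}
    (hC : IsClosed C) (hμ : μ.restrict C = μ) {u : E d → ℝ} (hu : LocallyIntegrableOn u (U ∩ C) μ)
    {g : E d → ℝ} (hg : Continuous g) (hgc : HasCompactSupport g) (hgU : tsupport g ⊆ U) :
    Integrable (fun x => u x * g x) μ := by
  obtain ⟨c, hc⟩ := hgc.exists_bound_of_continuous hg
  have h1 := hu.integrableOn_compact_subset (inter_subset_inter_left C hgU)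
    (hgc.isCompact.inter_right hC)
  rw [IntegrableOn, ← Measure.restrict_restrict (isClosed_tsupport g).measurableSet, hμ] at h1
  have h2 := h1.mul_bdd (g := g) hg.aestronglyMeasurable (.of_forall hc)
  change IntegrableOn _ _ _ at h2
  rw [← integrable_indicator_iff (isClosed_tsupport g).measurableSet, indicator_eq_self.2] at h2
  · exact h2
  · intro x hx
    refine subset_tsupport g fun h => hx ?_
    simp only [h, mul_zero]

theorem locallyIntegrableOn_of_inter {d : ℕ} {U C : Set (E d)} {μ : Measure (E d)}
    (hU : IsOpen U) (hC : IsClosed C) (hμ : μ.restrict C = μ) {u : E d → ℝ}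
    (hu : LocallyIntegrableOn u (U ∩ C) μ) : LocallyIntegrableOn u U μ := by
  rw [locallyIntegrableOn_iff hU.isLocallyClosed]
  intro K hKU hK
  have h1 := hu.integrableOn_compact_subset (inter_subset_inter_left C hKU) (hK.inter_right hC)
  rwa [IntegrableOn, ← Measure.restrict_restrict hK.measurableSet, hμ] at h1

theorem restrict_closure_restrict {d : ℕ} (μ : Measure (E d)) (Ω : Set (E d)) :
    (μ.restrict Ω).restrict (closure Ω) = μ.restrict Ω := by
  rw [Measure.restrict_restrict isClosed_closure.measurableSet, inter_eq_right.2 subset_closure]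

namespace BoundaryAtlas

variable {d k : ℕ} {Ω : Set (E d)} (A : BoundaryAtlas d k Ω)

theorem restrict_outflow_restrict_frontier (b : E d → E d) :
    (A.surface.restrict (A.outflow b)).restrict (frontier Ω) =
      A.surface.restrict (A.outflow b) := by
  rw [Measure.restrict_restrict isClosed_frontier.measurableSet,
    inter_eq_right.2 fun x hx => hx.1]

theorem ae_outflow_mem_frontier (b : E d → E d) :
    ∀ᵐ x ∂A.surface.restrict (A.outflow b), x ∈ frontier Ω := by
  rw [← A.restrict_outflow_restrict_frontier]
  exact ae_restrict_mem isClosed_frontier.measurableSet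

end BoundaryAtlas

/-- Integrals of a smooth function over segments of a fixed direction are smooth. -/
theorem contDiff_integral_translate {X : Type*} [NormedAddCommGroup X] [NormedSpace ℝ X]
    [MeasurableSpace X] [BorelSpace X] [SecondCountableTopology X] {Ψ : X × ℝ → ℝ}
    (hΨ : ContDiff ℝ ∞ Ψ) (hΨc : HasCompactSupport Ψ) (T : ℝ) :
    ContDiff ℝ ∞ fun p : X × ℝ => ∫ τ in Icc 0 T, Ψ (p.1, p.2 + τ) := by
  let ν : Measure (X × ℝ) := (volume.restrict (Icc 0 T)).map fun τ => ((0 : X), -τ)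
  have h := hΨc.contDiff_convolution_right (μ := ν) (f := fun _ => (1 : ℝ))
    (ContinuousLinearMap.mul ℝ ℝ) (integrable_const _).locallyIntegrable (n := ⊤) hΨ
  convert h using 1
  ext1 p
  rw [convolution, integral_map (by fun_prop)]
  · refine integral_congr_ae (.of_forall fun τ => ?_)
    simp [Prod.sub_def]
  · have := hΨ.continuous
    exact Continuous.aestronglyMeasurable (by fun_prop)

theorem hasDerivAt_integral_translate {f : ℝ → ℝ} (hf : Continuous f) {T : ℝ} (hT : 0 ≤ T) (s : ℝ) :
    HasDerivAt (fun s => ∫ τ in Icc 0 T, f (s + τ)) (f (s + T) - f s) s := by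
  have e : (fun s => ∫ τ in Icc 0 T, f (s + τ)) = fun s =>
      (∫ σ in (0 : ℝ)..(s + T), f σ) - ∫ σ in (0 : ℝ)..s, f σ := by
    ext1 s
    rw [integral_Icc_eq_integral_Ioc, ← intervalIntegral.integral_of_le hT,
      intervalIntegral.integral_comp_add_left (fun x => f x), add_zero,
      intervalIntegral.integral_interval_sub_left] <;> exact hf.intervalIntegrable _ _
  rw [e]
  have h1 : ∀ s, HasDerivAt (fun s => ∫ σ in (0 : ℝ)..s, f σ) (f s) s := fun s =>
    intervalIntegral.integral_hasDerivAt_right (hf.intervalIntegrable _ _)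
      hf.aestronglyMeasurable.stronglyMeasurableAtFilter hf.continuousAt
  have h2 := (h1 (s + T)).comp s ((hasDerivAt_id s).add_const T)
  rw [mul_one] at h2
  exact h2.sub (h1 s)

namespace LocalChart

variable {d k : ℕ} {Ω : Set (E d)} {A : BoundaryAtlas d k Ω} {M : LocalChart A} {v : E (d - 1)}
  {b : E d → E d}

theorem fderiv_field_eq (hv : M.Admissible v) {φ : E d → ℝ} (hφ : Differentiable ℝ φ)
    {φ' : E (d - 1) × ℝ → ℝ} (h : ∀ p, φ (M.flow v p) = φ' p) {L : E (d - 1)} {s m : ℝ}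
    (hm : HasDerivAt (fun s => φ' (L, s)) m s) :
    fderiv ℝ φ (M.flow v (L, s)) (M.field v (M.flow v (L, s))) = m := by
  have h1 := (hφ (M.flow v (L, s))).hasFDerivAt.comp_hasDerivAt s (hasDerivAt_flow hv L s)
  refine h1.unique (hm.congr_of_eventuallyEq (.of_forall fun s => ?_))
  exact h _

/-- The test functions of the uniqueness proof. -/
theorem Fits.exists_test_function (hv : M.Fits v) {ψ : E d → ℝ}
    (hψ : ContDiff ℝ ∞ ψ) (hψc : HasCompactSupport ψ) (hψs : tsupport ψ ⊆ M.domain v ∩ Ω) :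
    ∃ φ : E d → ℝ, ContDiff ℝ ∞ φ ∧ HasCompactSupport φ ∧ tsupport φ ⊆ M.domain v ∧
      (∀ x ∈ Ω, fderiv ℝ φ x (M.field v x) = ψ x) ∧ ∀ y ∈ M.crossing 1 v, φ (M.graph y) = 0 := by
  have hva := hv.admissible
  set K₀ : Set (E (d - 1) × ℝ) := M.flowInv v '' tsupport ψ with hK₀
  have hK₀c : IsCompact K₀ := hψc.isCompact.image contDiff_flowInv.continuous
  have hK₀s : ∀ p ∈ K₀, p.1 ∈ M.leaves v ∧ |p.2| < 3 / 2 ∧ 0 < M.gap v p.1 p.2 := by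
    rintro _ ⟨x, hx, rfl⟩
    obtain ⟨⟨h1, h2⟩, h3⟩ := hψs hx
    refine ⟨h1, h2, (hv.flow_mem_iff h1 h2).1 ?_⟩
    rwa [flow_flowInv hva]
  set Ψ : E (d - 1) × ℝ → ℝ := fun p => ψ (M.flow v p) with hΨ
  have hΨd : ContDiff ℝ ∞ Ψ := hψ.comp contDiff_flow
  have hΨK : ∀ p, p ∉ K₀ → Ψ p = 0 := fun p hp => by
    by_contra h
    exact hp ⟨M.flow v p, subset_tsupport ψ h, flowInv_flow hva p⟩
  have hΨc : HasCompactSupport Ψ := HasCompactSupport.intro hK₀c hΨK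
  -- The source is integrated over later times. The window of length `4` exceeds the time span `3`
  -- of the domain, so that nothing is left at its far end.
  set I : E (d - 1) × ℝ → ℝ := fun p => ∫ τ in Icc 0 4, Ψ (p.1, p.2 + τ) with hI
  have hId : ContDiff ℝ ∞ I := contDiff_integral_translate hΨd hΨc 4
  -- The cut-off is `1` for `s ≥ -5/4`, hence at all times spent in `Ω`, and `0` for `s ≤ -11/8`. It
  -- truncates between the earliest possible entry and the end `-3/2` of the domain, and so does not
  -- disturb the equation in `Ω`.
  set χ : ℝ → ℝ := fun s => Real.smoothTransition ((s + 11 / 8) * 8) with hχ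
  have hχd : ContDiff ℝ ∞ χ := Real.smoothTransition.contDiff.comp
    ((contDiff_id.add contDiff_const).mul contDiff_const)
  set φ' : E (d - 1) × ℝ → ℝ := fun p => -(χ p.2 * I p) with hφ'
  have hφ'd : ContDiff ℝ ∞ φ' := ((hχd.comp contDiff_snd).mul hId).neg
  set K₁ : Set (E (d - 1) × ℝ) := ((fun q : (E (d - 1) × ℝ) × ℝ => (q.1.1, q.1.2 - q.2)) ''
    (K₀ ×ˢ Icc 0 4)) ∩ {p | -(11 / 8) ≤ p.2} with hK₁
  have hK₁c : IsCompact K₁ := ((hK₀c.prod isCompact_Icc).image (by fun_prop)).inter_right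
    (isClosed_le continuous_const continuous_snd)
  have hIzero : ∀ p, (∀ τ ∈ Icc (0 : ℝ) 4, (p.1, p.2 + τ) ∉ K₀) → I p = 0 := fun p hp => by
    rw [hI]
    refine (setIntegral_congr_fun (g := fun _ => 0) measurableSet_Icc fun τ hτ => ?_).trans
      (by simp)
    exact hΨK _ (hp τ hτ)
  have hφ'K : ∀ p, p ∉ K₁ → φ' p = 0 := fun p hp => by
    rw [hφ']
    by_cases hp2 : -(11 / 8) ≤ p.2
    · have : I p = 0 := hIzero p fun τ hτ h => hp ⟨⟨((p.1, p.2 + τ), τ), ⟨h, hτ⟩, by simp⟩, hp2⟩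
      simp [this]
    · have : χ p.2 = 0 := Real.smoothTransition.zero_of_nonpos (by linarith)
      simp [this]
  set φ : E d → ℝ := fun x => φ' (M.flowInv v x) with hφ
  have hφflow : ∀ p, φ (M.flow v p) = φ' p := fun p => by rw [hφ]; simp only [flowInv_flow hva]
  have hφd : ContDiff ℝ ∞ φ := hφ'd.comp contDiff_flowInv
  have hKc : IsCompact (M.flow v '' K₁) := hK₁c.image continuous_flow
  have hφK : ∀ x, x ∉ M.flow v '' K₁ → φ x = 0 := fun x hx =>
    hφ'K _ fun h => hx ⟨_, h, flow_flowInv hva x⟩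
  have hsupp : tsupport φ ⊆ M.flow v '' K₁ :=
    closure_minimal (fun x hx => by by_contra h; exact hx (hφK x h)) hKc.isClosed
  have hKdom : M.flow v '' K₁ ⊆ M.domain v := by
    rintro _ ⟨_, ⟨⟨⟨p, τ⟩, ⟨hp, hτ⟩, rfl⟩, hs⟩, rfl⟩
    obtain ⟨h1, h2, -⟩ := hK₀s p hp
    rw [flow_mem_domain_iff hva]
    simp only [mem_ofPred_eq] at hs
    refine ⟨h1, abs_lt.2 ⟨by simp only; linarith, ?_⟩⟩
    have := (abs_lt.1 h2).2
    simp only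
    linarith [hτ.1]
  refine ⟨φ, hφd, HasCompactSupport.intro hKc hφK, hsupp.trans hKdom, fun x hx => ?_,
    fun y hy => ?_⟩
  · by_cases hxd : x ∈ M.domain v
    · rw [← flow_flowInv hva x] at hxd hx ⊢
      set p := M.flowInv v x
      obtain ⟨h1, h2⟩ := (flow_mem_domain_iff hva p).1 hxd
      have h3 := (hva.gap_pos_iff h1 p.2).1 ((hv.flow_mem_iff h1 h2).1 hx)
      have h4 := (hva.root_spec h1 (σ := -1) (by simp)).1.2
      have h5 : -(5 / 4) < p.2 := by linarith [h3.1]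
      have h6 := hasDerivAt_integral_translate (f := fun s => Ψ (p.1, s))
        (hΨd.continuous.comp (by fun_prop)) (T := 4) (by norm_num) p.2
      have h7 : Ψ (p.1, p.2 + 4) = 0 := hΨK _ fun h => by
        have := (abs_lt.1 (hK₀s _ h).2.1).2
        simp only at this
        linarith
      rw [h7, zero_sub] at h6
      have h8 : HasDerivAt (fun s => φ' (p.1, s)) (Ψ (p.1, p.2)) p.2 := by
        have h9 := h6.neg
        rw [neg_neg] at h9
        refine h9.congr_of_eventuallyEq ?_
        filter_upwards [lt_mem_nhds h5] with s hs
        have : χ s = 1 := Real.smoothTransition.one_of_one_le (by linarith)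
        simp [hφ', this, hI]
      exact fderiv_field_eq hva (hφd.differentiable (by simp)) hφflow h8
    · have h1 : φ =ᶠ[nhds x] fun _ => 0 :=
        notMem_tsupport_iff_eventuallyEq.1 fun h => hxd (hKdom (hsupp h))
      have h2 : ψ x = 0 := by
        by_contra h
        exact hxd (hψs (subset_tsupport ψ h)).1
      rw [h1.fderiv_eq, h2]
      simp
  -- From an outflow point on, the leaf stays out of `Ω` within the domain, and the source vanishes.
  · rw [graph_eq_flow hva, hφflow]
    have : I (M.leaf v y, M.time v y) = 0 := hIzero _ fun τ hτ h => by
      obtain ⟨h1, h2, h3⟩ := hK₀s _ h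
      have h4 := ((hva.gap_pos_iff h1 _).1 h3).2
      simp only at h4
      rw [hva.root_leaf (by simp) hy, one_mul] at h4
      linarith [hτ.1]
    simp [hφ', this]

theorem divergence_smul_eq_of_tsupport (hb : EqOn b (M.field v) (M.domain v)) {φ : E d → ℝ}
    (hφ : Differentiable ℝ φ) (hs : tsupport φ ⊆ M.domain v) (x : E d) :
    divergence (fun y => φ y • b y) x = fderiv ℝ φ x (M.field v x) := by
  by_cases hx : x ∈ M.domain v
  · exact divergence_smul_eq hb hφ hx
  · have h1 : φ =ᶠ[nhds x] fun _ => 0 := notMem_tsupport_iff_eventuallyEq.1 fun h => hx (hs h)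
    have h2 : (fun y => φ y • b y) =ᶠ[nhds x] fun _ => 0 := by
      filter_upwards [h1] with y hy
      rw [hy, zero_smul]
    rw [divergence, h2.fderiv_eq, h1.fderiv_eq]
    simp

/-- Uniqueness of weak solutions. -/
theorem Fits.unique_isWeakSolution (hΩ : IsOpen Ω) (hv : M.Fits v)
    (hb : EqOn b (M.field v) (M.domain v)) {gIn u uOut w wOut : E d → ℝ}
    (hu : IsWeakSolution A b gIn (M.domain v) u uOut)
    (hw : IsWeakSolution A b gIn (M.domain v) w wOut) :
    u =ᵐ[volume.restrict (M.domain v ∩ Ω)] w ∧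
      uOut =ᵐ[A.surface.restrict (M.domain v ∩ A.outflow b)] wOut := by
  set g : (E d → ℝ) → E d → ℝ := fun φ x => fderiv ℝ φ x (M.field v x) with hg
  have hgc : ∀ φ : E d → ℝ, ContDiff ℝ ∞ φ → Continuous (g φ) := fun φ hφ =>
    (hφ.continuous_fderiv (by simp)).clm_apply contDiff_field.continuous
  have hgs : ∀ φ : E d → ℝ, tsupport (g φ) ⊆ tsupport φ := fun φ => by
    refine (closure_mono fun x hx => ?_).trans (tsupport_fderiv_subset ℝ)
    simp only [hg, Function.mem_support] at hx ⊢
    intro h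
    rw [h] at hx
    simp at hx
  -- In the difference of the two weak formulations the inflow data cancel.
  have key : ∀ φ : E d → ℝ, ContDiff ℝ ∞ φ → HasCompactSupport φ → tsupport φ ⊆ M.domain v →
      ∫ x in Ω, (u x - w x) * g φ x =
        ∫ x in A.outflow b, φ x * (inner ℝ (b x) (A.normal x) * (uOut x - wOut x))
          ∂A.surface := by
    intro φ hφ hφc hφs
    have h1 := hu.weak φ hφ hφc hφs
    have h2 := hw.weak φ hφ hφc hφs
    simp only [divergence_smul_eq_of_tsupport hb (hφ.differentiable (by simp)) hφs] at h1 h2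
    have hgcs : HasCompactSupport (g φ) :=
      hφc.isCompact.of_isClosed_subset (isClosed_tsupport _) (hgs φ)
    have i1 := integrable_mul_of_locallyIntegrableOn isClosed_closure
      (restrict_closure_restrict volume Ω) hu.locallyIntegrable (hgc φ hφ) hgcs
      ((hgs φ).trans hφs)
    have i2 := integrable_mul_of_locallyIntegrableOn isClosed_closure
      (restrict_closure_restrict volume Ω) hw.locallyIntegrable (hgc φ hφ) hgcs
      ((hgs φ).trans hφs)
    have i3 := integrable_mul_of_locallyIntegrableOn isClosed_frontier
      (A.restrict_outflow_restrict_frontier b) hu.locallyIntegrable_trace hφ.continuous hφc hφs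
    have i4 := integrable_mul_of_locallyIntegrableOn isClosed_frontier
      (A.restrict_outflow_restrict_frontier b) hw.locallyIntegrable_trace hφ.continuous hφc hφs
    have e1 : ∫ x in Ω, (u x - w x) * g φ x =
        (∫ x in Ω, u x * g φ x) - ∫ x in Ω, w x * g φ x := by
      rw [← integral_sub i1 i2]
      simp only [sub_mul]
    have e2 : ∫ x in A.outflow b, φ x * (inner ℝ (b x) (A.normal x) * (uOut x - wOut x))
        ∂A.surface = (∫ x in A.outflow b, inner ℝ (b x) (A.normal x) * uOut x * φ x ∂A.surface) -
          ∫ x in A.outflow b, inner ℝ (b x) (A.normal x) * wOut x * φ x ∂A.surface := by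
      rw [← integral_sub i3 i4]
      congr 1
      ext1 x
      ring
    have e3 : ∀ f : E d → ℝ, ∫ x in A.outflow b, f x * φ x * inner ℝ (b x) (A.normal x) ∂A.surface =
        ∫ x in A.outflow b, inner ℝ (b x) (A.normal x) * f x * φ x ∂A.surface := fun f => by
      congr 1
      ext1 x
      ring
    rw [e1, e2, ← e3, ← e3, h1, h2]
    ring
  have hout := hv.domain_inter_outflow hΩ hb
  have hzero : ∀ φ : E d → ℝ, tsupport φ ⊆ M.domain v → ∀ x ∉ M.domain v, φ x = 0 :=
    fun φ hφs x hx => by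
      by_contra h
      exact hx (hφs (subset_tsupport _ h))
  -- Duality: for an arbitrary source `ψ` the adjoint equation has a solution that vanishes at the
  -- outflow, so the difference of the solutions is orthogonal to `ψ`.
  have step1 : ∀ᵐ x ∂(volume : Measure (E d)), x ∈ M.domain v ∩ Ω → u x - w x = 0 := by
    refine (isOpen_domain.inter hΩ).ae_eq_zero_of_integral_contDiff_smul_eq_zero ?_ ?_
    · rw [locallyIntegrableOn_iff (isOpen_domain.inter hΩ).isLocallyClosed]
      intro K hK hKc
      have h1 := (hu.locallyIntegrable.sub hw.locallyIntegrable).integrableOn_compact_subset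
        (hK.trans (inter_subset_inter_right _ subset_closure)) hKc
      rwa [IntegrableOn, Measure.restrict_restrict hKc.measurableSet,
        inter_eq_left.2 (hK.trans inter_subset_right)] at h1
    · intro ψ hψ hψc hψs
      obtain ⟨φ, hφ, hφc, hφs, h1, h2⟩ := hv.exists_test_function hψ hψc hψs
      have h3 := key φ hφ hφc hφs
      rw [setIntegral_eq_of_domain (M := M) (v := v)
        (fun x hx => by rw [hzero φ hφs x hx, zero_mul]), hout] at h3
      have hm : MeasurableSet (M.graph '' M.crossing 1 v) :=
        measurableEmbedding_graph.measurableSet_image.2 (UTurn.isOpen_crossing 1).measurableSet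
      rw [setIntegral_congr_fun (g := fun _ => (0 : ℝ)) hm, integral_zero] at h3
      · rw [← setIntegral_eq_integral_of_forall_compl_eq_zero (s := Ω), ← h3]
        · refine setIntegral_congr_fun hΩ.measurableSet fun x hx => ?_
          simp only [hg, h1 x hx, smul_eq_mul]
          ring
        · intro x hx
          have : ψ x = 0 := by
            by_contra h
            exact hx (hψs (subset_tsupport _ h)).2
          rw [this, zero_smul]
      · rintro _ ⟨y, hy, rfl⟩
        simp only [h2 y hy, zero_mul]
  have hUΩ : MeasurableSet (M.domain v ∩ Ω) := (isOpen_domain.inter hΩ).measurableSet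
  refine ⟨?_, ?_⟩
  · refine (ae_restrict_iff' hUΩ).2 ?_
    filter_upwards [step1] with x hx hx2 using sub_eq_zero.1 (hx hx2)
  -- Once the solutions agree in `Ω`, the volume term vanishes for every test function, and only the
  -- traces are tested.
  · have step2 : ∀ᵐ x ∂A.surface.restrict (A.outflow b), x ∈ M.domain v →
        inner ℝ (b x) (A.normal x) * (uOut x - wOut x) = 0 := by
      refine isOpen_domain.ae_eq_zero_of_integral_contDiff_smul_eq_zero ?_ fun φ hφ hφc hφs => ?_
      · refine locallyIntegrableOn_of_inter isOpen_domain isClosed_frontier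
          (A.restrict_outflow_restrict_frontier b) ?_
        refine (hu.locallyIntegrable_trace.sub hw.locallyIntegrable_trace).congr ?_
        exact .of_forall fun x => by simp only [Pi.sub_apply]; ring
      · simp only [smul_eq_mul]
        rw [← key φ hφ hφc hφs]
        refine integral_eq_zero_of_ae ?_
        refine (ae_restrict_iff' hΩ.measurableSet).2 ?_
        filter_upwards [step1] with x hx hxΩ
        by_cases hxd : x ∈ M.domain v
        · simp [hx ⟨hxd, hxΩ⟩]
        · have : g φ x = 0 := by
            by_contra h
            exact hxd (hφs (hgs φ (subset_tsupport _ h)))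
          simp [this]
    have hm : MeasurableSet (M.graph '' M.crossing 1 v) :=
      measurableEmbedding_graph.measurableSet_image.2 (UTurn.isOpen_crossing 1).measurableSet
    have h3 := ae_restrict_of_ae (s := M.domain v) step2
    rw [Measure.restrict_restrict isOpen_domain.measurableSet, hout] at h3
    rw [hout]
    filter_upwards [h3, ae_restrict_mem hm] with x hx hxm
    rw [← hout] at hxm
    exact sub_eq_zero.1 ((mul_eq_zero.1 (hx hxm.1)).resolve_left hxm.2.2.ne')

end LocalChart

/-! ### Well-posedness and the quantity of interest -/

/-- The Sobolev norm of the inflow data enters well-posedness only through integrability in this one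
chart. -/
theorem LocallyIntegrable.of_boundaryNorm {d k : ℕ} {Ω : Set (E d)} {A : BoundaryAtlas d k Ω}
    (M : LocalChart A) {s : ℝ} {p : ℝ≥0∞} (hp : 1 ≤ p) {gIn : E d → ℝ}
    (hg : boundaryNorm A s p gIn < ⊤) :
    IntegrableOn (fun y => gIn (M.graph y)) (ball M.xs M.radius) := by
  have h1 := (sobolevNorm_comp_param_le_boundaryNorm A s p gIn M.j).trans_lt hg
  have h2 : MemLp (fun y => gIn (A.param M.j y)) p (volume.restrict (A.base M.j)) :=
    ⟨aestronglyMeasurable_of_sobolevNorm_lt_top h1,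
      (eLpNorm_le_sobolevNorm (A.isOpen_base M.j)).trans_lt h1⟩
  have : IsFiniteMeasure (volume.restrict (ball M.xs M.radius)) :=
    isFiniteMeasure_restrict.2 measure_ball_lt_top.ne
  have h3 := (h2.mono_measure (Measure.restrict_mono M.ball_subset le_rfl)).integrable hp
  refine IntegrableOn.congr_fun h3 (fun y hy => ?_) measurableSet_ball
  simp only [LocalChart.graph_eq_param hy]

namespace LocalChart

variable {d k : ℕ} {Ω : Set (E d)} {A : BoundaryAtlas d k Ω} {M : LocalChart A} {v : E (d - 1)}
  {b : E d → E d}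

theorem areaDensity_le {y : E (d - 1)} (hy : y ∈ ball M.xs M.radius) :
    A.areaDensity M.j y ≤ 2 + ‖M.slope‖ := by
  have h1 : ‖gradient (A.height M.j) y‖ ≤ ‖M.slope‖ + 1 := by
    rw [gradient, LinearIsometryEquiv.norm_map, (hasFDerivAt_height hy).fderiv]
    refine (norm_add_le _ _).trans ?_
    linarith [M.norm_fderiv_r_le y]
  refine (Real.sqrt_le_left (by positivity)).2 ?_
  nlinarith [norm_nonneg (gradient (A.height M.j) y), norm_nonneg M.slope]

theorem leafFunction_graph {σ : ℝ} (hσ : |σ| = 1) {y : E (d - 1)} (hy : y ∈ M.crossing σ v)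
    (F : E (d - 1) → ℝ) : M.leafFunction v F (M.graph y) = F (M.leaf v y) := by
  rw [leafFunction, indicator_of_mem (graph_mem_domain hσ hy), flowInv_graph]

/-- The trace is determined only inside the domain, whereas the quantity of interest is an integral
over all of the outflow boundary. On the boundary `gOut` vanishes outside the domain, so nothing
else is seen. -/
theorem ae_indicator_eq (b : E d → E d) {gOut : E d → ℝ}
    (hs : closure {x | x ∈ frontier Ω ∧ gOut x ≠ 0} ⊆ M.domain v) (uOut : E d → ℝ) :
    (fun x => gOut x * uOut x) =ᵐ[A.surface.restrict (A.outflow b)]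
      (M.domain v).indicator fun x => gOut x * uOut x := by
  filter_upwards [A.ae_outflow_mem_frontier b] with x hx
  by_cases hxd : x ∈ M.domain v
  · rw [indicator_of_mem hxd]
  · rw [indicator_of_notMem hxd]
    have : gOut x = 0 := by
      by_contra h
      exact hxd (hs (subset_closure ⟨hx, h⟩))
    rw [this, zero_mul]

theorem Fits.integrableOn_leafData_comp (hv : M.Fits v) {gIn : E d → ℝ}
    (hg : IntegrableOn (fun y => gIn (M.graph y)) (ball M.xs M.radius)) {σ : ℝ} (hσ : |σ| = 1) :
    IntegrableOn (fun y => M.leafData v gIn (M.leaf v y)) (M.crossing σ v) :=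
  (hv.admissible.integrableOn_det_mul_iff hσ _).1
    ((hv.admissible.integrableOn_leaves_iff hσ _).1 (hv.integrableOn_leafData hg))

theorem Fits.integrableOn_outflow (hΩ : IsOpen Ω) (hv : M.Fits v)
    (hb : EqOn b (M.field v) (M.domain v)) {gIn : E d → ℝ}
    (hg : IntegrableOn (fun y => gIn (M.graph y)) (ball M.xs M.radius)) {gOut : E d → ℝ}
    (hgOut : Continuous gOut) {C : ℝ} (hC : ∀ x, ‖gOut x‖ ≤ C)
    (hs : closure {x | x ∈ frontier Ω ∧ gOut x ≠ 0} ⊆ M.domain v) {u uOut : E d → ℝ}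
    (hu : IsWeakSolution A b gIn (M.domain v) u uOut) :
    IntegrableOn (fun x => gOut x * uOut x) (A.outflow b) A.surface := by
  have hσ : |(1 : ℝ)| = 1 := by simp
  have hD := (UTurn.isOpen_crossing (M := M.toUTurn) (v := v) 1).measurableSet
  rw [IntegrableOn, integrable_congr (ae_indicator_eq b hs uOut),
    integrable_indicator_iff isOpen_domain.measurableSet, IntegrableOn,
    Measure.restrict_restrict isOpen_domain.measurableSet]
  have h1 := (hv.unique_isWeakSolution hΩ hb hu (hv.isWeakSolution hΩ hb hg)).2
  have h2 : (fun x => gOut x * uOut x) =ᵐ[A.surface.restrict (M.domain v ∩ A.outflow b)]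
      fun x => gOut x * M.leafFunction v (M.leafData v gIn) x := by
    filter_upwards [h1] with x hx
    rw [hx]
  rw [integrable_congr h2, hv.domain_inter_outflow hΩ hb]
  change IntegrableOn _ _ _
  rw [integrableOn_image_graph_iff hΩ hD (hv.crossing_subset hσ)]
  have h3 := Integrable.bdd_mul (f := fun y => A.areaDensity M.j y * gOut (M.graph y))
    (c := (2 + ‖M.slope‖) * C) (hv.integrableOn_leafData_comp hg hσ)
    ((A.measurable_areaDensity M.j).mul
      (hgOut.comp continuous_graph).measurable).aestronglyMeasurable ?_
  · refine IntegrableOn.congr_fun h3 (fun y hy => ?_) hD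
    simp only [leafFunction_graph hσ hy, mul_assoc]
  · refine (ae_restrict_iff' hD).2 (.of_forall fun y hy => ?_)
    rw [norm_mul, Real.norm_of_nonneg (zero_le_one.trans (A.one_le_areaDensity M.j y))]
    exact mul_le_mul (areaDensity_le (hv.crossing_subset hσ hy)) (hC _) (norm_nonneg _)
      (by positivity)

/-- The transport problem for the parabolic flow is well posed. -/
theorem Fits.isWellPosed (hΩ : IsOpen Ω) (hv : M.Fits v)
    (hb : EqOn b (M.field v) (M.domain v)) {s : ℝ} {p : ℝ≥0∞} (hp : 1 ≤ p) {gOut : E d → ℝ}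
    (hgOut : Continuous gOut) {C : ℝ} (hC : ∀ x, ‖gOut x‖ ≤ C)
    (hs : closure {x | x ∈ frontier Ω ∧ gOut x ≠ 0} ⊆ M.domain v) :
    IsWellPosed A s p b gOut (M.domain v) where
  isOpen := isOpen_domain
  support_subset := hs
  exists_solution _ hg :=
    ⟨_, _, hv.isWeakSolution hΩ hb (LocallyIntegrable.of_boundaryNorm M hp hg)⟩
  unique_solution _ _ _ _ _ _ hu hw := hv.unique_isWeakSolution hΩ hb hu hw
  integrable _ hg _ _ hu := hv.integrableOn_outflow hΩ hb
    (LocallyIntegrable.of_boundaryNorm M hp hg) hgOut hC hs hu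

/-- The quantity of interest as an integral in the chart. -/
theorem Fits.setIntegral_outflow (hΩ : IsOpen Ω) (hv : M.Fits v)
    (hb : EqOn b (M.field v) (M.domain v)) {gIn : E d → ℝ}
    (hg : IntegrableOn (fun y => gIn (M.graph y)) (ball M.xs M.radius)) {gOut : E d → ℝ}
    (hs : closure {x | x ∈ frontier Ω ∧ gOut x ≠ 0} ⊆ M.domain v) {r : ℝ}
    (hr : r ≤ M.speed v ^ 2 / 128)
    (hs' : ∀ y ∈ ball M.xs M.radius, y ∉ ball M.xs r → gOut (M.graph y) = 0) {u uOut : E d → ℝ}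
    (hu : IsWeakSolution A b gIn (M.domain v) u uOut) :
    ∫ x in A.outflow b, gOut x * uOut x ∂A.surface =
      ∫ y in ball M.xs r,
        A.areaDensity M.j y * gOut (M.graph y) * gIn (M.graph (M.transport v y)) := by
  have hσ : |(1 : ℝ)| = 1 := by simp
  have hD := (UTurn.isOpen_crossing (M := M.toUTurn) (v := v) 1).measurableSet
  rw [integral_congr_ae (ae_indicator_eq b hs uOut),
    integral_indicator isOpen_domain.measurableSet,
    Measure.restrict_restrict isOpen_domain.measurableSet]
  have h1 := (hv.unique_isWeakSolution hΩ hb hu (hv.isWeakSolution hΩ hb hg)).2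
  have h2 : (fun x => gOut x * uOut x) =ᵐ[A.surface.restrict (M.domain v ∩ A.outflow b)]
      fun x => gOut x * M.leafFunction v (M.leafData v gIn) x := by
    filter_upwards [h1] with x hx
    rw [hx]
  rw [integral_congr_ae h2, hv.domain_inter_outflow hΩ hb,
    setIntegral_image_graph hΩ hD (hv.crossing_subset hσ)]
  have hsub : ball M.xs r ⊆ M.crossing 1 v :=
    (ball_subset_ball hr).trans hv.admissible.ball_subset_crossing
  rw [setIntegral_eq_of_subset_of_forall_sdiff_eq_zero hD hsub fun y hy => by
    rw [hs' y (hv.crossing_subset hσ hy.1) hy.2]; ring]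
  refine setIntegral_congr_fun measurableSet_ball fun y hy => ?_
  simp only [leafFunction_graph hσ (hsub hy), mul_assoc]
  rfl

end LocalChart

/-! ### The response as a function of the velocity: bounds and continuity. -/

namespace UTurn

variable {n : ℕ} {M : UTurn n} {v : E n}

/-- The transport map does not increase integrals by more than a constant factor. -/
theorem Admissible.integrableOn_comp_transport (hv : M.Admissible v) {B D : Set (E n)}
    (hB : B ⊆ M.crossing 1 v) (hD : M.crossing (-1) v ⊆ D)
    {f : E n → ℝ} (hf : IntegrableOn f D) :
    IntegrableOn (fun y => f (M.transport v y)) B ∧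
      ∫ y in B, |f (M.transport v y)| ≤ 16 * ∫ y in D, |f y| := by
  have h1 : |(1 : ℝ)| = 1 := by simp
  have h2 : |(-1 : ℝ)| = 1 := by simp
  have hm1 := (isOpen_crossing (M := M) (v := v) 1).measurableSet
  have hm2 := (isOpen_crossing (M := M) (v := v) (-1)).measurableSet
  have h0 := hv.speed_pos
  have key : ∀ f : E n → ℝ, IntegrableOn f D →
      IntegrableOn (fun L => f (M.cross (-1) v L)) (M.leaves v) := by
    intro f hf
    rw [hv.integrableOn_leaves_iff h2]
    refine IntegrableOn.congr_fun ((hv.integrableOn_det_mul_iff h2 f).2 (hf.mono_set hD))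
      (fun y hy => ?_) hm2
    simp only [hv.cross_leaf h2 hy]
  have i1 := (hv.integrableOn_leaves_iff h1 _).1 (key f hf)
  have i2 := (hv.integrableOn_det_mul_iff h1 _).1 i1
  refine ⟨i2.mono_set hB, ?_⟩
  have i3 := (hv.integrableOn_leaves_iff h1 _).1 (key _ hf.abs)
  have i4 := (hv.integrableOn_leaves_iff h2 _).1 (key _ hf.abs)
  -- The Jacobian is at least `speed / 8` at outflow points and at most `2 * speed` at inflow
  -- points. The speed cancels and the factor `16` remains.
  calc ∫ y in B, |f (M.transport v y)|
      ≤ ∫ y in M.crossing 1 v, |f (M.transport v y)| :=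
        setIntegral_mono_set i2.abs (.of_forall fun _ => abs_nonneg _) hB.eventuallyLE
    _ ≤ ∫ y in M.crossing 1 v, 8 / M.speed v *
          (|(M.leafDeriv v y).det| * |f (M.cross (-1) v (M.leaf v y))|) := by
        refine setIntegral_mono_on i2.abs (i3.const_mul _) hm1 fun y hy => ?_
        have h3 := (hv.det_leafDeriv_mem h1 hy).1
        rw [← hv.abs_det_leafDeriv h1 hy] at h3
        change |f (M.cross (-1) v (M.leaf v y))| ≤ _
        rw [← mul_assoc]
        refine le_mul_of_one_le_left (abs_nonneg _) ?_
        rw [div_mul_eq_mul_div, le_div_iff₀ h0]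
        linarith
    _ = 8 / M.speed v * ∫ y in M.crossing (-1) v,
          |(M.leafDeriv v y).det| * |f (M.cross (-1) v (M.leaf v y))| := by
        rw [integral_const_mul,
          ← hv.setIntegral_leaves h1 fun L => |f (M.cross (-1) v L)|,
          ← hv.setIntegral_leaves h2 fun L => |f (M.cross (-1) v L)|]
    _ ≤ 8 / M.speed v * ∫ y in M.crossing (-1) v, 2 * M.speed v * |f y| := by
        refine mul_le_mul_of_nonneg_left ?_ (by positivity)
        refine setIntegral_mono_on i4
          ((hf.abs.mono_measure (Measure.restrict_mono hD le_rfl)).const_mul _) hm2 fun y hy => ?_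
        have h3 := (hv.det_leafDeriv_mem h2 hy).2
        rw [← hv.abs_det_leafDeriv h2 hy] at h3
        rw [hv.cross_leaf h2 hy]
        exact mul_le_mul_of_nonneg_right h3 (abs_nonneg _)
    _ = 16 * ∫ y in M.crossing (-1) v, |f y| := by
        rw [integral_const_mul]
        field_simp
        ring
    _ ≤ 16 * ∫ y in D, |f y| := by
        refine mul_le_mul_of_nonneg_left ?_ (by norm_num)
        exact setIntegral_mono_set hf.abs (.of_forall fun _ => abs_nonneg _) hD.eventuallyLE

variable (M) in
/-- The weighted integral of `f` along the transport map. -/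
def response (r : ℝ) (W f : E n → ℝ) (v : E n) : ℝ :=
  ∫ y in ball M.xs r, W y * f (M.transport v y)

theorem Admissible.abs_response_le (hv : M.Admissible v) {r : ℝ} (hr : r ≤ M.speed v ^ 2 / 128)
    {D : Set (E n)} (hD : M.crossing (-1) v ⊆ D) {W : E n → ℝ} {C : ℝ} (hC : 0 ≤ C)
    (hW : ∀ y ∈ ball M.xs r, |W y| ≤ C) {f : E n → ℝ} (hf : IntegrableOn f D) :
    |M.response r W f v| ≤ C * (16 * ∫ y in D, |f y|) := by
  obtain ⟨h1, h2⟩ := hv.integrableOn_comp_transport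
    ((ball_subset_ball hr).trans hv.ball_subset_crossing) hD hf
  refine (norm_integral_le_of_norm_le (f := fun y => W y * f (M.transport v y))
    (h1.abs.const_mul C) ?_).trans ?_
  · refine (ae_restrict_iff' measurableSet_ball).2 (.of_forall fun y hy => ?_)
    rw [norm_mul]
    exact mul_le_mul_of_nonneg_right (hW y hy) (abs_nonneg _)
  · rw [integral_const_mul]
    exact mul_le_mul_of_nonneg_left h2 hC

theorem Admissible.continuousOn_transport (hv : M.Admissible v) :
    ContinuousOn (M.transport v) (ball M.xs (M.speed v ^ 2 / 128)) :=
  (LipschitzOnWith.of_dist_le_mul (K := 19) fun y hy z hz => by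
    rw [dist_eq_norm, dist_eq_norm]
    exact hv.norm_transport_sub_le hy hz).continuousOn

theorem Admissible.response_sub (hv : M.Admissible v) {r : ℝ} (hr : r ≤ M.speed v ^ 2 / 128)
    {D : Set (E n)} (hD : M.crossing (-1) v ⊆ D) {W : E n → ℝ} (hWm : Measurable W) {C : ℝ}
    (hW : ∀ y ∈ ball M.xs r, |W y| ≤ C) {f g : E n → ℝ} (hf : IntegrableOn f D)
    (hg : IntegrableOn g D) :
    M.response r W (f - g) v = M.response r W f v - M.response r W g v := by
  have key : ∀ f : E n → ℝ, IntegrableOn f D →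
      IntegrableOn (fun y => W y * f (M.transport v y)) (ball M.xs r) := fun f hf =>
    Integrable.bdd_mul (c := C) (hv.integrableOn_comp_transport
      ((ball_subset_ball hr).trans hv.ball_subset_crossing) hD hf).1 hWm.aestronglyMeasurable
      ((ae_restrict_iff' measurableSet_ball).2 (.of_forall hW))
  rw [response, response, response, ← integral_sub (key f hf) (key g hg)]
  simp only [Pi.sub_apply, mul_sub]

/-- The data are merely integrable. For continuous data with compact support dominated convergence
applies; general data are reached by uniform approximation, since the response is bounded by the
`L¹` norm with a constant independent of the velocity. -/
theorem continuousOn_response {S : Set (E n)} {r : ℝ} {D : Set (E n)} (hDm : MeasurableSet D)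
    (hS : ∀ w ∈ S, M.Admissible w ∧ r ≤ M.speed w ^ 2 / 128 ∧ M.crossing (-1) w ⊆ D)
    {W : E n → ℝ} (hWm : Measurable W) {C : ℝ} (hC : 0 ≤ C)
    (hW : ∀ y ∈ ball M.xs r, |W y| ≤ C) {f : E n → ℝ} (hf : IntegrableOn f D) :
    ContinuousOn (M.response r W f) S := by
  refine continuousOn_of_uniform_approx_of_continuousOn fun u hu => ?_
  obtain ⟨ε, hε, hεu⟩ := Metric.mem_uniformity_dist.1 hu
  have hδ : 0 < ε / (C * 16 + 1) := by positivity
  obtain ⟨g, hgc, hgi, hg, hgint⟩ := (hf.integrable_indicator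
    hDm).exists_hasCompactSupport_integral_sub_le (half_pos hδ)
  refine ⟨M.response r W g, ?_, fun w hw => hεu ?_⟩
  · intro v hv
    obtain ⟨c, hc⟩ := hgc.exists_bound_of_continuous hg
    refine continuousWithinAt_of_dominated (bound := fun _ => C * c) ?_ ?_ ?_ ?_
    · filter_upwards [self_mem_nhdsWithin] with w hw
      obtain ⟨h1, h2, h3⟩ := hS w hw
      exact hWm.aestronglyMeasurable.mul ((hg.comp_continuousOn
        (h1.continuousOn_transport.mono (ball_subset_ball h2))).aestronglyMeasurable
          measurableSet_ball)
    · refine .of_forall fun w => (ae_restrict_iff' measurableSet_ball).2 (.of_forall fun y hy => ?_)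
      rw [norm_mul]
      exact mul_le_mul (hW y hy) (hc _) (norm_nonneg _) hC
    · exact integrableOn_const (by finiteness)
    · refine (ae_restrict_iff' measurableSet_ball).2 (.of_forall fun y hy => ?_)
      refine continuousWithinAt_const.mul (hg.continuousAt.comp_continuousWithinAt ?_)
      refine Admissible.continuousWithinAt_transport (fun w hw => (hS w hw).1) hv fun w hw => ?_
      obtain ⟨h1, h2, -⟩ := hS w hw
      exact (h1.ball_subset_crossing (ball_subset_ball h2 hy)).1
  · obtain ⟨h1, h2, h3⟩ := hS w hw
    have h4 : ∫ y in D, |(f - g) y| ≤ ε / (C * 16 + 1) / 2 := by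
      refine le_trans ?_ hgi
      refine le_trans (le_of_eq ?_) (setIntegral_le_integral (s := D)
        ((hf.integrable_indicator hDm).sub hgint).norm (.of_forall fun _ => norm_nonneg _))
      refine setIntegral_congr_fun hDm fun y hy => ?_
      simp [indicator_of_mem hy]
    have h5 := h1.abs_response_le h2 h3 hC hW (hf.sub hgint.integrableOn)
    rw [Real.dist_eq, ← h1.response_sub h2 h3 hWm hW hf hgint.integrableOn]
    refine h5.trans_lt ?_
    have h6 : C * (16 * ∫ y in D, |(f - g) y|) ≤ C * (16 * (ε / (C * 16 + 1) / 2)) := by gcongr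
    refine h6.trans_lt ?_
    have h7 : C * (16 * (ε / (C * 16 + 1) / 2)) = ε * (C * 8 / (C * 16 + 1)) := by
      field_simp
      ring
    rw [h7]
    refine mul_lt_of_lt_one_right hε ?_
    rw [div_lt_one (by positivity)]
    linarith

end UTurn

/-! ### Choice of the velocities -/

theorem exists_localChart {d k : ℕ} (hd : 2 ≤ d) {Ω : Set (E d)} (hΩ : IsOpen Ω)
    (A : BoundaryAtlas d k Ω) {s : ℝ} (hs : 1 ≤ s) {Ξ : ℝ × E (d - 1) → E d}
    (hΞ : IsReferenceMap s Ω Ξ) : Nonempty (LocalChart A) := by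
  obtain ⟨j, y₀, ρ, hρ, hb, hh, hc⟩ := A.exists_regular_point hΩ hs hΞ
  obtain ⟨r, ρ₁, hρ₁, hρρ, hr, hδ, he⟩ :=
    exists_contDiff_extension hρ hh (δ := 1 / 64) (by norm_num)
  have hsub := ball_subset_ball (x := y₀) hρρ
  exact ⟨{
    e := EuclideanSpace.single ⟨0, by omega⟩ 1
    xs := y₀
    r := r
    norm_e := by simp
    contDiff_r := hr
    norm_fderiv_r_le := hδ
    j := j
    radius := ρ₁
    radius_pos := hρ₁
    height₀ := A.height j y₀
    slope := fderiv ℝ (A.height j) y₀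
    ball_subset := hsub.trans hb
    height_eq := he
    mem_cell := fun y hy => hc y (hsub hy) }⟩

namespace LocalChart

variable {d k : ℕ} {Ω : Set (E d)} {A : BoundaryAtlas d k Ω} (M : LocalChart A)

/-- For the two points `xs` and `yc` at distance `2 * ε` in direction `e`, the travel time is close
to `2` and the connecting velocity close to `ε • e`, which fits if `ε` is small. All conditions are
open and the velocity depends continuously on its end points, so they persist for nearby pairs. -/
theorem exists_velocities :
    ∃ (vc yc : E (d - 1)) (η r : ℝ), 0 < η ∧ 0 < r ∧
      (∀ v ∈ closedBall vc η, M.Fits v ∧ r ≤ M.speed v ^ 2 / 128) ∧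
      ∀ x ∈ ball M.xs r, ∀ y ∈ ball yc r, ∃ v ∈ ball vc (η / 2), M.transport v x = y := by
  have hw := A.width_pos M.j
  have hR := M.radius_pos
  have hee : inner ℝ M.e M.e = (1 : ℝ) := by
    rw [real_inner_self_eq_norm_sq, M.norm_e, one_pow]
  obtain ⟨ε, hε, hε1, hε2, hε3⟩ : ∃ ε : ℝ, 0 < ε ∧ ε ≤ 1 / 2 ∧ ε ≤ M.radius / 8 ∧
      ε ≤ A.width M.j / 2 :=
    ⟨min (1 / 2) (min (M.radius / 8) (A.width M.j / 2)), by positivity, min_le_left _ _,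
      (min_le_right _ _).trans (min_le_left _ _), (min_le_right _ _).trans (min_le_right _ _)⟩
  set yc := M.xs - (2 * ε) • M.e with hyc
  have hxy : M.xs - yc = (2 * ε) • M.e := by rw [hyc, sub_sub_cancel]
  have hD : inner ℝ (M.xs - yc) M.e = 2 * ε := by
    rw [hxy, inner_smul_left, hee]; simp
  have hden : inner ℝ (M.xs - yc) M.e / 2 - inner ℝ (M.xs - M.xs) M.e = ε := by
    rw [hD, sub_self, inner_zero_left]; ring
  set τ := M.travelTime M.xs yc with hτ
  have hτeq : τ * ε = 2 * ε - (M.r M.xs - M.r yc) := by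
    rw [hτ, UTurn.travelTime, hden, hD]
    field_simp
  have hrd : |M.r M.xs - M.r yc| ≤ ε / 32 := by
    have h := M.abs_r_sub_le M.xs yc
    rw [hxy, norm_smul, M.norm_e, Real.norm_of_nonneg (by positivity)] at h
    linarith
  have hτ1 : 63 / 32 ≤ τ := by
    rw [abs_le] at hrd
    nlinarith
  set vc := M.connect M.xs yc with hvc
  have hvce : vc = (2 * ε / τ) • M.e := by
    rw [hvc, UTurn.connect, hxy, ← hτ, smul_smul]
    congr 1
    ring
  set a := 2 * ε / τ with ha
  have ha0 : 0 < a := by positivity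
  have ha1 : a ≤ 64 / 63 * ε := by
    rw [ha, div_le_iff₀ (by linarith)]
    nlinarith
  have hsp : M.speed vc = a := by
    rw [UTurn.speed, hvce, inner_smul_left, hee]; simp
  have hnv : ‖vc‖ = a := by
    rw [hvce, norm_smul, M.norm_e, mul_one, Real.norm_of_nonneg ha0.le]
  have hspc := M.continuous_speed
  have hev : ∀ᶠ v in nhds vc, a / 2 < M.speed v ∧ M.speed v < 1 ∧ ‖v‖ < 2 * M.speed v ∧
      6 * M.speed v < M.radius ∧ M.speed v < A.width M.j := by
    refine (hspc.continuousAt.eventually_const_lt (by rw [hsp]; linarith)).and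
      ((hspc.continuousAt.eventually_lt_const (by rw [hsp]; linarith)).and ?_)
    refine (continuous_norm.continuousAt.eventually_lt (g := fun v => 2 * M.speed v)
      (by fun_prop) (by rw [hnv, hsp]; linarith)).and ?_
    have h6 : ContinuousAt (fun v => 6 * M.speed v) vc := by fun_prop
    refine (h6.eventually_lt_const (by
      change 6 * M.speed vc < _; rw [hsp]; linarith)).and (hspc.continuousAt.eventually_lt_const (by rw [hsp]; linarith))
  obtain ⟨η, hη, hball⟩ := Metric.eventually_nhds_iff_ball.1 hev
  have hfits : ∀ v ∈ ball vc η, M.Fits v ∧ a ^ 2 / 512 ≤ M.speed v ^ 2 / 128 := by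
    intro v hv
    obtain ⟨h1, h2, h3, h4, h5⟩ := hball v hv
    exact ⟨⟨⟨by linarith, h2.le, h3.le⟩, h4, h5⟩, by nlinarith⟩
  have hr := M.contDiff_r.continuous
  have hden0 : inner ℝ (M.xs - yc) M.e / 2 - inner ℝ (M.xs - M.xs) M.e ≠ 0 := by
    rw [hden]; exact hε.ne'
  have c0 : ContinuousAt (fun p : E (d - 1) × E (d - 1) =>
      inner ℝ (p.1 - p.2) M.e / 2 - inner ℝ (p.1 - M.xs) M.e) (M.xs, yc) := by fun_prop
  have c1 : ContinuousAt (fun p : E (d - 1) × E (d - 1) => M.travelTime p.1 p.2) (M.xs, yc) := by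
    unfold UTurn.travelTime
    exact ContinuousAt.div (by fun_prop) c0 hden0
  have hτ0 : M.travelTime M.xs yc ≠ 0 := by rw [← hτ]; linarith
  have c2 : ContinuousAt (fun p : E (d - 1) × E (d - 1) => M.connect p.1 p.2) (M.xs, yc) := by
    unfold UTurn.connect
    exact (c1.inv₀ hτ0).smul (by fun_prop)
  have c3 : ContinuousAt (fun p : E (d - 1) × E (d - 1) => M.time (M.connect p.1 p.2) p.1 -
      M.travelTime p.1 p.2) (M.xs, yc) := by
    unfold UTurn.time
    refine ContinuousAt.sub (ContinuousAt.add (ContinuousAt.div (by fun_prop)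
      (hspc.continuousAt.comp c2) ?_) continuousAt_const) c1
    change M.speed vc ≠ 0
    rw [hsp]
    exact ha0.ne'
  have hev2 : ∀ᶠ p in nhds (M.xs, yc), M.connect p.1 p.2 ∈ ball vc (η / 4) ∧
      inner ℝ (p.1 - p.2) M.e / 2 - inner ℝ (p.1 - M.xs) M.e ≠ 0 ∧ M.travelTime p.1 p.2 ≠ 0 ∧
      M.time (M.connect p.1 p.2) p.1 - M.travelTime p.1 p.2 < -1 / 4 := by
    refine (c2.tendsto.eventually (p := fun z => z ∈ ball vc (η / 4))
      (ball_mem_nhds _ (by positivity))).and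
      ((c0.eventually_ne hden0).and ((c1.eventually_ne hτ0).and (c3.eventually_lt_const ?_)))
    change M.time vc M.xs - τ < _
    rw [UTurn.time_xs]
    linarith
  obtain ⟨r₁, hr₁, hball2⟩ := Metric.eventually_nhds_iff_ball.1 hev2
  -- The radius `a ^ 2 / 512` is `(a / 2) ^ 2 / 128`, where `a / 2` is a lower bound of the speeds.
  -- Halving `η` keeps the closed ball inside the open ball of good velocities, and `η / 4` is half
  -- of the radius returned.
  refine ⟨vc, yc, η / 2, min r₁ (a ^ 2 / 512), by positivity, by positivity, fun v hv => ?_,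
    fun x hx y hy => ?_⟩
  · obtain ⟨h1, h2⟩ := hfits v (closedBall_subset_ball (by linarith) hv)
    exact ⟨h1, (min_le_right _ _).trans h2⟩
  · obtain ⟨h1, h2, h3, h4⟩ := hball2 (x, y) (by
      rw [← ball_prod_same]
      exact ⟨ball_subset_ball (min_le_left _ _) hx, ball_subset_ball (min_le_left _ _) hy⟩)
    obtain ⟨h5, h6⟩ := hfits _ (ball_subset_ball (by linarith) h1)
    refine ⟨_, ball_subset_ball (by linarith) h1, UTurn.transport_connect h5.admissible h2 h3 ?_
      h4.le⟩
    exact (h5.admissible.ball_subset_crossing (ball_subset_ball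
      ((min_le_right _ _).trans h6) hx)).1

end LocalChart

/-! ### Smooth functions with bounded derivatives -/

/-- Smooth functions all of whose derivatives are bounded. -/
structure BoundedSmooth {X Y : Type*} [NormedAddCommGroup X] [NormedSpace ℝ X]
    [NormedAddCommGroup Y] [NormedSpace ℝ Y] (f : X → Y) : Prop where
  contDiff : ContDiff ℝ ∞ f
  bounded : ∀ i : ℕ, ∃ C : ℝ, ∀ x, ‖iteratedFDeriv ℝ i f x‖ ≤ C

namespace BoundedSmooth

variable {X Y Z : Type*} [NormedAddCommGroup X] [NormedSpace ℝ X] [NormedAddCommGroup Y]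
  [NormedSpace ℝ Y] [NormedAddCommGroup Z] [NormedSpace ℝ Z] {f g : X → Y}

theorem of_hasCompactSupport (hf : ContDiff ℝ ∞ f) (hc : HasCompactSupport f) :
    BoundedSmooth f :=
  ⟨hf, fun i => (hc.iteratedFDeriv i).exists_bound_of_continuous
    (hf.continuous_iteratedFDeriv (by exact_mod_cast le_top))⟩

theorem add (hf : BoundedSmooth f) (hg : BoundedSmooth g) : BoundedSmooth fun x => f x + g x := by
  refine ⟨hf.contDiff.add hg.contDiff, fun i => ?_⟩
  obtain ⟨C, hC⟩ := hf.bounded i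
  obtain ⟨C', hC'⟩ := hg.bounded i
  refine ⟨C + C', fun x => ?_⟩
  have h : ∀ f : X → Y, ContDiff ℝ ∞ f → ContDiffAt ℝ i f x := fun f hf =>
    (hf.of_le (by exact_mod_cast le_top)).contDiffAt
  have := iteratedFDeriv_add_apply (h f hf.contDiff) (h g hg.contDiff)
  rw [show (fun x => f x + g x) = f + g from rfl, this]
  exact (norm_add_le _ _).trans (add_le_add (hC x) (hC' x))

theorem comp_clm (hf : BoundedSmooth f) (L : Z →L[ℝ] X) : BoundedSmooth fun z => f (L z) := by
  refine ⟨hf.contDiff.comp L.contDiff, fun i => ?_⟩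
  obtain ⟨C, hC⟩ := hf.bounded i
  refine ⟨C * ‖L‖ ^ i, fun z => ?_⟩
  have h := L.iteratedFDeriv_comp_right hf.contDiff z (i := i) (by exact_mod_cast le_top)
  rw [show (fun z => f (L z)) = f ∘ L from rfl, h]
  refine (ContinuousMultilinearMap.norm_compContinuousLinearMap_le _ _).trans ?_
  rw [Finset.prod_const, Finset.card_univ, Fintype.card_fin]
  exact mul_le_mul_of_nonneg_right (hC _) (by positivity)

theorem norm_iteratedFDeriv_sub_le (hf : ContDiff ℝ ∞ f) {i : ℕ} {C : ℝ}
    (hC : ∀ x, ‖iteratedFDeriv ℝ (i + 1) f x‖ ≤ C) (x y : X) :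
    ‖iteratedFDeriv ℝ i f x - iteratedFDeriv ℝ i f y‖ ≤ C * dist x y := by
  rw [dist_eq_norm]
  refine convex_univ.norm_image_sub_le_of_norm_fderiv_le (𝕜 := ℝ) (fun z _ => ?_)
    (fun z _ => ?_) (mem_univ y) (mem_univ x)
  · exact (hf.differentiable_iteratedFDeriv (by exact_mod_cast WithTop.coe_lt_top _)) z
  · rw [norm_fderiv_iteratedFDeriv]
    exact hC z

theorem memHolder (hf : BoundedSmooth f) {s : ℝ} (hs : 0 ≤ s) {S : Set X} (hS : IsOpen S) :
    MemHolder s f S := by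
  refine ⟨(hf.contDiff.of_le (by exact_mod_cast le_top)).contDiffOn, ?_⟩
  choose C hC using hf.bounded
  have hC0 : ∀ x i, 0 ≤ C i := fun x i => (norm_nonneg _).trans (hC i x)
  have hθ : 0 ≤ s - ⌊s⌋₊ := sub_nonneg.2 (Nat.floor_le hs)
  have hθ1 : s - ⌊s⌋₊ ≤ 1 := by linarith [Nat.lt_floor_add_one s]
  set k := ⌊s⌋₊
  have hsum : X → 0 ≤ ∑ i ∈ Finset.range (k + 1), C i := fun x =>
    Finset.sum_nonneg fun i _ => hC0 x i
  refine ⟨2 * (∑ i ∈ Finset.range (k + 1), C i) + C (k + 1), fun i hi x hx => ?_,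
    fun x hx y hy => ?_⟩
  · rw [iteratedFDerivWithin_of_isOpen i hS hx]
    have h1 := Finset.single_le_sum (f := C) (fun i _ => hC0 x i)
      (Finset.mem_range.2 (Nat.lt_succ_of_le hi))
    have h2 := hC0 x (k + 1)
    have h3 := hC0 x i
    linarith [hC i x]
  · rw [iteratedFDerivWithin_of_isOpen k hS hx, iteratedFDerivWithin_of_isOpen k hS hy]
    have h1 := Finset.single_le_sum (f := C) (fun i _ => hC0 x i)
      (Finset.mem_range.2 (Nat.lt_succ_self k))
    have h2 := hC0 x (k + 1)
    have h3 := hC0 x k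
    rcases le_total (dist x y) 1 with h | h
    · refine (norm_iteratedFDeriv_sub_le hf.contDiff (hC (k + 1)) x y).trans ?_
      refine mul_le_mul (by linarith) ?_ dist_nonneg (by linarith [hsum x])
      rcases (dist_nonneg (x := x) (y := y)).eq_or_lt with h0 | h0
      · rw [← h0]; positivity
      · calc dist x y = dist x y ^ (1 : ℝ) := (Real.rpow_one _).symm
          _ ≤ _ := Real.rpow_le_rpow_of_exponent_ge h0 h hθ1
    · refine (norm_sub_le _ _).trans ?_
      have h4 : (1 : ℝ) ≤ dist x y ^ (s - k) := Real.one_le_rpow h hθ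
      have h5 : 0 ≤ 2 * (∑ i ∈ Finset.range (k + 1), C i) + C (k + 1) := by linarith [hsum x]
      have h6 := le_mul_of_one_le_right h5 h4
      linarith [hC k x, hC k y]

end BoundedSmooth

/-! ### The parametric flow field -/

/-- The projection to the first coordinates. -/
def firstCoords {n m : ℕ} (h : n ≤ m) : E m →L[ℝ] E n :=
  LinearMap.toContinuousLinearMap
    { toFun := fun x => WithLp.toLp 2 fun i => x (Fin.castLE h i)
      map_add' := fun _ _ => rfl
      map_smul' := fun _ _ => rfl }

theorem exists_firstCoords_eq {n m : ℕ} (h : n ≤ m) :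
    ∃ J : E n →L[ℝ] E m, ∀ w, firstCoords h (J w) = w := by
  have hs : Function.Surjective (firstCoords h : E m →ₗ[ℝ] E n) := fun w => by
    refine ⟨WithLp.toLp 2 fun i => if hi : (i : ℕ) < n then w ⟨i, hi⟩ else 0, ?_⟩
    ext i
    change (if hi : (Fin.castLE h i : ℕ) < n then w ⟨Fin.castLE h i, hi⟩ else 0) = w i
    simp
  obtain ⟨J, hJ⟩ := LinearMap.exists_rightInverse_of_surjective _ (LinearMap.range_eq_top.2 hs)
  exact ⟨LinearMap.toContinuousLinearMap J, fun w => LinearMap.congr_fun hJ w⟩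

namespace LocalChart

variable {d k : ℕ} {Ω : Set (E d)} {A : BoundaryAtlas d k Ω} (M : LocalChart A)

theorem exists_graphBand_subset_ball :
    ∃ R : ℝ, 0 < R ∧ A.graphBand M.j M.height (ball M.xs M.radius) ⊆ ball (M.graph M.xs) R := by
  obtain ⟨C, hC⟩ := (isCompact_closedBall M.xs M.radius).exists_bound_of_continuousOn
    M.continuous_height.continuousOn
  have hK : IsCompact ((fun p : E (d - 1) × ℝ => M.point p.1 p.2) ''
      (closedBall M.xs M.radius ×ˢ Icc (-(C + A.width M.j)) (C + A.width M.j))) :=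
    ((isCompact_closedBall _ _).prod isCompact_Icc).image M.contDiff_point.continuous
  obtain ⟨R, hR, hsub⟩ := hK.isBounded.subset_ball_lt 0 (M.graph M.xs)
  refine ⟨R, hR, fun z hz => hsub ⟨(M.base z, M.elevation z), ⟨ball_subset_closedBall hz.1, ?_⟩,
    M.point_base_elevation z⟩⟩
  have h1 : |M.elevation z - M.height (M.base z)| < A.width M.j := hz.2
  have h2 := hC _ (ball_subset_closedBall hz.1)
  have h3 : |M.height (M.base z)| ≤ C := h2
  rw [abs_lt] at h1
  rw [abs_le] at h3
  exact ⟨by simp only; linarith, by simp only; linarith⟩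

/-- The linear dependence of the field on the velocity. -/
def fieldL : E (d - 1) →L[ℝ] E d :=
  (chartVectorL A M.j).comp ((ContinuousLinearMap.id ℝ _).prod (M.slope + innerSL ℝ M.e))

theorem field_eq_fieldL (v : E (d - 1)) (z : E d) :
    M.field v z =
      M.fieldL v + inner ℝ (M.base z - M.xs) M.e • A.chartVector M.j 0 1 := by
  rw [field, fieldL]
  simp [chartVectorL_apply, UTurn.speed, real_inner_comm]

/-- The field is affine in the velocity. It is cut off in space, and the velocity is `vc` plus a
cut-off of a dilated linear projection of the parameter. After these cut-offs all derivatives are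
bounded on the whole space, even if `Ω` or `P` is unbounded, and every Hölder order follows. The
dilation `c` is so strong that all velocities in the smaller ball are attained within a small ball
of `P`. -/
theorem exists_field {m : ℕ} (hm : d - 1 ≤ m) (hΩ : IsOpen Ω) {P : Set (E m)} (hP : IsOpen P)
    (hP' : P.Nonempty) (vc : E (d - 1)) {η : ℝ} (hη : 0 < η) :
    ∃ (b : E m → E d → E d) (vel : E m → E (d - 1)),
      (∀ s : ℝ, 0 ≤ s → MemHolder s (fun z : E d × E m => b z.2 z.1) (Ω ×ˢ P)) ∧
      Continuous (fun z : E d × E m => b z.2 z.1) ∧ Continuous vel ∧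
      (∀ μ, vel μ ∈ closedBall vc η) ∧ (∀ v ∈ ball vc (η / 2), ∃ μ ∈ P, vel μ = v) ∧
      ∀ μ, EqOn (b μ) (M.field (vel μ))
        (A.graphBand M.j M.height (ball M.xs M.radius)) := by
  obtain ⟨μ₀, hμ₀⟩ := hP'
  obtain ⟨ρ, hρ, hball⟩ := Metric.isOpen_iff.1 hP μ₀ hμ₀
  obtain ⟨J, hJ⟩ := exists_firstCoords_eq hm
  obtain ⟨R, hR, hband⟩ := M.exists_graphBand_subset_ball
  set c := (‖J‖ * η + 1) / ρ with hc
  have hc0 : 0 < c := by positivity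
  set w₀ := c • firstCoords hm μ₀ with hw₀
  let cut : ContDiffBump (M.graph M.xs) := ⟨R, 2 * R, hR, by linarith⟩
  let χ : ContDiffBump w₀ := ⟨η / 2, η, by positivity, by linarith⟩
  set W : E (d - 1) → E (d - 1) := fun w => χ w • (w - w₀) with hW
  have hcut : ContDiff ℝ ∞ cut := cut.contDiff
  have hWd : ContDiff ℝ ∞ W := χ.contDiff.smul (contDiff_id.sub contDiff_const)
  have hWc : HasCompactSupport W := χ.hasCompactSupport.smul_right
  set L : E d × E m →L[ℝ] E d × E (d - 1) :=
    (ContinuousLinearMap.id ℝ (E d)).prodMap (c • firstCoords hm) with hL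
  set vel : E m → E (d - 1) := fun μ => vc + W (c • firstCoords hm μ) with hvel
  have hfield : ∀ z : E d × E m, cut z.1 • M.field (vel z.2) z.1 =
      cut z.1 • M.field vc z.1 + cut (L z).1 • M.fieldL (W (L z).2) := by
    intro z
    have h1 : (L z).1 = z.1 := rfl
    have h2 : (L z).2 = c • firstCoords hm z.2 := rfl
    rw [h1, h2, field_eq_fieldL, field_eq_fieldL, hvel, map_add]
    module
  have b1 : BoundedSmooth fun z : E d => cut z • M.field vc z :=
    .of_hasCompactSupport (hcut.smul contDiff_field) cut.hasCompactSupport.smul_right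
  have b2 : BoundedSmooth fun q : E d × E (d - 1) => cut q.1 • M.fieldL (W q.2) := by
    refine .of_hasCompactSupport ((hcut.comp contDiff_fst).smul
      (M.fieldL.contDiff.comp (hWd.comp contDiff_snd))) ?_
    refine HasCompactSupport.intro (cut.hasCompactSupport.isCompact.prod hWc.isCompact)
      fun q hq => ?_
    rw [mem_prod, not_and_or] at hq
    rcases hq with hq | hq
    · rw [image_eq_zero_of_notMem_tsupport hq, zero_smul]
    · rw [image_eq_zero_of_notMem_tsupport hq, map_zero, smul_zero]
  have b3 : BoundedSmooth fun z : E d × E m => cut z.1 • M.field (vel z.2) z.1 := by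
    have := (b1.comp_clm (ContinuousLinearMap.fst ℝ (E d) (E m))).add (b2.comp_clm L)
    refine (funext hfield : (fun z : E d × E m => cut z.1 • M.field (vel z.2) z.1) = _) ▸ this
  refine ⟨fun μ z => cut z • M.field (vel μ) z, vel, fun s hs => b3.memHolder hs (hΩ.prod hP),
    b3.contDiff.continuous, ?_, fun μ => ?_, fun v hv => ?_, fun μ z hz => ?_⟩
  · exact continuous_const.add (hWd.continuous.comp (by fun_prop))
  · rw [mem_closedBall_iff_norm, hvel, add_sub_cancel_left, hW]
    simp only
    rw [norm_smul, Real.norm_of_nonneg χ.nonneg]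
    by_cases h : c • firstCoords hm μ ∈ ball w₀ η
    · calc _ ≤ 1 * ‖c • firstCoords hm μ - w₀‖ :=
            mul_le_mul_of_nonneg_right χ.le_one (norm_nonneg _)
        _ ≤ η := by rw [one_mul]; exact (mem_ball_iff_norm.1 h).le
    · rw [χ.zero_of_le_dist (not_lt.1 h), zero_mul]
      exact hη.le
  · refine ⟨μ₀ + c⁻¹ • J (v - vc), hball ?_, ?_⟩
    · rw [mem_ball_iff_norm, add_sub_cancel_left, norm_smul, norm_inv, Real.norm_of_nonneg hc0.le,
        inv_mul_lt_iff₀ hc0]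
      have h1 : ‖v - vc‖ ≤ η := (mem_ball_iff_norm.1 hv).le.trans (by linarith)
      have h2 := (J.le_opNorm (v - vc)).trans
        (mul_le_mul_of_nonneg_left h1 (norm_nonneg _))
      have h3 : c * ρ = ‖J‖ * η + 1 := by rw [hc]; field_simp
      linarith
    · have h1 : c • firstCoords hm (μ₀ + c⁻¹ • J (v - vc)) = w₀ + (v - vc) := by
        rw [map_add, map_smul, hJ, smul_add, smul_inv_smul₀ hc0.ne', hw₀]
      rw [hvel]
      simp only [h1, hW]
      rw [χ.one_of_mem_closedBall, one_smul, add_sub_cancel_left, add_sub_cancel]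
      rw [mem_closedBall_iff_norm, add_sub_cancel_left]
      exact (mem_ball_iff_norm.1 hv).le
  · have : cut z = 1 := cut.one_of_mem_closedBall (ball_subset_closedBall (hband hz))
    simp only [this, one_smul]

end LocalChart

/-! ### Sums of bump functions with disjoint supports -/

section DisjointSums

variable {X Y ι : Type} [NormedAddCommGroup X] [NormedSpace ℝ X] [NormedAddCommGroup Y]

/-- Each sum has at most one nonzero term. The factor `2` accounts for the case that these terms
have different indices. -/
theorem norm_tsum_sub_le_of_subsingleton {u w : ι → Y} {D : ℝ} (hD : 0 ≤ D)
    (hu : {i | u i ≠ 0}.Subsingleton) (hw : {i | w i ≠ 0}.Subsingleton)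
    (h : ∀ i, ‖u i - w i‖ ≤ D) : ‖∑' i, u i - ∑' i, w i‖ ≤ 2 * D := by
  have key : ∀ v : ι → Y, {i | v i ≠ 0}.Subsingleton →
      (∀ i, v i = 0) ∨ ∃ i, v i ≠ 0 ∧ ∑' j, v j = v i ∧ ∀ j, j ≠ i → v j = 0 := by
    intro v hv
    by_cases h0 : ∀ i, v i = 0
    · exact .inl h0
    · push Not at h0
      obtain ⟨i, hi⟩ := h0
      have h1 : ∀ j, j ≠ i → v j = 0 := fun j hj => by
        by_contra h2
        exact hj (hv h2 hi)
      exact .inr ⟨i, hi, tsum_eq_single i h1, h1⟩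
  rcases key u hu with h1 | ⟨i, h0, h1, h2⟩
  · rcases key w hw with h3 | ⟨j, -, h3, h4⟩
    · simp [h1, h3, hD]
    · have := h j
      simp only [h1, h3, tsum_zero] at this ⊢
      linarith
  · rcases key w hw with h3 | ⟨j, h5, h3, h4⟩
    · have := h i
      simp only [h1, h3, tsum_zero] at this ⊢
      linarith
    · rw [h1, h3]
      by_cases hij : i = j
      · subst hij
        linarith [h i]
      · have h6 := h i
        have h7 := h j
        rw [h4 i hij, sub_zero] at h6
        rw [h2 j (Ne.symm hij), zero_sub, norm_neg] at h7
        linarith [norm_sub_le (u i) (w j)]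

/-- A sum of functions with disjoint supports is as regular as its terms. -/
theorem HolderBound.tsum {θ Λ M : ℝ} {k : ℕ} (hΛ : 0 ≤ Λ) (hM : 0 ≤ M) {f : ι → X → Y}
    [NormedSpace ℝ Y] [CompleteSpace Y]
    (hf : ∀ i, ContDiff ℝ k (f i)) {v : ℕ → ι → ℝ} (hv : ∀ j ≤ k, Summable (v j))
    (hfv : ∀ j ≤ k, ∀ i x, ‖iteratedFDeriv ℝ j (f i) x‖ ≤ v j i)
    (hdisj : ∀ i i', i ≠ i' → Disjoint (tsupport (f i)) (tsupport (f i')))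
    (hb : ∀ j ≤ k, ∀ i x, ‖iteratedFDeriv ℝ j (f i) x‖ ≤ M * Λ ^ j)
    (hl : ∀ i x y, ‖iteratedFDeriv ℝ k (f i) x - iteratedFDeriv ℝ k (f i) y‖
      ≤ M * Λ ^ k * (Λ * dist x y) ^ θ) :
    HolderBound θ Λ univ k (fun x => ∑' i, f i x) (2 * M) := by
  have hder : ∀ j ≤ k, ∀ x, iteratedFDeriv ℝ j (fun x => ∑' i, f i x) x =
      ∑' i, iteratedFDeriv ℝ j (f i) x := fun j hj x =>
    iteratedFDeriv_tsum_apply (N := (k : ℕ∞)) hf (fun j hj => hv j (by exact_mod_cast hj))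
      (fun j i x hj => hfv j (by exact_mod_cast hj) i x) (by exact_mod_cast hj) x
  have hsub : ∀ j x, {i | iteratedFDeriv ℝ j (f i) x ≠ 0}.Subsingleton := by
    intro j x i hi i' hi'
    by_contra hne
    exact (disjoint_left.1 (hdisj i i' hne)) (support_iteratedFDeriv_subset j hi)
      (support_iteratedFDeriv_subset j hi')
  refine HolderBound.of_iteratedFDeriv isOpen_univ
    (contDiff_tsum (N := (k : ℕ∞)) hf (fun j hj => hv j (by exact_mod_cast hj))
      (fun j i x hj => hfv j (by exact_mod_cast hj) i x)).contDiffOn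
    (fun j hj x _ => ?_) (fun x _ y _ => ?_)
  · rw [hder j hj]
    have := norm_tsum_sub_le_of_subsingleton (D := M * Λ ^ j) (by positivity) (hsub j x)
      (w := fun _ => 0) (by simp) (fun i => by simpa using hb j hj i x)
    simpa [mul_assoc] using this
  · rw [hder k le_rfl, hder k le_rfl]
    have := norm_tsum_sub_le_of_subsingleton (D := M * Λ ^ k * (Λ * dist x y) ^ θ)
      (by positivity) (hsub k x) (hsub k y) (fun i => hl i x y)
    simpa [mul_assoc] using this

end DisjointSums

/-- A smooth cut-off function of the unit ball. -/
def unitBump (n : ℕ) : ContDiffBump (0 : E n) := ⟨1, 2, one_pos, one_lt_two⟩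

/-- A bump function of height one centred at `X`, whose width is about `1 / a`. -/
def scaledBump {n : ℕ} (a : ℝ) (X x : E n) : ℝ := unitBump n (a • (x - X))

section ScaledBump

variable {n : ℕ} {a : ℝ} {X x : E n}

theorem scaledBump_nonneg : 0 ≤ scaledBump a X x := (unitBump n).nonneg

theorem scaledBump_le_one : scaledBump a X x ≤ 1 := (unitBump n).le_one

theorem scaledBump_eq_one (ha : 0 ≤ a) (h : a * dist x X ≤ 1) : scaledBump a X x = 1 := by
  refine (unitBump n).one_of_mem_closedBall ?_
  rw [mem_closedBall_zero_iff, norm_smul, Real.norm_of_nonneg ha, ← dist_eq_norm]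
  exact h

theorem scaledBump_eq_zero (ha : 0 ≤ a) (h : 2 ≤ a * dist x X) : scaledBump a X x = 0 := by
  refine (unitBump n).zero_of_le_dist ?_
  rw [dist_zero_right, norm_smul, Real.norm_of_nonneg ha, ← dist_eq_norm]
  exact h

theorem contDiff_scaledBump : ContDiff ℝ ∞ (scaledBump a X) :=
  (unitBump n).contDiff.comp (f := fun x => a • (x - X)) (by fun_prop)

theorem tsupport_scaledBump_subset (ha : 0 < a) :
    tsupport (scaledBump a X) ⊆ closedBall X (2 / a) := by
  refine closure_minimal (fun x hx => ?_) isClosed_closedBall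
  by_contra h
  refine hx (scaledBump_eq_zero ha.le ?_)
  rw [mem_closedBall, not_le, div_lt_iff₀' ha] at h
  exact h.le

theorem exists_norm_iteratedFDeriv_scaledBump_le (n K : ℕ) :
    ∃ C : ℝ, 1 ≤ C ∧ ∀ i ≤ K, ∀ (a : ℝ) (_ : 0 ≤ a) (X x : E n),
      ‖iteratedFDeriv ℝ i (scaledBump a X) x‖ ≤ C * a ^ i := by
  choose C hC using (BoundedSmooth.of_hasCompactSupport (unitBump n).contDiff
    (unitBump n).hasCompactSupport).bounded
  have hC0 : ∀ i, 0 ≤ C i := fun i => (norm_nonneg _).trans (hC i 0)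
  refine ⟨1 + ∑ i ∈ Finset.range (K + 1), C i,
    le_add_of_nonneg_right (Finset.sum_nonneg fun i _ => hC0 i), fun i hi a ha X x => ?_⟩
  have h1 := Finset.single_le_sum (f := C) (fun i _ => hC0 i)
    (Finset.mem_range.2 (Nat.lt_succ_of_le hi))
  have h2 : iteratedFDeriv ℝ i (scaledBump a X) x =
      a ^ i • iteratedFDeriv ℝ i (unitBump n) (a • (x - X)) := by
    have e1 := iteratedFDeriv_comp_sub (𝕜 := ℝ) (f := fun z => unitBump n (a • z)) i X x
    have e2 := iteratedFDeriv_comp_const_smul (𝕜 := ℝ) (f := unitBump n) a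
      ((unitBump n).contDiff (n := (i : ℕ∞)))
    change iteratedFDeriv ℝ i (fun z => unitBump n (a • (z - X))) x = _
    rw [e1, e2]
  rw [h2, norm_smul, norm_pow, Real.norm_of_nonneg ha, mul_comm]
  gcongr
  linarith [hC i (a • (x - X))]

theorem tsupport_const_mul_subset {X : Type*} [TopologicalSpace X] (c : ℝ) (f : X → ℝ) :
    tsupport (fun x => c * f x) ⊆ tsupport f :=
  closure_mono fun x hx h => hx (by simp [h])

theorem iteratedFDeriv_const_mul {X : Type*} [NormedAddCommGroup X] [NormedSpace ℝ X] (c : ℝ)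
    {f : X → ℝ} (hf : ContDiff ℝ ∞ f) (i : ℕ) (x : X) :
    iteratedFDeriv ℝ i (fun x => c * f x) x = c • iteratedFDeriv ℝ i f x :=
  iteratedFDeriv_const_smul_apply' (𝕜 := ℝ) (a := c)
    (hf.of_le (by exact_mod_cast le_top)).contDiffAt

end ScaledBump

namespace BoundaryAtlas

variable {d k : ℕ} {Ω : Set (E d)} (A : BoundaryAtlas d k Ω)

/-- Sums of disjoint bumps of width `1 / Λ` with height `Λ ^ (-s)` are bounded in
`W^{s,p}(∂Ω)`. -/
theorem exists_boundaryNorm_bumps_le_one (hd : 2 ≤ d) (R κ : ℝ) (hκ : 1 ≤ κ) {s : ℝ} (hs : 0 < s)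
    (hsk : s ≤ k + 1) {p : ℝ≥0∞} (hp : 1 ≤ p) (hp' : p ≠ ⊤) :
    ∃ c : ℝ, 0 < c ∧ ∀ (Λ : ℝ) (_ : 1 ≤ Λ) (ι : Type) [Fintype ι] (Y : ι → E d) (ε : ι → ℝ),
      (∀ i, |ε i| ≤ 1) →
      (∀ i j, i ≠ j → Disjoint (closedBall (Y i) (2 / (κ * Λ))) (closedBall (Y j) (2 / (κ * Λ)))) →
      (∀ i, closedBall (Y i) (2 / (κ * Λ)) ⊆ closedBall 0 R) →
      boundaryNorm A s p (fun x => ∑' i, c * Λ ^ (-s) * ε i * scaledBump (κ * Λ) (Y i) x) ≤ 1 := by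
  obtain ⟨C, hC, hbound⟩ := exists_boundaryNorm_le A hd R hs hsk hp hp'
  set K := ⌈s⌉₊ - 1
  obtain ⟨D, hD, hder⟩ := exists_norm_iteratedFDeriv_scaledBump_le d (K + 1)
  -- The normalization depends on `κ` and the atlas, but not on `Λ`, the number of bumps or their
  -- signs.
  obtain ⟨c, hc0, hc⟩ : ∃ c : ℝ, 0 < c ∧ C * ENNReal.ofReal (2 * (D * κ ^ (K + 1)) * c) ≤ 1 := by
    refine ⟨(2 * (D * κ ^ (K + 1)))⁻¹ * (C.toReal + 1)⁻¹, by positivity, ?_⟩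
    rw [mul_inv_cancel_left₀ (by positivity), ← ENNReal.ofReal_toReal hC,
      ← ENNReal.ofReal_mul ENNReal.toReal_nonneg, ENNReal.ofReal_toReal hC, ENNReal.ofReal_le_one,
      ← div_eq_mul_inv, div_le_one (by positivity)]
    linarith
  refine ⟨c, hc0, fun Λ hΛ ι _ Y ε hε hdisj hsupp => ?_⟩
  have hΛ0 : 0 < Λ := by linarith
  set M := D * κ ^ (K + 1) * c * Λ ^ (-s) with hM
  have hM0 : 0 ≤ M := by positivity
  have hκΛ : 0 < κ * Λ := by positivity
  have hd1 : ∀ j ≤ K + 1, ∀ i x, ‖iteratedFDeriv ℝ j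
      (fun x => c * Λ ^ (-s) * ε i * scaledBump (κ * Λ) (Y i) x) x‖ ≤ M * Λ ^ j := by
    intro j hj i x
    rw [iteratedFDeriv_const_mul _ contDiff_scaledBump, norm_smul, Real.norm_eq_abs, abs_mul,
      abs_of_nonneg (show 0 ≤ c * Λ ^ (-s) by positivity)]
    have h1 : κ ^ j ≤ κ ^ (K + 1) := pow_le_pow_right₀ hκ hj
    calc c * Λ ^ (-s) * |ε i| * ‖iteratedFDeriv ℝ j (scaledBump (κ * Λ) (Y i)) x‖
        ≤ c * Λ ^ (-s) * 1 * (D * (κ * Λ) ^ j) := by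
          gcongr
          · exact hε i
          · exact hder j hj _ hκΛ.le _ _
      _ = D * κ ^ j * c * Λ ^ (-s) * Λ ^ j := by rw [mul_pow]; ring
      _ ≤ _ := by rw [hM]; gcongr
  have hH : HolderBound 1 Λ univ K
      (fun x => ∑' i, c * Λ ^ (-s) * ε i * scaledBump (κ * Λ) (Y i) x) (2 * M) := by
    have hcd : ∀ i, ContDiff ℝ ∞ (fun x => c * Λ ^ (-s) * ε i * scaledBump (κ * Λ) (Y i) x) :=
      fun i => contDiff_const.mul contDiff_scaledBump
    refine HolderBound.tsum hΛ0.le hM0 (v := fun j _ => M * Λ ^ j)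
      (fun i => (hcd i).of_le (by exact_mod_cast le_top)) (fun j _ => Summable.of_finite)
      (fun j hj => hd1 j (by omega)) (fun i i' hii => ?_) (fun j hj => hd1 j (by omega))
      (fun i x y => ?_)
    · refine (hdisj i i' hii).mono ?_ ?_ <;>
      exact (tsupport_const_mul_subset _ _).trans (tsupport_scaledBump_subset hκΛ)
    · rw [Real.rpow_one, ← mul_assoc, mul_assoc M, ← pow_succ]
      exact BoundedSmooth.norm_iteratedFDeriv_sub_le (hcd i) (hd1 (K + 1) le_rfl i) x y
  refine (hbound Λ _ _ hΛ (by positivity) (fun x hx => ?_) hH).trans (le_trans (le_of_eq ?_) hc)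
  · refine (tsum_congr fun i => ?_).trans tsum_zero
    have : x ∉ tsupport (scaledBump (κ * Λ) (Y i)) := fun h =>
      hx (hsupp i (tsupport_scaledBump_subset hκΛ h))
    rw [image_eq_zero_of_notMem_tsupport this, mul_zero]
  · congr 2
    rw [hM, Real.rpow_neg hΛ0.le]
    field_simp

/-- Series of disjoint bumps of width `B ^ (-i)` with height `B ^ (-s * i)` are bounded in
`W^{s,∞}(∂Ω)`. -/
theorem exists_boundaryNorm_top_bumps_le_one {s : ℝ} (hs : 0 < s) (hsk : s ≤ k + 1) (K : ℝ)
    (hK : 1 ≤ K) :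
    ∃ c : ℝ, 0 < c ∧ c ≤ 1 ∧ ∀ (B : ℝ) (_ : 1 < B) (X : ℕ → E d) (ξ : ℕ → ℝ),
      (∀ i, |ξ i| ≤ 1) →
      (∀ i j, i ≠ j → Disjoint (closedBall (X i) (2 / (K * B ^ i)))
        (closedBall (X j) (2 / (K * B ^ j)))) →
      Continuous (fun x => ∑' i, c * ξ i * (B ^ (-s)) ^ i * scaledBump (K * B ^ i) (X i) x) ∧
      (∃ C : ℝ, ∀ x,
        ‖∑' i, c * ξ i * (B ^ (-s)) ^ i * scaledBump (K * B ^ i) (X i) x‖ ≤ C) ∧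
      boundaryNorm A s ⊤
        (fun x => ∑' i, c * ξ i * (B ^ (-s)) ^ i * scaledBump (K * B ^ i) (X i) x) ≤ 1 := by
  obtain ⟨C, hC, hbound⟩ := exists_boundaryNorm_top_le A hs hsk
  set q := ⌈s⌉₊ - 1 with hq
  have hqs : (q : ℝ) < s := by
    have h1 : 0 < ⌈s⌉₊ := Nat.ceil_pos.2 hs
    have h2 := Nat.ceil_lt_add_one hs.le
    rw [hq, Nat.cast_sub (by omega), Nat.cast_one]
    linarith
  have hqs' : s - q ≤ 1 := by
    have h1 : 0 < ⌈s⌉₊ := Nat.ceil_pos.2 hs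
    have h2 := Nat.le_ceil s
    rw [hq, Nat.cast_sub (by omega), Nat.cast_one]
    linarith
  obtain ⟨D, hD, hder⟩ := exists_norm_iteratedFDeriv_scaledBump_le d (q + 1)
  obtain ⟨c, hc0, hc1, hc⟩ : ∃ c : ℝ, 0 < c ∧ c ≤ 1 ∧
      C * ENNReal.ofReal (2 * (2 * (D * K ^ (q + 1))) * c) ≤ 1 := by
    have h1 : 1 ≤ 2 * (2 * (D * K ^ (q + 1))) := by
      have := one_le_mul_of_one_le_of_one_le hD (one_le_pow₀ hK (n := q + 1))
      linarith
    refine ⟨(2 * (2 * (D * K ^ (q + 1))))⁻¹ * (C.toReal + 1)⁻¹, by positivity, ?_, ?_⟩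
    · exact mul_le_one₀ (inv_le_one_of_one_le₀ h1) (by positivity)
        (inv_le_one_of_one_le₀ (le_add_of_nonneg_left ENNReal.toReal_nonneg))
    rw [mul_inv_cancel_left₀ (by positivity), ← ENNReal.ofReal_toReal hC,
      ← ENNReal.ofReal_mul ENNReal.toReal_nonneg, ENNReal.ofReal_toReal hC, ENNReal.ofReal_le_one,
      ← div_eq_mul_inv, div_le_one (by positivity)]
    linarith
  refine ⟨c, hc0, hc1, fun B hB X ξ hξ hdisj => ?_⟩
  have hB0 : 0 < B := by linarith
  set M := D * K ^ (q + 1) * c with hM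
  have hM0 : 0 ≤ M := by positivity
  have hKB : ∀ i : ℕ, 0 < K * B ^ i := fun i => by positivity
  set f : ℕ → E d → ℝ := fun i x => c * ξ i * (B ^ (-s)) ^ i * scaledBump (K * B ^ i) (X i) x
    with hf
  have hcd : ∀ i, ContDiff ℝ ∞ (f i) := fun i => contDiff_const.mul contDiff_scaledBump
  have hd1 : ∀ j ≤ q + 1, ∀ i x, ‖iteratedFDeriv ℝ j (f i) x‖ ≤ M * (B ^ (-s) * B ^ j) ^ i := by
    intro j hj i x
    rw [hf, iteratedFDeriv_const_mul _ contDiff_scaledBump, norm_smul, Real.norm_eq_abs, abs_mul,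
      abs_mul, abs_of_nonneg hc0.le, abs_of_nonneg (show 0 ≤ (B ^ (-s)) ^ i by positivity)]
    have h1 : K ^ j ≤ K ^ (q + 1) := pow_le_pow_right₀ hK hj
    calc c * |ξ i| * (B ^ (-s)) ^ i * ‖iteratedFDeriv ℝ j (scaledBump (K * B ^ i) (X i)) x‖
        ≤ c * 1 * (B ^ (-s)) ^ i * (D * (K * B ^ i) ^ j) := by
          gcongr
          · exact hξ i
          · exact hder j hj _ (hKB i).le _ _
      _ = D * K ^ j * c * (B ^ (-s) * B ^ j) ^ i := by
          rw [mul_pow, mul_pow, ← pow_mul, ← pow_mul, mul_comm i j]; ring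
      _ ≤ _ := by rw [hM]; gcongr
  -- Up to the order `q < s` the terms decay geometrically, and the series may be differentiated
  -- term by term.
  have hρ : ∀ j ≤ q, B ^ (-s) * B ^ j < 1 := by
    intro j hj
    rw [← Real.rpow_natCast B j, ← Real.rpow_add hB0]
    refine Real.rpow_lt_one_of_one_lt_of_neg hB ?_
    have : (j : ℝ) ≤ q := by exact_mod_cast hj
    linarith
  have hH : HolderBound (s - q) 1 univ q (fun x => ∑' i, f i x) (2 * (2 * M)) := by
    refine HolderBound.tsum zero_le_one (by positivity)
      (v := fun j i => M * (B ^ (-s) * B ^ j) ^ i)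
      (fun i => (hcd i).of_le (by exact_mod_cast le_top))
      (fun j hj => (summable_geometric_of_lt_one (by positivity) (hρ j hj)).mul_left M)
      (fun j hj => hd1 j (by omega)) (fun i i' hii => ?_) (fun j hj i x => ?_)
      (fun i x y => ?_)
    · refine (hdisj i i' hii).mono ?_ ?_ <;>
      exact (tsupport_const_mul_subset _ _).trans (tsupport_scaledBump_subset (hKB _))
    · refine (hd1 j (by omega) i x).trans ?_
      have := mul_le_of_le_one_right hM0
        (pow_le_one₀ (n := i) (show 0 ≤ B ^ (-s) * B ^ j by positivity) (hρ j hj).le)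
      rw [one_pow]
      linarith
    · have h1 := norm_sub_le_rpow_of_norm_le (θ := s - q) (t := B ^ i * dist x y) (by linarith)
        hqs' (by positivity) (by positivity) (hd1 q (by omega) i x) (hd1 q (by omega) i y) (by
          refine (BoundedSmooth.norm_iteratedFDeriv_sub_le (hcd i)
            (hd1 (q + 1) le_rfl i) x y).trans (le_of_eq ?_)
          rw [pow_succ, mul_pow _ (B ^ q * B), mul_pow _ (B ^ q), mul_pow]
          ring)
      refine h1.trans (le_of_eq ?_)
      -- At the Hölder exponent `s - q` width and height balance exactly. No decay in `i` is left;
      -- the seminorm of the sum stays bounded because the supports are disjoint.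
      have h2 : (B ^ (-s) * B ^ q) ^ i * (B ^ i) ^ (s - q) = 1 := by
        rw [← Real.rpow_natCast B q, ← Real.rpow_add hB0, ← Real.rpow_natCast B i,
          ← Real.rpow_mul hB0.le, ← Real.rpow_natCast, ← Real.rpow_mul hB0.le,
          ← Real.rpow_add hB0]
        convert Real.rpow_zero B using 2
        ring
      rw [Real.mul_rpow (by positivity) dist_nonneg, one_pow, one_mul, mul_one]
      linear_combination (2 * M * dist x y ^ (s - (q : ℝ))) * h2
  have hcont := hH.continuousOn (by linarith)
  refine ⟨by simpa [continuousOn_univ] using hcont, ⟨_, fun x => hH.norm_le (mem_univ x)⟩, ?_⟩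
  refine (hbound _ _ (by positivity) hH).trans (le_trans (le_of_eq ?_) hc)
  rw [hM]
  ring_nf

end BoundaryAtlas

/-! ### Greedy choice of signs -/

/-- The sequence whose terms are computed from the preceding ones by the given functions. -/
def recursiveSeq (F : (l : ℕ) → (Fin l → ℝ) → ℝ) (l : ℕ) : ℝ :=
  F l fun i => recursiveSeq F i
termination_by l
decreasing_by exact i.2

theorem recursiveSeq_eq (F : (l : ℕ) → (Fin l → ℝ) → ℝ) (l : ℕ) :
    recursiveSeq F l = F l fun i => recursiveSeq F i := by
  rw [recursiveSeq]

/-- If `2 n` is less than the size of the grid, then one of the two signs separates all colourings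
of the sign patterns by `2 ^ n` colours. -/
theorem exists_sign {κ : Type*} [Fintype κ] (S a : (κ → Bool) → κ → ℝ) (amp : ℝ)
    (ha : ∀ ε k, a ε k = if ε k then amp else -amp) :
    ∃ σ : ℝ, |σ| = 1 ∧ ∀ n : ℕ, 2 * n < Fintype.card κ → ∀ col : (κ → Bool) → Fin (2 ^ n),
      ∃ ε ε', col ε = col ε' ∧ ∃ k, 2 * amp ≤ |S ε k - S ε' k + σ * (a ε k - a ε' k)| := by
  classical
  by_contra! H
  obtain ⟨n₁, hn₁, c₁, h₁⟩ := H 1 (by simp)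
  obtain ⟨n₂, hn₂, c₂, h₂⟩ := H (-1) (by simp)
  -- The pair of failing colourings uses at most `2 ^ (n₁ + n₂)` colours, fewer than the number of
  -- patterns, because both `2 * n₁` and `2 * n₂` are below the size of the grid.
  have hcard : Fintype.card (Fin (2 ^ n₁) × Fin (2 ^ n₂)) < Fintype.card (κ → Bool) := by
    simp only [Fintype.card_prod, Fintype.card_fin, Fintype.card_fun, Fintype.card_bool, ← pow_add]
    exact Nat.pow_lt_pow_right (by norm_num) (by omega)
  obtain ⟨ε, ε', hne, heq⟩ := Fintype.exists_ne_map_eq_of_card_lt (fun ε => (c₁ ε, c₂ ε)) hcard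
  obtain ⟨k, hk⟩ := Function.ne_iff.1 hne
  have e1 := h₁ ε ε' (congrArg Prod.fst heq) k
  have e2 := h₂ ε ε' (congrArg Prod.snd heq) k
  -- At a grid point where the patterns differ, the diagonal terms differ by `±2 * amp`. The
  -- difference of the `S` terms would have distance less than `2 * amp` from both `2 * amp` and `-2
  -- * amp`, which is impossible.
  rw [ha, ha] at e1 e2
  rw [abs_lt] at e1 e2
  cases h : ε k <;> cases h' : ε' k <;> simp [h, h'] at hk e1 e2 <;>
  linarith [e1.1, e1.2, e2.1, e2.2]

/-- The sign at level `l` is chosen with the earlier signs known, and later ones do not enter the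
condition at this level. Nothing is assumed about the terms with `i < l`. -/
theorem exists_signs {κ : ℕ → Type*} [∀ l, Fintype (κ l)] (a : (l : ℕ) → ℕ → (κ l → Bool) → κ l → ℝ)
    (amp : ℕ → ℝ) (ha : ∀ l ε k, a l l ε k = if ε k then amp l else -amp l) :
    ∃ ξ : ℕ → ℝ, (∀ i, |ξ i| = 1) ∧ ∀ l n, 2 * n < Fintype.card (κ l) →
      ∀ col : (κ l → Bool) → Fin (2 ^ n), ∃ ε ε', col ε = col ε' ∧
        ∃ k, 2 * amp l ≤ |∑ i ∈ Finset.range (l + 1), ξ i * (a l i ε k - a l i ε' k)| := by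
  choose F hF1 hF using fun (l : ℕ) (s : Fin l → ℝ) =>
    exists_sign (fun ε k => ∑ i : Fin l, s i * a l i ε k) (a l l) (amp l) (ha l)
  refine ⟨recursiveSeq F, fun i => by rw [recursiveSeq_eq]; exact hF1 _ _, fun l n hn col => ?_⟩
  obtain ⟨ε, ε', hcol, k, hk⟩ := hF l (fun i => recursiveSeq F i) n hn col
  refine ⟨ε, ε', hcol, k, hk.trans_eq (congrArg _ ?_)⟩
  rw [Finset.sum_range_succ, Finset.sum_range, ← Finset.sum_sub_distrib, ← recursiveSeq_eq F]
  simp only [mul_sub]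

/-! ### Lower bounds of entropy numbers -/

/-- A cover by `2 ^ n` balls colours the indices by the centre of a ball that contains them, and two
indices of the same colour are at distance at most `2 * ε`. -/
theorem le_entropyNumber {Z ι : Type*} [PseudoEMetricSpace Z] {K : Set Z} {n : ℕ} {δ : ℝ≥0∞}
    {F : ι → Z} (hF : ∀ i, F i ∈ K)
    (h : ∀ col : ι → Fin (2 ^ n), ∃ i j, col i = col j ∧ 2 * δ ≤ edist (F i) (F j)) :
    δ ≤ entropyNumber n K := by
  refine le_iInf₂ fun ε hε => ?_
  -- A cover is extracted from the infimum through the strict bound by `2 ^ n + 1`, which for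
  -- cardinalities means at most `2 ^ n`.
  obtain ⟨C, hC⟩ := iInf_lt_iff.1 (hε.trans_lt (Order.lt_add_one_iff_of_not_isMax (by
    rw [isMax_iff_eq_top]
    exact ENat.natCast_ne_top (2 ^ n)) |>.2 le_rfl))
  obtain ⟨hcov, hlt⟩ := iInf_lt_iff.1 hC
  have hle : C.encard ≤ (2 ^ n : ℕ) := by
    exact_mod_cast Order.le_of_lt_add_one hlt
  have hfin : C.Finite := finite_of_encard_le_coe hle
  have hcard : Nat.card C ≤ 2 ^ n := by
    rw [Nat.card_coe_set_eq]
    rwa [← hfin.cast_ncard_eq, Nat.cast_le] at hle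
  have := hfin.to_subtype
  set g := (Finite.equivFin C).toEmbedding.trans (Fin.castLEEmb hcard)
  choose c hcC hc using fun i => hcov (hF i)
  obtain ⟨i, j, hij, hδ⟩ := h fun i => g ⟨c i, hcC i⟩
  have hcij : c i = c j := congrArg Subtype.val (g.injective hij)
  have h1 : edist (F i) (F j) ≤ 2 * ε := by
    refine (edist_triangle _ (c i) _).trans ?_
    rw [two_mul]
    refine add_le_add (hc i) ?_
    rw [hcij, edist_comm]
    exact hc j
  exact (ENNReal.mul_le_mul_iff_right two_ne_zero ENNReal.ofNat_ne_top).1 (hδ.trans h1)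

/-- Every number lies between two consecutive powers. -/
theorem exists_pow_gt {N n : ℕ} (hN : 2 ≤ N) (hn : 1 ≤ n) : ∃ l : ℕ, n < N ^ l ∧ N ^ l ≤ n * N := by
  obtain ⟨l, h1, h2⟩ : ∃ l, N ^ l ≤ n ∧ n < N ^ (l + 1) :=
    ⟨Nat.log N n, Nat.pow_log_le_self N (by omega), Nat.lt_pow_succ_log_self hN n⟩
  exact ⟨l + 1, h2, by rw [pow_succ]; exact Nat.mul_le_mul_right N h1⟩

namespace LocalChart

variable {d k : ℕ} {Ω : Set (E d)} {A : BoundaryAtlas d k Ω} (M : LocalChart A)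

/-! ### Distances in a boundary chart -/

theorem dist_le_dist_graph (a b : E (d - 1)) : dist a b ≤ dist (M.graph a) (M.graph b) := by
  rw [graph, graph, point, point, A.dist_frame_symm]
  exact Real.le_sqrt_of_sq_le (by nlinarith [sq_nonneg (dist (M.height a) (M.height b))])

theorem dist_height_le (a b : E (d - 1)) :
    dist (M.height a) (M.height b) ≤ (1 + ‖M.slope‖) * dist a b := by
  have h1 : M.height a - M.height b = M.slope (a - b) + (M.r a - M.r b) := by
    rw [height, height, map_sub, map_sub, map_sub]
    ring
  rw [dist_eq_norm, h1, dist_eq_norm]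
  have h2 := M.slope.le_opNorm (a - b)
  have h3 := M.abs_r_sub_le a b
  have h4 := norm_add_le (M.slope (a - b)) (M.r a - M.r b)
  rw [Real.norm_eq_abs (M.r a - M.r b)] at h4
  nlinarith [norm_nonneg (a - b)]

theorem dist_graph_le (a b : E (d - 1)) :
    dist (M.graph a) (M.graph b) ≤ (2 + ‖M.slope‖) * dist a b := by
  rw [graph, graph, point, point, A.dist_frame_symm]
  refine Real.sqrt_le_iff.2 ⟨by positivity, ?_⟩
  have h1 := M.dist_height_le a b
  have h2 : dist (M.height a) (M.height b) ^ 2 ≤ ((1 + ‖M.slope‖) * dist a b) ^ 2 := by gcongr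
  have h3 : 0 ≤ ‖M.slope‖ * dist a b ^ 2 := by positivity
  nlinarith [sq_nonneg (dist a b)]

theorem dist_base_le (z w : E d) : dist (M.base z) (M.base w) ≤ dist z w := by
  rw [← M.point_base_elevation z, ← M.point_base_elevation w, base_point, base_point, point, point,
    A.dist_frame_symm]
  exact Real.le_sqrt_of_sq_le
    (by nlinarith [sq_nonneg (dist (M.elevation z) (M.elevation w))])

theorem abs_elevation_sub_height_le (z : E d) (y : E (d - 1)) :
    |M.elevation z - M.height (M.base z)| ≤ (3 + ‖M.slope‖) * dist z (M.graph y) := by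
  have h1 : |M.elevation z - M.height (M.base z)| ≤ dist z (M.graph (M.base z)) := by
    nth_rw 3 [← M.point_base_elevation z]
    rw [graph, point, point, A.dist_frame_symm, ← Real.dist_eq]
    exact Real.le_sqrt_of_sq_le (by nlinarith [sq_nonneg (dist (M.base z) (M.base z))])
  have h2 := M.dist_graph_le y (M.base z)
  have h3 := M.dist_base_le (M.graph y) z
  rw [graph, base_point, ← graph, dist_comm (M.graph y)] at h3
  have h4 := dist_triangle z (M.graph y) (M.graph (M.base z))
  have h5 : (2 + ‖M.slope‖) * dist y (M.base z) ≤ (2 + ‖M.slope‖) * dist z (M.graph y) := by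
    gcongr
  linarith

/-- Boundary points close to the graph over a small ball lie on the graph. -/
theorem eq_graph_of_dist_le (hΩ : IsOpen Ω) {z : E d} (hz : z ∈ frontier Ω) {y : E (d - 1)}
    (hb : M.base z ∈ ball M.xs M.radius)
    (h : (3 + ‖M.slope‖) * dist z (M.graph y) < A.width M.j) : z = M.graph (M.base z) := by
  have hband : z ∈ A.band M.j := graphBand_subset_band (M := M)
    ⟨hb, (M.abs_elevation_sub_height_le z y).trans_lt h⟩
  rw [graph_eq_param hb]
  exact A.eq_param_of_mem_frontier hΩ M.j hband hz

/-! ### Inflow data -/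

/-- The grids `Y` of centres of inflow bumps. -/
theorem exists_grid {n : ℕ} (yc : E n) {r : ℝ} (hr : 0 < r) :
    ∃ ρ : ℝ, 0 < ρ ∧ ∀ N : ℕ, 1 ≤ N → ∃ Y : (Fin n → Fin N) → E n, (∀ k, Y k ∈ ball yc r) ∧
      ∀ k k', k ≠ k' → ρ / N ≤ dist (Y k) (Y k') := by
  have hc : Continuous fun w : Fin n → ℝ => yc + WithLp.toLp 2 w :=
    continuous_const.add (PiLp.continuous_toLp 2 _)
  obtain ⟨ρ, hρ, hball⟩ := Metric.mem_nhds_iff.1 (hc.continuousAt (x := 0)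
    (isOpen_ball.mem_nhds (x := _) (s := ball yc r) (by simpa using hr)))
  refine ⟨ρ / 2, by positivity, fun N hN => ?_⟩
  have hN0 : (0 : ℝ) < N := by exact_mod_cast hN
  refine ⟨fun k => yc + WithLp.toLp 2 fun i => ρ / 2 / N * (k i : ℕ),
    fun k => hball (a := fun i => ρ / 2 / N * (k i : ℕ)) ?_,
    fun k k' hk => ?_⟩
  · rw [mem_ball_zero_iff, pi_norm_lt_iff hρ]
    intro i
    have h1 : ((k i : ℕ) : ℝ) ≤ N := by exact_mod_cast (k i).2.le
    rw [Real.norm_of_nonneg (by positivity)]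
    calc ρ / 2 / N * (k i : ℕ) ≤ ρ / 2 / N * N := by gcongr
      _ = ρ / 2 := by field_simp
      _ < ρ := by linarith
  · obtain ⟨i, hi⟩ := Function.ne_iff.1 hk
    have h1 : (1 : ℝ) ≤ |((k i : ℕ) : ℝ) - ((k' i : ℕ) : ℝ)| := by
      have : ((k i : ℕ) : ℤ) - ((k' i : ℕ) : ℤ) ≠ 0 := by
        intro h
        exact hi (Fin.ext (by omega))
      exact_mod_cast Int.one_le_abs this
    rw [dist_add_left, dist_eq_norm]
    refine le_trans ?_ (PiLp.norm_apply_le _ i)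
    simp only [PiLp.sub_apply]
    rw [← mul_sub, norm_mul, Real.norm_of_nonneg (by positivity), Real.norm_eq_abs]
    exact le_mul_of_one_le_right (by positivity) h1

/-- The choice `κ * ρ ≥ 5 > 4` separates the supports of the bumps. The last clause provides
plateaus around the grid points, so that the data remain constant when the transported points
deviate a little. The constants are fixed before the scale `N` and the signs. -/
theorem exists_inflow_data (hd : 2 ≤ d) {s : ℝ} (hs : 0 < s) (hsk : s ≤ k + 1) {p : ℝ≥0∞}
    (hp : 1 ≤ p) (hp' : p ≠ ⊤) (yc : E (d - 1)) {r : ℝ} (hr : 0 < r) :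
    ∃ κ c : ℝ, 1 ≤ κ ∧ 0 < c ∧ ∀ N : ℕ, 1 ≤ N →
      ∃ (Y : (Fin (d - 1) → Fin N) → E (d - 1)) (f : ((Fin (d - 1) → Fin N) → Bool) → E d → ℝ),
        (∀ k, Y k ∈ ball yc r) ∧ (∀ ε, boundaryNorm A s p (f ε) ≤ 1) ∧
        (∀ ε x, |f ε x| ≤ 2 * (c * (N : ℝ) ^ (-s))) ∧
        ∀ ε k x, κ * N * dist x (M.graph (Y k)) ≤ 1 →
          f ε x = if ε k then c * (N : ℝ) ^ (-s) else -(c * (N : ℝ) ^ (-s)) := by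
  obtain ⟨ρ, hρ, hgrid⟩ := exists_grid yc hr
  set κ := max 1 (5 / ρ) with hκ
  have hκ1 : 1 ≤ κ := le_max_left _ _
  have hκρ : 5 ≤ κ * ρ := by
    have := (div_le_iff₀ hρ).1 (le_max_right 1 (5 / ρ))
    exact this
  obtain ⟨c, hc, hbump⟩ := A.exists_boundaryNorm_bumps_le_one hd
    (‖M.graph yc‖ + (2 + ‖M.slope‖) * r + 2) κ hκ1 hs hsk hp hp'
  refine ⟨κ, c, hκ1, hc, fun N hN => ?_⟩
  obtain ⟨Y, hY, hsep⟩ := hgrid N hN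
  have hN1 : (1 : ℝ) ≤ N := by exact_mod_cast hN
  have hκN : 0 < κ * N := by positivity
  have hdisj : ∀ i j, i ≠ j → Disjoint (closedBall (M.graph (Y i)) (2 / (κ * N)))
      (closedBall (M.graph (Y j)) (2 / (κ * N))) := by
    intro i j hij
    refine closedBall_disjoint_closedBall (lt_of_lt_of_le ?_
      ((hsep i j hij).trans (M.dist_le_dist_graph _ _)))
    rw [← add_div, div_lt_div_iff₀ hκN (by positivity)]
    nlinarith
  refine ⟨Y, fun ε x => ∑' i, c * (N : ℝ) ^ (-s) * (if ε i then 1 else -1) *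
    scaledBump (κ * N) (M.graph (Y i)) x, hY, fun ε => ?_, fun ε x => ?_, fun ε i x hx => ?_⟩
  · refine hbump N hN1 _ (fun i => M.graph (Y i)) (fun i => if ε i then 1 else -1)
      (fun i => by split_ifs <;> simp) hdisj fun i => ?_
    refine (closedBall_subset_closedBall' ?_)
    have h1 := M.dist_graph_le (Y i) yc
    have h2 : (2 + ‖M.slope‖) * dist (Y i) yc ≤ (2 + ‖M.slope‖) * r := by
      gcongr
      exact (hY i).le
    have h3 := dist_triangle (M.graph (Y i)) (M.graph yc) 0
    rw [dist_zero_right (M.graph yc)] at h3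
    have h4 : 2 / (κ * N) ≤ 2 :=
      div_le_self zero_le_two (one_le_mul_of_one_le_of_one_le hκ1 hN1)
    linarith
  · have h1 := norm_tsum_sub_le_of_subsingleton (D := c * (N : ℝ) ^ (-s)) (by positivity)
      (u := fun i => c * (N : ℝ) ^ (-s) * (if ε i then 1 else -1) *
        scaledBump (κ * N) (M.graph (Y i)) x) (w := fun _ => 0) (fun i hi j hj => ?_) (by simp)
      (fun i => ?_)
    · simpa using h1
    · by_contra hne
      have h2 : ∀ i, c * (N : ℝ) ^ (-s) * (if ε i then 1 else -1) *
          scaledBump (κ * N) (M.graph (Y i)) x ≠ 0 →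
          x ∈ closedBall (M.graph (Y i)) (2 / (κ * N)) := fun i hi =>
        tsupport_scaledBump_subset hκN (subset_tsupport _ (right_ne_zero_of_mul hi))
      exact disjoint_left.1 (hdisj i j hne) (h2 i hi) (h2 j hj)
    · rw [sub_zero, norm_mul, norm_mul, Real.norm_of_nonneg (show 0 ≤ c * (N : ℝ) ^ (-s) by
        positivity), Real.norm_of_nonneg scaledBump_nonneg]
      have h3 : ‖(if ε i then 1 else -1 : ℝ)‖ = 1 := by split_ifs <;> simp
      rw [h3, mul_one]
      exact mul_le_of_le_one_right (by positivity) scaledBump_le_one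
  · dsimp only
    rw [tsum_eq_single i fun j hj => ?_, scaledBump_eq_one hκN.le hx]
    · split_ifs <;> ring
    · have h1 : x ∈ closedBall (M.graph (Y i)) (2 / (κ * N)) := by
        rw [mem_closedBall, le_div_iff₀' hκN]
        linarith
      rw [image_eq_zero_of_notMem_tsupport (f := scaledBump (κ * N) (M.graph (Y j)))
        fun h => disjoint_left.1 (hdisj j i hj) (tsupport_scaledBump_subset hκN h) h1, mul_zero]

/-! ### Outflow data -/

theorem volume_real_ball (n : ℕ) (x : E n) {r : ℝ} (hr : 0 < r) :
    volume.real (ball x r) = r ^ n * volume.real (ball (0 : E n) 1) := by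
  rw [measureReal_def, Measure.addHaar_ball_of_pos _ _ hr, finrank_euclideanSpace_fin,
    ENNReal.toReal_mul, ENNReal.toReal_ofReal (by positivity), measureReal_def]

/-- The series of outflow bumps, centred at points which converge geometrically to the centre of
the chart. -/
theorem exists_outflow_data (hΩ : IsOpen Ω) {s : ℝ} (hs : 0 < s) (hsk : s ≤ k + 1) {r : ℝ}
    (hr : 0 < r) (hrr : r ≤ M.radius) {κ : ℝ} (hκ : 1 ≤ κ) :
    ∃ c δ : ℝ, 0 < c ∧ 0 < δ ∧ ∀ B : ℕ, 2 ≤ B →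
      ∃ (x : ℕ → E (d - 1)) (φ : ℕ → E (d - 1) → ℝ),
        (∀ i, x i ∈ ball M.xs r) ∧ (∀ i, Continuous (φ i)) ∧ (∀ i y, 0 ≤ φ i y) ∧
        (∀ i y, φ i y ≤ c) ∧
        (∀ i y, φ i y ≠ 0 → κ * B ^ i * dist y (x i) ≤ 1) ∧
        (∀ i, c * ((B : ℝ) ^ (-s)) ^ i * (δ * ((B : ℝ) ^ i)⁻¹ ^ (d - 1)) ≤
          ∫ y in ball M.xs r, φ i y) ∧
        ∀ ξ : ℕ → ℝ, (∀ i, |ξ i| = 1) → ∃ g : E d → ℝ, Continuous g ∧ (∃ C, ∀ x, ‖g x‖ ≤ C) ∧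
          boundaryNorm A s ⊤ g ≤ 1 ∧
          closure {x | x ∈ frontier Ω ∧ g x ≠ 0} ⊆ M.graph '' ball M.xs r ∧
          (∀ y, y ∉ ball M.xs r → g (M.graph y) = 0) ∧
          (∀ l y, |g (M.graph y) - ∑ i ∈ Finset.range (l + 1), ξ i * φ i y| ≤
            2 * (c * ((B : ℝ) ^ (-s)) ^ l)) ∧
          ∀ l y, y ∉ ball M.xs (r / B ^ (l + 1)) →
            g (M.graph y) = ∑ i ∈ Finset.range (l + 1), ξ i * φ i y := by
  have hw := A.width_pos M.j
  set L := 2 + ‖M.slope‖ with hL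
  have hL0 : 0 < L := by positivity
  -- The summand `2 * κ` makes the supports as narrow as the caller requests, `24 / r` keeps them
  -- disjoint and inside the ball, and the last one ensures that all boundary points under a bump
  -- lie in the band of this chart.
  set K := 1 + 2 * κ + 24 / r + 2 * (3 + ‖M.slope‖) / A.width M.j with hKdef
  have hp1 : 0 < 24 / r := by positivity
  have hp2 : 0 < 2 * (3 + ‖M.slope‖) / A.width M.j := by positivity
  have hK1 : 1 ≤ K := by linarith
  have hK0 : 0 < K := by linarith
  have hKκ : 2 * κ ≤ K := by linarith
  have hKr : 24 ≤ K * r := (div_le_iff₀ hr).1 (by linarith)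
  have hKw : 2 * (3 + ‖M.slope‖) < K * A.width M.j := (div_lt_iff₀ hw).1 (by linarith)
  obtain ⟨c, hc, hc1, hbump⟩ := A.exists_boundaryNorm_top_bumps_le_one hs hsk K hK1
  refine ⟨c, (1 / (K * L)) ^ (d - 1) * volume.real (ball (0 : E (d - 1)) 1), hc,
    mul_pos (by positivity) (by
      rw [measureReal_def]
      exact ENNReal.toReal_pos (measure_ball_pos _ _ one_pos).ne' measure_ball_lt_top.ne),
    fun B hB => ?_⟩
  have hB2 : (2 : ℝ) ≤ B := by exact_mod_cast hB
  have hB0 : (0 : ℝ) < B := by linarith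
  have hB1 : (1 : ℝ) < B := by linarith
  have hBi : ∀ i : ℕ, 0 < (B : ℝ) ^ i := fun i => by positivity
  have hBi1 : ∀ i : ℕ, 1 ≤ (B : ℝ) ^ i := fun i => one_le_pow₀ hB1.le
  have hKB : ∀ i : ℕ, 0 < K * B ^ i := fun i => by positivity
  have hrad : ∀ i : ℕ, 2 / (K * B ^ i) ≤ r / 12 * ((B : ℝ) ^ i)⁻¹ := by
    intro i
    rw [← div_eq_mul_inv, div_div, div_le_div_iff₀ (hKB i) (by positivity)]
    nlinarith [hBi i]
  have hq0 : 0 ≤ (B : ℝ) ^ (-s) := by positivity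
  have hq1 : (B : ℝ) ^ (-s) ≤ 1 := Real.rpow_le_one_of_one_le_of_nonpos hB1.le (by linarith)
  -- The centres approach `xs` at the same rate as the widths shrink, so that the bumps of index `i
  -- ≥ l` all live in the ball of radius `r / B ^ l`.
  set x : ℕ → E (d - 1) := fun i => M.xs + (r / 2 * ((B : ℝ) ^ i)⁻¹) • M.e with hx
  have hxs : ∀ i, dist (x i) M.xs = r / 2 * ((B : ℝ) ^ i)⁻¹ := by
    intro i
    rw [hx, dist_eq_norm, add_sub_cancel_left, norm_smul, M.norm_e, mul_one,
      Real.norm_of_nonneg (by positivity)]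
  have hinv : ∀ i : ℕ, ((B : ℝ) ^ i)⁻¹ ≤ 1 := fun i => inv_le_one_of_one_le₀ (hBi1 i)
  have hinv0 : ∀ i : ℕ, 0 < ((B : ℝ) ^ i)⁻¹ := fun i => by positivity
  have hlt : ∀ i j : ℕ, i < j → ((B : ℝ) ^ j)⁻¹ ≤ ((B : ℝ) ^ i)⁻¹ / 2 := by
    intro i j hij
    rw [div_eq_mul_inv, ← mul_inv]
    refine inv_anti₀ (by positivity) ?_
    calc (B : ℝ) ^ i * 2 ≤ B ^ i * B := by gcongr
      _ = B ^ (i + 1) := (pow_succ _ _).symm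
      _ ≤ B ^ j := pow_le_pow_right₀ hB1.le hij
  have hdisj' : ∀ i j, i < j → Disjoint (closedBall (M.graph (x i)) (2 / (K * B ^ i)))
      (closedBall (M.graph (x j)) (2 / (K * B ^ j))) := by
    intro i j hij
    refine closedBall_disjoint_closedBall (lt_of_lt_of_le ?_ (M.dist_le_dist_graph _ _))
    have h1 := hrad i
    have h2 := hrad j
    have h3 := hlt i j hij
    have h4 := dist_triangle (x i) (x j) M.xs
    rw [hxs, hxs] at h4
    have h5 := hinv0 i
    nlinarith
  have hdisj : ∀ i j, i ≠ j → Disjoint (closedBall (M.graph (x i)) (2 / (K * B ^ i)))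
      (closedBall (M.graph (x j)) (2 / (K * B ^ j))) := fun i j hij =>
    hij.lt_or_gt.elim (hdisj' i j) fun h => (hdisj' j i h).symm
  set φ : ℕ → E (d - 1) → ℝ := fun i y =>
    c * ((B : ℝ) ^ (-s)) ^ i * scaledBump (K * B ^ i) (M.graph (x i)) (M.graph y) with hφ
  have hamp : ∀ i, 0 < c * ((B : ℝ) ^ (-s)) ^ i := fun i => by positivity
  have hφle : ∀ i y, φ i y ≤ c * ((B : ℝ) ^ (-s)) ^ i := fun i y =>
    mul_le_of_le_one_right (hamp i).le scaledBump_le_one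
  have hφ0 : ∀ i y, 0 ≤ φ i y := fun i y => mul_nonneg (hamp i).le scaledBump_nonneg
  have hφs : ∀ i y, φ i y ≠ 0 → dist (M.graph y) (M.graph (x i)) ≤ 2 / (K * B ^ i) := by
    intro i y h
    exact tsupport_scaledBump_subset (hKB i) (subset_tsupport _ (right_ne_zero_of_mul h))
  have hφc : ∀ i, Continuous (φ i) := fun i =>
    continuous_const.mul (contDiff_scaledBump.continuous.comp M.continuous_graph)
  have hnear : ∀ i y, dist y (x i) ≤ 2 / (K * B ^ i) →
      dist y M.xs ≤ 3 / 4 * r * ((B : ℝ) ^ i)⁻¹ := by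
    intro i y h
    have h1 := dist_triangle y (x i) M.xs
    rw [hxs] at h1
    have h2 := hrad i
    have h3 := mul_pos hr (hinv0 i)
    linarith
  refine ⟨x, φ, fun i => ?_, hφc, hφ0, fun i y => (hφle i y).trans ?_, fun i y h => ?_,
    fun i => ?_, fun ξ hξ => ?_⟩
  · rw [mem_ball, hxs]
    nlinarith [hinv i]
  · exact mul_le_of_le_one_right hc.le (pow_le_one₀ hq0 hq1)
  · have h1 := (M.dist_le_dist_graph _ _).trans (hφs i y h)
    rw [le_div_iff₀' (hKB i)] at h1
    have h2 : 2 * κ * (B ^ i * dist y (x i)) ≤ K * (B ^ i * dist y (x i)) := by gcongr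
    linarith
  · set ρ := 1 / (K * L) * ((B : ℝ) ^ i)⁻¹ with hρ
    have hρ0 : 0 < ρ := by positivity
    have hsub : ball (x i) ρ ⊆ ball M.xs r := by
      refine ball_subset_ball' ?_
      rw [hxs]
      have h1 : 1 / (K * L) ≤ r / 24 := by
        rw [div_le_div_iff₀ (by positivity) (by norm_num)]
        have : 1 ≤ L := by rw [hL]; linarith [norm_nonneg M.slope]
        nlinarith
      have h2 : ρ ≤ r / 24 * ((B : ℝ) ^ i)⁻¹ := by rw [hρ]; gcongr
      have h3 := mul_le_of_le_one_right hr.le (hinv i)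
      linarith
    have hone : ∀ y ∈ ball (x i) ρ, φ i y = c * ((B : ℝ) ^ (-s)) ^ i := by
      intro y hy
      rw [hφ]
      dsimp only
      rw [scaledBump_eq_one (hKB i).le, mul_one]
      have h1 := M.dist_graph_le y (x i)
      have h2 : L * dist y (x i) ≤ L * ρ := by gcongr; exact (mem_ball.1 hy).le
      calc K * B ^ i * dist (M.graph y) (M.graph (x i)) ≤ K * B ^ i * (L * ρ) := by
            gcongr; exact h1.trans h2
        _ = 1 := by rw [hρ]; field_simp
    have hint : IntegrableOn (φ i) (ball M.xs r) :=
      ((hφc i).continuousOn.integrableOn_compact (isCompact_closedBall M.xs r)).mono_set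
        ball_subset_closedBall
    calc _ = ∫ y in ball (x i) ρ, c * ((B : ℝ) ^ (-s)) ^ i := by
          rw [setIntegral_const, smul_eq_mul, volume_real_ball _ _ hρ0, hρ, mul_pow]
          ring
      _ = ∫ y in ball (x i) ρ, φ i y :=
          setIntegral_congr_fun measurableSet_ball fun y hy => (hone y hy).symm
      _ ≤ _ := setIntegral_mono_set hint (.of_forall (hφ0 i)) (.of_forall hsub)
  · obtain ⟨hg, hgb, hgn⟩ := hbump B hB1 (fun i => M.graph (x i)) ξ (fun i => (hξ i).le) hdisj
    have hterm : ∀ i y, c * ξ i * ((B : ℝ) ^ (-s)) ^ i *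
        scaledBump (K * B ^ i) (M.graph (x i)) (M.graph y) = ξ i * φ i y := fun i y => by
      rw [hφ]; ring
    have hsing : ∀ y, {i | ξ i * φ i y ≠ 0}.Subsingleton := by
      intro y i hi j hj
      by_contra hne
      exact disjoint_left.1 (hdisj i j hne) (hφs i y (right_ne_zero_of_mul hi))
        (hφs j y (right_ne_zero_of_mul hj))
    have hsum : ∀ y, Summable fun i => ξ i * φ i y := fun y =>
      summable_of_hasFiniteSupport (hsing y).finite
    -- This localization of the tail of the series, applied at `l + 1`, makes finer scales
    -- negligible at level `l`.
    have hzero : ∀ l i y, l ≤ i → y ∉ ball M.xs (r / B ^ l) → φ i y = 0 := by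
      intro l i y hli hy
      by_contra h
      have h1 := hnear i y ((M.dist_le_dist_graph _ _).trans (hφs i y h))
      have h2 : ((B : ℝ) ^ i)⁻¹ ≤ ((B : ℝ) ^ l)⁻¹ :=
        inv_anti₀ (hBi l) (pow_le_pow_right₀ hB1.le hli)
      refine hy (mem_ball.2 (h1.trans_lt ?_))
      rw [show r / (B : ℝ) ^ l = r * ((B : ℝ) ^ l)⁻¹ from div_eq_mul_inv _ _]
      have h3 := mul_pos hr (hinv0 l)
      have h4 : 3 / 4 * r * ((B : ℝ) ^ i)⁻¹ ≤ 3 / 4 * r * ((B : ℝ) ^ l)⁻¹ := by gcongr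
      linarith
    have hgy : ∀ y, ∑' i, c * ξ i * ((B : ℝ) ^ (-s)) ^ i *
        scaledBump (K * B ^ i) (M.graph (x i)) (M.graph y) = ∑' i, ξ i * φ i y := fun y =>
      tsum_congr fun i => hterm i y
    have htail : ∀ l y, ∑' i, ξ i * φ i y - ∑ i ∈ Finset.range (l + 1), ξ i * φ i y =
        ∑' i, ξ (i + (l + 1)) * φ (i + (l + 1)) y := fun l y => by
      rw [← (hsum y).sum_add_tsum_nat_add (l + 1), add_sub_cancel_left]
    refine ⟨_, hg, hgb, hgn, ?_, fun y hy => ?_, fun l y => ?_, fun l y hy => ?_⟩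
    · have hcl : IsClosed (M.graph '' closedBall M.xs (3 / 4 * r)) :=
        ((isCompact_closedBall _ _).image M.continuous_graph).isClosed
      refine (closure_minimal (fun z hz => ?_) hcl).trans
        (image_mono (closedBall_subset_ball (by linarith)))
      obtain ⟨hzf, hz0⟩ := hz
      obtain ⟨i, hi⟩ : ∃ i, scaledBump (K * B ^ i) (M.graph (x i)) z ≠ 0 := by
        by_contra! h
        exact hz0 ((tsum_congr fun i => by rw [h i, mul_zero]).trans tsum_zero)
      have h1 : dist z (M.graph (x i)) ≤ 2 / (K * B ^ i) :=
        tsupport_scaledBump_subset (hKB i) (subset_tsupport _ hi)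
      have h2 := M.dist_base_le z (M.graph (x i))
      rw [graph, base_point, ← graph] at h2
      have h3 := hnear i _ (h2.trans h1)
      have h4 := mul_le_of_le_one_right (show 0 ≤ 3 / 4 * r by positivity) (hinv i)
      refine ⟨M.base z, h3.trans h4, (M.eq_graph_of_dist_le hΩ hzf (y := x i)
        (mem_ball.2 (by linarith)) ?_).symm⟩
      have h5 : 2 / (K * B ^ i) ≤ 2 / K := by
        gcongr
        exact le_mul_of_one_le_right hK0.le (hBi1 i)
      have h6 : (3 + ‖M.slope‖) * (2 / K) < A.width M.j := by
        rw [mul_div_assoc', div_lt_iff₀ hK0]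
        linarith
      refine lt_of_le_of_lt ?_ h6
      gcongr
      exact h1.trans h5
    · rw [hgy]
      refine (tsum_congr fun i => ?_).trans tsum_zero
      rw [hzero 0 i y (Nat.zero_le i) (by simpa using hy), mul_zero]
    · rw [hgy, htail]
      have := norm_tsum_sub_le_of_subsingleton (D := c * ((B : ℝ) ^ (-s)) ^ l) (hamp l).le
        (u := fun i => ξ (i + (l + 1)) * φ (i + (l + 1)) y) (w := fun _ => 0)
        (fun i hi j hj => Nat.add_right_cancel (@hsing y (i + (l + 1)) hi (j + (l + 1)) hj))
        (by simp) (fun i => ?_)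
      · simpa using this
      · rw [sub_zero, norm_mul, Real.norm_eq_abs, hξ, one_mul, Real.norm_of_nonneg (hφ0 _ y)]
        refine (hφle _ y).trans ?_
        exact mul_le_mul_of_nonneg_left (pow_le_pow_of_le_one hq0 hq1 (by omega)) hc.le
    · rw [hgy, ← sub_eq_zero, htail]
      refine (tsum_congr fun i => ?_).trans tsum_zero
      rw [hzero (l + 1) _ y (by omega) hy, mul_zero]

end LocalChart

/-! ### Separation of the quantities of interest -/

theorem abs_setIntegral_sub_sum_le {X ι : Type*} [MeasurableSpace X] {μ : Measure X} {S D : Set X}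
    (hS : MeasurableSet S) (hDS : D ⊆ S) (hDμ : μ D < ⊤) (I : Finset ι)
    {ξ : ι → ℝ} {g w : X → ℝ} {φ : ι → X → ℝ} (hg : IntegrableOn (fun y => g y * w y) S μ)
    (hφ : ∀ i, IntegrableOn (fun y => φ i y * w y) S μ) {K : ℝ}
    (hK : ∀ y ∈ D, |g y - ∑ i ∈ I, ξ i * φ i y| * |w y| ≤ K)
    (h0 : ∀ y, y ∉ D → g y = ∑ i ∈ I, ξ i * φ i y) :
    |∫ y in S, g y * w y ∂μ - ∑ i ∈ I, ξ i * ∫ y in S, φ i y * w y ∂μ| ≤ K * μ.real D := by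
  have h1 : ∫ y in S, g y * w y ∂μ - ∑ i ∈ I, ξ i * ∫ y in S, φ i y * w y ∂μ =
      ∫ y in S, (g y - ∑ i ∈ I, ξ i * φ i y) * w y ∂μ := by
    simp_rw [← integral_const_mul]
    rw [← integral_finsetSum _ fun i _ => (hφ i).const_mul (ξ i), ← integral_sub hg
      (integrable_finsetSum _ fun i _ => (hφ i).const_mul (ξ i))]
    refine setIntegral_congr_fun hS fun y _ => ?_
    simp only [sub_mul, Finset.sum_mul, mul_assoc]
  rw [h1, setIntegral_eq_of_subset_of_forall_sdiff_eq_zero hS hDS fun y hy => by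
    rw [h0 y hy.2, sub_self, zero_mul]]
  rw [← Real.norm_eq_abs]
  exact norm_setIntegral_le_of_norm_le_const hDμ fun y hy => by
    rw [norm_mul]; exact hK y hy

namespace LocalChart

variable {d k : ℕ} {Ω : Set (E d)} {A : BoundaryAtlas d k Ω} (M : LocalChart A)

/-- Level `l` is tested only with the velocities `v l k` that carry `x l` to the grid point `Y l k`.
The response then splits into coarser terms of unknown size, the diagonal term of known sign, and a
small tail. `exists_signs` handles the coarser terms, the size of `B` the tail. -/
theorem exists_outflow_separating (hd : 2 ≤ d) (hΩ : IsOpen Ω) {sIn sOut : ℝ} (hsIn : 0 < sIn)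
    (hsOut : 0 < sOut) (hkIn : sIn ≤ k + 1) (hkOut : sOut ≤ k + 1) {p : ℝ≥0∞} (hp : 1 ≤ p)
    (hp' : p ≠ ⊤) {V : Set (E (d - 1))} {yc : E (d - 1)} {r : ℝ} (hr : 0 < r)
    (hrr : r ≤ M.radius) (hV : ∀ v ∈ V, M.Fits v ∧ r ≤ M.speed v ^ 2 / 128)
    (htr : ∀ x ∈ ball M.xs r, ∀ y ∈ ball yc r, ∃ v ∈ V, M.transport v x = y) :
    ∃ g : E d → ℝ, Continuous g ∧ (∃ C, ∀ x, ‖g x‖ ≤ C) ∧ boundaryNorm A sOut ⊤ g ≤ 1 ∧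
      closure {x | x ∈ frontier Ω ∧ g x ≠ 0} ⊆ M.graph '' ball M.xs r ∧
      (∀ y, y ∉ ball M.xs r → g (M.graph y) = 0) ∧
      ∃ c : ℝ, 0 < c ∧ ∀ n : ℕ, 1 ≤ n → ∃ (ι : Type) (f : ι → E d → ℝ),
        (∀ ε, boundaryNorm A sIn p (f ε) ≤ 1) ∧
        ∀ col : ι → Fin (2 ^ n), ∃ ε ε', col ε = col ε' ∧ ∃ v ∈ V,
          c * (n : ℝ) ^ (-((sIn + sOut + ((d : ℝ) - 1)) / ((d : ℝ) - 1))) ≤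
            |M.response r (fun y => A.areaDensity M.j y * g (M.graph y))
                (fun y => f ε (M.graph y)) v -
              M.response r (fun y => A.areaDensity M.j y * g (M.graph y))
                (fun y => f ε' (M.graph y)) v| := by
  set L := 2 + ‖M.slope‖ with hL
  have hL1 : 1 ≤ L := by linarith [norm_nonneg M.slope]
  have hL0 : 0 < L := by linarith
  obtain ⟨κ, c₁, hκ, hc₁, hin⟩ := M.exists_inflow_data hd hsIn hkIn hp hp' yc hr
  -- The factor `19 * L` compensates the stretching by the transport map and by the graph: the
  -- support of an outflow bump is sent into one plateau of the inflow data.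
  obtain ⟨c₀, δ, hc₀, hδ, hout⟩ := M.exists_outflow_data hΩ hsOut hkOut hr hrr
    (κ := 19 * L * κ) (by nlinarith)
  set vol := volume.real (ball (0 : E (d - 1)) 1) with hvol
  -- The factor `8` leaves half of `amp l` for the tail: the remainder of the series is at most
  -- twice the height of `φ l`, the data at most `2 * τ l`, and the area density at most `L`.
  obtain ⟨B, hB2, hB⟩ : ∃ B : ℕ, 2 ≤ B ∧ 8 * L * r ^ (d - 1) * vol / δ ≤ B := by
    obtain ⟨b, hb⟩ := exists_nat_ge (8 * L * r ^ (d - 1) * vol / δ)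
    exact ⟨max 2 b, le_max_left _ _, hb.trans (by exact_mod_cast le_max_right _ _)⟩
  have hB2' : (2 : ℝ) ≤ B := by exact_mod_cast hB2
  have hB0 : (0 : ℝ) < B := by linarith
  have hBpow : 8 * L * r ^ (d - 1) * vol ≤ δ * (B : ℝ) ^ (d - 1) := by
    have h1 : (B : ℝ) ≤ B ^ (d - 1) := le_self_pow₀ (by linarith) (by omega)
    rw [div_le_iff₀' hδ] at hB
    nlinarith
  obtain ⟨x, φ, hx, hφc, hφ0, hφle, hφs, hφint, hg⟩ := hout B hB2
  choose Y f hY hfn hfle hfeq using fun l : ℕ => hin (B ^ l) (Nat.one_le_pow _ _ (by omega))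
  choose v hvV hv using fun l k => htr (x l) (hx l) (Y l k) (hY l k)
  have hfit := fun l k => hV _ (hvV l k)
  have hballr : ∀ l k, ball M.xs r ⊆ ball M.xs (M.speed (v l k) ^ 2 / 128) := fun l k =>
    ball_subset_ball (hfit l k).2
  set τ : ℕ → ℝ := fun l => c₁ * ((B ^ l : ℕ) : ℝ) ^ (-sIn) with hτ
  have hτ0 : ∀ l, 0 < τ l := fun l =>
    mul_pos hc₁ (Real.rpow_pos_of_pos (by push_cast; positivity) _)
  have harea : ∀ y ∈ ball M.xs r, |A.areaDensity M.j y| ≤ L := fun y hy => by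
    rw [abs_of_nonneg (zero_le_one.trans (A.one_le_areaDensity M.j y))]
    exact areaDensity_le (ball_subset_ball hrr hy)
  have hint : ∀ l ε k (h : E (d - 1) → ℝ), Continuous h → (∃ C, ∀ y, ‖h y‖ ≤ C) →
      IntegrableOn (fun y => h y * (A.areaDensity M.j y *
        f l ε (M.graph (M.transport (v l k) y)))) (ball M.xs r) := by
    rintro l ε k h hh ⟨C, hC⟩
    have h1 := ((hfit l k).1.admissible.integrableOn_comp_transport
      ((hballr l k).trans (hfit l k).1.admissible.ball_subset_crossing)
      ((hfit l k).1.crossing_subset (by simp))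
      (LocallyIntegrable.of_boundaryNorm M hp ((hfn l ε).trans_lt ENNReal.one_lt_top))).1
    refine Integrable.bdd_mul (c := C) (Integrable.bdd_mul (c := L) h1 ?_ ?_)
      hh.aestronglyMeasurable (.of_forall hC)
    · exact (A.measurable_areaDensity M.j).aestronglyMeasurable
    · exact (ae_restrict_iff' measurableSet_ball).2 (.of_forall harea)
  set a : (l : ℕ) → ℕ → ((Fin (d - 1) → Fin (B ^ l)) → Bool) → (Fin (d - 1) → Fin (B ^ l)) → ℝ :=
    fun l i ε k => ∫ y in ball M.xs r,
      φ i y * (A.areaDensity M.j y * f l ε (M.graph (M.transport (v l k) y))) with ha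
  set amp : ℕ → ℝ := fun l => ∫ y in ball M.xs r, φ l y * (A.areaDensity M.j y * τ l) with hamp
  -- On the support of `φ l` the transported points stay in the plateau around `Y l k`, so the data
  -- are constant there, with the sign of `ε k`.
  have hdiag : ∀ l ε k, a l l ε k = if ε k then amp l else -amp l := by
    intro l ε k
    have h1 : ∀ y ∈ ball M.xs r, φ l y * (A.areaDensity M.j y *
        f l ε (M.graph (M.transport (v l k) y))) =
        φ l y * (A.areaDensity M.j y * if ε k then τ l else -τ l) := by
      intro y hy
      by_cases h : φ l y = 0
      · rw [h, zero_mul, zero_mul]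
      · rw [hfeq l ε k]
        have h2 := (hfit l k).1.admissible.norm_transport_sub_le (hballr l k hy)
          (hballr l k (hx l))
        rw [hv, ← dist_eq_norm, ← dist_eq_norm] at h2
        have h3 := M.dist_graph_le (M.transport (v l k) y) (Y l k)
        have h4 := hφs l y h
        have h5 : L * dist (M.transport (v l k) y) (Y l k) ≤ L * (19 * dist y (x l)) := by gcongr
        calc κ * (B ^ l : ℕ) * dist (M.graph (M.transport (v l k) y)) (M.graph (Y l k))
            ≤ κ * (B ^ l : ℕ) * (L * (19 * dist y (x l))) := by
              gcongr; exact h3.trans h5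
          _ = 19 * L * κ * B ^ l * dist y (x l) := by push_cast; ring
          _ ≤ 1 := h4
    rw [ha]
    dsimp only
    rw [setIntegral_congr_fun measurableSet_ball h1]
    split_ifs
    · rfl
    · rw [hamp]
      dsimp only
      rw [← integral_neg]
      simp only [mul_neg]
  have hamp_ge : ∀ l, τ l * (c₀ * ((B : ℝ) ^ (-sOut)) ^ l * (δ * ((B : ℝ) ^ l)⁻¹ ^ (d - 1))) ≤
      amp l := by
    intro l
    have h1 : IntegrableOn (φ l) (ball M.xs r) :=
      ((hφc l).continuousOn.integrableOn_compact (isCompact_closedBall M.xs r)).mono_set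
        ball_subset_closedBall
    calc _ ≤ τ l * ∫ y in ball M.xs r, φ l y := by
          exact mul_le_mul_of_nonneg_left (hφint l) (hτ0 l).le
      _ = ∫ y in ball M.xs r, τ l * φ l y := (integral_const_mul _ _).symm
      _ ≤ amp l := by
          refine setIntegral_mono_on (h1.const_mul _) ?_ measurableSet_ball fun y hy => ?_
          · refine (Integrable.bdd_mul (c := L) (h1.mul_const (τ l))
              (A.measurable_areaDensity M.j).aestronglyMeasurable
              ((ae_restrict_iff' measurableSet_ball).2 (.of_forall harea))).congr
              (.of_forall fun y => ?_)
            dsimp only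
            ring
          · have h2 := A.one_le_areaDensity M.j y
            have h3 := mul_nonneg (hφ0 l y) (hτ0 l).le
            nlinarith
  obtain ⟨ξ, hξ, hsep⟩ := exists_signs a amp hdiag
  obtain ⟨g, hgc, hgb, hgn, hgs, hg0, hgl, hgt⟩ := hg ξ hξ
  refine ⟨g, hgc, hgb, hgn, hgs, hg0, ?_⟩
  set γ := (sIn + sOut + ((d : ℝ) - 1)) / ((d : ℝ) - 1) with hγ
  -- The tail is supported in the ball of radius `r / B ^ (l + 1)`, smaller by a factor `B` than the
  -- scale of `φ l`; the gain `B ^ (d - 1)` in volume beats all constants.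
  have hclose : ∀ l ε k, |M.response r (fun y => A.areaDensity M.j y * g (M.graph y))
      (fun y => f l ε (M.graph y)) (v l k) -
      ∑ i ∈ Finset.range (l + 1), ξ i * a l i ε k| ≤ amp l / 2 := by
    intro l ε k
    have hsub : ball M.xs (r / B ^ (l + 1)) ⊆ ball M.xs r :=
      ball_subset_ball (div_le_self hr.le (one_le_pow₀ (by linarith)))
    have h := abs_setIntegral_sub_sum_le (K := 2 * (c₀ * ((B : ℝ) ^ (-sOut)) ^ l) * (L * (2 * τ l)))
      measurableSet_ball hsub measure_ball_lt_top (Finset.range (l + 1))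
      (hint l ε k (fun y => g (M.graph y)) (hgc.comp M.continuous_graph)
        (hgb.imp fun C hC y => hC _))
      (fun i => hint l ε k (φ i) (hφc i) ⟨c₀, fun y => by
        rw [Real.norm_of_nonneg (hφ0 i y)]; exact hφle i y⟩) (ξ := ξ)
      (fun y hy => by
        rw [abs_mul]
        refine mul_le_mul (hgl l y) (mul_le_mul (harea y (hsub hy)) (hfle l ε _) (abs_nonneg _)
          hL0.le) (by positivity) (by positivity)) (hgt l)
    have h1 : M.response r (fun y => A.areaDensity M.j y * g (M.graph y))
        (fun y => f l ε (M.graph y)) (v l k) = ∫ y in ball M.xs r, g (M.graph y) *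
          (A.areaDensity M.j y * f l ε (M.graph (M.transport (v l k) y))) := by
      rw [UTurn.response]
      congr 1
      ext y
      ring
    rw [h1]
    refine h.trans ?_
    have h2 : δ * ((B : ℝ) ^ l)⁻¹ ^ (d - 1) =
        δ * B ^ (d - 1) * ((B : ℝ) ^ (l + 1))⁻¹ ^ (d - 1) := by
      rw [pow_succ, mul_inv, mul_pow, inv_pow (B : ℝ) (d - 1)]
      field_simp
    have h3 := hamp_ge l
    rw [volume_real_ball _ _ (by positivity), div_eq_mul_inv, mul_pow, ← hvol]
    have h4 : 0 ≤ τ l * (c₀ * ((B : ℝ) ^ (-sOut)) ^ l) * ((B : ℝ) ^ (l + 1))⁻¹ ^ (d - 1) := by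
      have := hτ0 l
      positivity
    have h5 := mul_le_mul_of_nonneg_left hBpow h4
    rw [h2] at h3
    nlinarith
  have hd1 : (0 : ℝ) < (d : ℝ) - 1 := by
    have : (2 : ℝ) ≤ d := by exact_mod_cast hd
    linarith
  have hdc : ((d - 1 : ℕ) : ℝ) = (d : ℝ) - 1 := by
    rw [Nat.cast_sub (by omega), Nat.cast_one]
  have hγ0 : 0 < γ := by positivity
  -- The height of the inflow bumps, the height of the outflow bump and the volume of its support
  -- combine to the power `-γ` of the number of grid points.
  have hpow : ∀ l, τ l * (c₀ * ((B : ℝ) ^ (-sOut)) ^ l * (δ * ((B : ℝ) ^ l)⁻¹ ^ (d - 1))) =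
      c₁ * c₀ * δ * (((B : ℝ) ^ (d - 1)) ^ l) ^ (-γ) := by
    intro l
    have h1 : (((B : ℝ) ^ (d - 1)) ^ l) ^ (-γ) =
        ((B : ℝ) ^ l) ^ (-sIn) * ((B : ℝ) ^ (-sOut)) ^ l * ((B : ℝ) ^ l)⁻¹ ^ (d - 1) := by
      rw [← Real.rpow_natCast (B : ℝ) l, ← Real.rpow_natCast (B : ℝ) (d - 1),
        ← Real.rpow_neg hB0.le, ← Real.rpow_natCast (_ ^ (-(l : ℝ))), ← Real.rpow_natCast (_ ^ _) l,
        ← Real.rpow_natCast (_ ^ (-sOut)), ← Real.rpow_mul hB0.le, ← Real.rpow_mul hB0.le,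
        ← Real.rpow_mul hB0.le, ← Real.rpow_mul hB0.le, ← Real.rpow_mul hB0.le,
        ← Real.rpow_add hB0, ← Real.rpow_add hB0, hdc, hγ]
      congr 1
      field_simp
      ring
    rw [h1, hτ]
    push_cast
    ring
  refine ⟨c₁ * c₀ * δ * (2 * (B : ℝ) ^ (d - 1)) ^ (-γ), by positivity, fun n hn => ?_⟩
  -- The level is chosen so that the number of grid points exceeds `2 * n`, but by no more than the
  -- factor `B ^ (d - 1)`.
  obtain ⟨l, hl1, hl2⟩ := exists_pow_gt (N := B ^ (d - 1)) (n := 2 * n)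
    (hB2.trans (Nat.le_self_pow (by omega) B)) (by omega)
  refine ⟨_, f l, hfn l, fun col => ?_⟩
  obtain ⟨ε, ε', hcol, k, hk⟩ := hsep l n (by
    simp only [Fintype.card_fun, Fintype.card_fin]
    rwa [← pow_mul, mul_comm l, pow_mul]) col
  refine ⟨ε, ε', hcol, v l k, hvV l k, ?_⟩
  have h1 := hclose l ε k
  have h2 := hclose l ε' k
  simp only [mul_sub, Finset.sum_sub_distrib] at hk
  -- Of the separation `2 * amp l` of the partial sums, each of the two tails consumes at most `amp
  -- l / 2`.
  have h3 : amp l ≤ |M.response r (fun y => A.areaDensity M.j y * g (M.graph y))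
      (fun y => f l ε (M.graph y)) (v l k) -
      M.response r (fun y => A.areaDensity M.j y * g (M.graph y))
        (fun y => f l ε' (M.graph y)) (v l k)| := by
    rw [abs_le] at h1 h2
    rcases abs_cases (∑ i ∈ Finset.range (l + 1), ξ i * a l i ε k -
      ∑ i ∈ Finset.range (l + 1), ξ i * a l i ε' k) with ⟨h, -⟩ | ⟨h, -⟩
    · refine le_trans ?_ (le_abs_self _)
      linarith [h1.1, h1.2, h2.1, h2.2]
    · refine le_trans ?_ (neg_le_abs _)
      linarith [h1.1, h1.2, h2.1, h2.2]
  refine le_trans ?_ ((hamp_ge l).trans h3)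
  rw [hpow, mul_assoc (c₁ * c₀ * δ), ← Real.mul_rpow (by positivity) (by positivity)]
  refine mul_le_mul_of_nonneg_left ?_ (by positivity)
  refine Real.rpow_le_rpow_of_nonpos (by positivity) ?_ (by linarith)
  have : (((B ^ (d - 1)) ^ l : ℕ) : ℝ) ≤ ((2 * n * B ^ (d - 1) : ℕ) : ℝ) := by exact_mod_cast hl2
  push_cast at this
  linarith

end LocalChart

/-- A value above the essential supremum would be exceeded on a nonempty open set, which has
positive measure. -/
theorem enorm_le_eLpNorm_top_of_continuousOn {n : ℕ} {P : Set (E n)} (hP : IsOpen P) {h : E n → ℝ}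
    (hh : ContinuousOn h P) {μ : E n} (hμ : μ ∈ P) :
    ‖h μ‖ₑ ≤ eLpNorm h ⊤ (volume.restrict P) := by
  by_contra! hlt
  rw [eLpNorm_exponent_top] at hlt
  have hO : IsOpen (P ∩ (fun x => ‖h x‖ₑ) ⁻¹' Ioi (eLpNormEssSup h (volume.restrict P))) :=
    hh.enorm.isOpen_inter_preimage hP isOpen_Ioi
  refine (hO.measure_pos volume ⟨μ, hμ, hlt⟩).ne' ?_
  have h1 := enorm_ae_le_eLpNormEssSup h (volume.restrict P)
  rw [ae_restrict_iff' hP.measurableSet, ae_iff] at h1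
  refine measure_mono_null (fun x hx => ?_) h1
  simp only [Classical.not_imp, mem_ofPred_eq, not_le]
  exact hx

end Transport

end

/-! ### Assembly of the lower bound. -/

theorem mainTheorem1
    (d k m : ℕ) (hd : 2 ≤ d) (hm : d - 1 ≤ m)
    (sIn sOut sb : ℝ) (hsIn : 0 < sIn) (hsOut : 0 < sOut) (hsb : 1 ≤ sb)
    (p : ℝ≥0∞) (hp : 1 ≤ p) (hp' : p ≠ ⊤)
    (Ω : Set (Transport.E d)) (hΩ : IsOpen Ω) (A : Transport.BoundaryAtlas d k Ω)
    (hkIn : sIn ≤ k + 1) (hkOut : sOut ≤ k + 1)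
    (Ξ : ℝ × Transport.E (d - 1) → Transport.E d) (hΞ : Transport.IsReferenceMap sb Ω Ξ)
    (P : Set (Transport.E m)) (hP : IsOpen P) (hP' : P.Nonempty) :
    ∃ (b : Transport.E m → Transport.E d → Transport.E d) (gOut : Transport.E d → ℝ)
      (U : Transport.E m → Set (Transport.E d)),
      Transport.MemHolder sb (fun z : Transport.E d × Transport.E m => b z.2 z.1) (Ω ×ˢ P) ∧
      ContinuousOn (fun z : Transport.E d × Transport.E m => b z.2 z.1) (closure Ω ×ˢ P) ∧
      (∀ μ ∈ P, Transport.IsWellPosed A sIn p (b μ) gOut (U μ)) ∧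
      Transport.boundaryNorm A sOut ⊤ gOut ≤ 1 ∧
      (∀ (gIn : Transport.E d → ℝ) (q : Transport.E m → ℝ),
        Transport.boundaryNorm A sIn p gIn ≤ 1 →
        Transport.IsQuantityOfInterest A P b gOut U gIn q → MemLp q ⊤ (volume.restrict P)) ∧
      ∃ c : ℝ, 0 < c ∧ ∀ n : ℕ, 1 ≤ n →
        ENNReal.ofReal (c * (n : ℝ) ^ (-((sIn + sOut + ((d : ℝ) - 1)) / ((d : ℝ) - 1)))) ≤
          Transport.entropyNumber n (Transport.qoiClass A sIn p P b gOut U) := by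
  obtain ⟨M⟩ := Transport.exists_localChart hd hΩ A hsb hΞ
  obtain ⟨vc, yc, η, r₀, hη, hr₀, hfits, htr⟩ := M.exists_velocities
  obtain ⟨r, hr, hrr₀, hrr⟩ : ∃ r, 0 < r ∧ r ≤ r₀ ∧ r ≤ M.radius :=
    ⟨min r₀ M.radius, lt_min hr₀ M.radius_pos, min_le_left _ _, min_le_right _ _⟩
  obtain ⟨b, vel, hbH, hbc, hvelc, hvel, hvelP, hb⟩ := M.exists_field hm hΩ hP hP' vc hη
  have hV : ∀ v ∈ closedBall vc η, M.Fits v ∧ r ≤ M.speed v ^ 2 / 128 := fun v hv =>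
    ⟨(hfits v hv).1, hrr₀.trans (hfits v hv).2⟩
  -- Well-posedness and continuity are needed for all values of `vel`, which lie in the closed ball
  -- of radius `η`. Separation uses only the ball of radius `η / 2`, all of whose velocities are
  -- attained at parameters in `P`.
  obtain ⟨gOut, hgc, ⟨C, hC⟩, hgn, hgs, hg0, c, hc, hsep⟩ := M.exists_outflow_separating hd hΩ
    hsIn hsOut hkIn hkOut hp hp' (V := ball vc (η / 2)) (yc := yc) hr hrr
    (fun v hv => hV v (ball_subset_closedBall (ball_subset_ball (by linarith) hv)))
    (fun x hx y hy => htr x (ball_subset_ball hrr₀ hx) y (ball_subset_ball hrr₀ hy))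
  have hC0 : 0 ≤ C := (norm_nonneg _).trans (hC 0)
  have hF : ∀ μ, M.Fits (vel μ) := fun μ => (hV _ (hvel μ)).1
  have hrs : ∀ μ, r ≤ M.speed (vel μ) ^ 2 / 128 := fun μ => (hV _ (hvel μ)).2
  have hbd : ∀ μ, EqOn (b μ) (M.field (vel μ)) (M.domain (vel μ)) := fun μ =>
    (hb μ).mono (hF μ).domain_subset
  have hsupp : ∀ μ, closure {x | x ∈ frontier Ω ∧ gOut x ≠ 0} ⊆ M.domain (vel μ) := by
    intro μ
    refine hgs.trans ?_
    rintro _ ⟨y, hy, rfl⟩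
    exact Transport.LocalChart.graph_mem_domain (by simp)
      ((hF μ).admissible.ball_subset_crossing (ball_subset_ball (hrs μ) hy))
  set W : Transport.E (d - 1) → ℝ := fun y => A.areaDensity M.j y * gOut (M.graph y) with hW
  have hWm : Measurable W :=
    (A.measurable_areaDensity M.j).mul (hgc.comp M.continuous_graph).measurable
  set L := (2 + ‖M.slope‖) * C with hL
  have hL0 : 0 ≤ L := by positivity
  have hWb : ∀ y ∈ ball M.xs r, |W y| ≤ L := by
    intro y hy
    rw [hW, abs_mul, abs_of_nonneg (zero_le_one.trans (A.one_le_areaDensity M.j y))]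
    exact mul_le_mul (Transport.LocalChart.areaDensity_le (ball_subset_ball hrr hy)) (hC _)
      (abs_nonneg _) (by positivity)
  have hint : ∀ gIn : Transport.E d → ℝ, Transport.boundaryNorm A sIn p gIn ≤ 1 →
      IntegrableOn (fun y => gIn (M.graph y)) (ball M.xs M.radius) := fun gIn h =>
    Transport.LocallyIntegrable.of_boundaryNorm M hp (h.trans_lt ENNReal.one_lt_top)
  have hq : ∀ (gIn : Transport.E d → ℝ), Transport.boundaryNorm A sIn p gIn ≤ 1 →
      ∀ (μ : Transport.E m) (u uOut : Transport.E d → ℝ),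
        Transport.IsWeakSolution A (b μ) gIn (M.domain (vel μ)) u uOut →
        ∫ x in A.outflow (b μ), gOut x * uOut x ∂A.surface =
          M.response r W (fun y => gIn (M.graph y)) (vel μ) := fun gIn h μ u uOut hu =>
    (hF μ).setIntegral_outflow hΩ (hbd μ) (hint gIn h) (hsupp μ) (hrs μ)
      (fun y _ hy => hg0 y hy) hu
  have hcont : ∀ gIn : Transport.E d → ℝ, Transport.boundaryNorm A sIn p gIn ≤ 1 →
      Continuous fun μ => M.response r W (fun y => gIn (M.graph y)) (vel μ) := fun gIn h =>
    (Transport.UTurn.continuousOn_response (S := closedBall vc η) measurableSet_ball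
      (fun w hw => ⟨(hV w hw).1.admissible, (hV w hw).2, (hV w hw).1.crossing_subset (by simp)⟩)
      hWm hL0 hWb (hint gIn h)).comp_continuous hvelc hvel
  have hmem : ∀ gIn : Transport.E d → ℝ, Transport.boundaryNorm A sIn p gIn ≤ 1 →
      MemLp (fun μ => M.response r W (fun y => gIn (M.graph y)) (vel μ)) ⊤
        (volume.restrict P) := fun gIn h =>
    memLp_top_of_bound (hcont gIn h).aestronglyMeasurable _ (.of_forall fun μ =>
      (hF μ).admissible.abs_response_le (hrs μ) ((hF μ).crossing_subset (by simp)) hL0 hWb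
        (hint gIn h))
  -- The constant is halved because separation by `2 * δ` yields the lower bound `δ` for the entropy
  -- numbers.
  refine ⟨b, gOut, fun μ => M.domain (vel μ), hbH sb (by linarith), hbc.continuousOn,
    fun μ _ => (hF μ).isWellPosed hΩ (hbd μ) hp hgc hC (hsupp μ), hgn, fun gIn q hgIn hQ => ?_,
    c / 2, by positivity, fun n hn => ?_⟩
  · refine (hmem gIn hgIn).ae_eq ((ae_restrict_iff' hP.measurableSet).2 (.of_forall fun μ hμ => ?_))
    obtain ⟨u, uOut, hu, hqu⟩ := hQ μ hμ
    rw [hqu, hq gIn hgIn μ u uOut hu]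
  · obtain ⟨ι, f, hf, hcol⟩ := hsep n hn
    refine Transport.le_entropyNumber (F := fun ε => (hmem (f ε) (hf ε)).toLp _)
      (fun ε => ⟨f ε, _, hf ε, fun μ _ => ?_, MemLp.coeFn_toLp _⟩) fun col => ?_
    · have hu := (hF μ).isWeakSolution hΩ (hbd μ) (hint (f ε) (hf ε))
      exact ⟨_, _, hu, (hq (f ε) (hf ε) μ _ _ hu).symm⟩
    · obtain ⟨ε, ε', hεε, v, hv, hle⟩ := hcol col
      obtain ⟨μ, hμ, rfl⟩ := hvelP v hv
      refine ⟨ε, ε', hεε, ?_⟩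
      rw [Lp.edist_toLp_toLp]
      refine le_trans ?_ (Transport.enorm_le_eLpNorm_top_of_continuousOn hP
        (((hcont (f ε) (hf ε)).sub (hcont (f ε') (hf ε'))).continuousOn) hμ)
      rw [← ENNReal.ofReal_ofNat 2, ← ENNReal.ofReal_mul zero_le_two, ← ofReal_norm]
      refine ENNReal.ofReal_le_ofReal (le_trans (le_of_eq ?_) hle)
      ring
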